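/- **Conventions.** Let $N\ge 2$, $\omega=e^{2\pi i/N}$, $\omega^{1/2}=e^{\pi i/N}$, $\epsilon=(-1)^N$, $Q\ge 1$, $g=Q-1$, and $$[A,B;C,D]=\frac{(A-C)(B-D)}{(A-D)(B-C)} .$$ On $\mathbb C^N$ with basis $|\beta\rangle$, $\beta\in\mathbb Z_N$, let $\mathsf X|\beta\rangle=\omega^\beta|\beta\rangle$, $\mathsf Z|\beta\rangle=|\beta+1\rangle$. Calligraphic letters denote pairs of complex numbers, $\mathcal A=(A',A)$. **The chain.** Let $\mathcal Y_0,\dots,\mathcal Y_{Q-1},\mathcal Z_0,\mathcal Z_1$ be pairs such that $Z_0',Z_0,Z_1',Z_1$ are distinct and differ from all $Y_n',Y_n$. (The $Y_n,Y_n'$ encode $2Q$ rapidities, and $k^2=[Z_0,Z_0';Z_1,Z_1']$ is the Baxter modulus.) Let $u_n,\tilde u_n,v_n\ (=w_n/\tilde w_n),\kappa_n,\tilde\kappa_n$ be any complex numbers with $$u_n^N=-\epsilon\tfrac{Y_n-Z_0'}{Y_n-Z_0},\quad \tilde u_n^N=-\epsilon\tfrac{Y_n-Z_1'}{Y_n-Z_1},\quad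 v_n^N=[Y_n',Y_n;Z_0,Z_1],\quad \kappa_n^N=-[Y_n',Y_n;Z_0',Z_0],\quad \tilde\kappa_n^N=-[Y_n',Y_n;Z_1',Z_1].$$ For invertible $N\times N$ matrices $X_n,Z_n$ with $X_nZ_n=\omega Z_nX_n$, acting in the $n$-th factor of $(\mathbb C^N)^{\otimes Q}$, put $$L_n(\xi)=\begin{pmatrix}1-\omega^{1/2}\xi u_n\tilde u_n\kappa_n v_n Z_n & -u_nX_n(\omega^{1/2}-\kappa_n v_n Z_n)\\ \xi\tilde u_nX_n^{-1}(\tilde\kappa_n-\omega^{1/2}v_nZ_n) & -\omega^{1/2}\xi u_n\tilde u_n\tilde\kappa_n+v_nZ_n\end{pmatrix},\qquad T(\xi)=\mathrm{tr}_{\mathbb C^2}\,L_0(\xi)\cdots L_{Q-1}(\xi).$$ The initial transfer matrix has $X_n=\mathsf X$, $Z_n=\mathsf Z$. **The pairs $\mathcal P_j$.** Consider the equations $$\prod_{n=0}^{Q-1}[P',P;Y_n',Y_n]=1,\qquad \prod_{i=0,1}[P',P;Z_i',Z_i]=1,\qquad P'\ne P, \tag{1}$$ where $(P',P)$ and $(P,P')$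 count as equivalent. For inequivalent solutions $(P_0',P_0),\dots,(P_{g-1}',P_{g-1})$ and $f=(f_0,\dots,f_{g-1})\in\mathbb C^g$ put $$H(f)=\frac{\det|P_j^i-f_jP_j'^{\,i}|_{i,j=0}^{g-1}}{\prod_{i>j}(P_i-P_j)},\quad f_j(y)=\frac{P_j-y}{P_j'-y}f_j,\quad \sigma_j(\mathcal A)=[P_j',P_j;A',A],\quad I_j(n)=\prod_{i=0}^{n-1}\sigma_j(\mathcal Y_i)^{-1},$$ $$c^X_n(f)=\frac{H(\{f_j(Y_n)I_j(n+1)\})}{H(\{f_j(Y_n)I_j(n+1)\sigma_j(\mathcal Z_0)\})},$$ $$c^Z_n(f)=\frac{H(\{f_j(Z_0)I_j(n+1)\})}{H(\{f_j(Z_1)\sigma_j(\mathcal Z_0)I_j(n+1)\})}\cdot\frac{H(\{f_j(Z_1)\sigma_j(\mathcal Z_0)I_j(n)\})}{H(\{f_j(Z_0)I_j(n)\})} .$$ **The operator $\mathbf K$.** Put $U(f,\mathcal A,\mathcal B)=-\epsilon\frac{A-B'}{A-B}\frac{H(\{f_j(A)\})}{H(\{f_j(A)\sigma_j(\mathcal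 B)\})}$ and $W(f,\mathcal A,\mathcal B)=-U(f,\mathcal B,\mathcal A)$. A *vertex* for $(f;\mathcal X,\mathcal Y,\mathcal Z)$ consists of nonzero numbers $u_i,w_i,\kappa_i$ (incoming), $u_i',w_i'$ (outgoing), $i=1,2,3$, whose $N$-th powers are $u_1,w_1$: $U,W(f,\mathcal Y,\mathcal Z)$; $u_2,w_2$: $U,W(f\sigma(\mathcal Y),\mathcal X,\mathcal Z)$; $u_3,w_3$: $U,W(f,\mathcal X,\mathcal Y)$; $u_1',w_1'$: $U,W(f\sigma(\mathcal X),\mathcal Y,\mathcal Z)$; $u_2',w_2'$: $U,W(f,\mathcal X,\mathcal Z)$; $u_3',w_3'$: $U,W(f\sigma(\mathcal Z),\mathcal X,\mathcal Y)$; $\kappa_1,\kappa_2,\kappa_3$: $-[Y',Y;Z',Z]$, $-[X',X;Z',Z]$, $-[X',X;Y',Y]$, and such that $w_1w_2=w_1'w_2'$, $u_2u_3=u_2'u_3'$, $u_1/w_3=u_1'/w_3'$; together with points $p_i=(x_i,y_i)$, $y_i\ne0$, $i=1,\dots,4$, of the Fermat curve $x^N+y^N=1$ with $$x_1=\frac{\omega^{-1/2}u_2}{\kappa_1u_1},\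 x_2=\frac{\omega^{-1/2}\kappa_2u_2'}{u_1'},\ x_3=\frac{u_2'}{\omega u_1},\ x_4=\frac{x_1x_2}{\omega x_3},\ \frac{y_3}{y_1}=\frac{\kappa_1w_1}{u_3'},\ \frac{y_4}{y_1}=\frac{\omega^{-1/2}\kappa_3w_3}{w_2},\ \frac{y_3}{y_2}=\frac{w_2'}{w_3}.$$ Its matrix is $$R_{i_1i_2i_3}^{j_1j_2j_3}=\delta_{i_2+i_3,j_2+j_3}\,\omega^{(j_1-i_1)j_3}\frac{w_{p_1}(i_2-i_1)w_{p_2}(j_2-j_1)}{w_{p_3}(j_2-i_1)w_{p_4}(i_2-j_1)},\qquad \frac{w_p(n)}{w_p(n-1)}=\frac{y}{1-\omega^nx},\quad w_p(0)=1 .$$ Let $\mathcal X=(X',X)$ be a further pair with $\sigma_j(\mathcal X)$ finite and nonzero for all $j$. At each site $n$ take a vertex for $(\{f_jI_j(n+1)\};\mathcal X,\mathcal Y_n,\mathcal Z_0)$, with matrix $R$, and one (marked by a tilde) for $(\{f_jI_j(n+1)\sigma_j(\mathcal Z_0)\};\mathcal X,\mathcal Y_n,\mathcal Z_1)$, with matrix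 $\tilde R$, such that * (third links) $(\tilde u_3,\tilde w_3,\tilde\kappa_3)=(u_3',w_3',\kappa_3)$ and $(\tilde u_3',\tilde w_3')=(u_3,w_3)$; * (second links) $u_2',w_2',\kappa_2$ and $\tilde u_2',\tilde w_2',\tilde\kappa_2$ at the site $n$ equal $u_2,w_2,\kappa_2$ and $\tilde u_2,\tilde w_2,\tilde\kappa_2$ at the site $n+1$ (cyclically); * (first links) $u_1=u_n\alpha_n$, $\tilde u_1=\tilde u_n\alpha_n^{-1}$, $w_1/\tilde w_1=v_n\beta_n$, $\kappa_1=\kappa_n$, $\tilde\kappa_1=\tilde\kappa_n$, and $u_1'=u_n\alpha_n'$, $\tilde u_1'=\tilde u_n\alpha_n'^{-1}$, $w_1'/\tilde w_1'=v_n\beta_n'$, where $\alpha_n^N=c^X_n(f)$, $\beta_n^N=c^Z_n(f)$, $\alpha_n'^N=c^X_n(f\sigma(\mathcal X))$, $\beta_n'^N=c^Z_n(f\sigma(\mathcal X))$. We call this a consistent choice of roots. Put $$\mathbf S_n{}_{\,\alpha_1\alpha_2}^{\,\beta_1\beta_2}=\sum_{l,m\in\mathbb Z_N}R_{\alpha_1\alpha_2l}^{\beta_1\beta_2m}\,\tilde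 R_{-\alpha_1,-\alpha_2,m}^{-\beta_1,-\beta_2,l},$$ an operator on the $n$-th factor (index 1) and an auxiliary space $\mathbb C^N$ (index 2), lower indices numbering rows, and $\mathbf K=\mathrm{Tr}_{\mathbb C^N}\,\mathbf S_0\mathbf S_1\cdots\mathbf S_{Q-1}$. Let $T(\xi;f)$ and $T(\xi;f\sigma(\mathcal X))$ be the transfer matrices with $X_n=\alpha_n\mathsf X$, $Z_n=\beta_n\mathsf Z$ and with $X_n=\alpha'_n\mathsf X$, $Z_n=\beta'_n\mathsf Z$, respectively. **Proposition.** "Generic" means: off the zero set of some nonzero polynomial in the coordinates concerned. 1. For generic $\mathcal Y_n,\mathcal Z_0,\mathcal Z_1$ the system (1) has exactly $Q-1$ inequivalent solutions. 2. Let $\mathcal P_0,\dots,\mathcal P_{Q-2}$ be inequivalent solutions of (1). Then $c^X_n(0)=c^Z_n(0)=1$. For every $f\in\mathbb C^{Q-1}$ for which all $c^X_n(f),c^Z_n(f)$ are defined and nonzero, and all $N\times N$ matrices with $X_nZ_n=\omega Z_nX_n$, $X_n^N=c^X_n(f)$, $Z_n^N=c^Z_n(f)$, the transfer matrix $T(\xi)$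 has, for every $\xi$, the same characteristic polynomial (hence the same spectrum, with multiplicities) as the initial transfer matrix. Thus $f$ parametrizes a $(Q-1)$-parameter isospectral family. 3. For all such $\mathcal P_j$, all $f,\mathcal X$ and every consistent choice of roots, $T(\xi;f)\,\mathbf K=\mathbf K\,T(\xi;f\sigma(\mathcal X))$ for all $\xi$. 4. For generic $\mathcal Y_n,\mathcal Z_0,\mathcal Z_1,\mathcal X,f$, and any $Q-1$ inequivalent solutions of (1), there is a consistent choice of roots (with suitable $u_n,\tilde u_n,v_n,\kappa_n,\tilde\kappa_n$) for which $\mathbf K$ is invertible, so that $T(\xi;f\sigma(\mathcal X))=\mathbf K^{-1}T(\xi;f)\mathbf K$. -/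

import Mathlib

/-!
Conventions.  The chain has length `Q = g + 1`, with sites `n : Fin (g + 1)`.  A pair of points
`𝒜 = (A', A)` is an element of `ℂ × ℂ` whose first component is the primed point `A'`.
-/

namespace BS

noncomputable section

/-! ### Cross-ratios, rational theta functions -/

/-- `(A - C)(B - D) / ((A - D)(B - C))`. -/
def crossRatio (A B C D : ℂ) : ℂ := ((A - C) * (B - D)) / ((A - D) * (B - C))

/-- `σ_j(𝒜) = [P_j', P_j; A', A]`. -/
def sigma {g : ℕ} (P : Fin g → ℂ × ℂ) (A : ℂ × ℂ) (j : Fin g) : ℂ :=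
  crossRatio (P j).1 (P j).2 A.1 A.2

/-- `f_j(y) = f_j (P_j - y) / (P_j' - y)`. -/
def evalAt {g : ℕ} (P : Fin g → ℂ × ℂ) (f : Fin g → ℂ) (y : ℂ) (j : Fin g) : ℂ :=
  ((P j).2 - y) / ((P j).1 - y) * f j

/-- The rational theta function
`H({f_j}) = det |P_j^i - f_j P_j'^i| / ∏_{i > j} (P_i - P_j)`. -/
def H {g : ℕ} (P : Fin g → ℂ × ℂ) (f : Fin g → ℂ) : ℂ :=
  Matrix.det (Matrix.of fun i j : Fin g => (P j).2 ^ (i : ℕ) - f j * (P j).1 ^ (i : ℕ)) /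
    ∏ i : Fin g, ∏ j ∈ Finset.Ioi i, ((P j).2 - (P i).2)

/-- `I_j(n) = ∏_{i < n} σ_j(𝒴_i)⁻¹`, for `0 ≤ n ≤ Q`. -/
def shiftI {g : ℕ} (Y : Fin (g + 1) → ℂ × ℂ) (P : Fin g → ℂ × ℂ) (n : ℕ) (j : Fin g) : ℂ :=
  ∏ i : Fin (g + 1), if (i : ℕ) < n then (sigma P (Y i) j)⁻¹ else 1

/-- The system of algebraic equations for a pair `p = (P', P)`.  With division by zero equal to
zero, each equation forces all the differences that occur in it to be nonzero. -/
def PSystem {g : ℕ} (Y : Fin (g + 1) → ℂ × ℂ) (Z : Fin 2 → ℂ × ℂ) (p : ℂ × ℂ) : Prop :=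
  (∏ n, crossRatio p.1 p.2 (Y n).1 (Y n).2 = 1) ∧
    ∏ i, crossRatio p.1 p.2 (Z i).1 (Z i).2 = 1

/-- `P` lists `g = Q - 1` nontrivial (`P' ≠ P`) solutions of the system that are pairwise
inequivalent, where `(P', P)` and `(P, P')` count as equivalent. -/
structure IsSolutionSystem {g : ℕ} (Y : Fin (g + 1) → ℂ × ℂ) (Z : Fin 2 → ℂ × ℂ)
    (P : Fin g → ℂ × ℂ) : Prop where
  solves : ∀ j, PSystem Y Z (P j)
  nontrivial : ∀ j, (P j).1 ≠ (P j).2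
  inequivalent : ∀ i j, i ≠ j → P i ≠ P j ∧ P i ≠ (P j).swap

/-- The set of all equivalence classes of nontrivial solutions of the system. -/
def solutionClasses {g : ℕ} (Y : Fin (g + 1) → ℂ × ℂ) (Z : Fin 2 → ℂ × ℂ) : Set (Sym2 ℂ) :=
  {s | ∃ p : ℂ × ℂ, p.1 ≠ p.2 ∧ PSystem Y Z p ∧ s = s(p.1, p.2)}

/-- The four points `Z_0', Z_0, Z_1', Z_1` are distinct (so that the Baxter modulus, given by
`k² = [Z_0, Z_0'; Z_1, Z_1']` and `k'² = [Z_0', Z_1'; Z_0, Z_1]`, is finite with `k k' ≠ 0`)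
and differ from the points `Y_n', Y_n`, which encode the `2Q` rapidities. -/
structure AdmissiblePoints {g : ℕ} (Y : Fin (g + 1) → ℂ × ℂ) (Z : Fin 2 → ℂ × ℂ) : Prop where
  Z_distinct : [(Z 0).1, (Z 0).2, (Z 1).1, (Z 1).2].Nodup
  Y_ne_Z : ∀ n i, (Y n).1 ≠ (Z i).1 ∧ (Y n).1 ≠ (Z i).2 ∧ (Y n).2 ≠ (Z i).1 ∧ (Y n).2 ≠ (Z i).2

/-- A property of finitely many pairs of points and finitely many further complex numbers holds
generically: it holds off the zero set of some nonzero polynomial in all the coordinates. -/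
def Generically (ι κ : Type) (p : (ι → ℂ × ℂ) → (κ → ℂ) → Prop) : Prop :=
  ∃ D : MvPolynomial ((ι × Bool) ⊕ κ) ℂ, D ≠ 0 ∧
    ∀ (A : ι → ℂ × ℂ) (f : κ → ℂ),
      MvPolynomial.eval
        (Sum.elim (fun i : ι × Bool => if i.2 then (A i.1).1 else (A i.1).2) f) D ≠ 0 → p A f

/-! ### Weyl operators, Lax operators, transfer matrix -/

/-- `ω = exp(2πi/N)`. -/
def omega (N : ℕ) : ℂ := Complex.exp (2 * Real.pi * Complex.I / N)

/-- `ω^{1/2} = exp(πi/N)`. -/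
def omegaHalf (N : ℕ) : ℂ := Complex.exp (Real.pi * Complex.I / N)

/-- `X |β⟩ = ω^β |β⟩`. -/
def clock (N : ℕ) : Matrix (ZMod N) (ZMod N) ℂ :=
  Matrix.diagonal fun b => omega N ^ b.val

/-- `Z |β⟩ = |β + 1⟩`. -/
def shift (N : ℕ) : Matrix (ZMod N) (ZMod N) ℂ :=
  Matrix.of fun a b => if a = b + 1 then 1 else 0

/-- The operator on `(ℂ^N)^{⊗Q}` that acts as `A` in the `n`-th factor. -/
def siteOp {N g : ℕ} (n : Fin (g + 1)) (A : Matrix (ZMod N) (ZMod N) ℂ) :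
    Matrix (Fin (g + 1) → ZMod N) (Fin (g + 1) → ZMod N) ℂ :=
  Matrix.of fun a b => if ∀ m, m ≠ n → a m = b m then A (a n) (b n) else 0

/-- The scalars `u_n, ũ_n, w_n/w̃_n, κ_n, κ̃_n` of the Lax operators. -/
structure LaxScalars (g : ℕ) where
  u : Fin (g + 1) → ℂ
  ut : Fin (g + 1) → ℂ
  v : Fin (g + 1) → ℂ
  κ : Fin (g + 1) → ℂ
  κt : Fin (g + 1) → ℂ

/-- The parametrization of the scalars by cross-ratios. -/
structure LaxScalars.IsCrossRatioParam {g : ℕ} (N : ℕ) (Y : Fin (g + 1) → ℂ × ℂ)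
    (Z : Fin 2 → ℂ × ℂ) (c : LaxScalars g) : Prop where
  u_pow : ∀ n, c.u n ^ N = -(-1) ^ N * (((Y n).2 - (Z 0).1) / ((Y n).2 - (Z 0).2))
  ut_pow : ∀ n, c.ut n ^ N = -(-1) ^ N * (((Y n).2 - (Z 1).1) / ((Y n).2 - (Z 1).2))
  v_pow : ∀ n, c.v n ^ N = crossRatio (Y n).1 (Y n).2 (Z 0).2 (Z 1).2
  κ_pow : ∀ n, c.κ n ^ N = -crossRatio (Y n).1 (Y n).2 (Z 0).1 (Z 0).2
  κt_pow : ∀ n, c.κt n ^ N = -crossRatio (Y n).1 (Y n).2 (Z 1).1 (Z 1).2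

/-- The Lax operator, a `2 × 2` matrix of operators on `ℂ^N`, built from matrices `X`, `Z`. -/
def lax (N : ℕ) [NeZero N] (ξ u ut v κ κt : ℂ) (X Z : Matrix (ZMod N) (ZMod N) ℂ) :
    Matrix (Fin 2) (Fin 2) (Matrix (ZMod N) (ZMod N) ℂ) :=
  !![1 - (omegaHalf N * ξ * u * ut * κ * v) • Z,
      -(u • X * (omegaHalf N • 1 - (κ * v) • Z));
    (ξ * ut) • X⁻¹ * (κt • 1 - (omegaHalf N * v) • Z),
      -((omegaHalf N * ξ * u * ut * κt) • 1) + v • Z]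

/-- The monodromy `M(ξ) = L_0(ξ) L_1(ξ) ⋯ L_{Q-1}(ξ)`. -/
def monodromy {N g : ℕ} [NeZero N] (c : LaxScalars g)
    (X Z : Fin (g + 1) → Matrix (ZMod N) (ZMod N) ℂ) (ξ : ℂ) :
    Matrix (Fin 2) (Fin 2) (Matrix (Fin (g + 1) → ZMod N) (Fin (g + 1) → ZMod N) ℂ) :=
  (List.ofFn fun n =>
    (lax N ξ (c.u n) (c.ut n) (c.v n) (c.κ n) (c.κt n) (X n) (Z n)).map (siteOp n)).prod

/-- The transfer matrix `T(ξ) = tr_{ℂ²} M(ξ)`. -/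
def transfer {N g : ℕ} [NeZero N] (c : LaxScalars g)
    (X Z : Fin (g + 1) → Matrix (ZMod N) (ZMod N) ℂ) (ξ : ℂ) :
    Matrix (Fin (g + 1) → ZMod N) (Fin (g + 1) → ZMod N) ℂ :=
  (monodromy c X Z ξ).trace

/-- The value of the centre `X_n^N`. -/
def centreX {g : ℕ} (Y : Fin (g + 1) → ℂ × ℂ) (Z : Fin 2 → ℂ × ℂ) (P : Fin g → ℂ × ℂ)
    (f : Fin g → ℂ) (n : Fin (g + 1)) : ℂ :=
  H P (evalAt P f (Y n).2 * shiftI Y P ((n : ℕ) + 1)) /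
    H P (evalAt P f (Y n).2 * shiftI Y P ((n : ℕ) + 1) * sigma P (Z 0))

/-- The value of the centre `Z_n^N`. -/
def centreZ {g : ℕ} (Y : Fin (g + 1) → ℂ × ℂ) (Z : Fin 2 → ℂ × ℂ) (P : Fin g → ℂ × ℂ)
    (f : Fin g → ℂ) (n : Fin (g + 1)) : ℂ :=
  H P (evalAt P f (Z 0).2 * shiftI Y P ((n : ℕ) + 1)) /
      H P (evalAt P f (Z 1).2 * sigma P (Z 0) * shiftI Y P ((n : ℕ) + 1)) *
    (H P (evalAt P f (Z 1).2 * sigma P (Z 0) * shiftI Y P (n : ℕ)) /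
      H P (evalAt P f (Z 0).2 * shiftI Y P (n : ℕ)))

/-- `X_n, Z_n` are `N × N` matrices with `X_n Z_n = ω Z_n X_n` whose `N`-th powers are the
scalars prescribed by `{f_j}`, all of which are well defined and nonzero (with division by zero
equal to zero, a centre is nonzero only if every `H` in it is). -/
structure IsWeylFamily {N g : ℕ} [NeZero N] (Y : Fin (g + 1) → ℂ × ℂ) (Z : Fin 2 → ℂ × ℂ)
    (P : Fin g → ℂ × ℂ) (f : Fin g → ℂ)
    (Xop Zop : Fin (g + 1) → Matrix (ZMod N) (ZMod N) ℂ) : Prop where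
  weyl : ∀ n, Xop n * Zop n = omega N • (Zop n * Xop n)
  X_pow : ∀ n, Xop n ^ N = centreX Y Z P f n • (1 : Matrix (ZMod N) (ZMod N) ℂ)
  Z_pow : ∀ n, Zop n ^ N = centreZ Y Z P f n • (1 : Matrix (ZMod N) (ZMod N) ℂ)
  X_ne : ∀ n, centreX Y Z P f n ≠ 0
  Z_ne : ∀ n, centreZ Y Z P f n ≠ 0

/-! ### The three-dimensional vertex -/

/-- `U({f_j}, 𝒜, ℬ)`. -/
def Ufun {g : ℕ} (N : ℕ) (P : Fin g → ℂ × ℂ) (f : Fin g → ℂ) (A B : ℂ × ℂ) : ℂ :=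
  -(-1) ^ N * ((A.2 - B.1) / (A.2 - B.2)) *
    (H P (evalAt P f A.2) / H P (evalAt P f A.2 * sigma P B))

/-- `W({f_j}, 𝒜, ℬ) = -U({f_j}, ℬ, 𝒜)`. -/
def Wfun {g : ℕ} (N : ℕ) (P : Fin g → ℂ × ℂ) (f : Fin g → ℂ) (A B : ℂ × ℂ) : ℂ :=
  -Ufun N P f B A

/-- The scalar parts of the affine Weyl variables on the three incoming links and on the three
outgoing (primed) links of a vertex; `κ` does not change along a line. -/
structure Vertex where
  u₁ : ℂ
  w₁ : ℂ
  κ₁ : ℂ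
  u₂ : ℂ
  w₂ : ℂ
  κ₂ : ℂ
  u₃ : ℂ
  w₃ : ℂ
  κ₃ : ℂ
  u₁' : ℂ
  w₁' : ℂ
  u₂' : ℂ
  w₂' : ℂ
  u₃' : ℂ
  w₃' : ℂ

/-- The scalars are nonzero `N`-th roots of the solution of the functional mapping with
parameters `{f_j}` for three lines carrying the pairs `𝒳, 𝒴, 𝒵`, and the roots are chosen so that
the vertex preserves `w₁ w₂`, `u₂ u₃` and `u₁ / w₃`. -/
structure Vertex.IsFunctional {g : ℕ} (N : ℕ) (P : Fin g → ℂ × ℂ) (f : Fin g → ℂ)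
    (X Y Z : ℂ × ℂ) (V : Vertex) : Prop where
  u₁_pow : V.u₁ ^ N = Ufun N P f Y Z
  w₁_pow : V.w₁ ^ N = Wfun N P f Y Z
  u₂_pow : V.u₂ ^ N = Ufun N P (f * sigma P Y) X Z
  w₂_pow : V.w₂ ^ N = Wfun N P (f * sigma P Y) X Z
  u₃_pow : V.u₃ ^ N = Ufun N P f X Y
  w₃_pow : V.w₃ ^ N = Wfun N P f X Y
  u₁'_pow : V.u₁' ^ N = Ufun N P (f * sigma P X) Y Z
  w₁'_pow : V.w₁' ^ N = Wfun N P (f * sigma P X) Y Z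
  u₂'_pow : V.u₂' ^ N = Ufun N P f X Z
  w₂'_pow : V.w₂' ^ N = Wfun N P f X Z
  u₃'_pow : V.u₃' ^ N = Ufun N P (f * sigma P Z) X Y
  w₃'_pow : V.w₃' ^ N = Wfun N P (f * sigma P Z) X Y
  κ₁_pow : V.κ₁ ^ N = -crossRatio Y.1 Y.2 Z.1 Z.2
  κ₂_pow : V.κ₂ ^ N = -crossRatio X.1 X.2 Z.1 Z.2
  κ₃_pow : V.κ₃ ^ N = -crossRatio X.1 X.2 Y.1 Y.2
  ne_zero : ∀ z ∈ [V.u₁, V.w₁, V.κ₁, V.u₂, V.w₂, V.κ₂, V.u₃, V.w₃, V.κ₃,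
    V.u₁', V.w₁', V.u₂', V.w₂', V.u₃', V.w₃'], z ≠ 0
  ww : V.w₁ * V.w₂ = V.w₁' * V.w₂'
  uu : V.u₂ * V.u₃ = V.u₂' * V.u₃'
  uw : V.u₁ / V.w₃ = V.u₁' / V.w₃'

/-- The coordinates `x_1, x_2, x_3` of the Fermat points of a vertex, and
`x_4 = x_1 x_2 / (ω x_3)`. -/
def Vertex.x (N : ℕ) (V : Vertex) : Fin 4 → ℂ :=
  ![(omegaHalf N)⁻¹ * (V.u₂ / (V.κ₁ * V.u₁)),
    (omegaHalf N)⁻¹ * (V.κ₂ * V.u₂' / V.u₁'),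
    (omega N)⁻¹ * (V.u₂' / V.u₁),
    (omega N)⁻¹ * (V.κ₂ * V.u₂ / (V.κ₁ * V.u₁'))]

/-- `y_1, …, y_4` complete the `x_i` to points of the Fermat curve `x^N + y^N = 1` (with
`y_i ≠ 0`), with the phases of the ratios of the `y_i` fixed by the Weyl scalars. -/
structure Vertex.IsFermat (N : ℕ) (V : Vertex) (y : Fin 4 → ℂ) : Prop where
  curve : ∀ i, V.x N i ^ N + y i ^ N = 1
  ne_zero : ∀ i, y i ≠ 0
  y₃_y₁ : y 2 / y 0 = V.κ₁ * V.w₁ / V.u₃'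
  y₄_y₁ : y 3 / y 0 = (omegaHalf N)⁻¹ * (V.κ₃ * V.w₃ / V.w₂)
  y₃_y₂ : y 2 / y 1 = V.w₂' / V.w₃

/-- The cyclic function with `w_p(0) = 1`, `w_p(n) / w_p(n-1) = y / (1 - ω^n x)`. -/
def cyclicW (N : ℕ) (x y : ℂ) (n : ZMod N) : ℂ :=
  ∏ k ∈ Finset.range n.val, y / (1 - omega N ^ (k + 1) * x)

/-- The matrix `R_{i₁ i₂ i₃}^{j₁ j₂ j₃}` of the vertex (lower indices number the rows). -/
def vertexR (N : ℕ) (x y : Fin 4 → ℂ) (i₁ i₂ i₃ j₁ j₂ j₃ : ZMod N) : ℂ :=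
  if i₂ + i₃ = j₂ + j₃ then
    omega N ^ ((j₁ - i₁) * j₃).val *
      (cyclicW N (x 0) (y 0) (i₂ - i₁) * cyclicW N (x 1) (y 1) (j₂ - j₁)) /
      (cyclicW N (x 2) (y 2) (j₂ - i₁) * cyclicW N (x 3) (y 3) (i₂ - j₁))
  else 0

/-- The intertwiner `S_{12}`: the trace over the third space of the product of the matrices of the
vertices `V` and `Vt`, on the subspace of the spaces `1, 2, 1̃, 2̃` on which the indices
of the spaces `1` and `1̃`, and those of `2` and `2̃`, add up to `0`. -/
def intertwiner (N : ℕ) [NeZero N] (V Vt : Vertex) (y yt : Fin 4 → ℂ) :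
    Matrix (ZMod N × ZMod N) (ZMod N × ZMod N) ℂ :=
  Matrix.of fun a b => ∑ m : ZMod N, ∑ n : ZMod N,
    vertexR N (V.x N) y a.1 a.2 m b.1 b.2 n *
      vertexR N (Vt.x N) yt (-a.1) (-a.2) n (-b.1) (-b.2) m

/-- The operator on `(ℂ^N)^{⊗Q} ⊗ ℂ^N` that acts as `S` on the `n`-th factor of the chain and on
the auxiliary last factor. -/
def siteAuxOp {N g : ℕ} (n : Fin (g + 1)) (S : Matrix (ZMod N × ZMod N) (ZMod N × ZMod N) ℂ) :
    Matrix ((Fin (g + 1) → ZMod N) × ZMod N) ((Fin (g + 1) → ZMod N) × ZMod N) ℂ :=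
  Matrix.of fun a b =>
    if ∀ m, m ≠ n → a.1 m = b.1 m then S (a.1 n, a.2) (b.1 n, b.2) else 0

/-- All `N`-th roots that enter the isospectral transformation `{f_j} → {f_j σ_j(𝒳)}`: the scalars
`α_n, β_n` (before) and `α_n', β_n'` (after) of the Weyl operators of the chain, and for each site
the two vertices through which the auxiliary line passes, with the `y`-coordinates of their Fermat
points. -/
structure ChainRoots (g : ℕ) where
  α : Fin (g + 1) → ℂ
  β : Fin (g + 1) → ℂ
  α' : Fin (g + 1) → ℂ
  β' : Fin (g + 1) → ℂ
  V : Fin (g + 1) → Vertex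
  Vt : Fin (g + 1) → Vertex
  y : Fin (g + 1) → Fin 4 → ℂ
  yt : Fin (g + 1) → Fin 4 → ℂ

/-- `r` is a consistent choice of the roots.  The first vertex at the site `n` belongs to the pairs
`𝒳, 𝒴_n, 𝒵_0` and to `{f_j I_j(n+1)}`, the second one to `𝒳, 𝒴_n, 𝒵_1` and to
`{f_j I_j(n+1) σ_j(𝒵_0)}`.  The third links of the two vertices are connected periodically, the
auxiliary second links are connected periodically along the chain (`n + 1` is cyclic), and the
first links are those of the chain before and after the transformation. -/
structure ChainRoots.IsConsistent {g : ℕ} (N : ℕ) (Y : Fin (g + 1) → ℂ × ℂ) (Z : Fin 2 → ℂ × ℂ)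
    (P : Fin g → ℂ × ℂ) (c : LaxScalars g) (f : Fin g → ℂ) (X : ℂ × ℂ) (r : ChainRoots g) :
    Prop where
  sigma_ne : ∀ j, sigma P X j ≠ 0
  α_pow : ∀ n, r.α n ^ N = centreX Y Z P f n
  β_pow : ∀ n, r.β n ^ N = centreZ Y Z P f n
  α'_pow : ∀ n, r.α' n ^ N = centreX Y Z P (f * sigma P X) n
  β'_pow : ∀ n, r.β' n ^ N = centreZ Y Z P (f * sigma P X) n
  V_functional : ∀ n : Fin (g + 1),
    (r.V n).IsFunctional N P (f * shiftI Y P ((n : ℕ) + 1)) X (Y n) (Z 0)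
  Vt_functional : ∀ n : Fin (g + 1),
    (r.Vt n).IsFunctional N P (f * shiftI Y P ((n : ℕ) + 1) * sigma P (Z 0)) X (Y n) (Z 1)
  V_fermat : ∀ n, (r.V n).IsFermat N (r.y n)
  Vt_fermat : ∀ n, (r.Vt n).IsFermat N (r.yt n)
  first_in : ∀ n, (r.V n).u₁ = c.u n * r.α n ∧ (r.Vt n).u₁ = c.ut n * (r.α n)⁻¹ ∧
    (r.V n).w₁ / (r.Vt n).w₁ = c.v n * r.β n ∧ (r.V n).κ₁ = c.κ n ∧ (r.Vt n).κ₁ = c.κt n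
  first_out : ∀ n, (r.V n).u₁' = c.u n * r.α' n ∧ (r.Vt n).u₁' = c.ut n * (r.α' n)⁻¹ ∧
    (r.V n).w₁' / (r.Vt n).w₁' = c.v n * r.β' n
  second : ∀ n, (r.V (n + 1)).u₂ = (r.V n).u₂' ∧ (r.V (n + 1)).w₂ = (r.V n).w₂' ∧
    (r.V (n + 1)).κ₂ = (r.V n).κ₂
  second_t : ∀ n, (r.Vt (n + 1)).u₂ = (r.Vt n).u₂' ∧ (r.Vt (n + 1)).w₂ = (r.Vt n).w₂' ∧
    (r.Vt (n + 1)).κ₂ = (r.Vt n).κ₂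
  third : ∀ n, (r.Vt n).u₃ = (r.V n).u₃' ∧ (r.Vt n).w₃ = (r.V n).w₃' ∧ (r.Vt n).κ₃ = (r.V n).κ₃
  third_periodic : ∀ n, (r.Vt n).u₃' = (r.V n).u₃ ∧ (r.Vt n).w₃' = (r.V n).w₃

/-- `𝐐 = S(𝒳, 𝒴_0) S(𝒳, 𝒴_1) ⋯ S(𝒳, 𝒴_{Q-1})`. -/
def ChainRoots.bigQ {g : ℕ} (N : ℕ) [NeZero N] (r : ChainRoots g) :
    Matrix ((Fin (g + 1) → ZMod N) × ZMod N) ((Fin (g + 1) → ZMod N) × ZMod N) ℂ :=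
  (List.ofFn fun n => siteAuxOp n (intertwiner N (r.V n) (r.Vt n) (r.y n) (r.yt n))).prod

/-- `𝐊`, the trace of `𝐐` over the auxiliary space `ℂ^N`. -/
def ChainRoots.bigK {g : ℕ} (N : ℕ) [NeZero N] (r : ChainRoots g) :
    Matrix (Fin (g + 1) → ZMod N) (Fin (g + 1) → ZMod N) ℂ :=
  Matrix.of fun a b => ∑ s : ZMod N, r.bigQ N (a, s) (b, s)

/-- The transfer matrix `T(ξ; {f_j})` before the transformation, with `X_n = α_n X`,
`Z_n = β_n Z`. -/
def ChainRoots.transferBefore {g : ℕ} (N : ℕ) [NeZero N] (c : LaxScalars g) (r : ChainRoots g)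
    (ξ : ℂ) : Matrix (Fin (g + 1) → ZMod N) (Fin (g + 1) → ZMod N) ℂ :=
  transfer c (fun n => r.α n • clock N) (fun n => r.β n • shift N) ξ

/-- The transfer matrix `T(ξ; {f_j σ_j(𝒳)})` after the transformation. -/
def ChainRoots.transferAfter {g : ℕ} (N : ℕ) [NeZero N] (c : LaxScalars g) (r : ChainRoots g)
    (ξ : ℂ) : Matrix (Fin (g + 1) → ZMod N) (Fin (g + 1) → ZMod N) ℂ :=
  transfer c (fun n => r.α' n • clock N) (fun n => r.β' n • shift N) ξ

end

end BS

namespace BS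

noncomputable section

/-! ### Operators on a chain and on auxiliary spaces -/

section Lift

variable {A : Type*} [Ring A] {I J : Type*} [Fintype I] [Fintype J] [DecidableEq I] [DecidableEq J]

/-- `X ⊗ 1` for a matrix `X` with entries in a noncommutative ring. -/
def liftL (J : Type*) [Fintype J] [DecidableEq J] : Matrix I I A →+* Matrix (I × J) (I × J) A where
  toFun X := Matrix.of fun p q => if p.2 = q.2 then X p.1 q.1 else 0
  map_one' := by
    ext ⟨i, s⟩ ⟨j, t⟩
    by_cases h : s = t <;> by_cases h' : i = j <;> simp [Matrix.one_apply, h, h']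
  map_mul' X Y := by
    ext ⟨i, s⟩ ⟨j, t⟩
    simp only [Matrix.of_apply, Matrix.mul_apply, Fintype.sum_prod_type]
    by_cases h : s = t
    · subst h
      simp only [if_true]
      refine Finset.sum_congr rfl fun k _ => ?_
      rw [Finset.sum_eq_single s] <;> simp +contextual [eq_comm]
    · simp only [h, if_false]
      refine (Finset.sum_eq_zero fun k _ => Finset.sum_eq_zero fun u _ => ?_).symm
      by_cases hu : s = u
      · subst hu; simp [h]
      · simp [hu]
  map_zero' := by ext; simp
  map_add' X Y := by
    ext ⟨i, s⟩ ⟨j, t⟩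
    by_cases h : s = t <;> simp [h]

/-- `1 ⊗ S` for a matrix `S` with entries in a noncommutative ring. -/
def liftR (I : Type*) [Fintype I] [DecidableEq I] : Matrix J J A →+* Matrix (I × J) (I × J) A where
  toFun X := Matrix.of fun p q => if p.1 = q.1 then X p.2 q.2 else 0
  map_one' := by
    ext ⟨i, s⟩ ⟨j, t⟩
    by_cases h : s = t <;> by_cases h' : i = j <;> simp [Matrix.one_apply, h, h']
  map_mul' X Y := by
    ext ⟨i, s⟩ ⟨j, t⟩
    simp only [Matrix.of_apply, Matrix.mul_apply, Fintype.sum_prod_type_right]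
    by_cases h : i = j
    · subst h
      simp only [if_true]
      refine Finset.sum_congr rfl fun k _ => ?_
      rw [Finset.sum_eq_single i] <;> simp +contextual [eq_comm]
    · simp only [h, if_false]
      refine (Finset.sum_eq_zero fun k _ => Finset.sum_eq_zero fun u _ => ?_).symm
      by_cases hu : i = u
      · subst hu; simp [h]
      · simp [hu]
  map_zero' := by ext; simp
  map_add' X Y := by
    ext ⟨i, s⟩ ⟨j, t⟩
    by_cases h : i = j <;> simp [h]

theorem liftL_apply (X : Matrix I I A) (p q : I × J) :
    liftL J X p q = if p.2 = q.2 then X p.1 q.1 else 0 := rfl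

theorem liftR_apply (X : Matrix J J A) (p q : I × J) :
    liftR I X p q = if p.1 = q.1 then X p.2 q.2 else 0 := rfl

theorem liftL_mul_liftR_apply (X : Matrix I I A) (S : Matrix J J A) (p q : I × J) :
    (liftL J X * liftR I S) p q = X p.1 q.1 * S p.2 q.2 := by
  rw [Matrix.mul_apply, Fintype.sum_prod_type, Finset.sum_eq_single q.1, Finset.sum_eq_single p.2]
  · simp [liftL_apply, liftR_apply]
  · intro b _ hb; simp [liftL_apply, hb.symm]
  · simp
  · intro b _ hb; simp [liftR_apply, hb]
  · simp

theorem liftR_mul_liftL_apply (X : Matrix I I A) (S : Matrix J J A) (p q : I × J) :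
    (liftR I S * liftL J X) p q = S p.2 q.2 * X p.1 q.1 := by
  rw [Matrix.mul_apply, Fintype.sum_prod_type, Finset.sum_eq_single p.1, Finset.sum_eq_single q.2]
  · simp [liftL_apply, liftR_apply]
  · intro b _ hb; simp [liftL_apply, hb]
  · simp
  · intro b _ hb; simp [liftR_apply, hb.symm]
  · simp

theorem commute_liftL_liftR {X : Matrix I I A} {S : Matrix J J A}
    (h : ∀ i j s t, Commute (X i j) (S s t)) : Commute (liftL J X) (liftR I S) := by
  ext p q
  rw [liftL_mul_liftR_apply, liftR_mul_liftL_apply, (h _ _ _ _).eq]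

theorem trace_liftL_mul_liftR (X : Matrix I I A) (S : Matrix J J A) :
    (liftL J X * liftR I S).trace = X.trace * S.trace := by
  simp only [Matrix.trace, Matrix.diag_apply, liftL_mul_liftR_apply, Fintype.sum_prod_type,
    Finset.sum_mul_sum]

theorem trace_liftR_mul_liftL (X : Matrix I I A) (S : Matrix J J A) :
    (liftR I S * liftL J X).trace = S.trace * X.trace := by
  simp only [Matrix.trace, Matrix.diag_apply, liftR_mul_liftL_apply, Fintype.sum_prod_type_right,
    Finset.sum_mul_sum]

/-- Local intertwining relations at the sites of a chain combine to a global one. -/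
theorem intertwine_prod {m : ℕ} (X X' : Fin m → Matrix I I A) (S : Fin m → Matrix J J A)
    (G : Fin (m + 1) → Matrix (I × J) (I × J) A)
    (hX : ∀ n k, n ≠ k → ∀ i j s t, Commute (X n i j) (S k s t))
    (hX' : ∀ n k, n ≠ k → ∀ i j s t, Commute (X' n i j) (S k s t))
    (hG : ∀ n : Fin m, G n.castSucc * (liftL J (X n) * liftR I (S n)) =
      liftR I (S n) * liftL J (X' n) * G n.succ) :
    G 0 * (liftL J (List.ofFn X).prod * liftR I (List.ofFn S).prod) =
      liftR I (List.ofFn S).prod * liftL J (List.ofFn X').prod * G (Fin.last m) := by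
  induction m with
  | zero => simp
  | succ m ih =>
    have ih' := ih (fun n => X n.succ) (fun n => X' n.succ) (fun n => S n.succ) (fun n => G n.succ)
      (fun n k hnk => hX _ _ (by simpa using hnk)) (fun n k hnk => hX' _ _ (by simpa using hnk))
      (fun n => by simpa using hG n.succ)
    have h0 := hG 0
    simp only [List.ofFn_succ, List.prod_cons, map_mul]
    have c1 : Commute (liftL J (List.ofFn fun n : Fin m => X n.succ).prod) (liftR I (S 0)) := by
      rw [map_list_prod]
      refine Commute.list_prod_left _ _ fun x hx => ?_
      simp only [List.map_ofFn, List.mem_ofFn] at hx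
      obtain ⟨n, rfl⟩ := hx
      exact commute_liftL_liftR (hX _ _ (Fin.succ_ne_zero n))
    have c2 : Commute (liftL J (X' 0)) (liftR I (List.ofFn fun n : Fin m => S n.succ).prod) := by
      rw [map_list_prod]
      refine Commute.list_prod_right _ _ fun x hx => ?_
      simp only [List.map_ofFn, List.mem_ofFn] at hx
      obtain ⟨n, rfl⟩ := hx
      exact commute_liftL_liftR (hX' _ _ (Fin.succ_ne_zero n).symm)
    simp only [Fin.castSucc_zero, Fin.succ_zero_eq_one] at h0 ih'
    set XT := liftL J (List.ofFn fun n : Fin m => X n.succ).prod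
    set ST := liftR I (List.ofFn fun n : Fin m => S n.succ).prod
    set XT' := liftL J (List.ofFn fun n : Fin m => X' n.succ).prod
    calc G 0 * (liftL J (X 0) * XT * (liftR I (S 0) * ST))
        = G 0 * (liftL J (X 0) * (XT * liftR I (S 0)) * ST) := by simp only [mul_assoc]
      _ = G 0 * (liftL J (X 0) * liftR I (S 0)) * (XT * ST) := by
          rw [c1.eq]; simp only [mul_assoc]
      _ = liftR I (S 0) * liftL J (X' 0) * (G 1 * (XT * ST)) := by
          rw [h0]; simp only [mul_assoc]
      _ = liftR I (S 0) * (liftL J (X' 0) * ST) * (XT' * G (Fin.last (m + 1))) := by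
          rw [ih']; simp only [mul_assoc]; rfl
      _ = _ := by rw [c2.eq]; simp only [mul_assoc]

/-- The traces over the auxiliary spaces of intertwined products. -/
theorem trace_mul_trace_of_intertwine [Algebra ℂ A] {m : ℕ} (X X' : Fin m → Matrix I I A)
    (S : Fin m → Matrix J J A) (G : Fin (m + 1) → Matrix (I × J) (I × J) ℂ)
    (hX : ∀ n k, n ≠ k → ∀ i j s t, Commute (X n i j) (S k s t))
    (hX' : ∀ n k, n ≠ k → ∀ i j s t, Commute (X' n i j) (S k s t))
    (hG : ∀ n : Fin m, (G n.castSucc).map (algebraMap ℂ A) * (liftL J (X n) * liftR I (S n)) =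
      liftR I (S n) * liftL J (X' n) * (G n.succ).map (algebraMap ℂ A))
    (hG0 : G (Fin.last m) = G 0) (hu : IsUnit (G 0)) :
    (List.ofFn X).prod.trace * (List.ofFn S).prod.trace =
      (List.ofFn S).prod.trace * (List.ofFn X').prod.trace := by
  have key := intertwine_prod X X' S (fun n => (G n).map (algebraMap ℂ A)) hX hX' hG
  simp only [hG0] at key
  obtain ⟨u, hu⟩ := hu
  rw [← trace_liftL_mul_liftR, ← trace_liftR_mul_liftL]
  have tr_conj : ∀ (C : Matrix (I × J) (I × J) ℂ) (M : Matrix (I × J) (I × J) A),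
      (C.map (algebraMap ℂ A) * M).trace = (M * C.map (algebraMap ℂ A)).trace := by
    intro C M
    simp only [Matrix.trace, Matrix.diag_apply, Matrix.mul_apply, Matrix.map_apply]
    rw [Finset.sum_comm]
    refine Finset.sum_congr rfl fun i _ => Finset.sum_congr rfl fun j _ => ?_
    exact Algebra.commutes _ _
  have hinv : (↑u⁻¹ : Matrix (I × J) (I × J) ℂ).map (algebraMap ℂ A) *
      (G 0).map (algebraMap ℂ A) = 1 := by
    rw [← Matrix.map_mul, ← hu, Units.inv_mul, Matrix.map_one _ (map_zero _) (map_one _)]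
  have hinv' : (G 0).map (algebraMap ℂ A) *
      (↑u⁻¹ : Matrix (I × J) (I × J) ℂ).map (algebraMap ℂ A) = 1 := by
    rw [← Matrix.map_mul, ← hu, Units.mul_inv, Matrix.map_one _ (map_zero _) (map_one _)]
  set W := liftL J (List.ofFn X).prod * liftR I (List.ofFn S).prod
  set W' := liftR I (List.ofFn S).prod * liftL J (List.ofFn X').prod
  calc W.trace = ((↑u⁻¹ : Matrix (I × J) (I × J) ℂ).map (algebraMap ℂ A) *
        ((G 0).map (algebraMap ℂ A) * W)).trace := by rw [← mul_assoc, hinv, one_mul]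
    _ = W'.trace := by rw [tr_conj, key, mul_assoc, hinv', mul_one]

end Lift

section Site

variable {N g : ℕ}

theorem siteOp_apply (n : Fin (g + 1)) (A : Matrix (ZMod N) (ZMod N) ℂ)
    (a b : Fin (g + 1) → ZMod N) :
    siteOp n A a b = if ∀ m, m ≠ n → a m = b m then A (a n) (b n) else 0 := rfl

variable [NeZero N]

/-- Acting in one factor of the chain, as an algebra homomorphism. -/
def siteHom (n : Fin (g + 1)) : Matrix (ZMod N) (ZMod N) ℂ →ₐ[ℂ]
    Matrix (Fin (g + 1) → ZMod N) (Fin (g + 1) → ZMod N) ℂ :=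
  AlgHom.ofLinearMap
    { toFun := siteOp n
      map_add' := fun A B => by
        ext a b; simp only [siteOp_apply, Matrix.add_apply]; split_ifs <;> simp
      map_smul' := fun c A => by
        ext a b; simp only [siteOp_apply, Matrix.smul_apply, RingHom.id_apply]
        split_ifs <;> simp }
    (by
      ext a b
      simp only [LinearMap.coe_mk, AddHom.coe_mk, siteOp_apply, Matrix.one_apply]
      by_cases h : a = b
      · simp [h]
      · simp only [h, if_false]
        split_ifs with h1 h2
        · exact absurd (funext fun m => by
            by_cases hm : m = n
            · exact hm ▸ h2
            · exact h1 m hm) h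
        · rfl
        · rfl)
    (by
      intro A B
      ext a b
      simp only [LinearMap.coe_mk, AddHom.coe_mk, siteOp_apply, Matrix.mul_apply]
      have hsum : ∀ F : (Fin (g + 1) → ZMod N) → ℂ,
          (∀ c, (¬ ∀ m, m ≠ n → a m = c m) → F c = 0) →
          ∑ c, F c = ∑ x : ZMod N, F (Function.update a n x) := by
        intro F hF
        symm
        refine Finset.sum_of_injOn (fun x => Function.update a n x) ?_ (by simp) ?_ (by simp)
        · intro x _ y _ hxy
          simpa using congrFun hxy n
        · intro c _ hc
          refine hF c fun h => hc ?_
          refine ⟨c n, by simp, ?_⟩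
          ext m
          by_cases hm : m = n
          · subst hm; simp
          · simp [Function.update_of_ne hm, h m hm]
      rw [hsum _ (fun c hc => by simp [hc])]
      by_cases h : ∀ m, m ≠ n → a m = b m
      · rw [if_pos h]
        refine Finset.sum_congr rfl fun x _ => ?_
        rw [if_pos (fun m hm => by simp [Function.update_of_ne hm, h m hm]),
          if_pos (fun m hm => by simp [Function.update_of_ne hm, h m hm])]
        simp
      · rw [if_neg h]
        refine (Finset.sum_eq_zero fun x _ => ?_).symm
        rw [if_neg (c := ∀ m, m ≠ n → Function.update a n x m = b m), mul_zero]
        intro h'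
        exact h fun m hm => by simpa [Function.update_of_ne hm] using h' m hm)

theorem siteHom_apply (n : Fin (g + 1)) (A : Matrix (ZMod N) (ZMod N) ℂ) :
    siteHom n A = siteOp n A := rfl

theorem siteOp_mul_siteOp_apply {n k : Fin (g + 1)} (h : n ≠ k)
    (A B : Matrix (ZMod N) (ZMod N) ℂ) (a b : Fin (g + 1) → ZMod N) :
    (siteOp n A * siteOp k B) a b =
      if ∀ m, m ≠ n → m ≠ k → a m = b m then A (a n) (b n) * B (a k) (b k) else 0 := by
  rw [Matrix.mul_apply, Finset.sum_eq_single (Function.update a n (b n))]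
  · simp only [siteOp_apply]
    rw [if_pos (fun m hm => by simp [Function.update_of_ne hm])]
    simp only [Function.update_self, Function.update_of_ne h.symm]
    by_cases h' : ∀ m, m ≠ n → m ≠ k → a m = b m
    · rw [if_pos h', if_pos]
      intro m hm
      by_cases hmn : m = n
      · subst hmn; simp
      · simp [Function.update_of_ne hmn, h' m hmn hm]
    · rw [if_neg h', if_neg, mul_zero]
      intro h2
      exact h' fun m hmn hmk => by simpa [Function.update_of_ne hmn] using h2 m hmk
  · intro c _ hc
    simp only [siteOp_apply]
    by_cases h1 : ∀ m, m ≠ n → a m = c m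
    · rw [if_neg (c := ∀ m, m ≠ k → c m = b m), mul_zero]
      intro h2
      refine hc (funext fun m => ?_)
      by_cases hm : m = n
      · subst hm; simp [h2 m h]
      · simp [Function.update_of_ne hm, h1 m hm]
    · rw [if_neg h1, zero_mul]
  · simp

theorem commute_siteOp {n k : Fin (g + 1)} (h : n ≠ k) (A B : Matrix (ZMod N) (ZMod N) ℂ) :
    Commute (siteOp n A) (siteOp k B) := by
  ext a b
  rw [siteOp_mul_siteOp_apply h, siteOp_mul_siteOp_apply h.symm]
  simp only [mul_comm (A _ _)]
  congr 1
  exact propext ⟨fun h m h1 h2 => h m h2 h1, fun h m h1 h2 => h m h2 h1⟩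

end Site

end

end BS

namespace BS

noncomputable section

/-! ### Roots of unity and cyclic weights -/

section Weights

variable {K : Type*} [Field K] {N : ℕ}

/-- The additive character `a ↦ ζ^a` of `ZMod N`. -/
def chi (ζ : K) (a : ZMod N) : K := ζ ^ a.val

/-- The weight `w(n) = ∏_{k=1}^n y / (1 - ζ^k x)`. -/
def cycW (ζ x y : K) (n : ZMod N) : K := ∏ k ∈ Finset.range n.val, y / (1 - ζ ^ (k + 1) * x)

theorem cyclicW_eq (x y : ℂ) (n : ZMod N) : cyclicW N x y n = cycW (omega N) x y n := rfl

theorem chi_zero (ζ : K) : chi ζ (0 : ZMod N) = 1 := by simp [chi]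

variable [NeZero N] {ζ : K}

theorem chi_natCast (h : ζ ^ N = 1) (k : ℕ) : chi ζ (k : ZMod N) = ζ ^ k := by
  rw [chi, ZMod.val_natCast]
  conv_rhs => rw [← Nat.mod_add_div k N, pow_add, pow_mul, h, one_pow, mul_one]

theorem chi_add (h : ζ ^ N = 1) (a b : ZMod N) : chi ζ (a + b) = chi ζ a * chi ζ b := by
  obtain ⟨k, rfl⟩ := ZMod.natCast_zmod_surjective a
  obtain ⟨l, rfl⟩ := ZMod.natCast_zmod_surjective b
  rw [← Nat.cast_add, chi_natCast h, chi_natCast h, chi_natCast h, pow_add]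

theorem chi_one (h : ζ ^ N = 1) : chi ζ (1 : ZMod N) = ζ := by
  simpa using chi_natCast h 1

theorem chi_ne_zero (h : ζ ^ N = 1) (a : ZMod N) : chi ζ a ≠ 0 := by
  refine pow_ne_zero _ fun h0 => ?_
  rw [h0, zero_pow (NeZero.ne N)] at h
  exact zero_ne_one h

theorem chi_neg (h : ζ ^ N = 1) (a : ZMod N) : chi ζ (-a) = (chi ζ a)⁻¹ := by
  refine eq_inv_of_mul_eq_one_left ?_
  rw [← chi_add h, neg_add_cancel, chi_zero]

theorem chi_sub (h : ζ ^ N = 1) (a b : ZMod N) : chi ζ (a - b) = chi ζ a / chi ζ b := by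
  rw [sub_eq_add_neg, chi_add h, chi_neg h, div_eq_mul_inv]

theorem chi_pow (h : ζ ^ N = 1) (a : ZMod N) : chi ζ a ^ N = 1 := by
  rw [chi, ← pow_mul, mul_comm, pow_mul, h, one_pow]

theorem prod_range_sub_pow_mul (h : IsPrimitiveRoot ζ N) (x y : K) :
    ∏ k ∈ Finset.range N, (x - ζ ^ k * y) = x ^ N - y ^ N := by
  have hN : 0 < N := NeZero.pos N
  have := X_pow_sub_C_eq_prod h hN (α := y) (a := y ^ N) rfl
  have h2 := congrArg (Polynomial.eval x) this
  simpa [Polynomial.eval_prod] using h2.symm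

theorem one_sub_chi_mul_ne_zero (h : ζ ^ N = 1) {x y : K} (hc : x ^ N + y ^ N = 1) (hy : y ≠ 0)
    (n : ZMod N) : 1 - chi ζ n * x ≠ 0 := by
  intro h0
  have h1 : chi ζ n * x = 1 := (sub_eq_zero.1 h0).symm
  have h2 : x ^ N = 1 := by
    have := congrArg (· ^ N) h1
    simpa [mul_pow, chi_pow h] using this
  rw [h2] at hc
  exact pow_ne_zero N hy (by linear_combination hc)

theorem cycW_ne_zero (h : ζ ^ N = 1) {x y : K} (hc : x ^ N + y ^ N = 1) (hy : y ≠ 0)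
    (n : ZMod N) : cycW ζ x y n ≠ 0 := by
  refine Finset.prod_ne_zero_iff.2 fun k _ => div_ne_zero hy ?_
  rw [← chi_natCast h]
  exact one_sub_chi_mul_ne_zero h hc hy _

theorem cycW_mul (h : IsPrimitiveRoot ζ N) {x y : K} (hc : x ^ N + y ^ N = 1) (hy : y ≠ 0)
    (n : ZMod N) : cycW ζ x y n * (1 - chi ζ n * x) = y * cycW ζ x y (n - 1) := by
  have hz := h.pow_eq_one
  have hf : ∀ k : ℕ, 1 - ζ ^ k * x ≠ 0 := fun k => by
    rw [← chi_natCast hz]; exact one_sub_chi_mul_ne_zero hz hc hy _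
  have hNpos : 0 < N := NeZero.pos N
  by_cases hn : n = 0
  · subst hn
    obtain ⟨M, rfl⟩ : ∃ M, N = M + 1 := ⟨N - 1, by omega⟩
    have h1 : ((0 : ZMod (M + 1)) - 1).val = M := by rw [zero_sub]; exact ZMod.val_neg_one M
    rw [cycW, cycW, h1, chi_zero]
    simp only [ZMod.val_zero, Finset.range_zero, Finset.prod_empty, one_mul]
    have h2 := prod_range_sub_pow_mul h 1 x
    rw [Finset.prod_range_succ', one_pow] at h2
    rw [Finset.prod_div_distrib, Finset.prod_const, Finset.card_range, mul_div_assoc',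
      eq_div_iff (Finset.prod_ne_zero_iff.2 fun k _ => hf _), ← pow_succ']
    rw [pow_zero, one_mul] at h2
    linear_combination h2 - hc
  · have h1 : n.val = (n - 1).val + 1 := by
      have h3 : n.val ≠ 0 := fun h0 => hn ((ZMod.val_eq_zero n).1 h0)
      have h4 : (n - 1 : ZMod N) = ((n.val - 1 : ℕ) : ZMod N) := by
        rw [Nat.cast_sub (by omega), ZMod.natCast_zmod_val, Nat.cast_one]
      rw [h4, ZMod.val_natCast_of_lt (by have := ZMod.val_lt n; omega)]
      omega
    rw [cycW, cycW, chi, h1, Finset.prod_range_succ]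
    rw [mul_assoc, div_mul_cancel₀ _ (hf ((n - 1).val + 1)), mul_comm]

end Weights

section Omega

variable (N : ℕ) [NeZero N]

theorem omega_primitive : IsPrimitiveRoot (omega N) N :=
  Complex.isPrimitiveRoot_exp N (NeZero.ne N)

theorem omega_pow : omega N ^ N = 1 := (omega_primitive N).pow_eq_one

theorem omegaHalf_sq (N : ℕ) : omegaHalf N ^ 2 = omega N := by
  rw [omegaHalf, omega, ← Complex.exp_nat_mul]
  congr 1
  push_cast
  ring

theorem omegaHalf_ne_zero (N : ℕ) : omegaHalf N ≠ 0 := Complex.exp_ne_zero _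

theorem omega_ne_zero (N : ℕ) : omega N ≠ 0 := Complex.exp_ne_zero _

theorem omegaHalf_pow : omegaHalf N ^ N = -1 := by
  rw [omegaHalf, ← Complex.exp_nat_mul, mul_div_cancel₀ _ (Nat.cast_ne_zero.2 (NeZero.ne N)),
    Complex.exp_pi_mul_I]

end Omega

/-! ### The Lax operator built from clock and shift -/

section Lax

variable {N : ℕ} [NeZero N]

/-- A matrix supported on the diagonal and on the cyclic subdiagonal. -/
def twoTerm (c₀ c₁ : ZMod N → ℂ) : Matrix (ZMod N) (ZMod N) ℂ :=
  Matrix.of fun a b => (if a = b then c₀ a else 0) + if a = b + 1 then c₁ a else 0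

theorem sum_twoTerm_mul (c₀ c₁ Φ : ZMod N → ℂ) (s : ZMod N) :
    ∑ r, twoTerm c₀ c₁ s r * Φ r = c₀ s * Φ s + c₁ s * Φ (s - 1) := by
  have : ∀ r, twoTerm c₀ c₁ s r * Φ r =
      (if s = r then c₀ s * Φ r else 0) + if s - 1 = r then c₁ s * Φ r else 0 := by
    intro r
    simp only [twoTerm, Matrix.of_apply, add_mul, ite_mul, zero_mul, sub_eq_iff_eq_add]
  simp only [this, Finset.sum_add_distrib, Finset.sum_ite_eq, Finset.mem_univ, if_true]

theorem sum_mul_twoTerm (c₀ c₁ Φ : ZMod N → ℂ) (s : ZMod N) :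
    ∑ r, Φ r * twoTerm c₀ c₁ r s = Φ s * c₀ s + Φ (s + 1) * c₁ (s + 1) := by
  have : ∀ r, Φ r * twoTerm c₀ c₁ r s =
      (if r = s then Φ r * c₀ r else 0) + if r = s + 1 then Φ r * c₁ r else 0 := by
    intro r
    simp only [twoTerm, Matrix.of_apply, mul_add, mul_ite, mul_zero]
  simp only [this, Finset.sum_add_distrib, Finset.sum_ite_eq', Finset.mem_univ, if_true]

theorem clock_eq : clock N = Matrix.diagonal (chi (omega N)) := rfl

theorem clock_mul_inv : clock N * Matrix.diagonal (fun a => (chi (omega N) a)⁻¹) = 1 := by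
  rw [clock_eq, Matrix.diagonal_mul_diagonal, ← Matrix.diagonal_one]
  congr 1
  ext a
  exact mul_inv_cancel₀ (chi_ne_zero (omega_pow N) a)

theorem clock_inv : (clock N)⁻¹ = Matrix.diagonal (fun a => (chi (omega N) a)⁻¹) :=
  Matrix.inv_eq_right_inv clock_mul_inv

theorem isUnit_clock : IsUnit (clock N) := IsUnit.of_mul_eq_one _ clock_mul_inv

theorem shift_eq : shift N = twoTerm 0 1 := by
  ext a b; simp [shift, twoTerm]

theorem smul_one_add_smul_shift (c d : ℂ) :
    c • (1 : Matrix (ZMod N) (ZMod N) ℂ) + d • shift N = twoTerm (fun _ => c) (fun _ => d) := by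
  ext a b; simp [shift, twoTerm, Matrix.one_apply]

theorem diagonal_mul_twoTerm (e c₀ c₁ : ZMod N → ℂ) :
    Matrix.diagonal e * twoTerm c₀ c₁ = twoTerm (e * c₀) (e * c₁) := by
  ext a b; simp [twoTerm, Matrix.diagonal_mul, mul_add]

theorem smul_twoTerm (e : ℂ) (c₀ c₁ : ZMod N → ℂ) :
    e • twoTerm c₀ c₁ = twoTerm (e • c₀) (e • c₁) := by
  ext a b; simp [twoTerm, mul_add]

theorem lax_zero_zero (ξ u ut v κ κt : ℂ) : lax N ξ u ut v κ κt (clock N) (shift N) 0 0 =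
    twoTerm (fun _ => 1) (fun _ => -(omegaHalf N * ξ * u * ut * κ * v)) := by
  rw [← smul_one_add_smul_shift]
  simp [lax, sub_eq_add_neg]

theorem lax_zero_one (ξ u ut v κ κt : ℂ) : lax N ξ u ut v κ κt (clock N) (shift N) 0 1 =
    twoTerm (fun a => -(u * chi (omega N) a * omegaHalf N))
      (fun a => u * chi (omega N) a * (κ * v)) := by
  have : omegaHalf N • (1 : Matrix (ZMod N) (ZMod N) ℂ) - (κ * v) • shift N =
      twoTerm (fun _ => omegaHalf N) (fun _ => -(κ * v)) := by
    rw [← smul_one_add_smul_shift, neg_smul, sub_eq_add_neg]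
  simp only [lax, Matrix.of_apply, Matrix.cons_val_zero, Matrix.cons_val_one]
  rw [this, clock_eq, Matrix.smul_mul, diagonal_mul_twoTerm, ← neg_smul, smul_twoTerm]
  congr 1 <;> ext a <;> simp <;> ring

theorem lax_one_zero (ξ u ut v κ κt : ℂ) : lax N ξ u ut v κ κt (clock N) (shift N) 1 0 =
    twoTerm (fun a => ξ * ut * (chi (omega N) a)⁻¹ * κt)
      (fun a => -(ξ * ut * (chi (omega N) a)⁻¹ * (omegaHalf N * v))) := by
  have : κt • (1 : Matrix (ZMod N) (ZMod N) ℂ) - (omegaHalf N * v) • shift N =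
      twoTerm (fun _ => κt) (fun _ => -(omegaHalf N * v)) := by
    rw [← smul_one_add_smul_shift, neg_smul, sub_eq_add_neg]
  simp only [lax, Matrix.of_apply, Matrix.cons_val_zero, Matrix.cons_val_one]
  rw [this, clock_inv, Matrix.smul_mul, diagonal_mul_twoTerm, smul_twoTerm]
  congr 1 <;> ext a <;> simp <;> ring

theorem lax_one_one (ξ u ut v κ κt : ℂ) : lax N ξ u ut v κ κt (clock N) (shift N) 1 1 =
    twoTerm (fun _ => -(omegaHalf N * ξ * u * ut * κt)) (fun _ => v) := by
  rw [← smul_one_add_smul_shift]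
  simp [lax]

/-- Scalar factors of the Weyl operators can be moved into the scalars of the Lax operator. -/
theorem lax_smul (ξ u ut v κ κt α β : ℂ) (hα : α ≠ 0) (X Z : Matrix (ZMod N) (ZMod N) ℂ)
    (hX : IsUnit X) :
    lax N ξ u ut v κ κt (α • X) (β • Z) = lax N ξ (u * α) (ut * α⁻¹) (v * β) κ κt X Z := by
  have hdet : IsUnit X.det := (Matrix.isUnit_iff_isUnit_det X).1 hX
  have hinv : (α • X)⁻¹ = α⁻¹ • X⁻¹ := by
    refine Matrix.inv_eq_right_inv ?_
    rw [smul_mul_smul_comm, mul_inv_cancel₀ hα, one_smul, Matrix.mul_nonsing_inv _ hdet]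
  have hc : u * α * (ut * α⁻¹) = u * ut := by field_simp
  simp only [lax, hinv, smul_smul]
  congr 1
  have h1 : ∀ k : ℂ, omegaHalf N * ξ * (u * α) * (ut * α⁻¹) * k = omegaHalf N * ξ * u * ut * k := by
    intro k; linear_combination omegaHalf N * ξ * k * hc
  have h2 : omegaHalf N * ξ * u * ut * κ * v * β = omegaHalf N * ξ * u * ut * κ * (v * β) := by ring
  have h3 : ξ * ut * α⁻¹ = ξ * (ut * α⁻¹) := by ring
  have h4 : κ * v * β = κ * (v * β) := by ring
  have h5 : omegaHalf N * v * β = omegaHalf N * (v * β) := by ring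
  simp only [h1, h2, h3, h4, h5]

end Lax

section
variable {A B C D h u1 τ1 u2 τ2 γ δ k1 l1 k2 l2 s10 s01 s11 r10 r01 : ℂ}

theorem lax_core
    (hδ : δ ≠ 0)
    (n2 : h ^ 2 * γ * τ1 * D - τ2 * A ≠ 0)
    (n3 : h ^ 2 * k1 * γ * u1 * C - k2 * u2 * B ≠ 0)
    (e1 : δ * s10 * ((k1 * u1 * A - h * u2 * B) * (h ^ 2 * γ * τ1 * D - τ2 * A)) =
      h * ((h * l1 * γ * τ1 * B - δ * τ2 * A) * (u1 * A - δ * u2 * D)))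
    (e2 : s01 * ((h ^ 2 * k1 * γ * u1 * C - k2 * u2 * B) * (l1 * γ * τ1 * B - h * δ * τ2 * A)) =
      h * γ * ((l1 * τ1 * B - l2 * δ * τ2 * C) * (h * k1 * u1 * A - u2 * B)))
    (e3 : δ * s11 * ((h ^ 2 * k1 * γ * u1 * C - k2 * u2 * B) * (h ^ 2 * γ * τ1 * D - τ2 * A)) =
      h ^ 2 * γ * ((l1 * τ1 * B - l2 * δ * τ2 * C) * (u1 * A - δ * u2 * D)))
    (e4 : δ * r10 * ((h ^ 2 * k1 * γ * u1 * C - k2 * u2 * B) * (τ1 * D - h * l2 * τ2 * C)) =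
      h * ((l1 * τ1 * B - l2 * δ * τ2 * C) * (h * γ * u1 * C - k2 * δ * u2 * D)))
    (e5 : r01 * ((γ * u1 * C - h * k2 * δ * u2 * D) * (h ^ 2 * γ * τ1 * D - τ2 * A)) =
      h * γ * ((h * τ1 * D - l2 * τ2 * C) * (u1 * A - δ * u2 * D))) :
    (A * D * (-h * u1 * (γ * τ1) * k1 * s10 - h * u2 * (δ * τ2) * k2 * s01) -
        u2 * (γ * τ1) * (B * D) * (h * l1 - k2 * l1 * s01 - h ^ 2 * s10 + h * k2 * s11) =
      A * D * (-h * (γ * u1) * τ1 * k1 * r10 - h * (δ * u2) * τ2 * k2 * r01) -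
        (γ * u1) * τ2 * (C * A) * (h * l2 - k1 * l2 * h ^ 2 * r10 - r01 + h * k1 * s11)) ∧
    (-u1 * A * (h - k1 * s10) - u2 * B * (h * s10 - k2 * s11) =
      -(δ * u2) * (h * D - k2 * h ^ 2 * D * r01) -
        γ * u1 * (h * C * r01 - k1 * h ^ 2 * C * s11)) ∧
    (h * u2 * (δ * τ2) * k2 * u1 * A * (h * s01 - k1 * s11) +
        h * u1 * (γ * τ1) * l1 * u2 * B * (h - k2 * s01) =
      h * (γ * u1) * τ1 * k1 * (δ * u2) * (h * D * r10 - k2 * h ^ 2 * D * s11) +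
        h * (δ * u2) * τ2 * l2 * (γ * u1) * (h * C - k1 * h ^ 2 * C * r10)) ∧
    (h * (A * C * D) * (δ * τ2) * (l2 - h * s01) +
        h * (B * C * D) * (γ * τ1) * (l1 * s01 - h * s11) =
      h * (A * B * D) * τ1 * l1 - A * B * D * τ1 * r10 +
        h * (A * B * C) * τ2 * l2 * r10 - A * B * C * τ2 * s11) ∧
    (-h * u1 * (γ * τ1) * k1 * (δ * τ2) * (A * C * D) * (l2 * s10 - h * s11) -
        h * u2 * (δ * τ2) * l2 * (γ * τ1) * (B * C * D) * (l1 - h * s10) =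
      -(δ * u2) * τ2 * k2 * τ1 * (A * B * D) * (h * l1 * r01 - s11) -
        γ * u1 * τ1 * l1 * τ2 * (A * B * C) * (h * l2 - r01)) ∧
    (-u1 * (δ * τ2) * (A * C) * (h * l2 - k1 * l2 * s10 - h ^ 2 * s01 + h * k1 * s11) +
        B * C * (-h * u2 * (δ * τ2) * l2 * s10 - h * u1 * (γ * τ1) * l1 * s01) =
      -τ1 * (δ * u2) * (B * D) * (h * l1 - l1 * k2 * h ^ 2 * r01 - r10 + h * k2 * s11) +
        B * C * (-h * (γ * u1) * τ1 * l1 * r01 - h * (δ * u2) * τ2 * l2 * r10)) := by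
  have hne : δ * ((h ^ 2 * k1 * γ * u1 * C - k2 * u2 * B) * (h ^ 2 * γ * τ1 * D - τ2 * A)) ≠ 0 :=
    mul_ne_zero hδ (mul_ne_zero n3 n2)
  refine ⟨?_, ?_, ?_, ?_, ?_, ?_⟩
  · refine mul_right_cancel₀ hne ?_
    linear_combination (-h * γ * τ1 * D) * (h ^ 2 * k1 * γ * u1 * C - k2 * u2 * B) * e1 +
      (k2 * u2 * D) * (δ * (h ^ 2 * γ * τ1 * D - τ2 * A)) * e2 +
      (-u2 * γ * τ1 * B * D * h * k2 + γ * u1 * τ2 * C * A * h * k1) * e3 +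
      (h * γ * u1 * k1 * A) * (h ^ 2 * γ * τ1 * D - τ2 * A) * e4 -
      (τ2 * A) * (δ * (h ^ 2 * k1 * γ * u1 * C - k2 * u2 * B)) * e5
  · refine mul_right_cancel₀ hne ?_
    linear_combination (h ^ 2 * k1 * γ * u1 * C - k2 * u2 * B) * e1 -
      (h ^ 2 * k1 * γ * u1 * C - k2 * u2 * B) * e3 +
      h * (δ * (h ^ 2 * k1 * γ * u1 * C - k2 * u2 * B)) * e5
  · refine mul_right_cancel₀ hne ?_
    linear_combination (-h * u1 * u2 * k2) * (δ * (h ^ 2 * γ * τ1 * D - τ2 * A)) * e2 +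
      h * k1 * k2 * u1 * u2 * δ * (h ^ 2 * γ * τ1 * D - τ2 * A) * e3 -
      h ^ 2 * γ * u1 * δ * u2 * k1 * (h ^ 2 * γ * τ1 * D - τ2 * A) * e4
  · refine mul_right_cancel₀ hne ?_
    linear_combination (h * C * D) * (δ * (h ^ 2 * γ * τ1 * D - τ2 * A)) * e2 -
      B * C * (h ^ 2 * γ * τ1 * D - τ2 * A) * e3 + A * B * (h ^ 2 * γ * τ1 * D - τ2 * A) * e4
  · refine mul_right_cancel₀ hne ?_
    linear_combination (-(h * γ * τ1 * δ * τ2 * l2) * C * D) *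
        (h ^ 2 * k1 * γ * u1 * C - k2 * u2 * B) * e1 +
      δ * τ1 * τ2 * A * D * (h ^ 2 * k1 * γ * u1 * C - k2 * u2 * B) * e3 -
      τ1 * τ2 * l1 * A * B * (δ * (h ^ 2 * k1 * γ * u1 * C - k2 * u2 * B)) * e5
  · refine mul_right_cancel₀ hne ?_
    linear_combination (δ * τ2 * l2 * C) * (h ^ 2 * k1 * γ * u1 * C - k2 * u2 * B) * e1 -
      h * u1 * C * (δ * (h ^ 2 * γ * τ1 * D - τ2 * A)) * e2 +
      (-u1 * δ * τ2 * A * C * h * k1 + τ1 * δ * u2 * B * D * h * k2) * e3 -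
      δ * u2 * B * (h ^ 2 * γ * τ1 * D - τ2 * A) * e4 +
      h * τ1 * l1 * B * (δ * (h ^ 2 * k1 * γ * u1 * C - k2 * u2 * B)) * e5
end

end

end BS

namespace BS

noncomputable section

/-! ### The local intertwining relation -/

section Local

variable {N : ℕ} [NeZero N]

/-- The weight of the pair of vertices `V`, `Vt` for the `i`-th Fermat points. -/
def pairW (N : ℕ) (V Vt : Vertex) (y yt : Fin 4 → ℂ) (i : Fin 4) (n : ZMod N) : ℂ :=
  cyclicW N (V.x N i) (y i) n * cyclicW N (Vt.x N i) (yt i) (-n)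

theorem intertwiner_apply (V Vt : Vertex) (y yt : Fin 4 → ℂ) (a b c d : ZMod N) :
    intertwiner N V Vt y yt (a, b) (c, d) =
      N * (chi (omega N) ((c - a) * (b - d)) *
        (pairW N V Vt y yt 0 (b - a) * pairW N V Vt y yt 1 (d - c)) /
        (pairW N V Vt y yt 2 (d - a) * pairW N V Vt y yt 3 (b - c))) := by
  have hq := omega_pow N
  simp only [intertwiner, Matrix.of_apply, vertexR]
  have key : ∀ m n : ZMod N,
      ((if b + m = d + n then
        omega N ^ ((c - a) * n).val *
          (cyclicW N (V.x N 0) (y 0) (b - a) * cyclicW N (V.x N 1) (y 1) (d - c)) /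
          (cyclicW N (V.x N 2) (y 2) (d - a) * cyclicW N (V.x N 3) (y 3) (b - c)) else 0) *
      (if -b + n = -d + m then
        omega N ^ ((-c - -a) * m).val *
          (cyclicW N (Vt.x N 0) (yt 0) (-b - -a) * cyclicW N (Vt.x N 1) (yt 1) (-d - -c)) /
          (cyclicW N (Vt.x N 2) (yt 2) (-d - -a) * cyclicW N (Vt.x N 3) (yt 3) (-b - -c)) else 0)) =
      if n = m + (b - d) then (chi (omega N) ((c - a) * (b - d)) *
        (pairW N V Vt y yt 0 (b - a) * pairW N V Vt y yt 1 (d - c)) /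
        (pairW N V Vt y yt 2 (d - a) * pairW N V Vt y yt 3 (b - c))) else 0 := by
    intro m n
    by_cases h : n = m + (b - d)
    · have h1 : b + m = d + n := by rw [h]; ring
      have h2 : -b + n = -d + m := by rw [h]; ring
      rw [if_pos h1, if_pos h2, if_pos h]
      have h3 : ∀ s t : ZMod N, -s - -t = -(s - t) := fun s t => by ring
      have h4 : chi (omega N) ((c - a) * (b - d)) =
          omega N ^ ((c - a) * n).val * omega N ^ ((-c - -a) * m).val := by
        have := chi_add hq ((c - a) * n) ((-c - -a) * m)
        rw [show (c - a) * n + (-c - -a) * m = (c - a) * (b - d) by rw [h]; ring] at this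
        exact this
      rw [h4]
      simp only [h3, pairW]
      rw [div_mul_div_comm]
      congr 1 <;> ring
    · have h1 : ¬ b + m = d + n := fun h1 => h (by linear_combination -h1)
      rw [if_neg h1, if_neg h, zero_mul]
  simp only [key, Finset.sum_ite_eq', Finset.mem_univ, if_true, Finset.sum_const,
    Finset.card_univ, ZMod.card, nsmul_eq_mul]

variable {V Vt : Vertex} {y yt : Fin 4 → ℂ}

theorem pairW_ne_zero (hF : V.IsFermat N y) (hFt : Vt.IsFermat N yt) (i : Fin 4) (n : ZMod N) :
    pairW N V Vt y yt i n ≠ 0 :=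
  mul_ne_zero (cycW_ne_zero (omega_pow N) (hF.curve i) (hF.ne_zero i) _)
    (cycW_ne_zero (omega_pow N) (hFt.curve i) (hFt.ne_zero i) _)

theorem pairW_mul (hF : V.IsFermat N y) (hFt : Vt.IsFermat N yt) (i : Fin 4) (n : ZMod N) :
    pairW N V Vt y yt i (n + 1) * (1 - omega N * chi (omega N) n * V.x N i) =
      y i / yt i * pairW N V Vt y yt i n * (1 - (chi (omega N) n)⁻¹ * Vt.x N i) := by
  have h1 := cycW_mul (omega_primitive N) (hF.curve i) (hF.ne_zero i) (n + 1)
  have h2 := cycW_mul (omega_primitive N) (hFt.curve i) (hFt.ne_zero i) (-n)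
  have hq := omega_pow N
  rw [chi_add hq, chi_one hq, add_sub_cancel_right] at h1
  rw [chi_neg hq, show -n - 1 = -(n + 1) by ring] at h2
  have hy := hFt.ne_zero i
  simp only [pairW, cyclicW_eq]
  rw [div_mul_eq_mul_div, div_mul_eq_mul_div, eq_div_iff hy]
  linear_combination (yt i * cycW (omega N) (Vt.x N i) (yt i) (-(n + 1))) * h1 -
    y i * cycW (omega N) (V.x N i) (y i) n * h2

/-- The matrix element of the intertwiner as a function of the four spins. -/
def crossW (w : Fin 4 → ZMod N → ℂ) (a b c d : ZMod N) : ℂ :=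
  chi (omega N) ((c - a) * (b - d)) * (w 0 (b - a) * w 1 (d - c)) / (w 2 (d - a) * w 3 (b - c))

section Ratios

variable {w : Fin 4 → ZMod N → ℂ} {x xt Y : Fin 4 → ℂ}

theorem crossW_ne_zero (hw : ∀ i n, w i n ≠ 0) (a b c d : ZMod N) : crossW w a b c d ≠ 0 :=
  div_ne_zero (mul_ne_zero (chi_ne_zero (omega_pow N) _) (mul_ne_zero (hw _ _) (hw _ _)))
    (mul_ne_zero (hw _ _) (hw _ _))

theorem crossW_sub_one_left (hw : ∀ i n, w i n ≠ 0)
    (hr : ∀ i n, w i (n + 1) * (1 - omega N * chi (omega N) n * x i) =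
      Y i * w i n * (1 - (chi (omega N) n)⁻¹ * xt i)) (a b c d : ZMod N) :
    crossW w (a - 1) b c d * ((1 - omega N * chi (omega N) (b - a) * x 0) *
        (Y 2 * (1 - (chi (omega N) (d - a))⁻¹ * xt 2))) * chi (omega N) d =
      crossW w a b c d * chi (omega N) b * (Y 0 * (1 - (chi (omega N) (b - a))⁻¹ * xt 0) *
        (1 - omega N * chi (omega N) (d - a) * x 2)) := by
  have hq := omega_pow N
  have h0 := hr 0 (b - a)
  have h2 := hr 2 (d - a)
  have hc : chi (omega N) ((c - (a - 1)) * (b - d)) * chi (omega N) d =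
      chi (omega N) ((c - a) * (b - d)) * chi (omega N) b := by
    rw [← chi_add hq, ← chi_add hq]; congr 1; ring
  have e1 : b - (a - 1) = b - a + 1 := by ring
  have e2 : d - (a - 1) = d - a + 1 := by ring
  have n2 := hw 2 (d - a)
  have n2' := hw 2 (d - a + 1)
  have n3 := hw 3 (b - c)
  simp only [crossW, e1, e2]
  rw [div_mul_eq_mul_div, div_mul_eq_mul_div, div_mul_eq_mul_div, div_mul_eq_mul_div,
    div_eq_div_iff (mul_ne_zero n2' n3) (mul_ne_zero n2 n3)]
  linear_combination (w 0 (b - a + 1) * w 1 (d - c) * ((1 - omega N * chi (omega N) (b - a) * x 0) *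
        (Y 2 * (1 - (chi (omega N) (d - a))⁻¹ * xt 2))) * w 2 (d - a) * w 3 (b - c)) * hc +
    (chi (omega N) ((c - a) * (b - d)) * chi (omega N) b * w 1 (d - c) * w 3 (b - c) *
      (Y 2 * w 2 (d - a) * (1 - (chi (omega N) (d - a))⁻¹ * xt 2))) * h0 -
    (chi (omega N) ((c - a) * (b - d)) * chi (omega N) b * w 1 (d - c) * w 3 (b - c) *
      (Y 0 * w 0 (b - a) * (1 - (chi (omega N) (b - a))⁻¹ * xt 0))) * h2

theorem crossW_sub_one_right (hw : ∀ i n, w i n ≠ 0)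
    (hr : ∀ i n, w i (n + 1) * (1 - omega N * chi (omega N) n * x i) =
      Y i * w i n * (1 - (chi (omega N) n)⁻¹ * xt i)) (a b c d : ZMod N) :
    crossW w a (b - 1) c d * ((Y 0 * (1 - omega N * (chi (omega N) (b - a))⁻¹ * xt 0)) *
        (1 - chi (omega N) (b - c) * x 3)) * chi (omega N) c =
      crossW w a b c d * chi (omega N) a * ((1 - chi (omega N) (b - a) * x 0) *
        (Y 3 * (1 - omega N * (chi (omega N) (b - c))⁻¹ * xt 3))) := by
  have hq := omega_pow N
  have hq0 := omega_ne_zero N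
  have h0 := hr 0 (b - a - 1)
  have h3 := hr 3 (b - c - 1)
  rw [chi_sub hq _ 1, chi_one hq, mul_div_cancel₀ _ hq0, inv_div, div_eq_mul_inv,
    sub_add_cancel] at h0 h3
  have hc : chi (omega N) ((c - a) * (b - 1 - d)) * chi (omega N) c =
      chi (omega N) ((c - a) * (b - d)) * chi (omega N) a := by
    rw [← chi_add hq, ← chi_add hq]; congr 1; ring
  have e1 : b - 1 - a = b - a - 1 := by ring
  have e2 : b - 1 - c = b - c - 1 := by ring
  have n2 := hw 2 (d - a)
  have n3' := hw 3 (b - c - 1)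
  have n3 := hw 3 (b - c)
  simp only [crossW, e1, e2]
  rw [div_mul_eq_mul_div, div_mul_eq_mul_div, div_mul_eq_mul_div, div_mul_eq_mul_div,
    div_eq_div_iff (mul_ne_zero n2 n3') (mul_ne_zero n2 n3)]
  linear_combination (w 0 (b - a - 1) * w 1 (d - c) *
      ((Y 0 * (1 - omega N * (chi (omega N) (b - a))⁻¹ * xt 0)) *
        (1 - chi (omega N) (b - c) * x 3)) * w 2 (d - a) * w 3 (b - c)) * hc +
    (chi (omega N) ((c - a) * (b - d)) * chi (omega N) a * w 1 (d - c) * w 2 (d - a) *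
      (Y 0 * w 0 (b - a - 1) * (1 - omega N * (chi (omega N) (b - a))⁻¹ * xt 0))) * h3 -
    (chi (omega N) ((c - a) * (b - d)) * chi (omega N) a * w 1 (d - c) * w 2 (d - a) *
      (w 3 (b - c - 1) * (Y 3 * (1 - omega N * (chi (omega N) (b - c))⁻¹ * xt 3)))) * h0

theorem crossW_sub_one_both (hw : ∀ i n, w i n ≠ 0)
    (hr : ∀ i n, w i (n + 1) * (1 - omega N * chi (omega N) n * x i) =
      Y i * w i n * (1 - (chi (omega N) n)⁻¹ * xt i)) (a b c d : ZMod N) :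
    crossW w (a - 1) (b - 1) c d * ((Y 2 * (1 - (chi (omega N) (d - a))⁻¹ * xt 2)) *
        (1 - chi (omega N) (b - c) * x 3)) *
          (omega N * chi (omega N) c * chi (omega N) d) =
      crossW w a b c d * (chi (omega N) a * chi (omega N) b) *
        ((1 - omega N * chi (omega N) (d - a) * x 2) *
          (Y 3 * (1 - omega N * (chi (omega N) (b - c))⁻¹ * xt 3))) := by
  have hq := omega_pow N
  have hq0 := omega_ne_zero N
  have h2 := hr 2 (d - a)
  have h3 := hr 3 (b - c - 1)
  rw [chi_sub hq _ 1, chi_one hq, mul_div_cancel₀ _ hq0, inv_div, div_eq_mul_inv,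
    sub_add_cancel] at h3
  have hc : chi (omega N) ((c - (a - 1)) * (b - 1 - d)) *
      (omega N * chi (omega N) c * chi (omega N) d) =
      chi (omega N) ((c - a) * (b - d)) * (chi (omega N) a * chi (omega N) b) := by
    nth_rewrite 2 [← chi_one hq]
    rw [← chi_add hq, ← chi_add hq, ← chi_add hq, ← chi_add hq, ← chi_add hq]; congr 1; ring
  have e0 : b - 1 - (a - 1) = b - a := by ring
  have e1 : d - (a - 1) = d - a + 1 := by ring
  have e2 : b - 1 - c = b - c - 1 := by ring
  have n2 := hw 2 (d - a)
  have n2' := hw 2 (d - a + 1)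
  have n3' := hw 3 (b - c - 1)
  have n3 := hw 3 (b - c)
  simp only [crossW, e0, e1, e2]
  rw [div_mul_eq_mul_div, div_mul_eq_mul_div, div_mul_eq_mul_div, div_mul_eq_mul_div,
    div_eq_div_iff (mul_ne_zero n2' n3') (mul_ne_zero n2 n3)]
  linear_combination (w 0 (b - a) * w 1 (d - c) *
      ((Y 2 * (1 - (chi (omega N) (d - a))⁻¹ * xt 2)) *
        (1 - chi (omega N) (b - c) * x 3)) * w 2 (d - a) * w 3 (b - c)) * hc +
    (chi (omega N) ((c - a) * (b - d)) * (chi (omega N) a * chi (omega N) b) * w 1 (d - c) *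
      w 0 (b - a) * (Y 2 * w 2 (d - a) * (1 - (chi (omega N) (d - a))⁻¹ * xt 2))) * h3 -
    (chi (omega N) ((c - a) * (b - d)) * (chi (omega N) a * chi (omega N) b) * w 1 (d - c) *
      w 0 (b - a) *
      (w 3 (b - c - 1) * (Y 3 * (1 - omega N * (chi (omega N) (b - c))⁻¹ * xt 3)))) * h2

theorem crossW_add_one_left (hw : ∀ i n, w i n ≠ 0)
    (hr : ∀ i n, w i (n + 1) * (1 - omega N * chi (omega N) n * x i) =
      Y i * w i n * (1 - (chi (omega N) n)⁻¹ * xt i)) (a b c d : ZMod N) :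
    crossW w a b (c + 1) d * ((Y 1 * (1 - omega N * (chi (omega N) (d - c))⁻¹ * xt 1)) *
        (1 - chi (omega N) (b - c) * x 3)) * chi (omega N) d =
      crossW w a b c d * chi (omega N) b * ((1 - chi (omega N) (d - c) * x 1) *
        (Y 3 * (1 - omega N * (chi (omega N) (b - c))⁻¹ * xt 3))) := by
  have hq := omega_pow N
  have hq0 := omega_ne_zero N
  have h1 := hr 1 (d - c - 1)
  have h3 := hr 3 (b - c - 1)
  rw [chi_sub hq _ 1, chi_one hq, mul_div_cancel₀ _ hq0, inv_div, div_eq_mul_inv,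
    sub_add_cancel] at h1 h3
  have hc : chi (omega N) ((c + 1 - a) * (b - d)) * chi (omega N) d =
      chi (omega N) ((c - a) * (b - d)) * chi (omega N) b := by
    rw [← chi_add hq, ← chi_add hq]; congr 1; ring
  have e1 : d - (c + 1) = d - c - 1 := by ring
  have e2 : b - (c + 1) = b - c - 1 := by ring
  have n2 := hw 2 (d - a)
  have n3' := hw 3 (b - c - 1)
  have n3 := hw 3 (b - c)
  simp only [crossW, e1, e2]
  rw [div_mul_eq_mul_div, div_mul_eq_mul_div, div_mul_eq_mul_div, div_mul_eq_mul_div,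
    div_eq_div_iff (mul_ne_zero n2 n3') (mul_ne_zero n2 n3)]
  linear_combination (w 0 (b - a) * w 1 (d - c - 1) *
      ((Y 1 * (1 - omega N * (chi (omega N) (d - c))⁻¹ * xt 1)) *
        (1 - chi (omega N) (b - c) * x 3)) * w 2 (d - a) * w 3 (b - c)) * hc +
    (chi (omega N) ((c - a) * (b - d)) * chi (omega N) b * w 0 (b - a) * w 2 (d - a) *
      (Y 1 * w 1 (d - c - 1) * (1 - omega N * (chi (omega N) (d - c))⁻¹ * xt 1))) * h3 -
    (chi (omega N) ((c - a) * (b - d)) * chi (omega N) b * w 0 (b - a) * w 2 (d - a) *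
      (w 3 (b - c - 1) * (Y 3 * (1 - omega N * (chi (omega N) (b - c))⁻¹ * xt 3)))) * h1

theorem crossW_add_one_right (hw : ∀ i n, w i n ≠ 0)
    (hr : ∀ i n, w i (n + 1) * (1 - omega N * chi (omega N) n * x i) =
      Y i * w i n * (1 - (chi (omega N) n)⁻¹ * xt i)) (a b c d : ZMod N) :
    crossW w a b c (d + 1) * ((1 - omega N * chi (omega N) (d - c) * x 1) *
        (Y 2 * (1 - (chi (omega N) (d - a))⁻¹ * xt 2))) * chi (omega N) c =
      crossW w a b c d * chi (omega N) a * (Y 1 * (1 - (chi (omega N) (d - c))⁻¹ * xt 1) *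
        (1 - omega N * chi (omega N) (d - a) * x 2)) := by
  have hq := omega_pow N
  have h1 := hr 1 (d - c)
  have h2 := hr 2 (d - a)
  have hc : chi (omega N) ((c - a) * (b - (d + 1))) * chi (omega N) c =
      chi (omega N) ((c - a) * (b - d)) * chi (omega N) a := by
    rw [← chi_add hq, ← chi_add hq]; congr 1; ring
  have e1 : d + 1 - c = d - c + 1 := by ring
  have e2 : d + 1 - a = d - a + 1 := by ring
  have n2 := hw 2 (d - a)
  have n2' := hw 2 (d - a + 1)
  have n3 := hw 3 (b - c)
  simp only [crossW, e1, e2]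
  rw [div_mul_eq_mul_div, div_mul_eq_mul_div, div_mul_eq_mul_div, div_mul_eq_mul_div,
    div_eq_div_iff (mul_ne_zero n2' n3) (mul_ne_zero n2 n3)]
  linear_combination (w 1 (d - c + 1) * w 0 (b - a) * ((1 - omega N * chi (omega N) (d - c) * x 1) *
        (Y 2 * (1 - (chi (omega N) (d - a))⁻¹ * xt 2))) * w 2 (d - a) * w 3 (b - c)) * hc +
    (chi (omega N) ((c - a) * (b - d)) * chi (omega N) a * w 0 (b - a) * w 3 (b - c) *
      (Y 2 * w 2 (d - a) * (1 - (chi (omega N) (d - a))⁻¹ * xt 2))) * h1 -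
    (chi (omega N) ((c - a) * (b - d)) * chi (omega N) a * w 0 (b - a) * w 3 (b - c) *
      (Y 1 * w 1 (d - c) * (1 - (chi (omega N) (d - c))⁻¹ * xt 1))) * h2

theorem crossW_add_one_both (a b c d : ZMod N) :
    crossW w a b (c + 1) (d + 1) = crossW w (a - 1) (b - 1) c d := by
  simp only [crossW]
  congr 2
  · congr 1; ring
  · congr 2 <;> ring
  · congr 1; ring
  · congr 1; ring

end Ratios

end Local

end

end BS

namespace BS

noncomputable section

section Exchange

variable {N : ℕ} [NeZero N]

/-- The coefficient of `1` in the Lax operator, acting in the component with `χ(a) = A`. -/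
def laxC (h ξ u ut κt A : ℂ) : Matrix (Fin 2) (Fin 2) ℂ :=
  !![1, -(u * A * h); ξ * ut * A⁻¹ * κt, -(h * ξ * u * ut * κt)]

/-- The coefficient of `v Z` in the Lax operator, acting in the component with `χ(a) = A`. -/
def laxS (h ξ u ut κ A : ℂ) : Matrix (Fin 2) (Fin 2) ℂ :=
  !![-(h * ξ * u * ut * κ), u * A * κ; -(ξ * ut * A⁻¹ * h), 1]

theorem lax_apply (ξ u ut v κ κt : ℂ) (i k : Fin 2) :
    lax N ξ u ut v κ κt (clock N) (shift N) i k =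
      twoTerm (fun a => laxC (omegaHalf N) ξ u ut κt (chi (omega N) a) i k)
        (fun a => v * laxS (omegaHalf N) ξ u ut κ (chi (omega N) a) i k) := by
  fin_cases i <;> fin_cases k
  · refine (lax_zero_zero ..).trans ?_
    congr 1; ext a; simp [laxS]; ring
  · refine (lax_zero_one ..).trans ?_
    congr 1; ext a; simp [laxS]; ring
  · refine (lax_one_zero ..).trans ?_
    congr 1; ext a; simp [laxS]; ring
  · refine (lax_one_one ..).trans ?_
    congr 1; ext a; simp [laxS]

theorem laxC_laxS_exchange {A B C D h u1 τ1 u2 τ2 γ δ k1 l1 k2 l2 s10 s01 s11 r10 r01 : ℂ}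
    (hA : A ≠ 0) (hB : B ≠ 0) (hC : C ≠ 0) (hD : D ≠ 0) (hh : h ≠ 0)
    (hδ : δ ≠ 0)
    (n2 : h ^ 2 * γ * τ1 * D - τ2 * A ≠ 0)
    (n3 : h ^ 2 * k1 * γ * u1 * C - k2 * u2 * B ≠ 0)
    (e1 : δ * s10 * ((k1 * u1 * A - h * u2 * B) * (h ^ 2 * γ * τ1 * D - τ2 * A)) =
      h * ((h * l1 * γ * τ1 * B - δ * τ2 * A) * (u1 * A - δ * u2 * D)))
    (e2 : s01 * ((h ^ 2 * k1 * γ * u1 * C - k2 * u2 * B) * (l1 * γ * τ1 * B - h * δ * τ2 * A)) =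
      h * γ * ((l1 * τ1 * B - l2 * δ * τ2 * C) * (h * k1 * u1 * A - u2 * B)))
    (e3 : δ * s11 * ((h ^ 2 * k1 * γ * u1 * C - k2 * u2 * B) * (h ^ 2 * γ * τ1 * D - τ2 * A)) =
      h ^ 2 * γ * ((l1 * τ1 * B - l2 * δ * τ2 * C) * (u1 * A - δ * u2 * D)))
    (e4 : δ * r10 * ((h ^ 2 * k1 * γ * u1 * C - k2 * u2 * B) * (τ1 * D - h * l2 * τ2 * C)) =
      h * ((l1 * τ1 * B - l2 * δ * τ2 * C) * (h * γ * u1 * C - k2 * δ * u2 * D)))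
    (e5 : r01 * ((γ * u1 * C - h * k2 * δ * u2 * D) * (h ^ 2 * γ * τ1 * D - τ2 * A)) =
      h * γ * ((h * τ1 * D - l2 * τ2 * C) * (u1 * A - δ * u2 * D))) (ξ : ℂ) :
    laxC h ξ u2 (δ * τ2) l2 B * laxC h ξ u1 (γ * τ1) l1 A +
        s10 • (laxC h ξ u2 (δ * τ2) l2 B * laxS h ξ u1 (γ * τ1) k1 A) +
        s01 • (laxS h ξ u2 (δ * τ2) k2 B * laxC h ξ u1 (γ * τ1) l1 A) +
        s11 • (laxS h ξ u2 (δ * τ2) k2 B * laxS h ξ u1 (γ * τ1) k1 A) =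
      laxC h ξ (γ * u1) τ1 l1 C * laxC h ξ (δ * u2) τ2 l2 D +
        r10 • (laxS h ξ (γ * u1) τ1 k1 (h ^ 2 * C) * laxC h ξ (δ * u2) τ2 l2 D) +
        r01 • (laxC h ξ (γ * u1) τ1 l1 C * laxS h ξ (δ * u2) τ2 k2 (h ^ 2 * D)) +
        s11 • (laxS h ξ (γ * u1) τ1 k1 (h ^ 2 * C) * laxS h ξ (δ * u2) τ2 k2 (h ^ 2 * D)) := by
  obtain ⟨c1, c2, c3, c4, c5, c6⟩ := lax_core hδ n2 n3 e1 e2 e3 e4 e5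
  simp only [laxC, laxS, Matrix.mul_fin_two, Matrix.smul_of, Matrix.smul_cons, Matrix.smul_empty,
    smul_eq_mul, Matrix.of_add_of, Matrix.cons_add_cons, Matrix.empty_add_empty]
  congr 1
  congr 1
  · congr 1
    · field_simp
      linear_combination ξ * c1
    · congr 1
      field_simp
      linear_combination c2 + ξ * c3
  · congr 1
    congr 1
    · field_simp
      linear_combination ξ * c4 + ξ ^ 2 * h * c5
    · congr 1
      field_simp
      linear_combination ξ * c6

variable {g : ℕ} {P : Fin g → ℂ × ℂ} {f ft : Fin g → ℂ} {X Y Z Zt : ℂ × ℂ} {V Vt : Vertex}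
  {y yt : Fin 4 → ℂ}

theorem crossW_exchange (hV : V.IsFunctional N P f X Y Z) (hVt : Vt.IsFunctional N P ft X Y Zt)
    (hF : V.IsFermat N y) (hFt : Vt.IsFermat N yt)
    (h3 : Vt.u₃ = V.u₃' ∧ Vt.w₃ = V.w₃' ∧ Vt.κ₃ = V.κ₃) (h3' : Vt.u₃' = V.u₃ ∧ Vt.w₃' = V.w₃)
    (ξ : ℂ) (a b c d : ZMod N) :
    let S := crossW (pairW N V Vt y yt)
    let q := omega N
    let h := omegaHalf N
    let v₁ := V.w₁ / Vt.w₁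
    let v₂ := V.w₂ / Vt.w₂
    let v₁' := V.w₁' / Vt.w₁'
    let v₂' := V.w₂' / Vt.w₂'
    S a b c d • (laxC h ξ V.u₂ Vt.u₂ Vt.κ₂ (chi q b) * laxC h ξ V.u₁ Vt.u₁ Vt.κ₁ (chi q a)) +
        (S (a - 1) b c d * v₁) •
          (laxC h ξ V.u₂ Vt.u₂ Vt.κ₂ (chi q b) * laxS h ξ V.u₁ Vt.u₁ V.κ₁ (chi q a)) +
        (S a (b - 1) c d * v₂) •
          (laxS h ξ V.u₂ Vt.u₂ V.κ₂ (chi q b) * laxC h ξ V.u₁ Vt.u₁ Vt.κ₁ (chi q a)) +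
        (S (a - 1) (b - 1) c d * (v₁ * v₂)) •
          (laxS h ξ V.u₂ Vt.u₂ V.κ₂ (chi q b) * laxS h ξ V.u₁ Vt.u₁ V.κ₁ (chi q a)) =
      S a b c d •
          (laxC h ξ V.u₁' Vt.u₁' Vt.κ₁ (chi q c) * laxC h ξ V.u₂' Vt.u₂' Vt.κ₂ (chi q d)) +
        (S a b (c + 1) d * v₁') •
          (laxS h ξ V.u₁' Vt.u₁' V.κ₁ (chi q (c + 1)) * laxC h ξ V.u₂' Vt.u₂' Vt.κ₂ (chi q d)) +
        (S a b c (d + 1) * v₂') •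
          (laxC h ξ V.u₁' Vt.u₁' Vt.κ₁ (chi q c) * laxS h ξ V.u₂' Vt.u₂' V.κ₂ (chi q (d + 1))) +
        (S a b (c + 1) (d + 1) * (v₁' * v₂')) •
          (laxS h ξ V.u₁' Vt.u₁' V.κ₁ (chi q (c + 1)) *
            laxS h ξ V.u₂' Vt.u₂' V.κ₂ (chi q (d + 1))) := by
  intro S q h v₁ v₂ v₁' v₂'
  have hq := omega_pow N
  have hhq : h ^ 2 = q := omegaHalf_sq N
  have hh : h ≠ 0 := omegaHalf_ne_zero N
  have hq0 : q ≠ 0 := omega_ne_zero N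
  have hw := pairW_ne_zero hF hFt
  have hr := pairW_mul hF hFt
  have nS : S a b c d ≠ 0 := crossW_ne_zero hw a b c d
  have nA : chi q a ≠ 0 := chi_ne_zero hq a
  have nB : chi q b ≠ 0 := chi_ne_zero hq b
  have nC : chi q c ≠ 0 := chi_ne_zero hq c
  have nD : chi q d ≠ 0 := chi_ne_zero hq d
  have nV := hV.ne_zero
  have nVt := hVt.ne_zero
  simp only [List.mem_cons, List.not_mem_nil, or_false, forall_eq_or_imp, forall_eq] at nV nVt
  obtain ⟨nu1, nw1, nk1, nu2, nw2, nk2, nu3, nw3, nk3, nu1', nw1', nu2', nw2', nu3', nw3'⟩ := nV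
  obtain ⟨mu1, mw1, mk1, mu2, mw2, mk2, mu3, mw3, mk3, mu1', mw1', mu2', mw2', mu3', mw3'⟩ := nVt
  set γ := V.u₁' / V.u₁ with hγ
  set δ := V.u₂' / V.u₂ with hδ
  have nγ : γ ≠ 0 := div_ne_zero nu1' nu1
  have nδ : δ ≠ 0 := div_ne_zero nu2' nu2
  have eu1' : V.u₁' = γ * V.u₁ := by rw [hγ]; field_simp
  have eu2' : V.u₂' = δ * V.u₂ := by rw [hδ]; field_simp
  have eγ : γ = V.w₃' / V.w₃ := by
    have := hV.uw
    rw [div_eq_div_iff nw3 nw3'] at this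
    rw [hγ, div_eq_div_iff nu1 nw3]; linear_combination -this
  have eδ : δ = V.u₃ / V.u₃' := by
    have := hV.uu
    rw [hδ, div_eq_div_iff nu2 nu3']; linear_combination -this
  have et1 : Vt.u₁ = γ * Vt.u₁' := by
    have := hVt.uw
    rw [h3.2.1, h3'.2, div_eq_div_iff nw3' nw3] at this
    rw [eγ]; field_simp; linear_combination this
  have et2 : Vt.u₂ = δ * Vt.u₂' := by
    have := hVt.uu
    rw [h3.1, h3'.1] at this
    rw [eδ]; field_simp; linear_combination this
  -- the ratios of the `y`-coordinates
  have ny := hF.ne_zero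
  have nyt := hFt.ne_zero
  obtain ⟨Yr, hYr⟩ : ∃ Yr : Fin 4 → ℂ, ∀ i, Yr i = y i / yt i := ⟨fun i => y i / yt i, fun _ => rfl⟩
  simp only [← hYr] at hr
  have nY : ∀ i, Yr i ≠ 0 := fun i => hYr i ▸ div_ne_zero (ny i) (nyt i)
  have y31 : Yr 2 * Vt.κ₁ = Yr 0 * V.κ₁ * v₁ * δ := by
    have e1 := hF.y₃_y₁
    have e2 := hFt.y₃_y₁
    rw [h3'.1, div_eq_div_iff (nyt 0) nu3] at e2
    rw [div_eq_div_iff (ny 0) nu3'] at e1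
    rw [hYr, hYr, eδ]; simp only [v₁]
    have := nyt 0; have := nyt 2
    field_simp
    linear_combination y 2 * V.u₃' * (-e2) + yt 2 * V.u₃ * e1
  have y41 : Yr 3 * (v₂ * γ) = Yr 0 := by
    have e1 := hF.y₄_y₁
    have e2 := hFt.y₄_y₁
    rw [h3.2.2, h3.2.1] at e2
    rw [div_eq_iff (ny 0)] at e1
    rw [div_eq_iff (nyt 0)] at e2
    rw [hYr, hYr, e1, e2, eγ]; simp only [v₂]
    have := ny 0; have := nyt 0; have := omegaHalf_ne_zero N
    field_simp
  have y32 : Yr 2 = Yr 1 * v₂' * γ := by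
    have e1 := hF.y₃_y₂
    have e2 := hFt.y₃_y₂
    rw [h3.2.1] at e2
    rw [div_eq_iff (ny 1)] at e1
    rw [div_eq_iff (nyt 1)] at e2
    rw [hYr, hYr, e1, e2, eγ]; simp only [v₂']
    have := ny 1; have := nyt 1
    field_simp
  have vv : v₁' * v₂' = v₁ * v₂ := by
    have e1 := hV.ww
    have e2 := hVt.ww
    simp only [v₁, v₂, v₁', v₂']
    rw [div_mul_div_comm, div_mul_div_comm, e1, e2]
  have nv1 : v₁ ≠ 0 := div_ne_zero nw1 mw1
  have nv2 : v₂ ≠ 0 := div_ne_zero nw2 mw2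
  have nv2' : v₂' ≠ 0 := div_ne_zero nw2' mw2'
  -- linear factors
  have x0 : V.x N 0 = h⁻¹ * (V.u₂ / (V.κ₁ * V.u₁)) := rfl
  have x1 : V.x N 1 = h⁻¹ * (V.κ₂ * (δ * V.u₂) / (γ * V.u₁)) := by rw [← eu1', ← eu2']; rfl
  have x2 : V.x N 2 = q⁻¹ * (δ * V.u₂ / V.u₁) := by rw [← eu2']; rfl
  have x3 : V.x N 3 = q⁻¹ * (V.κ₂ * V.u₂ / (V.κ₁ * (γ * V.u₁))) := by rw [← eu1']; rfl
  have z0 : Vt.x N 0 = h⁻¹ * (δ * Vt.u₂' / (Vt.κ₁ * (γ * Vt.u₁'))) := by rw [← et1, ← et2]; rfl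
  have z1 : Vt.x N 1 = h⁻¹ * (Vt.κ₂ * Vt.u₂' / Vt.u₁') := rfl
  have z2 : Vt.x N 2 = q⁻¹ * (Vt.u₂' / (γ * Vt.u₁')) := by rw [← et1]; rfl
  have z3 : Vt.x N 3 = q⁻¹ * (Vt.κ₂ * (δ * Vt.u₂') / (Vt.κ₁ * Vt.u₁')) := by rw [← et2]; rfl
  have r10 := crossW_sub_one_left hw hr a b c d
  have r01 := crossW_sub_one_right hw hr a b c d
  have r11 := crossW_sub_one_both hw hr a b c d
  have t10 := crossW_add_one_left hw hr a b c d
  have t01 := crossW_add_one_right hw hr a b c d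
  have t11 := crossW_add_one_both (w := pairW N V Vt y yt) a b c d
  have nf2 : 1 - (chi (omega N) (d - a))⁻¹ * Vt.x N 2 ≠ 0 := by
    rw [← chi_neg hq]; exact one_sub_chi_mul_ne_zero hq (hFt.curve 2) (hFt.ne_zero 2) _
  have nf3 : 1 - chi (omega N) (b - c) * V.x N 3 ≠ 0 :=
    one_sub_chi_mul_ne_zero hq (hF.curve 3) (hF.ne_zero 3) _
  simp only [chi_sub hq, x0, x1, x2, x3, z0, z1, z2, z3, inv_div] at r10 r01 r11 t10 t01 nf2 nf3
  change S (a - 1) b c d * _ * _ = S a b c d * _ * _ at r10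
  change S a (b - 1) c d * _ * _ = S a b c d * _ * _ at r01
  change S (a - 1) (b - 1) c d * _ * _ = S a b c d * _ * _ at r11
  change S a b (c + 1) d * _ * _ = S a b c d * _ * _ at t10
  change S a b c (d + 1) * _ * _ = S a b c d * _ * _ at t01
  change S a b (c + 1) (d + 1) = S (a - 1) (b - 1) c d at t11
  have hc1 : chi q (c + 1) = h ^ 2 * chi q c := by
    rw [chi_add hq, chi_one hq, hhq, mul_comm]
  have hd1 : chi q (d + 1) = h ^ 2 * chi q d := by
    rw [chi_add hq, chi_one hq, hhq, mul_comm]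
  rw [t11, vv, hc1, hd1, eu1', eu2', et1, et2]
  have hqN : omega N = h ^ 2 := hhq.symm
  have hqq : q = h ^ 2 := hhq.symm
  change 1 - (chi q a / chi q d) * _ ≠ 0 at nf2
  change 1 - (chi q b / chi q c) * _ ≠ 0 at nf3
  change _ * ((1 - omega N * (chi q b / chi q a) * _) * (_ * (1 - chi q a / chi q d * _))) * chi q d
    = _ * chi q b * (_ * (1 - chi q a / chi q b * _) * (1 - omega N * (chi q d / chi q a) * _)) at r10
  change _ * (_ * (1 - omega N * (chi q a / chi q b) * _) * (1 - chi q b / chi q c * _)) * chi q c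
    = _ * chi q a * ((1 - chi q b / chi q a * _) * (_ * (1 - omega N * (chi q c / chi q b) * _))) at r01
  change _ * (_ * (1 - chi q a / chi q d * _) * (1 - chi q b / chi q c * _)) *
      (omega N * chi q c * chi q d) = _ * (chi q a * chi q b) *
      ((1 - omega N * (chi q d / chi q a) * _) * (_ * (1 - omega N * (chi q c / chi q b) * _))) at r11
  change _ * (_ * (1 - omega N * (chi q c / chi q d) * _) * (1 - chi q b / chi q c * _)) * chi q d
    = _ * chi q b * ((1 - chi q d / chi q c * _) * (_ * (1 - omega N * (chi q c / chi q b) * _))) at t10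
  change _ * ((1 - omega N * (chi q d / chi q c) * _) * (_ * (1 - chi q a / chi q d * _))) * chi q c
    = _ * chi q a * (_ * (1 - chi q c / chi q d * _) * (1 - omega N * (chi q d / chi q a) * _)) at t01
  generalize chi q a = A at *
  generalize chi q b = B at *
  generalize chi q c = C at *
  generalize chi q d = D at *
  generalize S (a - 1) b c d = S10 at *
  generalize S a (b - 1) c d = S01 at *
  generalize S (a - 1) (b - 1) c d = S11 at *
  generalize S a b (c + 1) d = R10 at *
  generalize S a b c (d + 1) = R01 at *
  generalize S a b c d = S00 at *
  rw [hqN] at r10 r01 r11 t10 t01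
  rw [hqq] at nf2 nf3 r10 r01 r11 t10 t01
  clear_value h v₁ v₂ v₁' v₂' γ δ
  have n2 : h ^ 2 * γ * Vt.u₁' * D - Vt.u₂' * A ≠ 0 := by
    have : h ^ 2 * γ * Vt.u₁' * D - Vt.u₂' * A = (h ^ 2 * γ * Vt.u₁' * D) *
        (1 - A / D * ((h ^ 2)⁻¹ * (Vt.u₂' / (γ * Vt.u₁')))) := by field_simp
    rw [this]
    exact mul_ne_zero (by simp [hh, nγ, mu1', nD]) nf2
  have n3 : h ^ 2 * V.κ₁ * γ * V.u₁ * C - V.κ₂ * V.u₂ * B ≠ 0 := by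
    have : h ^ 2 * V.κ₁ * γ * V.u₁ * C - V.κ₂ * V.u₂ * B = (h ^ 2 * V.κ₁ * γ * V.u₁ * C) *
        (1 - B / C * ((h ^ 2)⁻¹ * (V.κ₂ * V.u₂ / (V.κ₁ * (γ * V.u₁))))) := by field_simp
    rw [this]
    exact mul_ne_zero (by simp [hh, nγ, nu1, nk1, nC]) nf3
  have E := laxC_laxS_exchange (u1 := V.u₁) (τ1 := Vt.u₁') (u2 := V.u₂) (τ2 := Vt.u₂') (γ := γ)
    (δ := δ) (k1 := V.κ₁) (l1 := Vt.κ₁) (k2 := V.κ₂) (l2 := Vt.κ₂) (s10 := S10 * v₁ / S00)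
    (s01 := S01 * v₂ / S00) (s11 := S11 * (v₁ * v₂) / S00) (r10 := R10 * v₁' / S00)
    (r01 := R01 * v₂' / S00) nA nB nC nD hh nδ n2 n3 ?_ ?_ ?_ ?_ ?_ ξ
  · have E2 := congrArg (S00 • ·) E
    simp only [smul_add, smul_smul, mul_div_cancel₀ _ nS] at E2
    exact E2
  · rw [mul_div_assoc', div_mul_eq_mul_div, div_eq_iff nS]
    refine mul_right_cancel₀ (mul_ne_zero (nY 0) nk1) ?_
    field_simp at r10
    linear_combination r10 - (S10 * (A * V.κ₁ * V.u₁ - h * B * V.u₂) *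
      (h ^ 2 * D * γ * Vt.u₁' - A * Vt.u₂')) * y31
  · rw [div_mul_eq_mul_div, div_eq_iff nS]
    refine mul_right_cancel₀ (mul_ne_zero (nY 3) nγ) ?_
    field_simp at r01
    linear_combination r01 + S01 * ((h ^ 2 * V.κ₁ * γ * V.u₁ * C - V.κ₂ * V.u₂ * B) *
      (Vt.κ₁ * γ * Vt.u₁' * B - h * δ * Vt.u₂' * A)) * y41
  · rw [mul_div_assoc', div_mul_eq_mul_div, div_eq_iff nS]
    refine mul_right_cancel₀ (mul_ne_zero (mul_ne_zero (nY 3) nγ) nk1) ?_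
    field_simp at r11
    linear_combination r11 + S11 * ((h ^ 2 * V.κ₁ * γ * V.u₁ * C - V.κ₂ * V.u₂ * B) *
      (h ^ 2 * γ * Vt.u₁' * D - Vt.u₂' * A)) * (V.κ₁ * v₁ * δ * y41 - y31)
  · rw [mul_div_assoc', div_mul_eq_mul_div, div_eq_iff nS]
    refine mul_right_cancel₀ (mul_ne_zero (mul_ne_zero (nY 3) nγ) (mul_ne_zero nk1 nv2')) ?_
    field_simp at t10
    linear_combination v₂' * γ * t10 + R10 * ((h ^ 2 * V.κ₁ * γ * V.u₁ * C - V.κ₂ * V.u₂ * B) *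
      (Vt.u₁' * D - h * Vt.κ₂ * Vt.u₂' * C)) *
      (Vt.κ₁ * y32 - y31 + V.κ₁ * v₁ * δ * y41 + Yr 3 * γ * V.κ₁ * δ * vv)
  · rw [div_mul_eq_mul_div, div_eq_iff nS]
    refine mul_right_cancel₀ (mul_ne_zero (nY 1) nγ) ?_
    field_simp at t01
    linear_combination t01 - R01 * ((γ * V.u₁ * C - h * V.κ₂ * δ * V.u₂ * D) *
      (h ^ 2 * γ * Vt.u₁' * D - Vt.u₂' * A)) * y32

end Exchange

end

end BS

namespace BS

noncomputable section

/-! ### Polynomial dependence on the spectral parameter -/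

section PolynomialDependence

theorem exists_coeff_prod_ofFn {M : Type*} [Ring M] [Algebra ℂ M] {m : ℕ} (a b : Fin m → M) :
    ∃ p : ℕ → M, ∀ ξ : ℂ, (List.ofFn fun n => a n + ξ • b n).prod =
      ∑ k ∈ Finset.range (m + 1), ξ ^ k • p k := by
  induction m with
  | zero => exact ⟨fun _ => 1, fun ξ => by simp⟩
  | succ m ih =>
    obtain ⟨p, hp⟩ := ih (fun n => a n.succ) (fun n => b n.succ)
    refine ⟨fun k => (if k < m + 1 then a 0 * p k else 0) +
      (if k = 0 then 0 else b 0 * p (k - 1)), fun ξ => ?_⟩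
    rw [List.ofFn_succ, List.prod_cons, hp]
    simp only [smul_add, Finset.sum_add_distrib]
    rw [add_mul, Finset.mul_sum, Finset.mul_sum, Finset.sum_range_succ _ (m + 1),
      Finset.sum_range_succ' _ (m + 1)]
    simp only [lt_self_iff_false, if_false, smul_zero, add_zero, if_true, Nat.add_eq_zero_iff,
      one_ne_zero, and_false, Nat.add_sub_cancel]
    congr 1
    · refine Finset.sum_congr rfl fun k hk => ?_
      rw [if_pos (Finset.mem_range.1 hk), mul_smul_comm]
    · refine Finset.sum_congr rfl fun k _ => ?_
      rw [mul_smul_comm, smul_mul_assoc, smul_smul, pow_succ]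

theorem eq_zero_of_infinite_zeros {I J : Type*} {m : ℕ} (p : ℕ → Matrix I J ℂ)
    {s : Set ℂ} (hs : s.Infinite) (h : ∀ ξ ∈ s, ∑ k ∈ Finset.range m, ξ ^ k • p k = 0) (ξ : ℂ) :
    ∑ k ∈ Finset.range m, ξ ^ k • p k = 0 := by
  ext i j
  set P : Polynomial ℂ := ∑ k ∈ Finset.range m, Polynomial.monomial k (p k i j) with hP
  have he : ∀ z : ℂ, P.eval z = (∑ k ∈ Finset.range m, z ^ k • p k) i j := by
    intro z
    simp only [hP, Polynomial.eval_finsetSum, Polynomial.eval_monomial, Matrix.sum_apply,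
      Matrix.smul_apply, smul_eq_mul, mul_comm]
  have h0 : P = 0 := Polynomial.eq_zero_of_infinite_isRoot _
    (hs.mono fun z hz => by
      rw [Set.mem_ofPred_eq, Polynomial.IsRoot.def, he, h z hz, Matrix.zero_apply])
  rw [← he, h0]; simp

end PolynomialDependence

section Assembly

variable {N : ℕ} [NeZero N] {g : ℕ}

theorem sum_twoTerm_mul' (c₀ c₁ Φ : ZMod N → ℂ) (s : ZMod N) :
    ∑ r, twoTerm c₀ c₁ r s * Φ r = c₀ s * Φ s + c₁ (s + 1) * Φ (s + 1) := by
  simp only [mul_comm _ (Φ _), sum_mul_twoTerm]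

/-- The block of an operator on two spaces with given indices of the second space. -/
def auxBlock (S : Matrix (ZMod N × ZMod N) (ZMod N × ZMod N) ℂ) (s t : ZMod N) :
    Matrix (ZMod N) (ZMod N) ℂ := Matrix.of fun a c => S (a, s) (c, t)

theorem lax_intertwiner {P : Fin g → ℂ × ℂ} {f ft : Fin g → ℂ} {X Y Z Zt : ℂ × ℂ} {V Vt : Vertex}
    {y yt : Fin 4 → ℂ} (hV : V.IsFunctional N P f X Y Z) (hVt : Vt.IsFunctional N P ft X Y Zt)
    (hF : V.IsFermat N y) (hFt : Vt.IsFermat N yt)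
    (h3 : Vt.u₃ = V.u₃' ∧ Vt.w₃ = V.w₃' ∧ Vt.κ₃ = V.κ₃) (h3' : Vt.u₃' = V.u₃ ∧ Vt.w₃' = V.w₃)
    (ξ : ℂ) (i j : Fin 2) (s t : ZMod N) :
    ∑ k, ∑ r, lax N ξ V.u₂ Vt.u₂ (V.w₂ / Vt.w₂) V.κ₂ Vt.κ₂ (clock N) (shift N) i k s r •
        (lax N ξ V.u₁ Vt.u₁ (V.w₁ / Vt.w₁) V.κ₁ Vt.κ₁ (clock N) (shift N) k j *
          auxBlock (intertwiner N V Vt y yt) r t) =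
      ∑ k, ∑ r, lax N ξ V.u₂' Vt.u₂' (V.w₂' / Vt.w₂') V.κ₂ Vt.κ₂ (clock N) (shift N) k j r t •
        (auxBlock (intertwiner N V Vt y yt) s r *
          lax N ξ V.u₁' Vt.u₁' (V.w₁' / Vt.w₁') V.κ₁ Vt.κ₁ (clock N) (shift N) i k) := by
  ext a c
  have hS : ∀ a b c d, intertwiner N V Vt y yt (a, b) (c, d) =
      N * crossW (pairW N V Vt y yt) a b c d := fun a b c d => intertwiner_apply V Vt y yt a b c d
  simp only [Matrix.sum_apply, Matrix.smul_apply, Matrix.mul_apply, smul_eq_mul, lax_apply,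
    sum_twoTerm_mul, sum_twoTerm_mul', sum_mul_twoTerm, auxBlock, Matrix.of_apply,
    Fin.sum_univ_two, hS]
  have E := congrFun (congrFun (crossW_exchange hV hVt hF hFt h3 h3' ξ a s c t) i) j
  simp only [Matrix.add_apply, Matrix.smul_apply, Matrix.mul_apply, Fin.sum_univ_two,
    smul_eq_mul] at E
  linear_combination (N : ℂ) * E

/-- An operator on `C ⊗ J` as a matrix over `J` with operators on `C` as entries. -/
def blocks (C J : Type*) [Fintype C] [DecidableEq C] [Fintype J] [DecidableEq J] :
    Matrix (C × J) (C × J) ℂ →* Matrix J J (Matrix C C ℂ) where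
  toFun M := Matrix.of fun s t => Matrix.of fun a b => M (a, s) (b, t)
  map_one' := by
    ext s t a b
    by_cases h : s = t <;> by_cases h' : a = b <;> simp [Matrix.one_apply, h, h']
  map_mul' M M' := by
    ext s t a b
    simp only [Matrix.mul_apply, Matrix.of_apply, Matrix.sum_apply, Fintype.sum_prod_type_right]

theorem trace_blocks (r : ChainRoots g) :
    r.bigK N = (List.ofFn fun n => Matrix.of fun s t =>
      siteOp n (auxBlock (intertwiner N (r.V n) (r.Vt n) (r.y n) (r.yt n)) s t)).prod.trace := by
  have h : blocks (Fin (g + 1) → ZMod N) (ZMod N) (r.bigQ N) =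
      (List.ofFn fun n => Matrix.of fun s t =>
        siteOp n (auxBlock (intertwiner N (r.V n) (r.Vt n) (r.y n) (r.yt n)) s t)).prod := by
    rw [ChainRoots.bigQ, map_list_prod, List.map_ofFn]
    rfl
  rw [← h]
  ext a b
  simp only [ChainRoots.bigK, Matrix.of_apply, Matrix.trace, Matrix.diag_apply, Matrix.sum_apply]
  rfl

theorem shift_mul_transpose : shift N * (shift N).transpose = 1 := by
  ext a b
  rw [shift_eq, Matrix.mul_apply, sum_twoTerm_mul]
  by_cases h : a = b
  · subst h; simp [twoTerm]
  · rw [Matrix.one_apply_ne h]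
    simp [twoTerm, Ne.symm h]

theorem isUnit_shift : IsUnit (shift N) := IsUnit.of_mul_eq_one _ shift_mul_transpose

/-- The constant term of the Lax operator as a polynomial in `ξ`. -/
def laxConst (N : ℕ) [NeZero N] (u v κ : ℂ) (X Z : Matrix (ZMod N) (ZMod N) ℂ) :
    Matrix (Fin 2) (Fin 2) (Matrix (ZMod N) (ZMod N) ℂ) :=
  !![1, -(u • X * (omegaHalf N • 1 - (κ * v) • Z)); 0, v • Z]

/-- The coefficient of `ξ` in the Lax operator. -/
def laxLin (N : ℕ) [NeZero N] (u ut v κ κt : ℂ) (X Z : Matrix (ZMod N) (ZMod N) ℂ) :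
    Matrix (Fin 2) (Fin 2) (Matrix (ZMod N) (ZMod N) ℂ) :=
  !![-((omegaHalf N * u * ut * κ * v) • Z), 0;
    ut • X⁻¹ * (κt • 1 - (omegaHalf N * v) • Z), -((omegaHalf N * u * ut * κt) • 1)]

theorem lax_eq_add (ξ u ut v κ κt : ℂ) (X Z : Matrix (ZMod N) (ZMod N) ℂ) :
    lax N ξ u ut v κ κt X Z = laxConst N u v κ X Z + ξ • laxLin N u ut v κ κt X Z := by
  refine Matrix.ext fun i j => ?_
  fin_cases i <;> fin_cases j <;>
    simp only [lax, laxConst, laxLin, Matrix.add_apply, Matrix.smul_apply, Matrix.of_apply,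
      Fin.zero_eta, Fin.mk_one, Matrix.cons_val_zero, Matrix.cons_val_one, Fin.isValue]
  · rw [smul_neg, smul_smul, sub_eq_add_neg]; congr 3; ring
  · simp
  · rw [zero_add, ← smul_mul_assoc, smul_smul]
  · rw [smul_neg, smul_smul, add_comm]; congr 3; ring

theorem isUnit_laxConst {u v κ : ℂ} (hv : v ≠ 0) {X Z : Matrix (ZMod N) (ZMod N) ℂ}
    (hZ : IsUnit Z) : IsUnit (laxConst N u v κ X Z) := by
  obtain ⟨W, hW⟩ := hZ
  have h1 : v • Z * (v⁻¹ • (W⁻¹ : (Matrix (ZMod N) (ZMod N) ℂ)ˣ).val) = 1 := by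
    rw [smul_mul_smul_comm, mul_inv_cancel₀ hv, one_smul, ← hW, Units.mul_inv]
  have h2 : (v⁻¹ • (W⁻¹ : (Matrix (ZMod N) (ZMod N) ℂ)ˣ).val) * (v • Z) = 1 := by
    rw [smul_mul_smul_comm, inv_mul_cancel₀ hv, one_smul, ← hW, Units.inv_mul]
  generalize v⁻¹ • (W⁻¹ : (Matrix (ZMod N) (ZMod N) ℂ)ˣ).val = W' at h1 h2
  rw [laxConst]
  generalize -(u • X * (omegaHalf N • 1 - (κ * v) • Z)) = B
  generalize v • Z = vZ at h1 h2 ⊢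
  refine isUnit_iff_exists.2 ⟨!![1, -(B * W'); 0, W'], ?_, ?_⟩
  · simp [h1, Matrix.one_fin_two]
  · simp [h2, Matrix.one_fin_two, mul_assoc]

theorem map_siteOp_eq (n : Fin (g + 1))
    (L : Matrix (Fin 2) (Fin 2) (Matrix (ZMod N) (ZMod N) ℂ)) :
    L.map (siteOp n) = (siteHom n).mapMatrix L := rfl

theorem exists_coeff_transfer (c : LaxScalars g)
    (X Z : Fin (g + 1) → Matrix (ZMod N) (ZMod N) ℂ) :
    ∃ p : ℕ → Matrix (Fin (g + 1) → ZMod N) (Fin (g + 1) → ZMod N) ℂ, ∀ ξ : ℂ,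
      transfer c X Z ξ = ∑ k ∈ Finset.range (g + 2), ξ ^ k • p k := by
  obtain ⟨p, hp⟩ := exists_coeff_prod_ofFn
    (fun n => (siteHom n).mapMatrix (laxConst N (c.u n) (c.v n) (c.κ n) (X n) (Z n)))
    (fun n => (siteHom n).mapMatrix (laxLin N (c.u n) (c.ut n) (c.v n) (c.κ n) (c.κt n) (X n) (Z n)))
  refine ⟨fun k => (p k).trace, fun ξ => ?_⟩
  simp only [← map_smul, ← map_add, ← lax_eq_add] at hp
  rw [transfer, monodromy]
  simp only [map_siteOp_eq]
  rw [hp, Matrix.trace_sum]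
  simp only [Matrix.trace_smul]

theorem transfer_mul_bigK {Y : Fin (g + 1) → ℂ × ℂ} {Z : Fin 2 → ℂ × ℂ} {P : Fin g → ℂ × ℂ}
    {c : LaxScalars g} {f : Fin g → ℂ} {X : ℂ × ℂ} {r : ChainRoots g}
    (hr : r.IsConsistent N Y Z P c f X) (ξ : ℂ) :
    r.transferBefore N c ξ * r.bigK N = r.bigK N * r.transferAfter N c ξ := by
  have hα : ∀ n, r.α n ≠ 0 := fun n h0 => by
    have := (hr.V_functional n).ne_zero (r.V n).u₁ (by simp)
    rw [(hr.first_in n).1, h0, mul_zero] at this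
    exact this rfl
  have hα' : ∀ n, r.α' n ≠ 0 := fun n h0 => by
    have := (hr.V_functional n).ne_zero (r.V n).u₁' (by simp)
    rw [(hr.first_out n).1, h0, mul_zero] at this
    exact this rfl
  -- the auxiliary Lax operator
  let ℓ : ℂ → Fin (g + 1) → Matrix (Fin 2) (Fin 2) (Matrix (ZMod N) (ZMod N) ℂ) := fun ξ n =>
    lax N ξ (r.V n).u₂ (r.Vt n).u₂ ((r.V n).w₂ / (r.Vt n).w₂) (r.V n).κ₂ (r.Vt n).κ₂
      (clock N) (shift N)
  have main : ∀ ξ, IsUnit (ℓ ξ 0) →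
      r.transferBefore N c ξ * r.bigK N = r.bigK N * r.transferAfter N c ξ := by
    intro ξ hu
    rw [trace_blocks, ChainRoots.transferBefore, ChainRoots.transferAfter, transfer, transfer,
      monodromy, monodromy]
    refine trace_mul_trace_of_intertwine _ _ _
      (fun m => Matrix.compRingEquiv (Fin 2) (ZMod N) ℂ (ℓ ξ (Fin.ofNat (g + 1) m))) ?_ ?_ ?_ ?_ ?_
    · exact fun n k hnk i j s t => commute_siteOp hnk _ _
    · exact fun n k hnk i j s t => commute_siteOp hnk _ _
    · intro n
      have h1 : Fin.ofNat (g + 1) n.castSucc = n := Fin.ext (by simp)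
      have h2 : Fin.ofNat (g + 1) n.succ = n + 1 := Fin.ext (by simp [Fin.val_add])
      rw [h1, h2, lax_smul _ _ _ _ _ _ _ _ (hα n) _ _ isUnit_clock,
        lax_smul _ _ _ _ _ _ _ _ (hα' n) _ _ isUnit_clock]
      have hin := hr.first_in n
      have hout := hr.first_out n
      rw [← hin.1, ← hin.2.1, ← hin.2.2.1, ← hin.2.2.2.1, ← hin.2.2.2.2, ← hout.1, ← hout.2.1,
        ← hout.2.2]
      ext ⟨i, s⟩ ⟨j, t⟩ : 1
      have E := congrArg (siteHom n) (lax_intertwiner (hr.V_functional n) (hr.Vt_functional n)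
        (hr.V_fermat n) (hr.Vt_fermat n) (hr.third n) (hr.third_periodic n) ξ i j s t)
      simp only [map_sum, map_smul, map_mul, siteHom_apply] at E
      rw [Matrix.mul_apply, Matrix.mul_apply]
      simp only [liftL_mul_liftR_apply, liftR_mul_liftL_apply, Fintype.sum_prod_type,
        Matrix.map_apply, Matrix.of_apply, Matrix.compRingEquiv_apply, Matrix.comp_apply]
      have hs := hr.second n
      have hst := hr.second_t n
      simp only [ℓ, hs.1, hs.2.1, hs.2.2, hst.1, hst.2.1, hst.2.2]
      simp only [← Algebra.smul_def, ← Algebra.commutes]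
      exact E
    · have h1 : Fin.ofNat (g + 1) (Fin.last (g + 1)) = 0 := Fin.ext (by simp)
      have h2 : Fin.ofNat (g + 1) (0 : Fin (g + 2)) = 0 := Fin.ext (by simp)
      rw [h1, h2]
    · have h2 : Fin.ofNat (g + 1) (0 : Fin (g + 2)) = 0 := Fin.ext (by simp)
      rw [h2, MulEquiv.isUnit_map]
      exact hu
  obtain ⟨p, hp⟩ := exists_coeff_transfer c (fun n => r.α n • clock N) (fun n => r.β n • shift N)
  obtain ⟨p', hp'⟩ := exists_coeff_transfer c (fun n => r.α' n • clock N) (fun n => r.β' n • shift N)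
  have hinf : {ξ | IsUnit (ℓ ξ 0)}.Infinite := by
    have hl : ∀ ξ, ℓ ξ 0 = laxConst N (r.V 0).u₂ ((r.V 0).w₂ / (r.Vt 0).w₂) (r.V 0).κ₂ (clock N)
        (shift N) + ξ • laxLin N (r.V 0).u₂ (r.Vt 0).u₂ ((r.V 0).w₂ / (r.Vt 0).w₂) (r.V 0).κ₂
          (r.Vt 0).κ₂ (clock N) (shift N) := fun ξ => lax_eq_add ..
    have hU := isUnit_laxConst (N := N) (u := (r.V 0).u₂) (v := (r.V 0).w₂ / (r.Vt 0).w₂)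
      (κ := (r.V 0).κ₂) (X := clock N)
      (div_ne_zero ((hr.V_functional 0).ne_zero (r.V 0).w₂ (by simp))
        ((hr.Vt_functional 0).ne_zero (r.Vt 0).w₂ (by simp))) isUnit_shift
    generalize laxConst N (r.V 0).u₂ ((r.V 0).w₂ / (r.Vt 0).w₂) (r.V 0).κ₂ (clock N)
        (shift N) = L₀ at hl hU
    generalize laxLin N (r.V 0).u₂ (r.Vt 0).u₂ ((r.V 0).w₂ / (r.Vt 0).w₂) (r.V 0).κ₂
          (r.Vt 0).κ₂ (clock N) (shift N) = L₁ at hl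
    let φ := Matrix.compAlgEquiv (Fin 2) (ZMod N) ℂ ℂ
    have h1 : ∀ ξ, IsUnit (ℓ ξ 0) ↔ (φ L₀ + ξ • φ L₁).det ≠ 0 := by
      intro ξ
      rw [← isUnit_iff_ne_zero, ← Matrix.isUnit_iff_isUnit_det, ← map_smul, ← map_add, ← hl,
        MulEquiv.isUnit_map]
    have h2 : Continuous fun ξ : ℂ => (φ L₀ + ξ • φ L₁).det := by
      refine Continuous.matrix_det ?_
      fun_prop
    have h3 : (φ L₀ + (0 : ℂ) • φ L₁).det ≠ 0 := by
      rw [zero_smul, add_zero, ← isUnit_iff_ne_zero, ← Matrix.isUnit_iff_isUnit_det,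
        MulEquiv.isUnit_map]
      exact hU
    simp only [h1]
    exact infinite_of_mem_nhds 0 (h2.continuousAt.eventually_ne h3)
  have := eq_zero_of_infinite_zeros (m := g + 2) (fun k => p k * r.bigK N - r.bigK N * p' k) hinf
  have hs : ∀ ξ : ℂ, ∑ k ∈ Finset.range (g + 2), ξ ^ k • (p k * r.bigK N - r.bigK N * p' k) =
      r.transferBefore N c ξ * r.bigK N - r.bigK N * r.transferAfter N c ξ := by
    intro ξ
    rw [ChainRoots.transferBefore, ChainRoots.transferAfter, hp, hp', Finset.sum_mul,
      Finset.mul_sum, ← Finset.sum_sub_distrib]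
    simp only [smul_sub, smul_mul_assoc, mul_smul_comm]
  simp only [hs] at this
  exact sub_eq_zero.1 (this (fun ξ hξ => sub_eq_zero.2 (main ξ hξ)) ξ)

end Assembly

end

end BS

namespace BS

noncomputable section

/-! ### Fusion of `2 × 2` matrices with noncommuting entries -/

section Fusion

open Polynomial

variable {A : Type*} [Ring A]

/-- The linear polynomial whose coefficients are the entries of the `i`-th row. -/
def rowPoly (M : Matrix (Fin 2) (Fin 2) A) (i : Fin 2) : A[X] := C (M i 0) + C (M i 1) * X

/-- The quantum determinant relation between two matrices. -/
structure IsQDet (L L' : Matrix (Fin 2) (Fin 2) A) (Δ : A) : Prop where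
  left : L 0 0 * L' 1 0 = L 1 0 * L' 0 0
  right : L 0 1 * L' 1 1 = L 1 1 * L' 0 1
  det : L 0 0 * L' 1 1 - L 1 0 * L' 0 1 = Δ
  det' : L 1 1 * L' 0 0 - L 0 1 * L' 1 0 = Δ

theorem coeff_mul_rowPoly_succ (p : A[X]) (M : Matrix (Fin 2) (Fin 2) A) (i : Fin 2) (j : ℕ) :
    (p * rowPoly M i).coeff (j + 1) = p.coeff (j + 1) * M i 0 + p.coeff j * M i 1 := by
  rw [rowPoly, mul_add, ← mul_assoc, coeff_add, coeff_mul_C, coeff_mul_X, coeff_mul_C]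

theorem coeff_mul_rowPoly_zero (p : A[X]) (M : Matrix (Fin 2) (Fin 2) A) (i : Fin 2) :
    (p * rowPoly M i).coeff 0 = p.coeff 0 * M i 0 := by
  rw [rowPoly, mul_add, ← mul_assoc, coeff_add, coeff_mul_C, coeff_mul_X_zero, add_zero]

theorem IsQDet.rowPoly_mul {L L' : Matrix (Fin 2) (Fin 2) A} {Δ : A} (h : IsQDet L L' Δ) :
    rowPoly L 0 * rowPoly L' 1 = rowPoly L 1 * rowPoly L' 0 := by
  have h3 : L 0 1 * L' 1 0 + L 0 0 * L' 1 1 = L 1 1 * L' 0 0 + L 1 0 * L' 0 1 := by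
    have := h.det.trans h.det'.symm
    rw [sub_eq_sub_iff_add_eq_add] at this
    rw [← this, add_comm]
  have c0 : ∀ (M : Matrix (Fin 2) (Fin 2) A) i, (rowPoly M i).coeff 0 = M i 0 := fun M i => by
    simp [rowPoly]
  have c1 : ∀ (M : Matrix (Fin 2) (Fin 2) A) i, (rowPoly M i).coeff 1 = M i 1 := fun M i => by
    simp [rowPoly, coeff_C]
  have c2 : ∀ (M : Matrix (Fin 2) (Fin 2) A) i n, (rowPoly M i).coeff (n + 2) = 0 := fun M i n => by
    simp [rowPoly]
  ext n
  match n with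
  | 0 => rw [coeff_mul_rowPoly_zero, coeff_mul_rowPoly_zero, c0, c0, h.left]
  | 1 => rw [coeff_mul_rowPoly_succ, coeff_mul_rowPoly_succ, c0, c0, zero_add, c1, c1, h3]
  | 2 => rw [coeff_mul_rowPoly_succ, coeff_mul_rowPoly_succ, c2, c2, c1, c1, zero_mul, zero_add,
          h.right, zero_mul, zero_add]
  | n + 3 => rw [coeff_mul_rowPoly_succ, coeff_mul_rowPoly_succ, c2 _ _ (n + 1), c2 _ _ (n + 1),
          c2, c2, zero_mul, zero_mul, zero_mul, zero_mul]

/-- The products of `m` row polynomials, `i` of them of the second row. -/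
def fusedRow (M : ℕ → Matrix (Fin 2) (Fin 2) A) : ℕ → ℕ → A[X]
  | 0, _ => 1
  | m + 1, 0 => fusedRow M m 0 * rowPoly (M m) 0
  | m + 1, i + 1 => fusedRow M m i * rowPoly (M m) 1

variable {M L : ℕ → Matrix (Fin 2) (Fin 2) A} {Δ Δ' : ℕ → A}

theorem fusedRow_succ (h : ∀ k, IsQDet (M k) (M (k + 1)) (Δ k)) {m i : ℕ} (hi : i ≤ m) :
    fusedRow M (m + 1) i = fusedRow M m i * rowPoly (M m) 0 := by
  induction m generalizing i with
  | zero => obtain rfl : i = 0 := by omega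
            rfl
  | succ m ih =>
    cases i with
    | zero => rfl
    | succ i =>
      rw [fusedRow, ih (by omega), mul_assoc, (h m).rowPoly_mul, ← mul_assoc]
      rfl

theorem coeff_fusedRow_eq_zero (m i : ℕ) {j : ℕ} (hj : m < j) : (fusedRow M m i).coeff j = 0 := by
  induction m generalizing i j with
  | zero => rw [fusedRow, coeff_one, if_neg (by omega)]
  | succ m ih =>
    obtain ⟨j, rfl⟩ : ∃ k, j = k + 1 := ⟨j - 1, by omega⟩
    cases i <;> rw [fusedRow, coeff_mul_rowPoly_succ, ih _ (by omega), ih _ (by omega)] <;> simp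

/-- The trace over the `m`-th symmetric power. -/
def fusedTrace (M : ℕ → Matrix (Fin 2) (Fin 2) A) (m : ℕ) : A :=
  ∑ i ∈ Finset.range (m + 1), (fusedRow M m i).coeff i

theorem fusedTrace_zero : fusedTrace M 0 = 1 := by simp [fusedTrace, fusedRow]

theorem fusedTrace_one : fusedTrace M 1 = (M 0).trace := by
  simp [fusedTrace, fusedRow, rowPoly, Finset.sum_range_succ, Matrix.trace_fin_two]

theorem fusedTrace_succ_succ (h : ∀ k, IsQDet (M k) (M (k + 1)) (Δ k)) (m : ℕ) :
    fusedTrace M (m + 2) = fusedTrace M (m + 1) * (M (m + 1)).trace - fusedTrace M m * Δ m := by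
  have hD := (h m).det
  have hR := (h m).right
  have e1 : fusedTrace M (m + 2) = (fusedRow M (m + 1) (m + 1)).coeff (m + 1) * M (m + 1) 1 1 +
      (∑ i ∈ Finset.range (m + 2), (fusedRow M (m + 1) i).coeff i) * M (m + 1) 0 0 +
      (∑ i ∈ Finset.range (m + 1), (fusedRow M (m + 1) (i + 1)).coeff i) * M (m + 1) 0 1 := by
    rw [fusedTrace, Finset.sum_range_succ, fusedRow, coeff_mul_rowPoly_succ,
      coeff_fusedRow_eq_zero (m + 1) (m + 1) (Nat.lt_succ_self _), zero_mul, zero_add]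
    have : ∀ i ∈ Finset.range (m + 2), (fusedRow M (m + 2) i).coeff i =
        (fusedRow M (m + 1) i).coeff i * M (m + 1) 0 0 +
          (if i = 0 then 0 else (fusedRow M (m + 1) i).coeff (i - 1) * M (m + 1) 0 1) := by
      intro i hi
      rw [fusedRow_succ h (by have := Finset.mem_range.1 hi; omega)]
      cases i with
      | zero => rw [coeff_mul_rowPoly_zero, if_pos rfl, add_zero]
      | succ i => rw [coeff_mul_rowPoly_succ, if_neg (Nat.succ_ne_zero i), Nat.add_sub_cancel]
    rw [Finset.sum_congr rfl this, Finset.sum_add_distrib, ← Finset.sum_mul,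
      Finset.sum_range_succ' (fun i => if i = 0 then (0 : A) else _) (m + 1)]
    simp only [if_true, Nat.succ_ne_zero, if_false, Nat.add_sub_cancel, add_zero, ← Finset.sum_mul]
    abel
  have e2 : (∑ i ∈ Finset.range (m + 1), (fusedRow M (m + 1) i).coeff i) * M (m + 1) 1 1 -
      (∑ i ∈ Finset.range (m + 1), (fusedRow M (m + 1) (i + 1)).coeff i) * M (m + 1) 0 1 =
      fusedTrace M m * Δ m := by
    rw [fusedTrace, Finset.sum_mul, Finset.sum_mul, Finset.sum_mul, ← Finset.sum_sub_distrib]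
    refine Finset.sum_congr rfl fun i hi => ?_
    rw [fusedRow_succ h (by have := Finset.mem_range.1 hi; omega), fusedRow]
    cases i with
    | zero => rw [coeff_mul_rowPoly_zero, coeff_mul_rowPoly_zero, mul_assoc, mul_assoc, ← mul_sub, hD]
    | succ i =>
      rw [coeff_mul_rowPoly_succ, coeff_mul_rowPoly_succ, add_mul, add_mul, mul_assoc, mul_assoc,
        mul_assoc, mul_assoc, hR, add_sub_add_right_eq_sub, ← mul_sub, hD]
  rw [e1, ← e2, Matrix.trace_fin_two, mul_add, fusedTrace, Finset.sum_range_succ]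
  simp only [add_mul]
  abel

theorem fusedRow_add_left (h : ∀ k, IsQDet (M k) (M (k + 1)) (Δ k)) {n : ℕ}
    (hn : ∀ k, M (k + n) = M k) {m i : ℕ} (hi : i ≤ m) :
    fusedRow M (n + m) i = fusedRow M n 0 * fusedRow M m i := by
  induction m generalizing i with
  | zero => obtain rfl : i = 0 := by omega
            simp [fusedRow]
  | succ m ih =>
    rw [← add_assoc]
    rcases Nat.lt_or_ge m i with h' | h'
    · obtain rfl : i = m + 1 := by omega
      rw [fusedRow, fusedRow, ih le_rfl, mul_assoc, add_comm n m, hn]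
    · rw [fusedRow_succ h (by omega), fusedRow_succ h h', ih h', mul_assoc, add_comm n m, hn]

theorem fusedRow_add_right (h : ∀ k, IsQDet (M k) (M (k + 1)) (Δ k)) {n : ℕ}
    (hn : ∀ k, M (k + n) = M k) {m i : ℕ} (hi : i ≤ m) :
    fusedRow M (n + m) (n + i) = fusedRow M n n * fusedRow M m i := by
  induction m generalizing i with
  | zero => obtain rfl : i = 0 := by omega
            simp [fusedRow]
  | succ m ih =>
    rw [← add_assoc]
    rcases Nat.lt_or_ge m i with h' | h'
    · obtain rfl : i = m + 1 := by omega
      rw [← add_assoc, fusedRow, fusedRow, ih le_rfl, mul_assoc, add_comm n m, hn]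
    · rw [fusedRow_succ h (by omega), fusedRow_succ h h', ih h', mul_assoc, add_comm n m, hn]

theorem fusedRow_mul (hM : ∀ k, IsQDet (M k) (M (k + 1)) (Δ k))
    (hc : ∀ k l i j s t, Commute (L k i j) (M l s t)) (m i : ℕ) :
    fusedRow (fun k => L k * M k) m i =
      ∑ j ∈ Finset.range (m + 1), C ((fusedRow L m i).coeff j) * fusedRow M m j := by
  have hcomm : ∀ k i j m n l, Commute (L k i j) ((fusedRow M m n).coeff l) := by
    intro k i j m
    induction m with
    | zero => intro n l; rw [fusedRow, coeff_one]; split_ifs <;> simp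
    | succ m ih =>
      intro n l
      cases n <;> cases l <;> rw [fusedRow] <;>
        simp only [coeff_mul_rowPoly_zero, coeff_mul_rowPoly_succ]
      · exact (ih _ _).mul_right (hc ..)
      · exact ((ih _ _).mul_right (hc ..)).add_right ((ih _ _).mul_right (hc ..))
      · exact (ih _ _).mul_right (hc ..)
      · exact ((ih _ _).mul_right (hc ..)).add_right ((ih _ _).mul_right (hc ..))
  have hC : ∀ k i j m n, C (L k i j) * fusedRow M m n = fusedRow M m n * C (L k i j) := by
    intro k i j m n
    ext l
    rw [coeff_C_mul, coeff_mul_C, (hcomm ..).eq]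
  have hrow : ∀ k i, rowPoly (L k * M k) i =
      C (L k i 0) * rowPoly (M k) 0 + C (L k i 1) * rowPoly (M k) 1 := by
    intro k i
    simp only [rowPoly, Matrix.mul_apply, Fin.sum_univ_two, C_add, C_mul, mul_add, add_mul,
      mul_assoc]
    abel
  have step : ∀ m i s, (∑ j ∈ Finset.range (m + 1), C ((fusedRow L m i).coeff j) * fusedRow M m j) *
        rowPoly (L m * M m) s =
      ∑ j ∈ Finset.range (m + 2), C ((fusedRow L m i * rowPoly (L m) s).coeff j) *
        fusedRow M (m + 1) j := by
    intro m i s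
    rw [Finset.sum_mul]
    have e1 : ∀ j ∈ Finset.range (m + 1), C ((fusedRow L m i).coeff j) * fusedRow M m j *
        rowPoly (L m * M m) s =
        C ((fusedRow L m i).coeff j * L m s 0) * fusedRow M (m + 1) j +
        C ((fusedRow L m i).coeff j * L m s 1) * fusedRow M (m + 1) (j + 1) := by
      intro j hj
      rw [fusedRow_succ hM (by have := Finset.mem_range.1 hj; omega), fusedRow, hrow, mul_add,
        C_mul, C_mul]
      simp only [mul_assoc]
      simp only [← mul_assoc (fusedRow M m j), ← hC]
      simp only [mul_assoc]
    have e2 : ∀ j ∈ Finset.range (m + 2), C ((fusedRow L m i * rowPoly (L m) s).coeff j) *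
        fusedRow M (m + 1) j = C ((fusedRow L m i).coeff j * L m s 0) * fusedRow M (m + 1) j +
        (if j = 0 then 0 else
          C ((fusedRow L m i).coeff (j - 1) * L m s 1) * fusedRow M (m + 1) j) := by
      intro j _
      cases j with
      | zero => rw [coeff_mul_rowPoly_zero, if_pos rfl, add_zero]
      | succ j =>
        rw [coeff_mul_rowPoly_succ, if_neg (Nat.succ_ne_zero j), Nat.add_sub_cancel, C_add, add_mul]
    rw [Finset.sum_congr rfl e1, Finset.sum_congr rfl e2, Finset.sum_add_distrib,
      Finset.sum_add_distrib, Finset.sum_range_succ _ (m + 1),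
      coeff_fusedRow_eq_zero m i (Nat.lt_succ_self m),
      Finset.sum_range_succ' (fun j => if j = 0 then (0 : A[X]) else _) (m + 1)]
    simp
  induction m generalizing i with
  | zero => simp [fusedRow]
  | succ m ih =>
    cases i with
    | zero => rw [fusedRow, ih, step]; rfl
    | succ i => rw [fusedRow, ih, step]; rfl

end Fusion

end

end BS

namespace BS

noncomputable section

section Fused

open Polynomial

variable {A : Type*} [Ring A]

theorem IsQDet.mul {L L' M M' : Matrix (Fin 2) (Fin 2) A} {Δ Δ' : A} (hL : IsQDet L L' Δ)
    (hM : IsQDet M M' Δ') (hc : ∀ i j s t, Commute (L' i j) (M s t)) :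
    IsQDet (L * M) (L' * M') (Δ * Δ') := by
  have e : ∀ i j a b, (L * M) i a * (L' * M') j b =
      L i 0 * L' j 0 * (M 0 a * M' 0 b) + L i 0 * L' j 1 * (M 0 a * M' 1 b) +
      L i 1 * L' j 0 * (M 1 a * M' 0 b) + L i 1 * L' j 1 * (M 1 a * M' 1 b) := by
    intro i j a b
    have hs : ∀ s t c d, L i s * M s a * (L' j t * M' c d) = L i s * L' j t * (M s a * M' c d) := by
      intro s t c d
      rw [mul_assoc, ← mul_assoc (M s a), ← (hc j t s a).eq]
      simp only [mul_assoc]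
    simp only [Matrix.mul_apply, Fin.sum_univ_two, add_mul, mul_add, hs]
    abel
  have key : ∀ a b, (L * M) 0 a * (L' * M') 1 b - (L * M) 1 a * (L' * M') 0 b =
      Δ * (M 0 a * M' 1 b - M 1 a * M' 0 b) := by
    intro a b
    rw [e, e, hL.left, hL.right, eq_add_of_sub_eq hL.det, eq_add_of_sub_eq hL.det']
    simp only [add_mul, mul_sub]
    abel
  refine ⟨?_, ?_, ?_, ?_⟩
  · rw [← sub_eq_zero, key, hM.left, sub_self, mul_zero]
  · rw [← sub_eq_zero, key, hM.right, sub_self, mul_zero]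
  · rw [key, hM.det]
  · rw [← neg_sub, key, ← mul_neg, neg_sub, hM.det']

variable [Algebra ℂ A]

/-- A sequence of matrices with quantum determinants whose products over a period `N` are those of
the classical matrix `ℓ`. -/
structure IsFused (N : ℕ) (M : ℕ → Matrix (Fin 2) (Fin 2) A) (Δ : ℕ → A)
    (ℓ : Matrix (Fin 2) (Fin 2) ℂ) : Prop where
  qdet : ∀ k, IsQDet (M k) (M (k + 1)) (Δ k)
  top : fusedRow M N 0 = C (algebraMap ℂ A (ℓ 0 0)) + C (algebraMap ℂ A (ℓ 0 1)) * X ^ N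
  bot : fusedRow M N N = C (algebraMap ℂ A (ℓ 1 0)) + C (algebraMap ℂ A (ℓ 1 1)) * X ^ N

theorem sum_range_coeff_mul (N : ℕ) (a b : A) (F : ℕ → A[X]) :
    ∑ j ∈ Finset.range (N + 1), C ((C a + C b * X ^ N).coeff j) * F j =
      C a * F 0 + C b * F N := by
  have h : ∀ j, C ((C a + C b * X ^ N : A[X]).coeff j) * F j =
      (if j = 0 then C a * F j else 0) + (if j = N then C b * F j else 0) := by
    intro j
    rw [coeff_add, coeff_C, coeff_C_mul, coeff_X_pow, C_add, add_mul]
    split_ifs <;> simp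
  simp only [h, Finset.sum_add_distrib, Finset.sum_ite_eq', Finset.mem_range]
  simp

theorem IsFused.mul {N : ℕ} {L M : ℕ → Matrix (Fin 2) (Fin 2) A} {Δ Δ' : ℕ → A}
    {ℓ ℓ' : Matrix (Fin 2) (Fin 2) ℂ} (hL : IsFused N L Δ ℓ) (hM : IsFused N M Δ' ℓ')
    (hc : ∀ k l i j s t, Commute (L k i j) (M l s t)) :
    IsFused N (fun k => L k * M k) (fun k => Δ k * Δ' k) (ℓ * ℓ') := by
  refine ⟨fun k => (hL.qdet k).mul (hM.qdet k) (hc _ _), ?_, ?_⟩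
  · rw [fusedRow_mul hM.qdet hc, hL.top, sum_range_coeff_mul, hM.top, hM.bot]
    simp only [Matrix.mul_apply, Fin.sum_univ_two, map_add, map_mul, mul_add, add_mul, mul_assoc]
    abel
  · rw [fusedRow_mul hM.qdet hc, hL.bot, sum_range_coeff_mul, hM.top, hM.bot]
    simp only [Matrix.mul_apply, Fin.sum_univ_two, map_add, map_mul, mul_add, add_mul, mul_assoc]
    abel

theorem IsFused.one (N : ℕ) : IsFused (A := A) N (fun _ => 1) (fun _ => 1) 1 := by
  have h : ∀ m i, i ≤ m → fusedRow (fun _ => (1 : Matrix (Fin 2) (Fin 2) A)) m i = X ^ i := by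
    intro m
    induction m with
    | zero => intro i hi; obtain rfl : i = 0 := by omega
              simp [fusedRow]
    | succ m ih =>
      intro i hi
      cases i with
      | zero => rw [fusedRow, ih _ (by omega)]; simp [rowPoly]
      | succ i => rw [fusedRow, ih _ (by omega)]; simp [rowPoly, pow_succ]
  refine ⟨fun _ => ⟨?_, ?_, ?_, ?_⟩, ?_, ?_⟩
  · simp
  · simp
  · simp
  · simp
  · rw [h _ _ (Nat.zero_le _)]; simp
  · rw [h _ _ le_rfl]; simp

theorem IsFused.prod_ofFn {N : ℕ} {m : ℕ} {L : Fin m → ℕ → Matrix (Fin 2) (Fin 2) A}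
    {Δ : Fin m → ℕ → A} {ℓ : Fin m → Matrix (Fin 2) (Fin 2) ℂ}
    (hL : ∀ n, IsFused N (L n) (Δ n) (ℓ n))
    (hc : ∀ n n', n ≠ n' → ∀ k l i j s t, Commute (L n k i j) (L n' l s t)) :
    IsFused N (fun k => (List.ofFn fun n => L n k).prod) (fun k => (List.ofFn fun n => Δ n k).prod)
      (List.ofFn ℓ).prod := by
  induction m with
  | zero => simpa using IsFused.one N
  | succ m ih =>
    simp only [List.ofFn_succ, List.prod_cons]
    refine (hL 0).mul (ih (fun n => hL n.succ) fun n n' h => hc _ _ (by simpa using h)) ?_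
    intro k l i j s t
    have : ∀ (a : ℕ) (K : Fin a → Matrix (Fin 2) (Fin 2) A) (x : A),
        (∀ n s t, Commute x (K n s t)) → ∀ s t, Commute x ((List.ofFn K).prod s t) := by
      intro a
      induction a with
      | zero =>
        intro K x _ s t
        rw [List.ofFn_zero, List.prod_nil, Matrix.one_apply]
        split_ifs <;> simp
      | succ a iha =>
        intro K x hx s t
        rw [List.ofFn_succ, List.prod_cons, Matrix.mul_apply]
        exact Commute.sum_right _ _ _ fun r _ =>
          (hx _ _ _).mul_right (iha (fun n => K n.succ) x (fun n => hx _) _ _)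
    exact this _ _ _ (fun n s t => hc 0 n.succ (Fin.succ_ne_zero n).symm _ _ _ _ _ _) s t

theorem IsFused.fusedTrace {N : ℕ} (hN : N ≠ 0) {M : ℕ → Matrix (Fin 2) (Fin 2) A} {Δ : ℕ → A}
    {ℓ : Matrix (Fin 2) (Fin 2) ℂ} (hM : IsFused N M Δ ℓ) (hp : ∀ k, M (k + N) = M k) :
    BS.fusedTrace M (2 * N - 1) = ℓ.trace • BS.fusedTrace M (N - 1) := by
  obtain ⟨n, rfl⟩ : ∃ n, N = n + 1 := ⟨N - 1, by omega⟩
  rw [show 2 * (n + 1) - 1 = (n + 1) + n by omega, Nat.add_sub_cancel, BS.fusedTrace,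
    show n + 1 + n + 1 = (n + 1) + (n + 1) by ring, Finset.sum_range_add]
  have e1 : ∀ i ∈ Finset.range (n + 1), (fusedRow M (n + 1 + n) i).coeff i =
      ℓ 0 0 • (fusedRow M n i).coeff i := by
    intro i hi
    have hi' := Finset.mem_range.1 hi
    rw [fusedRow_add_left hM.qdet hp (by omega), hM.top, add_mul, coeff_add, coeff_C_mul, mul_assoc,
      coeff_C_mul, coeff_X_pow_mul', if_neg (by omega), mul_zero, add_zero, Algebra.smul_def]
  have e2 : ∀ i ∈ Finset.range (n + 1), (fusedRow M (n + 1 + n) (n + 1 + i)).coeff (n + 1 + i) =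
      ℓ 1 1 • (fusedRow M n i).coeff i := by
    intro i hi
    have hi' := Finset.mem_range.1 hi
    rw [fusedRow_add_right hM.qdet hp (by omega), hM.bot, add_mul, coeff_add, coeff_C_mul, mul_assoc,
      coeff_C_mul, coeff_X_pow_mul', if_pos (by omega), coeff_fusedRow_eq_zero n i (by omega),
      mul_zero, zero_add, Algebra.smul_def, Nat.add_sub_cancel_left]
  rw [Finset.sum_congr rfl e1, Finset.sum_congr rfl e2, ← Finset.smul_sum, ← Finset.smul_sum,
    ← add_smul, Matrix.trace_fin_two]
  rfl

end Fused

/-! ### The `q`-binomial theorem at a root of unity -/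

section QBinomial

open Polynomial

/-- The coefficients of `∏_{k < m} (1 + q^k t)`. -/
def qcoeff (q : ℂ) : ℕ → ℕ → ℂ
  | _, 0 => 1
  | 0, _ + 1 => 0
  | m + 1, j + 1 => qcoeff q m (j + 1) + q ^ m * qcoeff q m j

theorem qcoeff_zero (q : ℂ) (m : ℕ) : qcoeff q m 0 = 1 := by cases m <;> rfl

theorem qcoeff_eq_zero (q : ℂ) {m j : ℕ} (h : m < j) : qcoeff q m j = 0 := by
  induction m generalizing j with
  | zero => obtain ⟨j, rfl⟩ : ∃ k, j = k + 1 := ⟨j - 1, by omega⟩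
            rfl
  | succ m ih =>
    obtain ⟨j, rfl⟩ : ∃ k, j = k + 1 := ⟨j - 1, by omega⟩
    rw [qcoeff, ih (by omega), ih (by omega)]; ring

theorem qcoeff_succ' (q : ℂ) (m j : ℕ) :
    qcoeff q (m + 1) (j + 1) = q ^ (j + 1) * qcoeff q m (j + 1) + q ^ j * qcoeff q m j := by
  induction m generalizing j with
  | zero => cases j <;> simp [qcoeff]
  | succ m ih =>
    rw [qcoeff]
    cases j with
    | zero =>
      rw [ih 0]
      have h1 := qcoeff_zero q
      rw [h1, h1]
      have h2 : qcoeff q (m + 1) (0 + 1) = qcoeff q m (0 + 1) + q ^ m * qcoeff q m 0 := rfl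
      have h3 := ih 0
      rw [h1] at h2 h3
      linear_combination q * h3 - q * h2
    | succ j =>
      have h1 := ih (j + 1)
      have h2 : qcoeff q (m + 1) (j + 1) = qcoeff q m (j + 1) + q ^ m * qcoeff q m j := rfl
      have h3 := ih j
      have h4 : qcoeff q (m + 1) (j + 1 + 1) = qcoeff q m (j + 1 + 1) + q ^ m * qcoeff q m (j + 1) :=
        rfl
      linear_combination h1 - q ^ (j + 1 + 1) * h4 + q ^ (m + 1) * h3 - q ^ (j + 1) * h2

theorem qcoeff_self (q : ℂ) (m : ℕ) : qcoeff q m m = ∏ k ∈ Finset.range m, q ^ k := by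
  induction m with
  | zero => rfl
  | succ m ih => rw [qcoeff, qcoeff_eq_zero q (Nat.lt_succ_self m), ih, Finset.prod_range_succ]; ring

theorem prod_range_pow_primitive {q : ℂ} {N : ℕ} [NeZero N] (hq : IsPrimitiveRoot q N) :
    ∏ k ∈ Finset.range N, q ^ k = -(-1) ^ N := by
  have h := prod_range_sub_pow_mul hq 0 1
  have h2 : ∏ k ∈ Finset.range N, ((0 : ℂ) - q ^ k * 1) = (-1) ^ N * ∏ k ∈ Finset.range N, q ^ k := by
    rw [← Finset.card_range N, ← Finset.prod_const, Finset.card_range, ← Finset.prod_mul_distrib]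
    exact Finset.prod_congr rfl fun _ _ => by ring
  rw [h2, one_pow, zero_pow (NeZero.ne N)] at h
  have h3 : ((-1 : ℂ) ^ N) * (-1) ^ N = 1 := by rw [← mul_pow]; norm_num
  linear_combination (-1) ^ N * h - (∏ k ∈ Finset.range N, q ^ k) * h3

theorem qcoeff_primitive {q : ℂ} {N : ℕ} (hq : IsPrimitiveRoot q N) {j : ℕ} (h0 : 0 < j)
    (hj : j < N) : qcoeff q N j = 0 := by
  obtain ⟨m, rfl⟩ : ∃ m, N = m + 1 := ⟨N - 1, by omega⟩
  obtain ⟨j, rfl⟩ : ∃ k, j = k + 1 := ⟨j - 1, by omega⟩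
  have h1 : qcoeff q (m + 1) (j + 1) = qcoeff q m (j + 1) + q ^ m * qcoeff q m j := rfl
  have h2 := qcoeff_succ' q m j
  have h3 := hq.pow_eq_one
  have h4 : q ^ (j + 1) ≠ 1 := hq.pow_ne_one_of_pos_of_lt (by omega) hj
  have : (q ^ (j + 1) - 1) * qcoeff q (m + 1) (j + 1) = 0 := by
    linear_combination q ^ (j + 1) * h1 - h2 + q ^ j * qcoeff q m j * h3
  exact (mul_eq_zero.1 this).resolve_left (sub_ne_zero.2 h4)

variable {R : Type*} [Ring R] [Algebra ℂ R]

theorem mul_aeval_of_qcommute {q : ℂ} {W B : R} (h : B * W = q • (W * B)) (p : ℂ[X]) :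
    B * aeval W p = aeval W (p.comp (C q * X)) * B := by
  induction p using Polynomial.induction_on' with
  | add p p' h1 h2 => rw [map_add, mul_add, h1, h2, add_comp, map_add, add_mul]
  | monomial n a =>
    have hn : B * W ^ n = q ^ n • (W ^ n * B) := by
      induction n with
      | zero => simp
      | succ n ih =>
        rw [pow_succ, ← mul_assoc, ih, smul_mul_assoc, mul_assoc, h, mul_smul_comm, smul_smul,
          pow_succ, mul_assoc]
    rw [← C_mul_X_pow_eq_monomial]
    simp only [map_mul, aeval_C, map_pow, aeval_X, mul_comp, C_comp, X_comp, pow_comp, mul_pow]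
    rw [← mul_assoc, ← Algebra.commutes a B, mul_assoc, hn, Algebra.smul_def, map_pow]
    simp only [mul_assoc]

theorem qbinomial_coeff {q α β : ℂ} {W B : R} (h : B * W = q • (W * B)) (c : ℕ → ℕ → R)
    (h00 : c 0 0 = 1) (h0 : ∀ j, c 0 (j + 1) = 0)
    (hz : ∀ m, c (m + 1) 0 = c m 0 * aeval W (C α + C (β * q ^ m) * X))
    (hs : ∀ m j, c (m + 1) (j + 1) =
      c m (j + 1) * aeval W (C α + C (β * q ^ m) * X) + c m j * (q ^ m • B)) (m j : ℕ) :
    c m j = qcoeff q m j •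
      (aeval W (∏ k ∈ Finset.Ico j m, (C α + C (β * q ^ k) * X)) * B ^ j) := by
  have hB : ∀ j m, B ^ j * aeval W (C α + C (β * q ^ m) * X) =
      aeval W (C α + C (β * q ^ (m + j)) * X) * B ^ j := by
    intro j
    induction j with
    | zero => intro m; simp
    | succ j ih =>
      intro m
      rw [pow_succ, mul_assoc, mul_aeval_of_qcommute h, ← mul_assoc]
      have : (C α + C (β * q ^ m) * X).comp (C q * X) = C α + C (β * q ^ (m + 1)) * X := by
        simp only [add_comp, C_comp, mul_comp, X_comp, pow_succ, ← mul_assoc, C_mul]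
      rw [this, ih, mul_assoc, add_assoc, add_comm 1 j]
  induction m generalizing j with
  | zero =>
    cases j with
    | zero => simp [h00, qcoeff]
    | succ j => simp [h0, qcoeff]
  | succ m ih =>
    cases j with
    | zero =>
      rw [hz, ih, qcoeff_zero, qcoeff_zero, Finset.prod_Ico_succ_top (Nat.zero_le m), map_mul]
      simp
    | succ j =>
      rw [hs, ih, ih, smul_mul_assoc, mul_assoc, hB, ← mul_assoc, ← map_mul, smul_mul_smul_comm,
        mul_assoc, ← pow_succ, mul_comm (qcoeff q m j), ← smul_mul_assoc, ← smul_mul_assoc,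
        ← add_mul, ← map_smul, ← map_smul, ← map_add,
        ← smul_mul_assoc (qcoeff q (m + 1) (j + 1)), ← map_smul]
      congr 2
      rcases Nat.lt_trichotomy j m with hj | rfl | hj
      · rw [Finset.prod_Ico_succ_top (by omega), Finset.prod_eq_prod_Ico_succ_bot hj]
        have e1 : qcoeff q (m + 1) (j + 1) = qcoeff q m (j + 1) + q ^ m * qcoeff q m j := rfl
        have e2 := qcoeff_succ' q m j
        have e3 : qcoeff q m (j + 1) • (C α + C (β * q ^ (m + (j + 1))) * X) +
            (q ^ m * qcoeff q m j) • (C α + C (β * q ^ j) * X) =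
            qcoeff q (m + 1) (j + 1) • (C α + C (β * q ^ m) * X) := by
          simp only [smul_eq_C_mul, mul_add, ← mul_assoc, ← C_mul]
          have e4 : qcoeff q (m + 1) (j + 1) * β * q ^ m =
              qcoeff q m (j + 1) * β * q ^ (m + (j + 1)) +
                q ^ m * qcoeff q m j * β * q ^ j := by rw [e2]; ring
          rw [e4]
          have e5 : qcoeff q (m + 1) (j + 1) * α =
            qcoeff q m (j + 1) * α + q ^ m * qcoeff q m j * α := by rw [e1]; ring
          rw [e5, C_add, C_add]
          ring
        simp only [smul_eq_C_mul] at e3 ⊢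
        linear_combination (∏ k ∈ Finset.Ico (j + 1) m, (C α + C (β * q ^ k) * X)) * e3
      · rw [qcoeff_eq_zero q (Nat.lt_succ_self j)]
        have : qcoeff q (j + 1) (j + 1) = q ^ j * qcoeff q j j := by
          rw [qcoeff, qcoeff_eq_zero q (Nat.lt_succ_self j), zero_add]
        simp [this]
      · rw [qcoeff_eq_zero q (show m < j + 1 by omega), qcoeff_eq_zero q hj,
          qcoeff_eq_zero q (show m + 1 < j + 1 by omega)]
        simp

theorem aeval_prod_primitive {q : ℂ} {N : ℕ} [NeZero N] (hq : IsPrimitiveRoot q N) (α β : ℂ)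
    (W : R) : aeval W (∏ k ∈ Finset.Ico 0 N, (C α + C (β * q ^ k) * X)) =
      algebraMap ℂ R (α ^ N) - (-β) ^ N • W ^ N := by
  have h : ∏ k ∈ Finset.Ico 0 N, (C α + C (β * q ^ k) * X) = C (α ^ N) - C ((-β) ^ N) * X ^ N := by
    refine Polynomial.funext fun x => ?_
    have := prod_range_sub_pow_mul hq α (-β * x)
    rw [mul_pow] at this
    simp only [eval_prod, eval_add, eval_sub, eval_mul, eval_C, eval_X, eval_pow,
      Nat.Ico_zero_eq_range]
    rw [← this]
    exact Finset.prod_congr rfl fun k _ => by ring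
  rw [h, map_sub, aeval_C, map_mul, aeval_C, map_pow (aeval W), aeval_X,
    ← Algebra.smul_def]

/-- Products over a period of linear polynomials with `q`-commuting coefficients. -/
theorem qbinomial_primitive {q : ℂ} {N : ℕ} [NeZero N] (hq : IsPrimitiveRoot q N) {α β : ℂ}
    {W B : R} (h : B * W = q • (W * B)) (c : ℕ → ℕ → R)
    (h00 : c 0 0 = 1) (h0 : ∀ j, c 0 (j + 1) = 0)
    (hz : ∀ m, c (m + 1) 0 = c m 0 * (α • 1 + (β * q ^ m) • W))
    (hs : ∀ m j, c (m + 1) (j + 1) =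
      c m (j + 1) * (α • 1 + (β * q ^ m) • W) + c m j * (q ^ m • B)) (j : ℕ) :
    c N j = if j = 0 then algebraMap ℂ R (α ^ N) - (-β) ^ N • W ^ N else
      if j = N then (-(-1) ^ N : ℂ) • B ^ N else 0 := by
  have e : ∀ m, (α • 1 + (β * q ^ m) • W : R) = aeval W (C α + C (β * q ^ m) * X) := by
    intro m
    rw [map_add, aeval_C, map_mul, aeval_C, aeval_X, Algebra.algebraMap_eq_smul_one,
      ← Algebra.smul_def]
  simp only [e] at hz hs
  rw [qbinomial_coeff h c h00 h0 hz hs]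
  split_ifs with h1 h2
  · subst h1
    rw [qcoeff_zero, aeval_prod_primitive hq, one_smul, pow_zero, mul_one]
  · subst h2
    rw [qcoeff_self, prod_range_pow_primitive hq, Finset.Ico_self, Finset.prod_empty, map_one,
      one_mul]
  · rcases Nat.lt_or_ge j N with h3 | h3
    · rw [qcoeff_primitive hq (by omega) h3, zero_smul]
    · rw [qcoeff_eq_zero q (by omega), zero_smul]

/-- The `N`-th power of `X (a + b Z)` for a Weyl pair `X`, `Z`. -/
theorem mul_affine_pow {q : ℂ} {N : ℕ} [NeZero N] (hq : IsPrimitiveRoot q N) (a b : ℂ)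
    {Y W : R} (h : Y * W = q • (W * Y)) :
    (Y * (a • 1 + b • W)) ^ N = (algebraMap ℂ R (a ^ N) - (-b) ^ N • W ^ N) * Y ^ N := by
  have e : ∀ m : ℕ, (Y * (a • 1 + b • W)) ^ m =
      aeval W (∏ k ∈ Finset.range m, (C a + C (b * q ^ (k + 1)) * X)) * Y ^ m := by
    intro m
    induction m with
    | zero => simp
    | succ m ih =>
      have e1 : (a • 1 + b • W : R) = aeval W (C a + C b * X) := by
        rw [map_add, aeval_C, map_mul, aeval_C, aeval_X, Algebra.algebraMap_eq_smul_one,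
          ← Algebra.smul_def]
      rw [pow_succ', ih, e1, mul_assoc, ← mul_assoc (aeval W _), ← map_mul, ← mul_assoc,
        mul_aeval_of_qcommute h, mul_assoc, ← pow_succ', Finset.prod_range_succ']
      congr 2
      rw [mul_comp, prod_comp, mul_comm]
      congr 1
      · refine Finset.prod_congr rfl fun k _ => ?_
        simp only [add_comp, C_comp, mul_comp, X_comp, pow_succ, ← mul_assoc, C_mul]
      · simp only [add_comp, C_comp, mul_comp, X_comp, pow_succ, ← mul_assoc, C_mul, pow_zero,
          mul_one]
  rw [e]
  congr 1
  rw [← aeval_prod_primitive hq, Nat.Ico_zero_eq_range]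
  congr 1
  obtain ⟨n, rfl⟩ : ∃ n, N = n + 1 := ⟨N - 1, by have := NeZero.ne N; omega⟩
  rw [Finset.prod_range_succ, Finset.prod_range_succ', hq.pow_eq_one, pow_zero]

end QBinomial

end

end BS

namespace BS

noncomputable section

/-! ### Exchange relations for the Lax operator -/

section LaxAlgebra

variable {R : Type*} [Ring R] [Algebra ℂ R]

/-- The Lax operator in an algebra generated by a Weyl pair `X`, `Z`, with `Y = X⁻¹`. -/
def laxAlg (h ξ u ut v κ κt : ℂ) (X Y Z : R) : Matrix (Fin 2) (Fin 2) R :=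
  !![1 - (h * ξ * u * ut * κ * v) • Z, -(u • X * (h • 1 - (κ * v) • Z));
    (ξ * ut) • Y * (κt • 1 - (h * v) • Z), -((h * ξ * u * ut * κt) • 1) + v • Z]

/-- Conjugation of a `2 × 2` matrix by a diagonal one. -/
def gauge (c : ℂ) (M : Matrix (Fin 2) (Fin 2) R) : Matrix (Fin 2) (Fin 2) R :=
  !![M 0 0, c • M 0 1; c⁻¹ • M 1 0, M 1 1]

/-- `X Z = h² Z X` and `Y = X⁻¹`. -/
structure IsWeylTriple (h : ℂ) (X Y Z : R) : Prop where
  XY : X * Y = 1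
  YX : Y * X = 1
  XZ : X * Z = h ^ 2 • (Z * X)

variable {h : ℂ} {X Y Z : R}

theorem IsWeylTriple.ZX (hW : IsWeylTriple h X Y Z) (hh : h ≠ 0) :
    Z * X = (h ^ 2)⁻¹ • (X * Z) := by
  rw [hW.XZ, inv_smul_smul₀ (pow_ne_zero 2 hh)]

theorem IsWeylTriple.ZY (hW : IsWeylTriple h X Y Z) : Z * Y = h ^ 2 • (Y * Z) := by
  have : Y * (X * Z) * Y = Y * (h ^ 2 • (Z * X)) * Y := by rw [hW.XZ]
  rw [← mul_assoc, hW.YX, one_mul, mul_smul_comm, smul_mul_assoc, mul_assoc, mul_assoc, hW.XY,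
    mul_one] at this
  exact this

theorem isQDet_laxAlg (hW : IsWeylTriple h X Y Z) (hh : h ≠ 0) {c : ℂ} (hc : c ≠ 0)
    (ξ u ut v κ κt : ℂ) :
    IsQDet (gauge c (laxAlg h ξ u ut v κ κt X Y Z))
      (gauge (h ^ 2 * c) (laxAlg h (h ^ 2 * ξ) u ut v κ κt X Y Z))
      ((v * ((1 - h ^ 2 * ξ * u * ut) * (1 - h ^ 2 * ξ * u * ut * κ * κt))) • Z) := by
  have r1 := hW.XY
  have r2 := hW.YX
  have r3 := hW.ZX hh
  have r4 := hW.ZY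
  have r1' : ∀ w, X * (Y * w) = w := fun w => by rw [← mul_assoc, r1, one_mul]
  have r2' : ∀ w, Y * (X * w) = w := fun w => by rw [← mul_assoc, r2, one_mul]
  have r3' : ∀ w, Z * (X * w) = (h ^ 2)⁻¹ • (X * (Z * w)) := fun w => by
    rw [← mul_assoc, r3, smul_mul_assoc, mul_assoc]
  have r4' : ∀ w, Z * (Y * w) = h ^ 2 • (Y * (Z * w)) := fun w => by
    rw [← mul_assoc, r4, smul_mul_assoc, mul_assoc]
  constructor <;>
  · simp only [gauge, laxAlg, Matrix.of_apply, Matrix.cons_val', Matrix.cons_val_zero,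
      Matrix.cons_val_one, Matrix.cons_val_fin_one, Matrix.empty_val']
    simp only [mul_add, add_mul, mul_sub, sub_mul, smul_mul_assoc, mul_smul_comm, smul_smul,
      smul_add, smul_sub, mul_assoc, mul_one, one_mul, neg_mul, mul_neg, smul_neg, r1, r2, r3, r4,
      r1', r2', r3', r4']
    match_scalars <;> field_simp <;> ring

/-- The `R`-matrix. -/
def rMatrix (q ξ μ : ℂ) : Matrix (Fin 2 × Fin 2) (Fin 2 × Fin 2) ℂ := Matrix.of fun p r =>
  if p = r then (if p.1 = p.2 then q * ξ - μ else if p.1 = 0 then ξ - μ else q * (ξ - μ))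
  else if p = (1, 0) ∧ r = (0, 1) then (q - 1) * ξ
  else if p = (0, 1) ∧ r = (1, 0) then (q - 1) * μ else 0

theorem rMatrix_mul_lift (q ξ μ : ℂ) (L L' : Matrix (Fin 2) (Fin 2) R)
    (h1 : ∀ i j, (q * ξ - μ) • (L i j * L' i j) = (q * ξ - μ) • (L' i j * L i j))
    (h2 : ∀ j, (ξ - μ) • (L 0 j * L' 1 j) + ((q - 1) * μ) • (L 1 j * L' 0 j) =
      (q * ξ - μ) • (L' 1 j * L 0 j))
    (h3 : ∀ j, ((q - 1) * ξ) • (L 0 j * L' 1 j) + (q * (ξ - μ)) • (L 1 j * L' 0 j) =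
      (q * ξ - μ) • (L' 0 j * L 1 j))
    (h4 : ∀ i, (q * ξ - μ) • (L i 0 * L' i 1) =
      (ξ - μ) • (L' i 1 * L i 0) + ((q - 1) * ξ) • (L' i 0 * L i 1))
    (h5 : ∀ i, (q * ξ - μ) • (L i 1 * L' i 0) =
      ((q - 1) * μ) • (L' i 1 * L i 0) + (q * (ξ - μ)) • (L' i 0 * L i 1))
    (h6 : (ξ - μ) • (L 0 0 * L' 1 1) + ((q - 1) * μ) • (L 1 0 * L' 0 1) =
      (ξ - μ) • (L' 1 1 * L 0 0) + ((q - 1) * ξ) • (L' 1 0 * L 0 1))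
    (h7 : (ξ - μ) • (L 0 1 * L' 1 0) + ((q - 1) * μ) • (L 1 1 * L' 0 0) =
      ((q - 1) * μ) • (L' 1 1 * L 0 0) + (q * (ξ - μ)) • (L' 1 0 * L 0 1))
    (h8 : ((q - 1) * ξ) • (L 0 0 * L' 1 1) + (q * (ξ - μ)) • (L 1 0 * L' 0 1) =
      (ξ - μ) • (L' 0 1 * L 1 0) + ((q - 1) * ξ) • (L' 0 0 * L 1 1))
    (h9 : ((q - 1) * ξ) • (L 0 1 * L' 1 0) + (q * (ξ - μ)) • (L 1 1 * L' 0 0) =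
      ((q - 1) * μ) • (L' 0 1 * L 1 0) + (q * (ξ - μ)) • (L' 0 0 * L 1 1)) :
    (rMatrix q ξ μ).map (algebraMap ℂ R) * (liftL (Fin 2) L * liftR (Fin 2) L') =
      liftR (Fin 2) L' * liftL (Fin 2) L * (rMatrix q ξ μ).map (algebraMap ℂ R) := by
  ext ⟨i, s⟩ ⟨j, t⟩
  rw [Matrix.mul_apply, Matrix.mul_apply]
  simp only [liftL_mul_liftR_apply, liftR_mul_liftL_apply, Fintype.sum_prod_type,
    Matrix.map_apply, Fin.sum_univ_two, ← Algebra.smul_def, ← Algebra.commutes]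
  fin_cases i <;> fin_cases s <;> fin_cases j <;> fin_cases t <;>
    simp only [rMatrix, Matrix.of_apply, Fin.zero_eta, Fin.mk_one, Prod.mk.injEq, Fin.isValue,
      one_ne_zero, zero_ne_one, and_false, and_true, and_self, if_true,
      if_false, zero_smul, add_zero, zero_add]
  exacts [h1 0 0, h4 0, h5 0, h1 0 1, h2 0, h6, h7, h2 1, h3 0, h8, h9, h3 1, h1 1 0, h4 1, h5 1,
    h1 1 1]

theorem rMatrix_laxAlg (hW : IsWeylTriple h X Y Z) (hh : h ≠ 0)
    (ξ μ u ut v κ κt : ℂ) :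
    (rMatrix (h ^ 2) ξ μ).map (algebraMap ℂ R) * (liftL (Fin 2) (laxAlg h ξ u ut v κ κt X Y Z) *
        liftR (Fin 2) (laxAlg h μ u ut v κ κt X Y Z)) =
      liftR (Fin 2) (laxAlg h μ u ut v κ κt X Y Z) * liftL (Fin 2) (laxAlg h ξ u ut v κ κt X Y Z) *
        (rMatrix (h ^ 2) ξ μ).map (algebraMap ℂ R) := by
  have r1 := hW.XY
  have r2 := hW.YX
  have r3 := hW.ZX hh
  have r4 := hW.ZY
  have r1' : ∀ w, X * (Y * w) = w := fun w => by rw [← mul_assoc, r1, one_mul]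
  have r2' : ∀ w, Y * (X * w) = w := fun w => by rw [← mul_assoc, r2, one_mul]
  have r3' : ∀ w, Z * (X * w) = (h ^ 2)⁻¹ • (X * (Z * w)) := fun w => by
    rw [← mul_assoc, r3, smul_mul_assoc, mul_assoc]
  have r4' : ∀ w, Z * (Y * w) = h ^ 2 • (Y * (Z * w)) := fun w => by
    rw [← mul_assoc, r4, smul_mul_assoc, mul_assoc]
  have e00 : ∀ ξ, laxAlg h ξ u ut v κ κt X Y Z 0 0 = 1 - (h * ξ * u * ut * κ * v) • Z := fun _ => rfl
  have e01 : ∀ ξ, laxAlg h ξ u ut v κ κt X Y Z 0 1 = -((u * h) • X) + (u * κ * v) • (X * Z) := by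
    intro ξ
    change -(u • X * (h • 1 - (κ * v) • Z)) = _
    simp only [mul_sub, smul_mul_assoc, mul_smul_comm, mul_one]
    module
  have e10 : ∀ ξ, laxAlg h ξ u ut v κ κt X Y Z 1 0 =
      (ξ * ut * κt) • Y - (ξ * ut * h * v) • (Y * Z) := by
    intro ξ
    change (ξ * ut) • Y * (κt • 1 - (h * v) • Z) = _
    simp only [mul_sub, smul_mul_assoc, mul_smul_comm, mul_one]
    module
  have e11 : ∀ ξ, laxAlg h ξ u ut v κ κt X Y Z 1 1 = -((h * ξ * u * ut * κt) • 1) + v • Z :=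
    fun _ => rfl
  refine rMatrix_mul_lift _ _ _ _ _ ?_ ?_ ?_ ?_ ?_ ?_ ?_ ?_ ?_
  all_goals try simp only [Fin.forall_fin_two]
  all_goals try constructor
  all_goals try constructor
  all_goals try simp only [e00, e01, e10, e11]
  all_goals
    simp only [mul_add, add_mul, mul_sub, sub_mul, smul_mul_assoc, mul_smul_comm, smul_smul,
      smul_add, smul_sub, mul_assoc, mul_one, one_mul, neg_mul, mul_neg, smul_neg, r1, r2, r3, r4,
      r1', r2', r3', r4']
    match_scalars <;> field_simp <;> ring

end LaxAlgebra

end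

end BS

namespace BS

noncomputable section

section LaxFused

open Polynomial

variable {R : Type*} [Ring R] [Algebra ℂ R]

/-- The classical Lax matrix, in terms of `N`-th powers. -/
def classicalLax (lam U Ut V K Kt x : ℂ) : Matrix (Fin 2) (Fin 2) ℂ :=
  !![1 + lam * U * Ut * K * V, U * x * (1 + K * V);
    lam * Ut * x⁻¹ * (Kt + V), V + lam * U * Ut * Kt]

theorem isFused_laxAlg {N : ℕ} [NeZero N] {h x z : ℂ} {X Y Z : R} (hW : IsWeylTriple h X Y Z)
    (hh : h ≠ 0) (hhN : h ^ N = -1) (hq : IsPrimitiveRoot (h ^ 2) N) (hx : x ≠ 0)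
    (hX : X ^ N = algebraMap ℂ R x) (hZ : Z ^ N = algebraMap ℂ R z) (ξ u ut v κ κt : ℂ) :
    IsFused N (fun k => gauge ((h ^ 2) ^ k) (laxAlg h ((h ^ 2) ^ k * ξ) u ut v κ κt X Y Z))
      (fun k => (v * ((1 - (h ^ 2) ^ (k + 1) * ξ * u * ut) *
        (1 - (h ^ 2) ^ (k + 1) * ξ * u * ut * κ * κt))) • Z)
      (classicalLax (ξ ^ N) (u ^ N) (ut ^ N) (v ^ N * z) (κ ^ N) (κt ^ N) x) := by
  have hq0 : h ^ 2 ≠ 0 := pow_ne_zero 2 hh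
  have hN := NeZero.ne N
  have hY : Y ^ N = algebraMap ℂ R x⁻¹ := by
    have h1 : Commute X Y := by rw [Commute, SemiconjBy, hW.XY, hW.YX]
    have h2 : X ^ N * Y ^ N = 1 := by rw [← h1.mul_pow, hW.XY, one_pow]
    rw [hX] at h2
    calc Y ^ N = algebraMap ℂ R x⁻¹ * (algebraMap ℂ R x * Y ^ N) := by
          rw [← mul_assoc, ← map_mul, inv_mul_cancel₀ hx, map_one, one_mul]
      _ = _ := by rw [h2, mul_one]
  have hs1 : ((-1 : ℂ) ^ N) * (-1) ^ N = 1 := by rw [← mul_pow]; norm_num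
  set M : ℕ → Matrix (Fin 2) (Fin 2) R := fun k =>
    gauge ((h ^ 2) ^ k) (laxAlg h ((h ^ 2) ^ k * ξ) u ut v κ κt X Y Z) with hM
  set B : R := X * ((-u * h) • 1 + (u * κ * v) • Z) with hB
  set B' : R := Y * ((ξ * ut * κt) • 1 + (-(ξ * ut * h * v)) • Z) with hB'
  have m00 : ∀ k, M k 0 0 = (1 : ℂ) • 1 + (-(h * ξ * u * ut * κ * v) * (h ^ 2) ^ k) • Z := by
    intro k
    change 1 - (h * ((h ^ 2) ^ k * ξ) * u * ut * κ * v) • Z = _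
    module
  have m01 : ∀ k, M k 0 1 = (h ^ 2) ^ k • B := by
    intro k
    change (h ^ 2) ^ k • -(u • X * (h • 1 - (κ * v) • Z)) = _
    simp only [hB, mul_add, mul_sub, smul_mul_assoc, mul_smul_comm, mul_one]
    module
  have m10 : ∀ k, M k 1 0 = B' := by
    intro k
    change ((h ^ 2) ^ k)⁻¹ • ((((h ^ 2) ^ k * ξ) * ut) • Y * (κt • 1 - (h * v) • Z)) = _
    simp only [hB', mul_add, mul_sub, smul_mul_assoc, mul_smul_comm, mul_one]
    match_scalars <;> field_simp
  have m11 : ∀ k, M k 1 1 = (h ^ 2) ^ k • ((-(h * ξ * u * ut * κt)) • (1 : R) +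
      (v * ((h ^ 2)⁻¹) ^ k) • Z) := by
    intro k
    change -((h * ((h ^ 2) ^ k * ξ) * u * ut * κt) • 1) + v • Z = _
    match_scalars
    · ring
    · rw [inv_pow]; field_simp
  have hBZ : B * Z = h ^ 2 • (Z * B) := by
    have e : ((-u * h) • 1 + (u * κ * v) • Z) * Z = Z * ((-u * h) • 1 + (u * κ * v) • Z) := by
      simp [mul_add, add_mul]
    rw [hB, mul_assoc, e, ← mul_assoc, hW.XZ, smul_mul_assoc, mul_assoc]
  have hYZ : Y * Z = (h ^ 2)⁻¹ • (Z * Y) := by rw [hW.ZY, inv_smul_smul₀ hq0]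
  have hBZ' : B' * Z = (h ^ 2)⁻¹ • (Z * B') := by
    have e : ((ξ * ut * κt) • 1 + (-(ξ * ut * h * v)) • Z) * Z =
        Z * ((ξ * ut * κt) • 1 + (-(ξ * ut * h * v)) • Z) := by
      simp [mul_add, add_mul]
    rw [hB', mul_assoc, e, ← mul_assoc, hYZ, smul_mul_assoc, mul_assoc]
  refine ⟨fun k => ?_, ?_, ?_⟩
  · have := isQDet_laxAlg hW hh (pow_ne_zero k hq0) ((h ^ 2) ^ k * ξ) u ut v κ κt
    rw [← mul_assoc (h ^ 2), ← pow_succ'] at this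
    exact this
  · have key := qbinomial_primitive hq (α := 1) (β := -(h * ξ * u * ut * κ * v)) hBZ
      (fun m j => (fusedRow M m 0).coeff j) (by simp [fusedRow])
      (fun j => by simp [fusedRow, coeff_one]) (fun m => by
        rw [fusedRow, coeff_mul_rowPoly_zero, m00])
      (fun m j => by rw [fusedRow, coeff_mul_rowPoly_succ, m00, m01])
    ext j
    rw [key j, coeff_add, coeff_C, coeff_C_mul, coeff_X_pow]
    by_cases h0 : j = 0
    · subst h0
      rw [if_pos rfl, if_pos rfl, if_neg hN.symm, mul_zero, add_zero, hZ,
        Algebra.smul_def, ← map_mul, ← map_sub]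
      congr 1
      simp only [classicalLax, Matrix.of_apply, Matrix.cons_val_zero, neg_neg, mul_pow, one_pow, hhN]
      ring
    · rw [if_neg h0, if_neg h0, zero_add]
      by_cases h1 : j = N
      · rw [if_pos h1, if_pos h1, mul_one, mul_affine_pow hq _ _ hW.XZ, hX, hZ,
          Algebra.smul_def, Algebra.smul_def, ← map_mul, ← map_sub, ← map_mul, ← map_mul]
        congr 1
        simp only [classicalLax, Matrix.of_apply, Matrix.cons_val_zero, Matrix.cons_val_one]
        have e1 : (-u * h) ^ N = -((-1) ^ N * u ^ N) := by
          rw [mul_pow, hhN, neg_pow]; ring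
        have e2 : (-(u * κ * v)) ^ N = (-1) ^ N * (u ^ N * κ ^ N * v ^ N) := by
          rw [neg_pow, mul_pow, mul_pow]
        rw [e1, e2]
        linear_combination (u ^ N * x + u ^ N * κ ^ N * v ^ N * z * x) * hs1
      · rw [if_neg h1, if_neg h1, mul_zero]
  · set π : ℕ → ℂ := fun m => ∏ k ∈ Finset.range m, (h ^ 2) ^ k with hπ
    have hπ0 : ∀ m, π m ≠ 0 := fun m => Finset.prod_ne_zero_iff.2 fun k _ => pow_ne_zero k hq0
    have hπs : ∀ m, (π (m + 1))⁻¹ = (π m)⁻¹ * ((h ^ 2)⁻¹) ^ m := by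
      intro m
      simp only [hπ, Finset.prod_range_succ, mul_inv, inv_pow]
    have key := qbinomial_primitive hq.inv (α := -(h * ξ * u * ut * κt)) (β := v) hBZ'
      (fun m j => if j ≤ m then (π m)⁻¹ • (fusedRow M m m).coeff (m - j) else 0)
      (by simp [fusedRow, hπ])
      (fun j => by simp) (fun m => by
        simp only [Nat.zero_le, if_true, Nat.sub_zero]
        rw [fusedRow, coeff_mul_rowPoly_succ, coeff_fusedRow_eq_zero m m (Nat.lt_succ_self m),
          zero_mul, zero_add, m11, hπs, mul_smul_comm, smul_smul, smul_mul_assoc, inv_pow]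
        congr 1
        have := pow_ne_zero m hq0
        field_simp)
      (fun m j => by
        simp only [Nat.succ_le_succ_iff, Nat.add_sub_add_right]
        by_cases hj : j ≤ m
        · rw [if_pos hj, if_pos hj, fusedRow, hπs]
          rcases Nat.lt_or_ge j m with hj' | hj'
          · obtain ⟨d, hd⟩ : ∃ d, m - j = d + 1 := ⟨m - j - 1, by omega⟩
            rw [if_pos (by omega : j + 1 ≤ m), hd, coeff_mul_rowPoly_succ, m10, m11,
              show m - (j + 1) = d by omega]
            have := pow_ne_zero m hq0
            simp only [smul_add, mul_smul_comm, smul_mul_assoc, mul_add, smul_smul, inv_pow, mul_one]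
            match_scalars <;> field_simp
          · obtain rfl : j = m := by omega
            rw [if_neg (by omega), zero_mul, zero_add, Nat.sub_self, coeff_mul_rowPoly_zero, m10,
              mul_smul_comm, smul_mul_assoc, smul_smul, mul_comm]
        · rw [if_neg hj, if_neg hj, if_neg (by omega), zero_mul, zero_mul, add_zero])
    ext j
    rw [coeff_add, coeff_C, coeff_C_mul, coeff_X_pow]
    have hπN : π N = -(-1) ^ N := prod_range_pow_primitive hq
    rcases Nat.lt_or_ge N j with hj | hj
    · rw [coeff_fusedRow_eq_zero N N hj, if_neg (by omega), if_neg (by omega), mul_zero, add_zero]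
    have kj := key (N - j)
    rw [if_pos (by omega), Nat.sub_sub_self hj, inv_smul_eq_iff₀ (hπ0 N), hπN] at kj
    rw [kj]
    by_cases h0 : j = 0
    · subst h0
      rw [if_neg (by omega), if_pos (by omega), if_pos rfl, if_neg hN.symm, mul_zero, add_zero,
        mul_affine_pow hq.inv _ _ hYZ, hY, hZ, Algebra.smul_def, Algebra.smul_def, Algebra.smul_def,
        ← map_mul, ← map_sub, ← map_mul, ← map_mul, ← map_mul]
      congr 1
      simp only [classicalLax, Matrix.of_apply, Matrix.cons_val_zero, Matrix.cons_val_one]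
      have e1 : (-(-(ξ * ut * h * v))) ^ N = -(ξ ^ N * ut ^ N * v ^ N) := by
        rw [neg_neg, mul_pow, mul_pow, mul_pow, hhN]; ring
      rw [e1, mul_pow, mul_pow]
      linear_combination (ξ ^ N * ut ^ N * κt ^ N + ξ ^ N * ut ^ N * v ^ N * z) * x⁻¹ * hs1
    · rw [if_neg h0, zero_add]
      by_cases h1 : j = N
      · rw [if_pos (by omega), if_pos h1, mul_one, hZ,
          Algebra.smul_def, Algebra.smul_def, ← map_mul, ← map_sub, ← map_mul]
        congr 1
        change _ = v ^ N * z + ξ ^ N * u ^ N * ut ^ N * κt ^ N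
        have e1 : (-(h * ξ * u * ut * κt)) ^ N =
            -((-1) ^ N * (ξ ^ N * u ^ N * ut ^ N * κt ^ N)) := by
          rw [neg_pow, mul_pow, mul_pow, mul_pow, mul_pow, hhN]; ring
        rw [e1, neg_pow v]
        linear_combination (ξ ^ N * u ^ N * ut ^ N * κt ^ N + v ^ N * z) * hs1
      · rw [if_neg (by omega), if_neg (by omega), if_neg h1, mul_zero, smul_zero]

end LaxFused

end

end BS

namespace BS

noncomputable section

section ChainRelations

variable {R S : Type*} [Ring R] [Algebra ℂ R] [Ring S] [Algebra ℂ S]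

theorem map_laxAlg (φ : R →ₐ[ℂ] S) (h ξ u ut v κ κt : ℂ) (X Y Z : R) :
    φ.mapMatrix (laxAlg h ξ u ut v κ κt X Y Z) = laxAlg h ξ u ut v κ κt (φ X) (φ Y) (φ Z) := by
  refine Matrix.ext fun i j => ?_
  fin_cases i <;> fin_cases j <;> simp [laxAlg]

theorem IsWeylTriple.map (φ : R →ₐ[ℂ] S) {h : ℂ} {X Y Z : R} (hW : IsWeylTriple h X Y Z) :
    IsWeylTriple h (φ X) (φ Y) (φ Z) :=
  ⟨by rw [← map_mul, hW.XY, map_one], by rw [← map_mul, hW.YX, map_one],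
    by rw [← map_mul, hW.XZ, map_smul, map_mul]⟩

theorem gauge_mul {c : ℂ} (hc : c ≠ 0) (M M' : Matrix (Fin 2) (Fin 2) R) :
    gauge c (M * M') = gauge c M * gauge c M' := by
  refine Matrix.ext fun i j => ?_
  fin_cases i <;> fin_cases j <;>
    simp [gauge, Matrix.mul_apply, smul_smul, hc]

theorem gauge_one (c : ℂ) : gauge c (1 : Matrix (Fin 2) (Fin 2) R) = 1 := by
  refine Matrix.ext fun i j => ?_
  fin_cases i <;> fin_cases j <;> simp [gauge]

theorem trace_gauge (c : ℂ) (M : Matrix (Fin 2) (Fin 2) R) : (gauge c M).trace = M.trace := by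
  simp [gauge, Matrix.trace_fin_two]

theorem gauge_prod_ofFn {c : ℂ} (hc : c ≠ 0) {m : ℕ} (M : Fin m → Matrix (Fin 2) (Fin 2) R) :
    gauge c (List.ofFn M).prod = (List.ofFn fun n => gauge c (M n)).prod := by
  induction m with
  | zero => simp [gauge_one]
  | succ m ih => simp only [List.ofFn_succ, List.prod_cons, gauge_mul hc, ih]

theorem isUnit_rMatrix {q ξ μ : ℂ} (h1 : q * ξ - μ ≠ 0) (h2 : ξ - q * μ ≠ 0) :
    IsUnit (rMatrix q ξ μ) := by
  rw [← Matrix.mulVec_injective_iff_isUnit]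
  intro a b hab
  have e := sub_eq_zero.2 hab
  rw [← Matrix.mulVec_sub] at e
  set w := a - b with hw
  suffices h : w = 0 by exact sub_eq_zero.1 h
  have r : ∀ p, ∑ k, ∑ l, rMatrix q ξ μ p (k, l) * w (k, l) = 0 := by
    intro p
    have := congrFun e p
    rwa [Matrix.mulVec, dotProduct, Fintype.sum_prod_type] at this
  have r00 := r (0, 0)
  have r01 := r (0, 1)
  have r10 := r (1, 0)
  have r11 := r (1, 1)
  simp [rMatrix] at r00 r01 r10 r11
  ext ⟨i, s⟩
  fin_cases i <;> fin_cases s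
  · exact r00.resolve_left h1
  · refine (mul_eq_zero.1 ?_ : (q * ξ - μ) * (ξ - q * μ) = 0 ∨ _).resolve_left (mul_ne_zero h1 h2)
    simp only [Fin.zero_eta, Fin.mk_one, Fin.isValue]
    linear_combination q * (ξ - μ) * r01 - (q - 1) * μ * r10
  · refine (mul_eq_zero.1 ?_ : (q * ξ - μ) * (ξ - q * μ) = 0 ∨ _).resolve_left (mul_ne_zero h1 h2)
    simp only [Fin.zero_eta, Fin.mk_one, Fin.isValue]
    linear_combination (ξ - μ) * r10 - (q - 1) * ξ * r01
  · exact r11.resolve_left h1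

end ChainRelations

section Transfer

variable {N : ℕ} [NeZero N] {g : ℕ}

/-- Operators `X_n`, `Z_n` of a chain that form Weyl pairs with given centres. -/
structure IsWeylChain (X Z : Fin (g + 1) → Matrix (ZMod N) (ZMod N) ℂ) (x z : Fin (g + 1) → ℂ) :
    Prop where
  weyl : ∀ n, X n * Z n = omega N • (Z n * X n)
  X_pow : ∀ n, X n ^ N = x n • 1
  Z_pow : ∀ n, Z n ^ N = z n • 1
  X_ne : ∀ n, x n ≠ 0

variable {X Z : Fin (g + 1) → Matrix (ZMod N) (ZMod N) ℂ} {x z : Fin (g + 1) → ℂ}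

theorem isUnit_of_pow_eq_smul_one {ι : Type*} [Fintype ι] [DecidableEq ι] {X : Matrix ι ι ℂ} {x : ℂ}
    (hx : x ≠ 0) {N : ℕ} [NeZero N] (h : X ^ N = x • 1) : IsUnit X := by
  refine (isUnit_pow_iff (NeZero.ne N)).1 ?_
  rw [h]
  exact (isUnit_one).smul (Units.mk0 x hx)

theorem IsWeylChain.isUnit_X (h : IsWeylChain X Z x z) (n : Fin (g + 1)) : IsUnit (X n) :=
  isUnit_of_pow_eq_smul_one (h.X_ne n) (h.X_pow n)

theorem IsWeylChain.triple (h : IsWeylChain X Z x z) (n : Fin (g + 1)) :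
    IsWeylTriple (omegaHalf N) (X n) (X n)⁻¹ (Z n) := by
  have hd := (Matrix.isUnit_iff_isUnit_det _).1 (h.isUnit_X n)
  exact ⟨Matrix.mul_nonsing_inv _ hd, Matrix.nonsing_inv_mul _ hd,
    by rw [omegaHalf_sq]; exact h.weyl n⟩

theorem IsWeylChain.triple' (h : IsWeylChain X Z x z) (n : Fin (g + 1)) :
    IsWeylTriple (omegaHalf N) (siteHom n (X n)) (siteHom n (X n)⁻¹) (siteHom n (Z n)) :=
  (h.triple n).map (siteHom n)

theorem map_siteOp_lax (n : Fin (g + 1)) (ξ u ut v κ κt : ℂ) (X Z : Matrix (ZMod N) (ZMod N) ℂ) :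
    (lax N ξ u ut v κ κt X Z).map (siteOp n) =
      laxAlg (omegaHalf N) ξ u ut v κ κt (siteHom n X) (siteHom n X⁻¹) (siteHom n Z) :=
  map_laxAlg (R := Matrix (ZMod N) (ZMod N) ℂ)
    (S := Matrix (Fin (g + 1) → ZMod N) (Fin (g + 1) → ZMod N) ℂ) (siteHom n) (omegaHalf N) ξ u ut v
    κ κt X X⁻¹ Z

theorem IsWeylChain.commute_transfer (h : IsWeylChain X Z x z) (c : LaxScalars g) (ξ μ : ℂ) :
    transfer c X Z ξ * transfer c X Z μ = transfer c X Z μ * transfer c X Z ξ := by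
  set q := omega N with hq
  have main : ∀ μ, q * ξ - μ ≠ 0 → ξ - q * μ ≠ 0 →
      transfer c X Z ξ * transfer c X Z μ = transfer c X Z μ * transfer c X Z ξ := by
    intro μ h1 h2
    refine trace_mul_trace_of_intertwine _ _ _ (fun _ => rMatrix q ξ μ) ?_ ?_ ?_ rfl
      (isUnit_rMatrix h1 h2)
    · exact fun n k hnk i j s t => commute_siteOp hnk _ _
    · exact fun n k hnk i j s t => commute_siteOp hnk _ _
    · intro n
      simp only [map_siteOp_lax]
      rw [hq, ← omegaHalf_sq]
      exact rMatrix_laxAlg (h.triple' n) (omegaHalf_ne_zero N) _ _ _ _ _ _ _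
  obtain ⟨p, hp⟩ := exists_coeff_transfer c X Z
  have hinf : ({q * ξ, ξ / q}ᶜ : Set ℂ).Infinite := (Set.toFinite _).infinite_compl
  have := eq_zero_of_infinite_zeros (m := g + 2)
    (fun k => transfer c X Z ξ * p k - p k * transfer c X Z ξ) hinf
  have hs : ∀ μ : ℂ, ∑ k ∈ Finset.range (g + 2), μ ^ k • (transfer c X Z ξ * p k -
      p k * transfer c X Z ξ) =
      transfer c X Z ξ * transfer c X Z μ - transfer c X Z μ * transfer c X Z ξ := by
    intro μ
    rw [hp μ, Finset.sum_mul, Finset.mul_sum, ← Finset.sum_sub_distrib]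
    simp only [smul_sub, smul_mul_assoc, mul_smul_comm]
  simp only [hs] at this
  refine sub_eq_zero.1 (this (fun μ hμ => sub_eq_zero.2 (main μ ?_ ?_)) μ)
  · intro h0
    exact hμ (Or.inl (sub_eq_zero.1 h0).symm)
  · intro h0
    refine hμ (Or.inr ?_)
    rw [Set.mem_singleton_iff, eq_div_iff (omega_ne_zero N), mul_comm]
    exact (sub_eq_zero.1 h0).symm

/-- The product of the operators `Z_n` over the chain. -/
def totalZ (Z : Fin (g + 1) → Matrix (ZMod N) (ZMod N) ℂ) :
    Matrix (Fin (g + 1) → ZMod N) (Fin (g + 1) → ZMod N) ℂ :=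
  (List.ofFn fun n => siteOp n (Z n)).prod

theorem IsWeylChain.commute_totalZ (h : IsWeylChain X Z x z) (c : LaxScalars g) (ξ : ℂ) :
    transfer c X Z ξ * totalZ Z = totalZ Z * transfer c X Z ξ := by
  have e : totalZ Z = (List.ofFn fun n => (Matrix.of fun _ _ => siteOp n (Z n) :
      Matrix Unit Unit (Matrix (Fin (g + 1) → ZMod N) (Fin (g + 1) → ZMod N) ℂ))).prod.trace := by
    have : ∀ m (K : Fin m → Matrix (Fin (g + 1) → ZMod N) (Fin (g + 1) → ZMod N) ℂ),
        (List.ofFn fun n => (Matrix.of fun _ _ => K n :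
          Matrix Unit Unit (Matrix (Fin (g + 1) → ZMod N) (Fin (g + 1) → ZMod N) ℂ))).prod =
        Matrix.of fun _ _ => (List.ofFn K).prod := by
      intro m
      induction m with
      | zero => intro K; ext i j; simp
      | succ m ih =>
        intro K
        simp only [List.ofFn_succ, List.prod_cons, ih]
        refine Matrix.ext fun i j => ?_
        simp [Matrix.mul_apply]
    rw [this]
    simp [Matrix.trace, totalZ]
  rw [e]
  refine trace_mul_trace_of_intertwine _ _ _
    (fun _ => Matrix.diagonal fun p : Fin 2 × Unit => if p.1 = 0 then 1 else omega N) ?_ ?_ ?_ rfl ?_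
  · exact fun n k hnk i j s t => commute_siteOp hnk _ _
  · exact fun n k hnk i j s t => commute_siteOp hnk _ _
  · intro n
    simp only [map_siteOp_lax]
    have hW := h.triple' n
    have r3 := hW.XZ
    have r4 := hW.ZY
    simp only [← siteHom_apply]
    rw [omegaHalf_sq] at r3 r4
    have r4' : siteHom n (Z n) * (siteHom n (X n)⁻¹ * siteHom n (Z n)) =
        omega N • (siteHom n (X n)⁻¹ * (siteHom n (Z n) * siteHom n (Z n))) := by
      rw [← mul_assoc, r4, smul_mul_assoc, mul_assoc]
    generalize siteHom n (Z n) = Z₀ at *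
    generalize siteHom n (X n) = X₀ at *
    generalize siteHom n (X n)⁻¹ = Y₀ at *
    rw [Matrix.diagonal_map (map_zero _)]
    refine Matrix.ext fun i j => ?_
    rw [Matrix.diagonal_mul, Matrix.mul_diagonal, liftL_mul_liftR_apply, liftR_mul_liftL_apply]
    obtain ⟨i, _⟩ := i
    obtain ⟨j, _⟩ := j
    simp only [Matrix.of_apply, ← Algebra.smul_def, ← Algebra.commutes]
    fin_cases i <;> fin_cases j
    · simp [laxAlg, mul_sub, sub_mul]
    · simp only [laxAlg, Fin.zero_eta, Fin.mk_one, if_true, Matrix.of_apply, Matrix.cons_val_zero,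
        Matrix.cons_val_one, one_ne_zero, if_false, smul_mul_assoc, mul_smul_comm,
        mul_sub, sub_mul, mul_one, neg_mul, mul_neg, mul_assoc, smul_sub, r3, smul_neg,
        smul_smul]
      module
    · simp only [laxAlg, Fin.zero_eta, Fin.mk_one, if_true, Matrix.of_apply, Matrix.cons_val_zero,
        Matrix.cons_val_one, one_ne_zero, if_false, smul_mul_assoc, mul_smul_comm,
        mul_sub, sub_mul, mul_one, mul_assoc, smul_sub, r4, r4', smul_smul]
      module
    · simp [laxAlg, mul_add, add_mul]
  · rw [Matrix.isUnit_iff_isUnit_det, Matrix.det_diagonal, isUnit_iff_ne_zero]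
    refine Finset.prod_ne_zero_iff.2 fun p _ => ?_
    split_ifs
    · exact one_ne_zero
    · exact omega_ne_zero N

end Transfer

end

end BS

namespace BS

noncomputable section

section FusedChain

variable {N : ℕ} [NeZero N] {g : ℕ} {X Z : Fin (g + 1) → Matrix (ZMod N) (ZMod N) ℂ}
  {x z : Fin (g + 1) → ℂ}

theorem prod_ofFn_smul {A : Type*} [Ring A] [Algebra ℂ A] {m : ℕ} (s : Fin m → ℂ) (K : Fin m → A) :
    (List.ofFn fun n => s n • K n).prod = (∏ n, s n) • (List.ofFn K).prod := by
  induction m with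
  | zero => simp
  | succ m ih =>
    simp only [List.ofFn_succ, List.prod_cons, ih, Fin.prod_univ_succ, smul_mul_smul_comm]

theorem prod_ofFn_pow {A : Type*} [Ring A] {m : ℕ} (K : Fin m → A)
    (hK : ∀ n k, n ≠ k → Commute (K n) (K k)) (N : ℕ) :
    (List.ofFn K).prod ^ N = (List.ofFn fun n => K n ^ N).prod := by
  induction m with
  | zero => simp
  | succ m ih =>
    simp only [List.ofFn_succ, List.prod_cons]
    rw [Commute.mul_pow, ih]
    · exact fun n k hnk => hK _ _ (by simpa using hnk)
    · refine Commute.list_prod_right _ _ fun a ha => ?_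
      obtain ⟨n, rfl⟩ := List.mem_ofFn.1 ha
      exact hK 0 n.succ (Fin.succ_ne_zero n).symm

theorem IsWeylChain.totalZ_pow (h : IsWeylChain X Z x z) :
    totalZ Z ^ N = (∏ n, z n) • (1 : Matrix (Fin (g + 1) → ZMod N) (Fin (g + 1) → ZMod N) ℂ) := by
  rw [totalZ, prod_ofFn_pow _ fun n k hnk => commute_siteOp hnk _ _]
  have : ∀ n, siteOp n (Z n) ^ N =
      z n • (1 : Matrix (Fin (g + 1) → ZMod N) (Fin (g + 1) → ZMod N) ℂ) := by
    intro n
    rw [← siteHom_apply, ← map_pow, h.Z_pow, map_smul, map_one]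
  simp only [this]
  rw [prod_ofFn_smul]
  simp

/-- The scalar factor of the quantum determinant of the monodromy. -/
def qdetFactor (N : ℕ) (c : LaxScalars g) (ξ : ℂ) (k : ℕ) : ℂ :=
  ∏ n, c.v n * ((1 - omega N ^ (k + 1) * ξ * c.u n * c.ut n) *
    (1 - omega N ^ (k + 1) * ξ * c.u n * c.ut n * c.κ n * c.κt n))

/-- The trace of the classical monodromy. -/
def classicalTrace (N : ℕ) (c : LaxScalars g) (x z : Fin (g + 1) → ℂ) (lam : ℂ) : ℂ :=
  (List.ofFn fun n => classicalLax lam (c.u n ^ N) (c.ut n ^ N) (c.v n ^ N * z n) (c.κ n ^ N)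
    (c.κt n ^ N) (x n)).prod.trace

theorem IsWeylChain.exists_fused (h : IsWeylChain X Z x z) (c : LaxScalars g) (ξ : ℂ) :
    ∃ F : ℕ → Matrix (Fin (g + 1) → ZMod N) (Fin (g + 1) → ZMod N) ℂ,
      F 0 = 1 ∧ F 1 = transfer c X Z ξ ∧
      (∀ m, F (m + 2) = F (m + 1) * transfer c X Z (omega N ^ (m + 1) * ξ) -
        qdetFactor N c ξ m • (F m * totalZ Z)) ∧
      F (2 * N - 1) = classicalTrace N c x z (ξ ^ N) • F (N - 1) := by
  have hloc : ∀ n : Fin (g + 1), IsFused N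
      (fun k => gauge (omega N ^ k) ((lax N (omega N ^ k * ξ) (c.u n) (c.ut n) (c.v n) (c.κ n)
        (c.κt n) (X n) (Z n)).map (siteOp n)))
      (fun k => (c.v n * ((1 - omega N ^ (k + 1) * ξ * c.u n * c.ut n) *
        (1 - omega N ^ (k + 1) * ξ * c.u n * c.ut n * c.κ n * c.κt n))) • siteOp n (Z n))
      (classicalLax (ξ ^ N) (c.u n ^ N) (c.ut n ^ N) (c.v n ^ N * z n) (c.κ n ^ N)
        (c.κt n ^ N) (x n)) := by
    intro n
    simp only [map_siteOp_lax, ← omegaHalf_sq]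
    refine isFused_laxAlg (h.triple' n) (omegaHalf_ne_zero N) (omegaHalf_pow N) ?_ (h.X_ne n) ?_ ?_
      _ _ _ _ _ _
    · rw [omegaHalf_sq]; exact omega_primitive N
    · rw [← map_pow, h.X_pow, map_smul, map_one, Algebra.algebraMap_eq_smul_one]
    · rw [← map_pow, h.Z_pow, map_smul, map_one, Algebra.algebraMap_eq_smul_one]
  have hglob := IsFused.prod_ofFn hloc ?_
  · have hM : ∀ k, (List.ofFn fun n => gauge (omega N ^ k) ((lax N (omega N ^ k * ξ) (c.u n) (c.ut n)
        (c.v n) (c.κ n) (c.κt n) (X n) (Z n)).map (siteOp n))).prod =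
        gauge (omega N ^ k) (monodromy c X Z (omega N ^ k * ξ)) := by
      intro k
      rw [monodromy, gauge_prod_ofFn (pow_ne_zero k (omega_ne_zero N))]
    have hD : ∀ k, (List.ofFn fun n => (c.v n * ((1 - omega N ^ (k + 1) * ξ * c.u n * c.ut n) *
        (1 - omega N ^ (k + 1) * ξ * c.u n * c.ut n * c.κ n * c.κt n))) • siteOp n (Z n)).prod =
        qdetFactor N c ξ k • totalZ Z := fun k => prod_ofFn_smul _ _
    simp only [hM, hD] at hglob
    refine ⟨fusedTrace fun k => gauge (omega N ^ k) (monodromy c X Z (omega N ^ k * ξ)),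
      fusedTrace_zero, ?_, fun m => ?_, ?_⟩
    · rw [fusedTrace_one, trace_gauge, pow_zero, one_mul, transfer]
    · rw [fusedTrace_succ_succ hglob.qdet, trace_gauge, mul_smul_comm, transfer]
    · exact hglob.fusedTrace (NeZero.ne N) fun k => by
        rw [pow_add, omega_pow, mul_one]
  · intro n n' hn k l i j s t
    have e : ∀ (c₀ : ℂ) (n : Fin (g + 1)) (L : Matrix (Fin 2) (Fin 2) (Matrix (ZMod N) (ZMod N) ℂ))
        (i j), ∃ A, gauge c₀ (L.map (siteOp n)) i j = siteOp n A := by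
      intro c₀ n L i j
      fin_cases i <;> fin_cases j
      · exact ⟨L 0 0, rfl⟩
      · exact ⟨c₀ • L 0 1, (map_smul (siteHom n) c₀ (L 0 1)).symm⟩
      · exact ⟨c₀⁻¹ • L 1 0, (map_smul (siteHom n) c₀⁻¹ (L 1 0)).symm⟩
      · exact ⟨L 1 1, rfl⟩
    obtain ⟨A, hA⟩ := e (omega N ^ k) n (lax N (omega N ^ k * ξ) (c.u n) (c.ut n)
        (c.v n) (c.κ n) (c.κt n) (X n) (Z n)) i j
    obtain ⟨B, hB⟩ := e (omega N ^ l) n' (lax N (omega N ^ l * ξ) (c.u n') (c.ut n')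
        (c.v n') (c.κ n') (c.κt n') (X n') (Z n')) s t
    rw [hA, hB]
    exact commute_siteOp hn A B

end FusedChain

/-! ### Bounds on eigenvalues -/

section Bounds

theorem exists_common_eigenvector {V : Type*} [AddCommGroup V] [Module ℂ V] [FiniteDimensional ℂ V]
    (s : Set (Module.End ℂ V)) (hs : ∀ a ∈ s, ∀ b ∈ s, Commute a b) (W : Submodule ℂ V)
    (hW : W ≠ ⊥) (hinv : ∀ a ∈ s, ∀ v ∈ W, a v ∈ W) :
    ∃ v ∈ W, v ≠ 0 ∧ ∀ a ∈ s, ∃ μ : ℂ, a v = μ • v := by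
  induction hd : Module.finrank ℂ W using Nat.strong_induction_on generalizing W with
  | _ d ih =>
    by_cases hsc : ∀ a ∈ s, ∃ μ : ℂ, ∀ v ∈ W, a v = μ • v
    · obtain ⟨v, hv, hv0⟩ := W.exists_mem_ne_zero_of_ne_bot hW
      exact ⟨v, hv, hv0, fun a ha => (hsc a ha).imp fun μ hμ => hμ v hv⟩
    push Not at hsc
    obtain ⟨a, ha, hna⟩ := hsc
    have : Nontrivial W := Submodule.nontrivial_iff_ne_bot.2 hW
    obtain ⟨μ, hμ⟩ := Module.End.exists_eigenvalue (a.restrict (hinv a ha))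
    obtain ⟨w, hw⟩ := hμ.exists_hasEigenvector
    set W' := W ⊓ Module.End.eigenspace a μ with hW'
    have hw' : (w : V) ∈ W' := by
      refine ⟨w.2, Module.End.mem_eigenspace_iff.2 ?_⟩
      have := congrArg (Subtype.val) hw.apply_eq_smul
      simpa using this
    have hne : W' ≠ ⊥ := fun h => hw.2 (by
      rw [h, Submodule.mem_bot] at hw'
      exact Subtype.ext hw')
    have hlt : W' < W := by
      refine lt_of_le_of_ne inf_le_left fun h => ?_
      obtain ⟨v, hv, hv'⟩ := hna μ
      rw [← h] at hv
      exact hv' (Module.End.mem_eigenspace_iff.1 hv.2)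
    obtain ⟨v, hv, hv0, hv1⟩ := ih _ (hd ▸ Submodule.finrank_lt_finrank_of_lt hlt) W' hne
      (fun b hb v hv => ⟨hinv b hb v hv.1, by
        refine Module.End.mem_eigenspace_iff.2 ?_
        have h1 := Module.End.mem_eigenspace_iff.1 hv.2
        have h2 := LinearMap.congr_fun (hs a ha b hb).eq v
        simp only [Module.End.mul_apply] at h2
        rw [h2, h1, map_smul]⟩) rfl
    exact ⟨v, hv.1, hv0, hv1⟩

/-- A solution of a three-term recursion with large coefficients grows. -/
theorem exists_small_coefficient {φ t δ : ℕ → ℂ} {τ : ℂ} {d : ℝ} {N : ℕ} (hN : N ≠ 0)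
    (h0 : φ 0 = 1) (h1 : φ 1 = t 0) (hr : ∀ m, φ (m + 2) = t (m + 1) * φ (m + 1) - δ m * φ m)
    (hδ : ∀ m, ‖δ m‖ ≤ d) (hτ : φ (2 * N - 1) = τ * φ (N - 1)) :
    ∃ k, ‖t k‖ ≤ d + 1 + ‖τ‖ := by
  by_contra! hc
  have hd : 0 ≤ d := (norm_nonneg _).trans (hδ 0)
  set r : ℝ := 1 + ‖τ‖ with hr'
  have hr1 : 1 ≤ r := by have := norm_nonneg τ; linarith
  have hstep : ∀ m, 0 < ‖φ m‖ ∧ r * ‖φ m‖ ≤ ‖φ (m + 1)‖ ∧ ‖φ m‖ ≤ ‖φ (m + 1)‖ ∧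
      (r * ‖φ m‖ < ‖φ (m + 1)‖) := by
    intro m
    induction m with
    | zero =>
      have := hc 0
      rw [h0, h1, norm_one]
      refine ⟨one_pos, by linarith, by linarith, by linarith⟩
    | succ m ih =>
      obtain ⟨i1, i2, i3, i4⟩ := ih
      have hp : 0 < ‖φ (m + 1)‖ := i1.trans_le i3
      have h2 : ‖t (m + 1)‖ * ‖φ (m + 1)‖ ≤ ‖φ (m + 2)‖ + d * ‖φ (m + 1)‖ := by
        rw [← norm_mul]
        have e : t (m + 1) * φ (m + 1) = φ (m + 2) + δ m * φ m := by rw [hr]; ring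
        rw [e]
        refine (norm_add_le _ _).trans (add_le_add_right ?_ _)
        rw [norm_mul]
        exact mul_le_mul (hδ m) i3 (norm_nonneg _) hd
      have h3 := hc (m + 1)
      have h4 : (d + r) * ‖φ (m + 1)‖ < ‖t (m + 1)‖ * ‖φ (m + 1)‖ :=
        mul_lt_mul_of_pos_right (by linarith) hp
      have h5 : r * ‖φ (m + 1)‖ < ‖φ (m + 1 + 1)‖ := by
        have : ‖φ (m + 1 + 1)‖ = ‖φ (m + 2)‖ := rfl
        rw [this]; linarith
      refine ⟨hp, h5.le, ?_, h5⟩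
      have : 1 * ‖φ (m + 1)‖ ≤ r * ‖φ (m + 1)‖ := mul_le_mul_of_nonneg_right hr1 hp.le
      linarith
  have hmono : ∀ a b, ‖φ a‖ ≤ ‖φ (a + b)‖ := by
    intro a b
    induction b with
    | zero => exact le_rfl
    | succ b ih => exact ih.trans (hstep _).2.2.1
  obtain ⟨n, rfl⟩ : ∃ n, N = n + 1 := ⟨N - 1, by omega⟩
  rw [show 2 * (n + 1) - 1 = n + 1 + n by omega, Nat.add_sub_cancel] at hτ
  have h2 := hmono (n + 1) n
  have h3 := (hstep n).2.2.2
  rw [hτ, norm_mul] at h2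
  have h4 : ‖τ‖ * ‖φ n‖ ≤ r * ‖φ n‖ := mul_le_mul_of_nonneg_right (by linarith) (norm_nonneg _)
  linarith

theorem lagrange_sum {I J : Type*} {m : ℕ} (p : ℕ → Matrix I J ℂ) (η : Fin m → ℂ)
    (hη : Function.Injective η) (ξ : ℂ) :
    ∑ k ∈ Finset.range m, ξ ^ k • p k =
      ∑ i, (∏ j ∈ Finset.univ.erase i, ((ξ - η j) / (η i - η j))) •
        ∑ k ∈ Finset.range m, η i ^ k • p k := by
  ext a b
  set P : Polynomial ℂ := ∑ k ∈ Finset.range m, Polynomial.monomial k (p k a b) with hP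
  have he : ∀ z : ℂ, P.eval z = (∑ k ∈ Finset.range m, z ^ k • p k) a b := by
    intro z
    simp only [hP, Polynomial.eval_finsetSum, Polynomial.eval_monomial, Matrix.sum_apply,
      Matrix.smul_apply, smul_eq_mul, mul_comm]
  have hdeg : P.degree < (Finset.univ : Finset (Fin m)).card := by
    rw [Finset.card_univ, Fintype.card_fin]
    rw [← Polynomial.mem_degreeLT]
    refine Submodule.sum_mem _ fun k hk => ?_
    rw [Polynomial.mem_degreeLT]
    refine (Polynomial.degree_monomial_le _ _).trans_lt ?_
    exact_mod_cast Finset.mem_range.1 hk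
  have h := Lagrange.eq_interpolate (s := Finset.univ) (v := η) hη.injOn hdeg
  have h2 := congrArg (Polynomial.eval ξ) h
  rw [he, Lagrange.interpolate_apply, Polynomial.eval_finsetSum] at h2
  rw [h2, Matrix.sum_apply]
  refine Finset.sum_congr rfl fun i _ => ?_
  rw [Polynomial.eval_mul, Polynomial.eval_C, he, Matrix.smul_apply, smul_eq_mul, mul_comm,
    Lagrange.basis, Polynomial.eval_prod]
  congr 1
  refine Finset.prod_congr rfl fun j _ => ?_
  simp only [Lagrange.basisDivisor, Polynomial.eval_mul, Polynomial.eval_C, Polynomial.eval_sub,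
    Polynomial.eval_X]
  rw [div_eq_inv_mul]

theorem norm_omega (N : ℕ) : ‖omega N‖ = 1 := by
  rw [omega, show 2 * (Real.pi : ℂ) * Complex.I / N = ((2 * Real.pi / N : ℝ) : ℂ) * Complex.I by
    push_cast; ring]
  exact Complex.norm_exp_ofReal_mul_I _

/-- The eigenvalues of the transfer matrix are bounded in terms of the trace of the classical
monodromy. -/
theorem exists_bound_eigenvalue {N : ℕ} [NeZero N] {g : ℕ} (c : LaxScalars g) (τ : ℂ → ℂ) (ξ : ℂ) :
    ∃ b : ℝ, 0 ≤ b ∧ ∀ (X Z : Fin (g + 1) → Matrix (ZMod N) (ZMod N) ℂ) (x z : Fin (g + 1) → ℂ),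
      IsWeylChain X Z x z → (∏ n, z n = 1) → (∀ lam, classicalTrace N c x z lam = τ lam) →
      ∀ t : ℂ, (∃ v, v ≠ 0 ∧ (transfer c X Z ξ).mulVec v = t • v) → ‖t‖ ≤ b := by
  -- nodes
  set node : Fin (g + 2) → ℂ := fun i => ((i : ℕ) + 1 : ℕ) with hnode
  have hqd : ∀ i : Fin (g + 2), ∃ d : ℝ, ∀ k, ‖qdetFactor N c (node i) k‖ ≤ d := by
    intro i
    refine ⟨∏ n, ‖c.v n‖ * ((1 + ‖node i‖ * ‖c.u n‖ * ‖c.ut n‖) *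
      (1 + ‖node i‖ * ‖c.u n‖ * ‖c.ut n‖ * ‖c.κ n‖ * ‖c.κt n‖)), fun k => ?_⟩
    rw [qdetFactor, norm_prod]
    refine Finset.prod_le_prod (fun _ _ => norm_nonneg _) fun n _ => ?_
    rw [norm_mul, norm_mul]
    have h1 : ‖omega N ^ (k + 1)‖ = 1 := by rw [norm_pow, norm_omega, one_pow]
    gcongr
    · refine (norm_sub_le _ _).trans ?_
      simp [h1]
    · refine (norm_sub_le _ _).trans ?_
      simp [h1]
  choose d hd using hqd
  set B : Fin (g + 2) → ℝ := fun i => d i + 1 + ‖τ (node i ^ N)‖ with hB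
  have hB0 : ∀ i, 0 ≤ B i := fun i => by
    have := (norm_nonneg _).trans (hd i 0)
    simp only [hB]; positivity
  refine ⟨∑ i, (∏ j ∈ Finset.univ.erase i, (‖ξ‖ + ‖node j‖)) * B i,
    Finset.sum_nonneg fun i _ => mul_nonneg (Finset.prod_nonneg fun _ _ => by positivity) (hB0 i), ?_⟩
  intro X Z x z hW hz hτ t ⟨v₀, hv₀, hT⟩
  -- a common eigenvector
  set s : Set (Module.End ℂ ((Fin (g + 1) → ZMod N) → ℂ)) :=
    insert (Matrix.toLin' (totalZ Z)) (Set.range fun μ => Matrix.toLin' (transfer c X Z μ)) with hs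
  have hcomm : ∀ a ∈ s, ∀ b ∈ s, Commute a b := by
    have e1 : ∀ μ, Commute (Matrix.toLin' (totalZ Z)) (Matrix.toLin' (transfer c X Z μ)) := fun μ => by
      rw [Commute, SemiconjBy, Module.End.mul_eq_comp, Module.End.mul_eq_comp, ← Matrix.toLin'_mul, ← Matrix.toLin'_mul,
        hW.commute_totalZ]
    have e2 : ∀ μ ν, Commute (Matrix.toLin' (transfer c X Z μ)) (Matrix.toLin' (transfer c X Z ν)) :=
      fun μ ν => by
        rw [Commute, SemiconjBy, Module.End.mul_eq_comp, Module.End.mul_eq_comp, ← Matrix.toLin'_mul, ← Matrix.toLin'_mul,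
          hW.commute_transfer]
    rintro a (rfl | ⟨μ, rfl⟩) b (rfl | ⟨ν, rfl⟩)
    · exact Commute.refl _
    · exact e1 ν
    · exact (e1 μ).symm
    · exact e2 μ ν
  obtain ⟨v, hvW, hv0, hv⟩ := exists_common_eigenvector s hcomm
    (Module.End.eigenspace (Matrix.toLin' (transfer c X Z ξ)) t)
    (fun h => hv₀ (by
      have : v₀ ∈ Module.End.eigenspace (Matrix.toLin' (transfer c X Z ξ)) t := by
        rw [Module.End.mem_eigenspace_iff, Matrix.toLin'_apply, hT]
      rwa [h, Submodule.mem_bot] at this))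
    (fun a ha v hv => by
      rw [Module.End.mem_eigenspace_iff] at hv ⊢
      have h2 := LinearMap.congr_fun (hcomm _ (Or.inr ⟨ξ, rfl⟩) a ha).eq v
      simp only [Module.End.mul_apply] at h2
      rw [h2, hv, map_smul])
  have hvt : (transfer c X Z ξ).mulVec v = t • v := by
    have := Module.End.mem_eigenspace_iff.1 hvW
    rwa [Matrix.toLin'_apply] at this
  obtain ⟨ζ, hζ⟩ := hv _ (Or.inl rfl)
  rw [Matrix.toLin'_apply] at hζ
  have hev : ∀ μ, ∃ t : ℂ, (transfer c X Z μ).mulVec v = t • v := fun μ => by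
    obtain ⟨t, ht⟩ := hv _ (Or.inr ⟨μ, rfl⟩)
    exact ⟨t, by rwa [Matrix.toLin'_apply] at ht⟩
  choose T hT' using hev
  have hζ1 : ‖ζ‖ = 1 := by
    have h1 : ∀ m : ℕ, (totalZ Z ^ m).mulVec v = ζ ^ m • v := by
      intro m
      induction m with
      | zero => simp
      | succ m ih => rw [pow_succ, ← Matrix.mulVec_mulVec, hζ, Matrix.mulVec_smul, ih, smul_smul,
          ← pow_succ']
    have h2 := h1 N
    rw [hW.totalZ_pow, hz, one_smul, Matrix.one_mulVec] at h2
    have h3 : ζ ^ N = 1 := by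
      have h4 : (ζ ^ N - 1) • v = 0 := by rw [sub_smul, ← h2, one_smul, sub_self]
      exact sub_eq_zero.1 ((smul_eq_zero.1 h4).resolve_right hv0)
    exact Complex.norm_eq_one_of_pow_eq_one h3 (NeZero.ne N)
  -- a small eigenvalue on each orbit
  have hsmall : ∀ i, ∃ k : ℕ, ‖T (omega N ^ k * node i)‖ ≤ B i := by
    intro i
    obtain ⟨F, hF0, hF1, hF2, hFN⟩ := hW.exists_fused c (node i)
    have hφ : ∀ m, ∃ φ : ℂ, (F m).mulVec v = φ • v := by
      have : ∀ m, (∃ φ : ℂ, (F m).mulVec v = φ • v) ∧ ∃ φ : ℂ, (F (m + 1)).mulVec v = φ • v := by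
        intro m
        induction m with
        | zero => exact ⟨⟨1, by rw [hF0]; simp⟩, ⟨T (node i), by rw [hF1, hT']⟩⟩
        | succ m ih =>
          obtain ⟨⟨a, ha⟩, ⟨b, hb⟩⟩ := ih
          refine ⟨⟨b, hb⟩, ⟨T (omega N ^ (m + 1) * node i) * b - qdetFactor N c (node i) m * (ζ * a),
            ?_⟩⟩
          rw [hF2, Matrix.sub_mulVec, ← Matrix.mulVec_mulVec, hT', Matrix.smul_mulVec,
            ← Matrix.mulVec_mulVec, hζ, Matrix.mulVec_smul, Matrix.mulVec_smul, ha, hb]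
          module
      exact fun m => (this m).1
    choose φ hφ using hφ
    have hinj : ∀ a b : ℂ, a • v = b • v → a = b := fun a b hab =>
      smul_left_injective ℂ hv0 hab
    refine exists_small_coefficient (φ := φ) (t := fun k => T (omega N ^ k * node i))
      (δ := fun m => qdetFactor N c (node i) m * ζ) (N := N) (NeZero.ne N) ?_ ?_ ?_ ?_ ?_
    · refine hinj _ _ ?_
      rw [← hφ, hF0]; simp
    · refine hinj _ _ ?_
      rw [← hφ, hF1, hT', pow_zero, one_mul]
    · intro m
      refine hinj _ _ ?_
      rw [← hφ, hF2, Matrix.sub_mulVec, ← Matrix.mulVec_mulVec, hT', Matrix.smul_mulVec,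
        ← Matrix.mulVec_mulVec, hζ, Matrix.mulVec_smul, Matrix.mulVec_smul, hφ, hφ]
      module
    · intro m
      rw [norm_mul, hζ1, mul_one]
      exact hd i m
    · refine hinj _ _ ?_
      rw [← hφ, hFN, Matrix.smul_mulVec, hφ, hτ, smul_smul]
  choose k hk using hsmall
  set η : Fin (g + 2) → ℂ := fun i => omega N ^ k i * node i with hη
  have hηn : ∀ i, ‖η i‖ = (i : ℕ) + 1 := fun i => by
    rw [hη, norm_mul, norm_pow, norm_omega, one_pow, one_mul, hnode, Complex.norm_natCast]
    push_cast; rfl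
  have hnn : ∀ i, ‖node i‖ = (i : ℕ) + 1 := fun i => by
    rw [hnode, Complex.norm_natCast]; push_cast; rfl
  have hsep : ∀ i j, i ≠ j → 1 ≤ ‖η i - η j‖ := by
    intro i j hij
    refine le_trans ?_ (abs_norm_sub_norm_le (η i) (η j))
    rw [hηn, hηn, add_sub_add_right_eq_sub]
    have hij' : ((i : ℕ) : ℤ) - (j : ℕ) ≠ 0 := by
      intro h; exact hij (Fin.ext (by omega))
    have := Int.one_le_abs hij'
    exact_mod_cast this
  have hinjη : Function.Injective η := by
    intro i j hij
    by_contra hne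
    have := hsep i j hne
    rw [hij, sub_self, norm_zero] at this
    linarith
  obtain ⟨p, hp⟩ := exists_coeff_transfer c X Z
  have hL := lagrange_sum (m := g + 2) p η hinjη ξ
  simp only [← hp] at hL
  have ht : t = ∑ i, (∏ j ∈ Finset.univ.erase i, ((ξ - η j) / (η i - η j))) * T (η i) := by
    refine smul_left_injective ℂ hv0 ?_
    change t • v = _ • v
    rw [← hvt, hL, Matrix.sum_mulVec, Finset.sum_smul]
    refine Finset.sum_congr rfl fun i _ => ?_
    rw [Matrix.smul_mulVec, hT', smul_smul]
  rw [ht]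
  refine (norm_sum_le _ _).trans (Finset.sum_le_sum fun i _ => ?_)
  rw [norm_mul]
  refine mul_le_mul ?_ (hk i) (norm_nonneg _) (Finset.prod_nonneg fun _ _ => by positivity)
  rw [norm_prod]
  refine Finset.prod_le_prod (fun _ _ => norm_nonneg _) fun j hj => ?_
  have hij : i ≠ j := (Finset.ne_of_mem_erase hj).symm
  rw [norm_div]
  refine (div_le_self (norm_nonneg _) (hsep i j hij)).trans ((norm_sub_le _ _).trans ?_)
  rw [hηn, hnn]

end Bounds

end

end BS

namespace BS

noncomputable section

section WeylUniqueness

variable {N : ℕ} [NeZero N]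

theorem mulVec_pow_smul {X Z : Matrix (ZMod N) (ZMod N) ℂ} (hw : X * Z = omega N • (Z * X))
    {v : ZMod N → ℂ} {e : ℂ} (hv : X.mulVec v = e • v) (k : ℕ) :
    X.mulVec ((Z ^ k).mulVec v) = (omega N ^ k * e) • (Z ^ k).mulVec v := by
  induction k with
  | zero => simpa using hv
  | succ k ih =>
    rw [pow_succ' Z, ← Matrix.mulVec_mulVec, Matrix.mulVec_mulVec, hw, Matrix.smul_mulVec,
      ← Matrix.mulVec_mulVec, ih, Matrix.mulVec_smul, smul_smul, pow_succ']
    ring_nf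

/-- A Weyl pair of `N × N` matrices is determined by its centre up to conjugation. -/
theorem exists_conj_clock_shift {X Z : Matrix (ZMod N) (ZMod N) ℂ} {α β : ℂ}
    (hw : X * Z = omega N • (Z * X)) (hα : α ≠ 0) (hβ : β ≠ 0)
    (hX : X ^ N = α ^ N • (1 : Matrix (ZMod N) (ZMod N) ℂ))
    (hZ : Z ^ N = β ^ N • (1 : Matrix (ZMod N) (ZMod N) ℂ)) :
    ∃ G : Matrix (ZMod N) (ZMod N) ℂ, IsUnit G ∧ X * G = G * (α • clock N) ∧
      Z * G = G * (β • shift N) := by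
  have hprim := omega_primitive N
  obtain ⟨e, he⟩ := Module.End.exists_eigenvalue (Matrix.toLin' X)
  obtain ⟨v, hv⟩ := he.exists_hasEigenvector
  have hv1 : X.mulVec v = e • v := by simpa using hv.apply_eq_smul
  have hv0 : v ≠ 0 := hv.2
  have hZk : ∀ k (w : ZMod N → ℂ), w ≠ 0 → (Z ^ k).mulVec w ≠ 0 := by
    intro k w hw0 h0
    have hu : IsUnit (Z ^ k) := (isUnit_of_pow_eq_smul_one (pow_ne_zero N hβ) hZ).pow k
    exact hw0 (Matrix.mulVec_injective_of_isUnit hu (by simpa using h0))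
  have heN : e ^ N = α ^ N := by
    have h : ∀ k, (X ^ k).mulVec v = e ^ k • v := by
      intro k
      induction k with
      | zero => simp
      | succ k ih => rw [pow_succ, ← Matrix.mulVec_mulVec, hv1, Matrix.mulVec_smul, ih, smul_smul,
          pow_succ' e]
    have h2 := h N
    rw [hX, Matrix.smul_mulVec, Matrix.one_mulVec] at h2
    exact (smul_left_injective ℂ hv0 h2).symm
  obtain ⟨k, hk, hk'⟩ := hprim.eq_pow_of_pow_eq_one (ξ := α / e) (by
    rw [div_pow, heN, div_self (pow_ne_zero _ hα)])
  have he0 : e ≠ 0 := by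
    rintro rfl
    rw [zero_pow (NeZero.ne N)] at heN
    exact pow_ne_zero N hα heN.symm
  set w := (Z ^ k).mulVec v with hwdef
  have hw0 : w ≠ 0 := hZk k v hv0
  have hw1 : X.mulVec w = α • w := by
    rw [hwdef, mulVec_pow_smul hw hv1, hk', div_mul_cancel₀ _ he0]
  set E : ℕ → ZMod N → ℂ := fun k => (β⁻¹) ^ k • (Z ^ k).mulVec w with hE
  have hEX : ∀ k, X.mulVec (E k) = (omega N ^ k * α) • E k := by
    intro k
    simp only [hE, Matrix.mulVec_smul, mulVec_pow_smul hw hw1]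
    rw [smul_comm]
  have hE0 : ∀ k, E k ≠ 0 := fun k => smul_ne_zero (pow_ne_zero _ (inv_ne_zero hβ)) (hZk k w hw0)
  have hEZ : ∀ k, Z.mulVec (E k) = β • E (k + 1) := by
    intro k
    simp only [hE, Matrix.mulVec_smul, Matrix.mulVec_mulVec, ← pow_succ']
    rw [smul_smul, pow_succ' β⁻¹, ← mul_assoc, mul_inv_cancel₀ hβ, one_mul]
  have hper : Function.Periodic E N := by
    intro k
    simp only [hE, pow_add, hZ]
    rw [mul_smul_comm, mul_one, Matrix.smul_mulVec, smul_smul, inv_pow β N, mul_assoc,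
      inv_mul_cancel₀ (pow_ne_zero N hβ), mul_one]
  refine ⟨Matrix.of fun a b => E b.val a, ?_, ?_, ?_⟩
  · rw [← Matrix.linearIndependent_cols_iff_isUnit]
    refine Module.End.eigenvectors_linearIndependent' (Matrix.toLin' X)
      (fun b : ZMod N => omega N ^ b.val * α) ?_ _ fun b => ?_
    · intro a b hab
      exact ZMod.val_injective N (hprim.pow_inj (ZMod.val_lt a) (ZMod.val_lt b)
        (mul_right_cancel₀ hα hab))
    · refine ⟨?_, hE0 b.val⟩
      rw [Module.End.mem_eigenspace_iff, Matrix.toLin'_apply]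
      exact hEX b.val
  · ext a b
    have := congrFun (hEX b.val) a
    rw [Matrix.mul_smul, Matrix.smul_apply, clock, Matrix.mul_diagonal]
    rw [Matrix.mulVec, dotProduct, Pi.smul_apply, smul_eq_mul] at this
    rw [Matrix.mul_apply]
    simp only [Matrix.of_apply, smul_eq_mul]
    rw [this]; ring
  · ext a b
    have := congrFun (hEZ b.val) a
    rw [Matrix.mulVec, dotProduct, Pi.smul_apply, smul_eq_mul] at this
    rw [Matrix.mul_smul, Matrix.smul_apply, Matrix.mul_apply, Matrix.mul_apply]
    simp only [Matrix.of_apply, shift, mul_ite, mul_one, mul_zero, Finset.sum_ite_eq',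
      Finset.mem_univ, if_true, smul_eq_mul]
    have hval : E (b.val + 1) = E (b + 1).val := by
      rw [← hper.map_mod_nat (b.val + 1), ZMod.val_add, ZMod.val_one_eq_one_mod, Nat.add_mod_mod]
    rw [this, hval]

variable {g : ℕ}

theorem mul_prod_ofFn_of_semiconj {R : Type*} [Ring R] {m : ℕ} (K : Fin m → R) {s s' : R}
    (n : Fin m) (hn : s * K n = K n * s') (hs : ∀ k, k ≠ n → Commute s (K k))
    (hs' : ∀ k, k ≠ n → Commute s' (K k)) :
    s * (List.ofFn K).prod = (List.ofFn K).prod * s' := by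
  induction m with
  | zero => exact n.elim0
  | succ m ih =>
    simp only [List.ofFn_succ, List.prod_cons]
    induction n using Fin.cases with
    | zero =>
      have : Commute s' (List.ofFn fun i => K (Fin.succ i)).prod := by
        refine Commute.list_prod_right _ _ fun a ha => ?_
        obtain ⟨k, rfl⟩ := List.mem_ofFn.1 ha
        exact hs' _ (Fin.succ_ne_zero k)
      rw [← mul_assoc, hn, mul_assoc, this.eq, mul_assoc]
    | succ n =>
      rw [← mul_assoc, (hs 0 (Fin.succ_ne_zero n).symm).eq, mul_assoc, mul_assoc,
        ih (fun i => K i.succ) n hn (fun k hk => hs _ (by simpa using hk))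
          (fun k hk => hs' _ (by simpa using hk))]

theorem lax_semiconj {X Z X' Z' G : Matrix (ZMod N) (ZMod N) ℂ} (hX : X * G = G * X')
    (hZ : Z * G = G * Z') (hXu : IsUnit X) (hXu' : IsUnit X') (ξ u ut v κ κt : ℂ) (i j : Fin 2) :
    lax N ξ u ut v κ κt X Z i j * G = G * lax N ξ u ut v κ κt X' Z' i j := by
  have hXi : X⁻¹ * G = G * X'⁻¹ := by
    have h1 : X⁻¹ * X = 1 := Matrix.nonsing_inv_mul X ((Matrix.isUnit_iff_isUnit_det X).1 hXu)
    have h2 : X' * X'⁻¹ = 1 := Matrix.mul_nonsing_inv X' ((Matrix.isUnit_iff_isUnit_det X').1 hXu')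
    calc X⁻¹ * G = X⁻¹ * (G * X') * X'⁻¹ := by rw [mul_assoc, mul_assoc, h2, mul_one]
      _ = G * X'⁻¹ := by rw [← hX, ← mul_assoc, h1, one_mul]
  fin_cases i <;> fin_cases j
  · simp [lax, sub_mul, mul_sub, hZ]
  · simp only [lax, Fin.zero_eta, Fin.mk_one, Matrix.of_apply, Matrix.cons_val', Matrix.cons_val_one,
      Matrix.cons_val_zero, Matrix.cons_val_fin_one, neg_mul, mul_neg, smul_mul_assoc, mul_smul_comm,
      mul_sub, sub_mul, mul_one, one_mul, mul_assoc, hZ]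
    simp only [← mul_assoc, hX]
  · simp only [lax, Fin.zero_eta, Fin.mk_one, Matrix.of_apply, Matrix.cons_val', Matrix.cons_val_one,
      Matrix.cons_val_zero, Matrix.cons_val_fin_one, neg_mul, mul_neg, smul_mul_assoc, mul_smul_comm,
      mul_sub, sub_mul, mul_one, one_mul, mul_assoc, hZ]
    simp only [← mul_assoc, hXi]
  · simp [lax, add_mul, mul_add, hZ]

theorem prod_ofFn_semiconj {R I : Type*} [Ring R] [Fintype I] [DecidableEq I] {m : ℕ}
    (L L' : Fin m → Matrix I I R) (G : R) (h : ∀ n i j, L n i j * G = G * L' n i j) (i j : I) :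
    (List.ofFn L).prod i j * G = G * (List.ofFn L').prod i j := by
  induction m generalizing i with
  | zero => by_cases hij : i = j <;> simp [hij, Matrix.one_apply]
  | succ m ih =>
    simp only [List.ofFn_succ, List.prod_cons, Matrix.mul_apply, Finset.sum_mul, Finset.mul_sum]
    refine Finset.sum_congr rfl fun k _ => ?_
    rw [mul_assoc, ih _ _ (fun n => h n.succ), ← mul_assoc, h, mul_assoc]

/-- The characteristic polynomial of the transfer matrix depends on the centres only. -/
theorem IsWeylChain.charpoly_transfer {X Z : Fin (g + 1) → Matrix (ZMod N) (ZMod N) ℂ}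
    {x z : Fin (g + 1) → ℂ} (h : IsWeylChain X Z x z) (hz : ∀ n, z n ≠ 0) (c : LaxScalars g)
    {α β : Fin (g + 1) → ℂ} (hα : ∀ n, α n ^ N = x n) (hβ : ∀ n, β n ^ N = z n) (ξ : ℂ) :
    (transfer c X Z ξ).charpoly =
      (transfer c (fun n => α n • clock N) (fun n => β n • shift N) ξ).charpoly := by
  have hα0 : ∀ n, α n ≠ 0 := fun n h0 => h.X_ne n (by
    rw [← hα, h0, zero_pow (NeZero.ne N)])
  have hβ0 : ∀ n, β n ≠ 0 := fun n h0 => hz n (by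
    rw [← hβ, h0, zero_pow (NeZero.ne N)])
  choose G hG hGX hGZ using fun n => exists_conj_clock_shift (h.weyl n) (hα0 n) (hβ0 n)
    (by rw [hα, h.X_pow]) (by rw [hβ, h.Z_pow])
  set K := (List.ofFn fun n => siteOp n (G n)).prod with hK
  have hKu : IsUnit K := by
    refine List.prod_induction IsUnit (fun a b ha hb => ha.mul hb) isUnit_one fun a ha => ?_
    obtain ⟨n, rfl⟩ := List.mem_ofFn.1 ha
    simp only [← siteHom_apply]
    exact (hG n).map (siteHom n)
  have hu : ∀ n, IsUnit (α n • clock N) := fun n =>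
    (isUnit_clock (N := N)).smul (Units.mk0 _ (hα0 n))
  have hmono : ∀ i j, monodromy c X Z ξ i j * K =
      K * monodromy c (fun n => α n • clock N) (fun n => β n • shift N) ξ i j := by
    refine prod_ofFn_semiconj _ _ _ fun n i j => ?_
    refine mul_prod_ofFn_of_semiconj _ n ?_ (fun k hk => commute_siteOp hk.symm _ _)
      (fun k hk => commute_siteOp hk.symm _ _)
    simp only [Matrix.map_apply, ← siteHom_apply, ← map_mul]
    rw [lax_semiconj (hGX n) (hGZ n) (h.isUnit_X n) (hu n)]
  have hT : transfer c X Z ξ * K =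
      K * transfer c (fun n => α n • clock N) (fun n => β n • shift N) ξ := by
    simp only [transfer, Matrix.trace, Matrix.diag_apply, Finset.sum_mul, Finset.mul_sum, hmono]
  obtain ⟨k, hk⟩ := hKu
  rw [← Matrix.charpoly_units_conj' k (transfer c X Z ξ)]
  congr 1
  rw [hk, mul_assoc, hT, ← mul_assoc, ← hk]
  simp

end WeylUniqueness

end

end BS

namespace BS

noncomputable section

section Fay

/-- Expansion of a determinant of moments along a column of powers. -/
theorem det_cons_pow {n : ℕ} (a : ℂ) (μ : Fin n → ℕ → ℂ) :
    (Matrix.of fun i j : Fin (n + 1) =>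
      (Fin.cons (fun k => a ^ k) μ : Fin (n + 1) → ℕ → ℂ) j i).det =
    (Matrix.of fun i j : Fin n => μ j (i + 1) - a * μ j i).det := by
  set A := Matrix.of fun i j : Fin (n + 1) =>
      (Fin.cons (fun k => a ^ k) μ : Fin (n + 1) → ℕ → ℂ) j i with hA
  set B : Matrix (Fin (n + 1)) (Fin (n + 1)) ℂ := Matrix.of fun i j =>
    Fin.cases (A 0 j) (fun i => A i.succ j - a * A i.castSucc j) i with hB
  have hdet : A.det = B.det := by
    refine Matrix.det_eq_of_forall_row_eq_smul_add_pred (fun _ => a) (fun j => ?_) fun i j => ?_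
    · simp [hB]
    · simp [hB]
  rw [hdet, Matrix.det_succ_column_zero, Fin.sum_univ_succ, Finset.sum_eq_zero, add_zero]
  · have : B.submatrix (Fin.succAbove 0) Fin.succ =
        Matrix.of fun i j : Fin n => μ j (i + 1) - a * μ j i := by
      ext i j
      simp [hB, hA]
    rw [this]
    simp [hB, hA]
  · intro i _
    have : B i.succ 0 = 0 := by
      simp only [hB, hA, Matrix.of_apply, Fin.cases_succ, Fin.cons_zero, Fin.val_succ,
        Fin.val_castSucc]
      ring
    rw [this]; ring

/-- The determinant with two columns of powers in front of given columns of moments. -/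
def border {n : ℕ} (μ : Fin n → ℕ → ℂ) (v w : ℕ → ℂ) : ℂ :=
  (Matrix.of fun i j : Fin (n + 2) =>
    (Fin.cons v (Fin.cons w μ : Fin (n + 1) → ℕ → ℂ) : Fin (n + 2) → ℕ → ℂ) j i).det

theorem border_pow {n : ℕ} (μ : Fin n → ℕ → ℂ) (a b : ℂ) :
    border μ (fun k => a ^ k) (fun k => b ^ k) = (b - a) *
      (Matrix.of fun i j : Fin n => μ j (i + 2) - (a + b) * μ j (i + 1) + a * b * μ j i).det := by
  rw [border, det_cons_pow]
  have : (Matrix.of fun i j : Fin (n + 1) =>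
      (Fin.cons (fun k => b ^ k) μ : Fin (n + 1) → ℕ → ℂ) j (i + 1) -
        a * (Fin.cons (fun k => b ^ k) μ : Fin (n + 1) → ℕ → ℂ) j i) =
      Matrix.of fun i j : Fin (n + 1) => (Fin.cons (b - a) (fun _ => 1) : Fin (n + 1) → ℂ) j *
        (Fin.cons (fun k => b ^ k) (fun j k => μ j (k + 1) - a * μ j k) :
          Fin (n + 1) → ℕ → ℂ) j i := by
    ext i j
    induction j using Fin.cases with
    | zero => simp only [Matrix.of_apply, Fin.cons_zero]; ring
    | succ j => simp
  rw [this]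
  have h2 := Matrix.det_mul_row (Fin.cons (b - a) (fun _ => 1) : Fin (n + 1) → ℂ)
    (Matrix.of fun i j : Fin (n + 1) => (Fin.cons (fun k => b ^ k) (fun j k => μ j (k + 1) - a * μ j k) :
          Fin (n + 1) → ℕ → ℂ) j i)
  simp only [Matrix.of_apply] at h2
  rw [h2, Fin.prod_univ_succ, det_cons_pow]
  simp only [Fin.cons_zero, Fin.cons_succ, Finset.prod_const_one, mul_one]
  congr 2
  ext i j
  simp only [Matrix.of_apply]
  ring

/-- The three-term Plücker relation. -/
theorem border_plucker {n : ℕ} (μ : Fin n → ℕ → ℂ) (a b c d : ℕ → ℂ) :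
    border μ a b * border μ c d - border μ a c * border μ b d + border μ a d * border μ b c = 0 := by
  -- `border` as a determinant of vectors
  set col : (ℕ → ℂ) → Fin (n + 2) → ℂ := fun v i => v i with hcol
  set M : (Fin (n + 2) → ℂ) → (Fin (n + 2) → ℂ) → Matrix (Fin (n + 2)) (Fin (n + 2)) ℂ := fun v w =>
    Matrix.of fun i j => (Fin.cons v (Fin.cons w (fun j => col (μ j)) : Fin (n + 1) → Fin (n + 2) → ℂ) :
      Fin (n + 2) → Fin (n + 2) → ℂ) j i with hM
  have hb : ∀ v w, border μ v w = (M (col v) (col w)).det := by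
    intro v w
    rw [border]
    congr 1
    ext i j
    induction j using Fin.cases with
    | zero => simp [hM, hcol]
    | succ j =>
      induction j using Fin.cases with
      | zero => simp [hM, hcol]
      | succ j => simp [hM, hcol]
  have up0 : ∀ v w x, (M v w).updateCol 0 x = M x w := by
    intro v w x
    ext i j
    induction j using Fin.cases with
    | zero => simp [hM]
    | succ j => simp [hM, Matrix.updateCol_apply, Fin.succ_ne_zero]
  have up1 : ∀ v w x, (M v w).updateCol 1 x = M v x := by
    intro v w x
    ext i j
    induction j using Fin.cases with
    | zero => simp [hM, Matrix.updateCol_apply]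
    | succ j =>
      induction j using Fin.cases with
      | zero => simp [hM, Matrix.updateCol_apply]
      | succ j =>
        have : j.succ.succ ≠ (1 : Fin (n + 2)) := by
          simp [Fin.ext_iff]
        simp [hM, Matrix.updateCol_apply, this]
  have swap : ∀ v w, (M v w).det = -(M w v).det := by
    intro v w
    have h := Matrix.det_permute' (Equiv.swap (0 : Fin (n + 2)) 1) (M w v)
    rw [Equiv.Perm.sign_swap (by simp)] at h
    simp only [Units.val_neg, Units.val_one, Int.cast_neg, Int.cast_one, neg_mul, one_mul] at h
    rw [← h]
    congr 1
    ext i j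
    induction j using Fin.cases with
    | zero => simp [hM]
    | succ j =>
      induction j using Fin.cases with
      | zero => simp [hM]
      | succ j =>
        have h1 : j.succ.succ ≠ (1 : Fin (n + 2)) := by
          simp [Fin.ext_iff]
        simp [hM, Equiv.swap_apply_of_ne_of_ne (Fin.succ_ne_zero _) h1]
  -- expansion of `c` by Cramer's rule
  have cramer := Matrix.mulVec_cramer (M (col a) (col b)) (col c)
  have hlin : ∀ x : Fin (n + 2) → ℂ, ∀ y, (M ((M (col a) (col b)).mulVec x) y).det =
      x 0 * (M (col a) y).det + x 1 * (M (col b) y).det := by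
    intro x y
    have e : (M (col a) (col b)).mulVec x = ∑ j, x j • fun i => M (col a) (col b) i j := by
      ext i
      simp [Matrix.mulVec, dotProduct, Finset.sum_apply, mul_comm]
    have hsum : ∀ v : Fin (n + 2) → Fin (n + 2) → ℂ, (M (∑ j, x j • v j) y).det =
        ∑ j, x j * (M (v j) y).det := by
      intro v
      have : ∀ v', M v' y = (M 0 y).updateCol 0 v' := fun v' => (up0 _ _ _).symm
      simp only [this (∑ j, x j • v j), this (v _)]
      simp only [← Matrix.cramer_apply]
      rw [map_sum, Finset.sum_apply]
      simp
    rw [e, hsum, Fin.sum_univ_succ, Fin.sum_univ_succ, Finset.sum_eq_zero, add_zero]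
    · congr 1
    · intro j _
      have : (M (fun i => M (col a) (col b) i j.succ.succ) y).det = 0 := by
        refine Matrix.det_zero_of_column_eq (i := 0) (j := j.succ.succ) (Fin.succ_ne_zero _).symm ?_
        intro k
        simp [hM]
      rw [this, mul_zero]
  have key := hlin ((M (col a) (col b)).cramer (col c)) (col d)
  rw [cramer, Matrix.cramer_apply, Matrix.cramer_apply, up0, up1] at key
  have hsm : (M ((M (col a) (col b)).det • col c) (col d)).det =
      (M (col a) (col b)).det * (M (col c) (col d)).det := by
    have : ∀ v', M v' (col d) = (M 0 (col d)).updateCol 0 v' := fun v' => (up0 _ _ _).symm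
    rw [this (_ • _), this (col c), Matrix.det_updateCol_smul]
  rw [hsm, swap (col c) (col b)] at key
  rw [hb, hb, hb, hb, hb, hb]
  linear_combination key

variable {g : ℕ} {P : Fin g → ℂ × ℂ}

/-- `(P_j - a) / (P_j' - a)`. -/
def mob (P : Fin g → ℂ × ℂ) (a : ℂ) (j : Fin g) : ℂ := ((P j).2 - a) / ((P j).1 - a)

/-- The points `P_j, P_j'` differ from `a`. -/
def Avoids (P : Fin g → ℂ × ℂ) (a : ℂ) : Prop := ∀ j, (P j).1 ≠ a ∧ (P j).2 ≠ a

theorem Avoids.mob_ne {a : ℂ} (h : Avoids P a) (j : Fin g) : mob P a j ≠ 0 :=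
  div_ne_zero (sub_ne_zero.2 (h j).2) (sub_ne_zero.2 (h j).1)

theorem evalAt_eq (f : Fin g → ℂ) (a : ℂ) : evalAt P f a = f * mob P a := by
  ext j; simp [evalAt, mob, mul_comm]

theorem sigma_eq (A : ℂ × ℂ) : sigma P A = mob P A.2 / mob P A.1 := by
  ext j
  simp only [sigma, crossRatio, mob, Pi.div_apply, div_eq_mul_inv, mul_inv, inv_inv]
  ring

theorem border_eq_H (f : Fin g → ℂ) {a b c d : ℂ} (ha : Avoids P a) (hb : Avoids P b)
    (hV : ∏ i : Fin g, ∏ j ∈ Finset.Ioi i, ((P j).2 - (P i).2) ≠ 0) :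
    border (fun j k => (P j).2 ^ k - (f * mob P a * mob P b * mob P c * mob P d) j * (P j).1 ^ k)
      (fun k => a ^ k) (fun k => b ^ k) =
    (b - a) * ((∏ j, ((P j).2 - a) * ((P j).2 - b)) *
      ((∏ i : Fin g, ∏ j ∈ Finset.Ioi i, ((P j).2 - (P i).2)) * H P (f * mob P c * mob P d))) := by
  rw [border_pow, H, mul_div_cancel₀ _ hV]
  congr 1
  rw [← Matrix.det_mul_row]
  congr 1
  ext i j
  have h1 := sub_ne_zero.2 (ha j).1
  have h2 := sub_ne_zero.2 (hb j).1
  simp only [Matrix.of_apply, Pi.mul_apply]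
  rw [show mob P a j = ((P j).2 - a) / ((P j).1 - a) from rfl,
    show mob P b j = ((P j).2 - b) / ((P j).1 - b) from rfl]
  field_simp
  ring

/-- The trisecant identity for the rational theta function. -/
theorem fay (f : Fin g → ℂ) {a b c d : ℂ} (ha : Avoids P a) (hb : Avoids P b) (hc : Avoids P c)
    (hd : Avoids P d) :
    (a - b) * (c - d) * (H P (f * mob P a * mob P b) * H P (f * mob P c * mob P d)) -
      (a - c) * (b - d) * (H P (f * mob P a * mob P c) * H P (f * mob P b * mob P d)) +
      (a - d) * (b - c) * (H P (f * mob P a * mob P d) * H P (f * mob P b * mob P c)) = 0 := by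
  by_cases hV : ∏ i : Fin g, ∏ j ∈ Finset.Ioi i, ((P j).2 - (P i).2) = 0
  · simp [H, hV]
  have hpl := border_plucker
    (fun j k => (P j).2 ^ k - (f * mob P a * mob P b * mob P c * mob P d) j * (P j).1 ^ k)
    (fun k => a ^ k) (fun k => b ^ k) (fun k => c ^ k) (fun k => d ^ k)
  rw [border_eq_H f ha hb hV] at hpl
  have e1 : f * mob P a * mob P b * mob P c * mob P d = f * mob P c * mob P d * mob P a * mob P b := by
    ring
  have e2 : f * mob P a * mob P b * mob P c * mob P d = f * mob P a * mob P c * mob P b * mob P d := by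
    ring
  have e3 : f * mob P a * mob P b * mob P c * mob P d = f * mob P b * mob P d * mob P a * mob P c := by
    ring
  have e4 : f * mob P a * mob P b * mob P c * mob P d = f * mob P a * mob P d * mob P b * mob P c := by
    ring
  have e5 : f * mob P a * mob P b * mob P c * mob P d = f * mob P b * mob P c * mob P a * mob P d := by
    ring
  rw [e1, border_eq_H f hc hd hV, ← e1, e2, border_eq_H f ha hc hV, ← e2, e3,
    border_eq_H f hb hd hV, ← e3, e4, border_eq_H f ha hd hV, ← e4, e5,
    border_eq_H f hb hc hV] at hpl
  set V := ∏ i : Fin g, ∏ j ∈ Finset.Ioi i, ((P j).2 - (P i).2) with hVdef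
  have hp : ∀ x, Avoids P x → ∏ j, ((P j).2 - x) ≠ 0 := fun x hx =>
    Finset.prod_ne_zero_iff.2 fun j _ => sub_ne_zero.2 (hx j).2
  simp only [Finset.prod_mul_distrib] at hpl
  have hne : (∏ j, ((P j).2 - a)) * (∏ j, ((P j).2 - b)) * (∏ j, ((P j).2 - c)) *
      (∏ j, ((P j).2 - d)) * V * V ≠ 0 :=
    mul_ne_zero (mul_ne_zero (mul_ne_zero (mul_ne_zero (mul_ne_zero (hp a ha) (hp b hb)) (hp c hc))
      (hp d hd)) hV) hV
  refine (mul_eq_zero.1 ?_).resolve_left hne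
  linear_combination hpl

theorem H_zero (hP : Function.Injective fun j => (P j).2) : H P 0 = 1 := by
  rw [H]
  have : (Matrix.of fun i j : Fin g => (P j).2 ^ (i : ℕ) - (0 : Fin g → ℂ) j * (P j).1 ^ (i : ℕ)) =
      (Matrix.vandermonde fun j => (P j).2).transpose := by
    ext i j; simp [Matrix.vandermonde]
  rw [this, Matrix.det_transpose, Matrix.det_vandermonde]
  refine div_self (Finset.prod_ne_zero_iff.2 fun i _ => Finset.prod_ne_zero_iff.2 fun j hj => ?_)
  exact sub_ne_zero.2 fun h => (Finset.mem_Ioi.1 hj).ne (hP h).symm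

end Fay

end

end BS

namespace BS

noncomputable section

section Solutions

theorem crossRatio_ne {A B C D : ℂ} (h : crossRatio A B C D ≠ 0) :
    A ≠ C ∧ B ≠ D ∧ A ≠ D ∧ B ≠ C := by
  simp only [crossRatio, ne_eq, div_eq_zero_iff, mul_eq_zero, not_or, sub_eq_zero] at h
  tauto

variable {g : ℕ} {P : Fin g → ℂ × ℂ} {Y : Fin (g + 1) → ℂ × ℂ} {Z : Fin 2 → ℂ × ℂ}

theorem avoids_of_sigma_ne {A : ℂ × ℂ} (h : ∀ j, sigma P A j ≠ 0) :
    Avoids P A.1 ∧ Avoids P A.2 :=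
  ⟨fun j => ⟨(crossRatio_ne (h j)).1, (crossRatio_ne (h j)).2.2.2⟩,
    fun j => ⟨(crossRatio_ne (h j)).2.2.1, (crossRatio_ne (h j)).2.1⟩⟩

namespace IsSolutionSystem

theorem sigma_Y_ne (hP : IsSolutionSystem Y Z P) (n : Fin (g + 1)) (j : Fin g) :
    sigma P (Y n) j ≠ 0 := by
  have h := (hP.solves j).1
  exact Finset.prod_ne_zero_iff.1 (h ▸ one_ne_zero) n (Finset.mem_univ n)

theorem sigma_Z_ne (hP : IsSolutionSystem Y Z P) (i : Fin 2) (j : Fin g) :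
    sigma P (Z i) j ≠ 0 := by
  have h := (hP.solves j).2
  exact Finset.prod_ne_zero_iff.1 (h ▸ one_ne_zero) i (Finset.mem_univ i)

theorem avoids_Y (hP : IsSolutionSystem Y Z P) (n : Fin (g + 1)) :
    Avoids P (Y n).1 ∧ Avoids P (Y n).2 := avoids_of_sigma_ne (hP.sigma_Y_ne n)

theorem avoids_Z (hP : IsSolutionSystem Y Z P) (i : Fin 2) :
    Avoids P (Z i).1 ∧ Avoids P (Z i).2 := avoids_of_sigma_ne (hP.sigma_Z_ne i)

theorem sigma_Z_mul (hP : IsSolutionSystem Y Z P) : sigma P (Z 0) * sigma P (Z 1) = 1 := by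
  ext j
  have h := (hP.solves j).2
  rw [Fin.prod_univ_two] at h
  exact h

theorem sigma_Z_zero (hP : IsSolutionSystem Y Z P) :
    sigma P (Z 0) = mob P (Z 1).1 / mob P (Z 1).2 := by
  have h := hP.sigma_Z_mul
  ext j
  have h1 := congrFun h j
  rw [sigma_eq (Z 1)] at h1
  simp only [Pi.mul_apply, Pi.div_apply, Pi.one_apply] at h1 ⊢
  have := (hP.avoids_Z 1).1.mob_ne j
  have := (hP.avoids_Z 1).2.mob_ne j
  field_simp at h1 ⊢
  exact h1

theorem shiftI_eq (hP : IsSolutionSystem Y Z P) (n : Fin (g + 1)) :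
    shiftI Y P n = shiftI Y P (n + 1) * sigma P (Y n) := by
  ext j
  simp only [shiftI, Pi.mul_apply]
  rw [← Finset.mul_prod_erase _ _ (Finset.mem_univ n), ← Finset.mul_prod_erase _ _ (Finset.mem_univ n)]
  rw [if_neg (lt_irrefl _), if_pos (Nat.lt_succ_self _), one_mul, mul_comm, ← mul_assoc,
    mul_inv_cancel₀ (hP.sigma_Y_ne n j), one_mul]
  refine Finset.prod_congr rfl fun i hi => ?_
  have hne : (i : ℕ) ≠ n := fun h => (Finset.mem_erase.1 hi).1 (Fin.ext h)
  have : (i : ℕ) < n ↔ (i : ℕ) < n + 1 := by omega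
  simp only [this]

theorem shiftI_zero : shiftI Y P 0 = 1 := by
  ext j; simp [shiftI]

theorem shiftI_last (hP : IsSolutionSystem Y Z P) : shiftI Y P (g + 1) = 1 := by
  ext j
  have h := (hP.solves j).1
  simp only [shiftI, Fin.is_lt, if_true, Finset.prod_inv_distrib, Pi.one_apply]
  rw [inv_eq_one]
  exact h

theorem injective (hYZ : AdmissiblePoints Y Z) (hP : IsSolutionSystem Y Z P) :
    Function.Injective fun j => (P j).2 := by
  intro i j hij
  by_contra hne
  simp only at hij
  have key : ∀ j, ((P j).1 - (Z 0).1) * ((P j).2 - (Z 0).2) * (((P j).1 - (Z 1).1) * ((P j).2 - (Z 1).2)) =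
      ((P j).1 - (Z 0).2) * ((P j).2 - (Z 0).1) * (((P j).1 - (Z 1).2) * ((P j).2 - (Z 1).1)) := by
    intro j
    have h := congrFun hP.sigma_Z_mul j
    have h0 := crossRatio_ne (hP.sigma_Z_ne 0 j)
    have h1 := crossRatio_ne (hP.sigma_Z_ne 1 j)
    simp only [Pi.mul_apply, Pi.one_apply, sigma, crossRatio] at h
    have := sub_ne_zero.2 h0.2.2.1
    have := sub_ne_zero.2 h0.2.2.2
    have := sub_ne_zero.2 h1.2.2.1
    have := sub_ne_zero.2 h1.2.2.2
    rw [div_mul_div_comm, div_eq_one_iff_eq (by positivity)] at h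
    exact h
  have hij' : (P i).1 ≠ (P j).1 := fun h => (hP.inequivalent i j hne).1 (Prod.ext h hij)
  have ki := key i
  have kj := key j
  rw [← hij] at kj
  have hni := sub_ne_zero.2 (hP.nontrivial i)
  have hnj := sub_ne_zero.2 (hP.nontrivial j)
  rw [← hij] at hnj
  set p := (P i).2
  set a := (P i).1
  set b := (P j).1
  set A := (Z 0).1
  set B := (Z 0).2
  set C := (Z 1).1
  set D := (Z 1).2
  have hd := hYZ.Z_distinct
  simp only [List.nodup_cons, List.mem_cons, List.not_mem_nil, or_false, not_or] at hd
  obtain ⟨⟨h1, h2, h3⟩, ⟨h4, h5⟩, h6, -⟩ := hd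
  -- the linear factor of the equation
  set α := ((A + C) - (B + D)) * p + (B * D - A * C) with hα
  set β := (B * D - A * C) * p + ((B + D) * (A * C) - (A + C) * (B * D)) with hβ
  have fac : ∀ x, (x - A) * (p - B) * ((x - C) * (p - D)) - (x - B) * (p - A) * ((x - D) * (p - C)) =
      (x - p) * (α * x + β) := by
    intro x; simp only [hα, hβ]; ring
  have fa : α * a + β = 0 := (mul_eq_zero.1 ((fac a).symm.trans (sub_eq_zero.2 ki))).resolve_left hni
  have fb : α * b + β = 0 := (mul_eq_zero.1 ((fac b).symm.trans (sub_eq_zero.2 kj))).resolve_left hnj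
  have hα0 : α = 0 := (mul_eq_zero.1 (show α * (a - b) = 0 by linear_combination fa - fb)).resolve_right
    (sub_ne_zero.2 hij')
  have hβ0 : β = 0 := by rw [hα0] at fa; linear_combination fa
  have := fac B
  rw [hα0, hβ0] at this
  have h0 := crossRatio_ne (hP.sigma_Z_ne 0 i)
  have h1' := crossRatio_ne (hP.sigma_Z_ne 1 i)
  have hz : (B - A) * (p - B) * ((B - C) * (p - D)) = 0 := by linear_combination this
  simp only [mul_eq_zero, sub_eq_zero] at hz
  rcases hz with (h | h) | (h | h)
  · exact h1 h.symm
  · exact h0.2.1 h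
  · exact h4 h
  · exact h1'.2.1 h

end IsSolutionSystem

theorem centreX_eq (f : Fin g → ℂ) (n : Fin (g + 1)) :
    centreX Y Z P f n = H P (f * shiftI Y P (n + 1) * mob P (Y n).2) /
      H P (f * shiftI Y P (n + 1) * mob P (Y n).2 * sigma P (Z 0)) := by
  rw [centreX, evalAt_eq, mul_right_comm]

theorem centreZ_eq (hP : IsSolutionSystem Y Z P) (f : Fin g → ℂ) (n : Fin (g + 1)) :
    centreZ Y Z P f n =
      H P (f * shiftI Y P (n + 1) * mob P (Z 0).2) / H P (f * shiftI Y P (n + 1) * mob P (Z 1).1) *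
        (H P (f * shiftI Y P n * mob P (Z 1).1) / H P (f * shiftI Y P n * mob P (Z 0).2)) := by
  have e : ∀ m, f * mob P (Z 1).2 * sigma P (Z 0) * shiftI Y P m = f * shiftI Y P m * mob P (Z 1).1 := by
    intro m
    rw [hP.sigma_Z_zero]
    ext j
    have := (hP.avoids_Z 1).2.mob_ne j
    simp only [Pi.mul_apply, Pi.div_apply]
    field_simp
  rw [centreZ, evalAt_eq, evalAt_eq, e, e, mul_right_comm f, mul_right_comm f (mob P (Z 0).2)
    (shiftI Y P n)]

theorem centre_zero (hYZ : AdmissiblePoints Y Z) (hP : IsSolutionSystem Y Z P) (n : Fin (g + 1)) :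
    centreX Y Z P 0 n = 1 ∧ centreZ Y Z P 0 n = 1 := by
  rw [centreX_eq, centreZ_eq hP]
  simp [H_zero (hP.injective hYZ)]

theorem prod_div_telescope {m : ℕ} (q : ℕ → ℂ) (hq : ∀ n ≤ m, q n ≠ 0) :
    ∏ n : Fin m, q (n + 1) / q n = q m / q 0 := by
  induction m with
  | zero => simp [div_self (hq 0 le_rfl)]
  | succ m ih =>
    rw [Fin.prod_univ_castSucc]
    simp only [Fin.val_castSucc, Fin.val_last]
    rw [ih fun n hn => hq n (by omega), mul_comm]
    have := hq m (by omega)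
    field_simp

/-- The data of nonvanishing theta functions that make all the centres finite and nonzero. -/
theorem centre_ne (hP : IsSolutionSystem Y Z P) {f : Fin g → ℂ}
    (hX : ∀ n, centreX Y Z P f n ≠ 0) (hZ : ∀ n, centreZ Y Z P f n ≠ 0) :
    (∀ n : Fin (g + 1), H P (f * shiftI Y P (n + 1) * mob P (Y n).2) ≠ 0 ∧
      H P (f * shiftI Y P (n + 1) * mob P (Y n).2 * sigma P (Z 0)) ≠ 0) ∧
    ∀ n ≤ g + 1, H P (f * shiftI Y P n * mob P (Z 0).2) ≠ 0 ∧
      H P (f * shiftI Y P n * mob P (Z 1).1) ≠ 0 := by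
  refine ⟨fun n => ?_, fun n hn => ?_⟩
  · have := hX n
    rw [centreX_eq] at this
    simpa [div_eq_zero_iff, not_or] using this
  · rcases Nat.lt_or_ge n (g + 1) with h | h
    · have := hZ ⟨n, h⟩
      rw [centreZ_eq hP] at this
      simp only [ne_eq, mul_eq_zero, div_eq_zero_iff, not_or] at this
      exact ⟨this.2.2, this.2.1⟩
    · obtain rfl : n = g + 1 := le_antisymm hn h
      have := hZ (Fin.last g)
      rw [centreZ_eq hP] at this
      simp only [ne_eq, mul_eq_zero, div_eq_zero_iff, not_or, Fin.val_last] at this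
      exact ⟨this.1.1, this.1.2⟩

theorem prod_centreZ (hP : IsSolutionSystem Y Z P) {f : Fin g → ℂ}
    (hX : ∀ n, centreX Y Z P f n ≠ 0) (hZ : ∀ n, centreZ Y Z P f n ≠ 0) :
    ∏ n, centreZ Y Z P f n = 1 := by
  have hne := (centre_ne hP hX hZ).2
  have := prod_div_telescope (m := g + 1) (fun n => H P (f * shiftI Y P n * mob P (Z 0).2) /
    H P (f * shiftI Y P n * mob P (Z 1).1)) fun n hn => div_ne_zero (hne n hn).1 (hne n hn).2
  rw [hP.shiftI_last, IsSolutionSystem.shiftI_zero, div_self (by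
    have := hne 0 (Nat.zero_le _)
    rw [IsSolutionSystem.shiftI_zero] at this
    exact div_ne_zero this.1 this.2)] at this
  rw [← this]
  refine Finset.prod_congr rfl fun n _ => ?_
  rw [centreZ_eq hP]
  simp only [div_eq_mul_inv, mul_inv, inv_inv]
  ring

end Solutions

section ClassicalStep

/-- The linear problem for the classical Lax matrix, in terms of the values of theta functions. -/
theorem classicalLax_mulVec {e φy φy' φt χy χy' χt V₀ : ℂ} {hy hys ht hts ht' hts' A B B' C D D' : ℂ}
    (he : e * e = 1) (hφy : φy ≠ 0) (hφt : φt ≠ 0) (hχy : χy ≠ 0) (hχt : χt ≠ 0)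
    (hty' : φt ≠ φy')
    (hV : (χy' - χt) * (φt - φy) = (φt - φy') * V₀ * (χy - χt))
    (n1 : hy ≠ 0) (n2 : hys ≠ 0) (n3 : ht ≠ 0) (n4 : ht' ≠ 0) (nA : A ≠ 0) (nB' : B' ≠ 0) (nD : D ≠ 0)
    (f1 : φt * (hys * ht) - φy * (hy * hts) = (φt - φy) * (A * B))
    (f2 : φt * (hys * ht') - φy' * (hy * hts') = (φt - φy') * (A * B'))
    (f3 : χy * (hys * ht) - χt * (hy * hts) = (χy - χt) * (C * D))
    (f4 : χy' * (hys * ht') - χt * (hy * hts') = (χy' - χt) * (C * D')) :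
    (classicalLax (φt * χt)⁻¹ (e * φy) (e * χy) (V₀ * (B / D * (D' / B'))) (-(φy' / φy)) (-(χy' / χy))
      (hy / hys)).mulVec ![1, -(e / φt) * (hts / ht)] =
    ((φt - φy) / (φt - φy') * (1 - (φt * χt)⁻¹ * (φy' * χy')) * ((B / ht) / (B' / ht'))) •
      ![1, -(e / φt) * (hts' / ht')] := by
  have hd := sub_ne_zero.2 hty'
  set u := e * φy * (hy / hys) with hu
  set ut := e * χy * (hy / hys)⁻¹ with hut
  set b := -(e / φt) * (hts / ht) with hb
  set b' := -(e / φt) * (hts' / ht') with hb'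
  set V := V₀ * (B / D * (D' / B')) with hVd
  set lam := (φt * χt)⁻¹ with hlam
  set p := (φt - φy) / φt * (A * B) / (ht * hys) with hp
  set p' := (φt - φy') / φt * (A * B') / (ht' * hys) with hp'
  set r := e * ((χy - χt) / (χt * φt)) * (C * D) / (ht * hy) with hr
  set r' := e * ((χy' - χt) / (χt * φt)) * (C * D') / (ht' * hy) with hr'
  have hp1 : 1 + u * b = p := by
    have : u * b = -(φy * (hy * hts)) / (φt * ht * hys) := by
      simp only [hu, hb]; field_simp; linear_combination -hts * he
    rw [this, hp]; field_simp; linear_combination f1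
  have hp1' : 1 + φy' / φy * u * b' = p' := by
    have : φy' / φy * u * b' = -(φy' * (hy * hts')) / (φt * ht' * hys) := by
      simp only [hu, hb']; field_simp; linear_combination -(φy' * hts') * he
    rw [this, hp']; field_simp; linear_combination f2
  have hr1 : lam * ut + b = r := by
    simp only [hut, hb, hr, hlam]; field_simp; linear_combination e * f3
  have hr1' : lam * (χy' / χy * ut) + b' = r' := by
    simp only [hut, hb', hr', hlam]; field_simp; linear_combination e * f4
  have hp'0 : p' ≠ 0 := by
    simp only [hp']
    exact div_ne_zero (mul_ne_zero (div_ne_zero hd hφt) (mul_ne_zero nA nB')) (mul_ne_zero n4 n2)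
  have hVr : V * r * p' = p * r' := by
    simp only [hVd, hr, hr', hp, hp']
    field_simp
    linear_combination (-(B * D' * e * C)) * hV
  have hus : u * ut = φy * χy := by
    simp only [hu, hut]; field_simp; linear_combination he
  have hs : ((φt - φy) / (φt - φy') * (1 - lam * (φy' * χy')) * ((B / ht) / (B' / ht'))) =
      p * (1 - lam * (φy' * χy')) / p' := by
    simp only [hp, hp']; field_simp
  have row0 : p + φy' / φy * (-1) * u * V * r = p * (1 - lam * (φy' * χy')) / p' := by
    rw [eq_div_iff hp'0]
    have : φy' * χy' = (φy' / φy) * (χy' / χy) * (u * ut) := by rw [hus]; field_simp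
    rw [this]
    linear_combination (-(φy' / φy) * u) * hVr - p * hp1' + (φy' / φy) * u * p * hr1'
  have row1 : lam * ut * (-(χy' / χy)) * p + V * r = b' * (p * (1 - lam * (φy' * χy')) / p') := by
    rw [← row0]
    have hk : V * r * (1 + φy' / φy * u * b') = p * (lam * (χy' / χy * ut) + b') := by
      rw [hp1', hr1', hVr]
    linear_combination hk
  have hE : e * φy * (e * χy) = u * ut := by rw [hus]; linear_combination φy * χy * he
  rw [hs]
  ext i
  fin_cases i
  · simp only [classicalLax, Matrix.mulVec, dotProduct, Fin.sum_univ_two, Fin.zero_eta, Matrix.of_apply,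
      Matrix.cons_val', Matrix.cons_val_zero, Matrix.cons_val_one, Matrix.cons_val_fin_one,
      Pi.smul_apply, smul_eq_mul, mul_one]
    rw [← row0, ← hp1, ← hr1, mul_assoc lam, hE]
    simp only [← hu]
    ring
  · simp only [classicalLax, Matrix.mulVec, dotProduct, Fin.sum_univ_two, Fin.mk_one, Matrix.of_apply,
      Matrix.cons_val', Matrix.cons_val_zero, Matrix.cons_val_one, Matrix.cons_val_fin_one,
      Pi.smul_apply, smul_eq_mul, mul_one]
    rw [mul_comm _ b', ← row1, ← hp1, ← hr1, mul_assoc lam (e * φy), hE]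
    rw [mul_assoc lam (e * χy), ← hut]
    ring

theorem fay_ratio {g : ℕ} {P : Fin g → ℂ × ℂ} (F : Fin g → ℂ) {y t w w' : ℂ} (hy : Avoids P y)
    (ht : Avoids P t) (hw : Avoids P w) (hw' : Avoids P w') (hyw : y ≠ w) (htw : t ≠ w) :
    (t - w') / (t - w) * (H P (F * mob P y * (mob P w / mob P w')) * H P (F * mob P t)) -
      (y - w') / (y - w) * (H P (F * mob P y) * H P (F * mob P t * (mob P w / mob P w'))) =
    ((t - w') / (t - w) - (y - w') / (y - w)) *
      (H P (F * mob P y * mob P t / mob P w') * H P (F * mob P w)) := by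
  have h := fay (F / mob P w') hy hw ht hw'
  have e1 : F / mob P w' * mob P y * mob P w = F * mob P y * (mob P w / mob P w') := by
    ext j; simp only [Pi.mul_apply, Pi.div_apply]; ring
  have e2 : F / mob P w' * mob P t * mob P w' = F * mob P t := by
    ext j; have := hw'.mob_ne j; simp only [Pi.mul_apply, Pi.div_apply]; field_simp
  have e3 : F / mob P w' * mob P y * mob P t = F * mob P y * mob P t / mob P w' := by
    ext j; simp only [Pi.mul_apply, Pi.div_apply]; ring
  have e4 : F / mob P w' * mob P w * mob P w' = F * mob P w := by
    ext j; have := hw'.mob_ne j; simp only [Pi.mul_apply, Pi.div_apply]; field_simp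
  have e5 : F / mob P w' * mob P y * mob P w' = F * mob P y := by
    ext j; have := hw'.mob_ne j; simp only [Pi.mul_apply, Pi.div_apply]; field_simp
  have e6 : F / mob P w' * mob P w * mob P t = F * mob P t * (mob P w / mob P w') := by
    ext j; simp only [Pi.mul_apply, Pi.div_apply]; ring
  rw [e1, e2, e3, e4, e5, e6] at h
  have n1 := sub_ne_zero.2 hyw
  have n2 := sub_ne_zero.2 htw
  field_simp
  linear_combination h

end ClassicalStep

end

end BS

namespace BS

noncomputable section

open Filter Topology

section ClassicalTrace

variable {g : ℕ} {P : Fin g → ℂ × ℂ} {Y : Fin (g + 1) → ℂ × ℂ} {Z : Fin 2 → ℂ × ℂ}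

theorem continuous_H (P : Fin g → ℂ × ℂ) : Continuous (H P) := by
  unfold H
  refine Continuous.div_const ?_ _
  refine Continuous.matrix_det (continuous_matrix fun i j => ?_)
  simp only [Matrix.of_apply]
  fun_prop

theorem continuousAt_mob {a : ℂ} (h : Avoids P a) : ContinuousAt (mob P) a := by
  refine continuousAt_pi.2 fun j => ?_
  unfold mob
  exact (continuousAt_const.sub continuousAt_id).div (continuousAt_const.sub continuousAt_id)
    (sub_ne_zero.2 (h j).1)

theorem eventually_H_ne {a : ℂ} (h : Avoids P a) (F : Fin g → ℂ) (hF : H P (F * mob P a) ≠ 0) :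
    ∀ᶠ t in 𝓝 a, H P (F * mob P t) ≠ 0 := by
  have : ContinuousAt (fun t => H P (F * mob P t)) a :=
    (continuous_H P).continuousAt.comp (continuousAt_const.mul (continuousAt_mob h))
  exact this.eventually_ne hF

theorem eventually_avoids {a : ℂ} (h : Avoids P a) : ∀ᶠ t in 𝓝 a, Avoids P t := by
  refine eventually_all.2 fun j => ?_
  have h1 := (continuousAt_id (x := a)).eventually_ne (h j).1.symm
  have h2 := (continuousAt_id (x := a)).eventually_ne (h j).2.symm
  filter_upwards [h1, h2] with t h1 h2 using ⟨h1.symm, h2.symm⟩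

/-- The degree one function `(t - A') / (t - A)`. -/
def ratioAt (A : ℂ × ℂ) (t : ℂ) : ℂ := (t - A.1) / (t - A.2)

/-- The eigenvalue of the classical monodromy. -/
def spectralFactor (Y : Fin (g + 1) → ℂ × ℂ) (Z : Fin 2 → ℂ × ℂ) (t : ℂ) : ℂ :=
  ∏ n, (ratioAt (Z 0) t - ratioAt (Z 0) (Y n).2) / (ratioAt (Z 0) t - ratioAt (Z 0) (Y n).1) *
    (1 - (ratioAt (Z 0) t * ratioAt (Z 1) t)⁻¹ * (ratioAt (Z 0) (Y n).1 * ratioAt (Z 1) (Y n).1))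

theorem prod_mulVec {m : ℕ} (L : Fin m → Matrix (Fin 2) (Fin 2) ℂ) (s : Fin m → ℂ)
    (ψ : ℕ → Fin 2 → ℂ) (h : ∀ n : Fin m, (L n).mulVec (ψ (n + 1)) = s n • ψ n) :
    (List.ofFn L).prod.mulVec (ψ m) = (∏ n, s n) • ψ 0 := by
  induction m with
  | zero => simp
  | succ m ih =>
    rw [List.ofFn_succ', List.prod_concat, ← Matrix.mulVec_mulVec]
    have h1 := h (Fin.last m)
    simp only [Fin.val_last] at h1
    rw [h1, Matrix.mulVec_smul, ih _ _ fun n => h n.castSucc, smul_smul, Fin.prod_univ_castSucc, mul_comm]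

theorem trace_eq_of_eigenvector {M : Matrix (Fin 2) (Fin 2) ℂ} {Λ b : ℂ} (hΛ : Λ ≠ 0)
    (h : M.mulVec ![1, b] = Λ • ![1, b]) : M.trace = Λ + M.det / Λ := by
  have h0 := congrFun h 0
  have h1 := congrFun h 1
  simp only [Matrix.mulVec, dotProduct, Fin.sum_univ_two, Matrix.cons_val_zero, Matrix.cons_val_one,
    Matrix.cons_val_fin_one, Pi.smul_apply, smul_eq_mul, mul_one] at h0 h1
  rw [Matrix.trace_fin_two, Matrix.det_fin_two]
  field_simp
  linear_combination (Λ - M 1 1) * h0 + M 0 1 * h1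

theorem det_classicalLax {lam U Ut V K Kt x : ℂ} (hx : x ≠ 0) :
    (classicalLax lam U Ut V K Kt x).det = V * ((1 - lam * U * Ut) * (1 - lam * U * Ut * K * Kt)) := by
  rw [classicalLax, Matrix.det_fin_two_of]
  field_simp
  ring

theorem prod_ofFn_det {m : ℕ} (L : Fin m → Matrix (Fin 2) (Fin 2) ℂ) :
    (List.ofFn L).prod.det = ∏ n, (L n).det := by
  rw [← Matrix.coe_detMonoidHom, map_list_prod, List.map_ofFn, List.prod_ofFn]
  rfl

theorem spectral_identity {y y' t a a' b b' : ℂ} (h1 : t ≠ a) (h2 : t ≠ b) (h3 : y ≠ a) (h4 : y ≠ b)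
    (h5 : y' ≠ a) (h6 : y' ≠ b) :
    ((y' - b') / (y' - b) - (t - b') / (t - b)) * ((t - a') / (t - a) - (y - a') / (y - a)) =
      ((t - a') / (t - a) - (y' - a') / (y' - a)) * crossRatio y' y a b *
        ((y - b') / (y - b) - (t - b') / (t - b)) := by
  have := sub_ne_zero.2 h1
  have := sub_ne_zero.2 h2
  have := sub_ne_zero.2 h3
  have := sub_ne_zero.2 h4
  have := sub_ne_zero.2 h5
  have := sub_ne_zero.2 h6
  rw [crossRatio]
  field_simp
  ring

theorem ratioAt_sub_ne {A : ℂ × ℂ} {s t : ℂ} (hA : A.1 ≠ A.2) (hs : s ≠ A.2) (ht : t ≠ A.2) (hst : s ≠ t) :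
    ratioAt A s ≠ ratioAt A t := by
  rw [ratioAt, ratioAt, ne_eq, div_eq_div_iff (sub_ne_zero.2 hs) (sub_ne_zero.2 ht)]
  intro h
  have : (s - t) * (A.1 - A.2) = 0 := by linear_combination h
  exact (mul_ne_zero (sub_ne_zero.2 hst) (sub_ne_zero.2 hA)) this

/-- The trace of the classical monodromy on the spectral curve. -/
theorem eventually_classicalTrace {N : ℕ} (hYZ : AdmissiblePoints Y Z) (hP : IsSolutionSystem Y Z P)
    {c : LaxScalars g} (hc : c.IsCrossRatioParam N Y Z) {f : Fin g → ℂ}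
    (hX : ∀ n, centreX Y Z P f n ≠ 0) (hZ : ∀ n, centreZ Y Z P f n ≠ 0) :
    ∀ᶠ t in 𝓝[≠] (Z 0).2, classicalTrace N c (centreX Y Z P f) (centreZ Y Z P f)
        (ratioAt (Z 0) t * ratioAt (Z 1) t)⁻¹ =
      spectralFactor Y Z t + (∏ n, (c.v n ^ N *
        ((1 - (ratioAt (Z 0) t * ratioAt (Z 1) t)⁻¹ * c.u n ^ N * c.ut n ^ N) *
        (1 - (ratioAt (Z 0) t * ratioAt (Z 1) t)⁻¹ * c.u n ^ N * c.ut n ^ N * c.κ n ^ N * c.κt n ^ N)))) /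
        spectralFactor Y Z t := by
  obtain ⟨hne1, hne2⟩ := centre_ne hP hX hZ
  have hd := hYZ.Z_distinct
  simp only [List.nodup_cons, List.mem_cons, List.not_mem_nil, or_false, not_or] at hd
  obtain ⟨⟨d1, d2, d3⟩, ⟨d4, d5⟩, d6, -⟩ := hd
  have hz0 := (hP.avoids_Z 0).2
  have hz0' := (hP.avoids_Z 0).1
  have ev1 : ∀ᶠ t in 𝓝 (Z 0).2, ∀ n : Fin (g + 2), H P (f * shiftI Y P n * mob P t) ≠ 0 :=
    eventually_all.2 fun n => eventually_H_ne hz0 _ (hne2 n (by omega)).1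
  have ev2 : ∀ᶠ t in 𝓝 (Z 0).2, ∀ n : Fin (g + 1),
      H P (f * shiftI Y P (n + 1) * mob P (Y n).2 / mob P (Z 0).1 * mob P t) ≠ 0 := by
    refine eventually_all.2 fun n => eventually_H_ne hz0 _ ?_
    have := (hne1 n).2
    rw [sigma_eq] at this
    rwa [div_mul_eq_mul_div, mul_div_assoc]
  have ev3 : ∀ᶠ t in 𝓝 (Z 0).2, t ≠ (Z 0).1 ∧ t ≠ (Z 1).1 ∧ t ≠ (Z 1).2 ∧
      ∀ n, t ≠ (Y n).1 ∧ t ≠ (Y n).2 := by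
    have hq : ∀ b, b ≠ (Z 0).2 → ∀ᶠ t in 𝓝 (Z 0).2, t ≠ b := fun b hb =>
      (continuousAt_id (x := (Z 0).2)).eventually_ne hb.symm
    filter_upwards [hq _ d1, hq _ (Ne.symm d4), hq _ (Ne.symm d5),
      eventually_all.2 fun n => (hq _ (hYZ.Y_ne_Z n 0).2.1).and (hq _ (hYZ.Y_ne_Z n 0).2.2.2)]
      with t h1 h2 h3 h4 using ⟨h1, h2, h3, h4⟩
  have ev4 : ∀ᶠ t in 𝓝 (Z 0).2, ∀ n, 1 - (ratioAt (Z 0) t * ratioAt (Z 1) t)⁻¹ *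
      (ratioAt (Z 0) (Y n).1 * ratioAt (Z 1) (Y n).1) ≠ 0 := by
    refine eventually_all.2 fun n => ?_
    have hcont : ContinuousAt (fun t => 1 - ((t - (Z 0).2) * (t - (Z 1).2)) / ((t - (Z 0).1) * (t - (Z 1).1)) *
      (ratioAt (Z 0) (Y n).1 * ratioAt (Z 1) (Y n).1)) (Z 0).2 := by
      refine continuousAt_const.sub (ContinuousAt.mul (ContinuousAt.div (by fun_prop) (by fun_prop) ?_)
        continuousAt_const)
      exact mul_ne_zero (sub_ne_zero.2 (Ne.symm d1)) (sub_ne_zero.2 d4)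
    have := hcont.eventually_ne (show _ ≠ (0 : ℂ) by simp)
    filter_upwards [this] with t ht
    have e : (ratioAt (Z 0) t * ratioAt (Z 1) t)⁻¹ =
        ((t - (Z 0).2) * (t - (Z 1).2)) / ((t - (Z 0).1) * (t - (Z 1).1)) := by
      rw [ratioAt, ratioAt, div_mul_div_comm, inv_div]
    rw [e]; exact ht
  filter_upwards [nhdsWithin_le_nhds ev1, nhdsWithin_le_nhds ev2, nhdsWithin_le_nhds ev3,
    nhdsWithin_le_nhds ev4, nhdsWithin_le_nhds (eventually_avoids hz0), self_mem_nhdsWithin]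
    with t h1 h2 h3 h4 hta htz
  have htz : t ≠ (Z 0).2 := htz
  have hrt0 : ratioAt (Z 0) t ≠ 0 := div_ne_zero (sub_ne_zero.2 h3.1) (sub_ne_zero.2 htz)
  have hrt1 : ratioAt (Z 1) t ≠ 0 := div_ne_zero (sub_ne_zero.2 h3.2.1) (sub_ne_zero.2 h3.2.2.1)
  set e : ℂ := -(-1) ^ N with he
  have hee : e * e = 1 := by
    rw [he, neg_mul_neg, ← mul_pow]; simp
  set q : ℕ → ℂ := fun n => H P (f * shiftI Y P n * mob P (Z 0).2) / H P (f * shiftI Y P n * mob P t)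
    with hq
  set ψ : ℕ → Fin 2 → ℂ := fun n => ![1, -(e / ratioAt (Z 0) t) *
    (H P (f * shiftI Y P n * mob P t * sigma P (Z 0)) / H P (f * shiftI Y P n * mob P t))] with hψ
  set L : Fin (g + 1) → Matrix (Fin 2) (Fin 2) ℂ := fun n =>
    classicalLax (ratioAt (Z 0) t * ratioAt (Z 1) t)⁻¹ (c.u n ^ N) (c.ut n ^ N)
      (c.v n ^ N * centreZ Y Z P f n) (c.κ n ^ N) (c.κt n ^ N) (centreX Y Z P f n) with hL
  set s : Fin (g + 1) → ℂ := fun n =>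
    (ratioAt (Z 0) t - ratioAt (Z 0) (Y n).2) / (ratioAt (Z 0) t - ratioAt (Z 0) (Y n).1) *
    (1 - (ratioAt (Z 0) t * ratioAt (Z 1) t)⁻¹ * (ratioAt (Z 0) (Y n).1 * ratioAt (Z 1) (Y n).1)) *
    (q (n + 1) / q n) with hs
  have step : ∀ n : Fin (g + 1), (L n).mulVec (ψ (n + 1)) = s n • ψ n := by
    intro n
    obtain ⟨y1, y2, y3, y4⟩ := hYZ.Y_ne_Z n 0
    obtain ⟨y5, y6, y7, y8⟩ := hYZ.Y_ne_Z n 1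
    obtain ⟨hay', hay⟩ := hP.avoids_Y n
    have hz1 := (hP.avoids_Z 1).2
    have hz1' := (hP.avoids_Z 1).1
    set F := f * shiftI Y P (n + 1) with hF
    set F' := f * shiftI Y P n with hF'
    have hFF : F' * mob P (Y n).1 = F * mob P (Y n).2 := by
      rw [hF', hF, hP.shiftI_eq n, sigma_eq]
      ext j
      have := hay'.mob_ne j
      simp only [Pi.mul_apply, Pi.div_apply]
      field_simp
    have f1 := fay_ratio F hay hta hz0 hz0' y4 htz
    have f2 := fay_ratio F' hay' hta hz0 hz0' y2 htz
    have f3 := fay_ratio F hay hta hz1' hz1 y7 h3.2.1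
    have f4 := fay_ratio F' hay' hta hz1' hz1 y5 h3.2.1
    rw [hFF] at f2 f4
    rw [← sigma_eq (P := P) (Z 0)] at f1 f2
    rw [← hP.sigma_Z_zero] at f3 f4
    have hA : H P (F * mob P (Y n).2 * mob P t / mob P (Z 0).1) ≠ 0 := by
      have := h2 n
      rwa [div_mul_eq_mul_div] at this
    have hinv : ∀ r, (r - (Z 1).2) / (r - (Z 1).1) = (ratioAt (Z 1) r)⁻¹ := fun r => by
      rw [ratioAt, inv_div]
    have hr0 : ∀ r, (r - (Z 0).1) / (r - (Z 0).2) = ratioAt (Z 0) r := fun r => rfl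
    rw [hr0, hr0] at f1 f2
    rw [hinv, hinv] at f3 f4
    have hx1 : ratioAt (Z 1) (Y n).2 ≠ 0 := div_ne_zero (sub_ne_zero.2 y7) (sub_ne_zero.2 y8)
    have hx1' : ratioAt (Z 1) (Y n).1 ≠ 0 := div_ne_zero (sub_ne_zero.2 y5) (sub_ne_zero.2 y6)
    have hφy : ratioAt (Z 0) (Y n).2 ≠ 0 := div_ne_zero (sub_ne_zero.2 y3) (sub_ne_zero.2 y4)
    have g3 : ratioAt (Z 1) (Y n).2 * (H P (F * mob P (Y n).2 * sigma P (Z 0)) * H P (F * mob P t)) -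
        ratioAt (Z 1) t * (H P (F * mob P (Y n).2) * H P (F * mob P t * sigma P (Z 0))) =
        (ratioAt (Z 1) (Y n).2 - ratioAt (Z 1) t) *
          (H P (F * mob P (Y n).2 * mob P t / mob P (Z 1).2) * H P (F * mob P (Z 1).1)) := by
      field_simp at f3
      linear_combination f3
    have g4 : ratioAt (Z 1) (Y n).1 * (H P (F * mob P (Y n).2 * sigma P (Z 0)) * H P (F' * mob P t)) -
        ratioAt (Z 1) t * (H P (F * mob P (Y n).2) * H P (F' * mob P t * sigma P (Z 0))) =
        (ratioAt (Z 1) (Y n).1 - ratioAt (Z 1) t) *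
          (H P (F * mob P (Y n).2 * mob P t / mob P (Z 1).2) * H P (F' * mob P (Z 1).1)) := by
      field_simp at f4
      linear_combination f4
    have main := classicalLax_mulVec (V₀ := crossRatio (Y n).1 (Y n).2 (Z 0).2 (Z 1).2) hee hφy hrt0 hx1 hrt1
      (ratioAt_sub_ne d1 htz y2 (h3.2.2.2 n).1)
      (spectral_identity htz h3.2.2.1 y4 y8 y2 y6) (hne1 n).1 (hne1 n).2 (h1 n.succ) (h1 n.castSucc) hA
      (hne2 n (by omega)).1 (hne2 (n + 1) (by omega)).2 f1 f2 g3 g4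
    simp only [hL, hψ, hs, hq]
    rw [hc.u_pow, hc.ut_pow, hc.v_pow, hc.κ_pow, hc.κt_pow, centreX_eq, centreZ_eq hP]
    have hκ : ∀ i, crossRatio (Y n).1 (Y n).2 (Z i).1 (Z i).2 =
        ratioAt (Z i) (Y n).1 / ratioAt (Z i) (Y n).2 := by
      intro i
      rw [crossRatio, ratioAt, ratioAt, div_div_div_eq]
    rw [hκ, hκ]
    exact main
  have hprod := prod_mulVec L s ψ step
  have hqne : ∀ n ≤ g + 1, q n ≠ 0 := fun n hn =>
    div_ne_zero (hne2 n hn).1 (h1 ⟨n, by omega⟩)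
  have hΛ : ∏ n, s n = spectralFactor Y Z t := by
    simp only [hs]
    rw [Finset.prod_mul_distrib, prod_div_telescope q hqne]
    have : q (g + 1) = q 0 := by
      simp only [hq, hP.shiftI_last, IsSolutionSystem.shiftI_zero]
    rw [this, div_self (hqne 0 (Nat.zero_le _)), mul_one, spectralFactor]
  have hψp : ψ (g + 1) = ψ 0 := by
    simp only [hψ, hP.shiftI_last, IsSolutionSystem.shiftI_zero]
  rw [hψp, hΛ] at hprod
  have hΛ0 : spectralFactor Y Z t ≠ 0 := by
    refine Finset.prod_ne_zero_iff.2 fun n _ => mul_ne_zero (div_ne_zero ?_ ?_) (h4 n)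
    · exact sub_ne_zero.2 (ratioAt_sub_ne d1 htz (hYZ.Y_ne_Z n 0).2.2.2 (h3.2.2.2 n).2)
    · exact sub_ne_zero.2 (ratioAt_sub_ne d1 htz (hYZ.Y_ne_Z n 0).2.1 (h3.2.2.2 n).1)
  rw [classicalTrace, trace_eq_of_eigenvector hΛ0 hprod, prod_ofFn_det]
  congr 2
  simp only [hL]
  rw [Finset.prod_congr rfl fun n _ => det_classicalLax (hX n)]
  rw [Finset.prod_mul_distrib, Finset.prod_mul_distrib, prod_centreZ hP hX hZ, mul_one,
    ← Finset.prod_mul_distrib]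

theorem classicalLax_eq_add (lam U Ut V K Kt x : ℂ) : classicalLax lam U Ut V K Kt x =
    !![1, U * x * (1 + K * V); 0, V] +
      lam • !![U * Ut * K * V, 0; Ut * x⁻¹ * (Kt + V), U * Ut * Kt] := by
  rw [classicalLax]
  ext i j
  fin_cases i <;> fin_cases j <;> simp <;> ring

/-- The trace of the classical monodromy is an invariant of the isospectral family. -/
theorem classicalTrace_eq {N : ℕ} (hYZ : AdmissiblePoints Y Z) (hP : IsSolutionSystem Y Z P)
    {c : LaxScalars g} (hc : c.IsCrossRatioParam N Y Z) {f : Fin g → ℂ}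
    (hX : ∀ n, centreX Y Z P f n ≠ 0) (hZ : ∀ n, centreZ Y Z P f n ≠ 0) (lam : ℂ) :
    classicalTrace N c (centreX Y Z P f) (centreZ Y Z P f) lam =
      classicalTrace N c (fun _ => 1) (fun _ => 1) lam := by
  have h0 : centreX Y Z P 0 = (fun _ => 1) ∧ centreZ Y Z P 0 = fun _ => 1 :=
    ⟨funext fun n => (centre_zero hYZ hP n).1, funext fun n => (centre_zero hYZ hP n).2⟩
  have ev1 := eventually_classicalTrace hYZ hP hc hX hZ
  have ev2 := eventually_classicalTrace hYZ hP hc (f := 0) (fun n => by rw [h0.1]; exact one_ne_zero)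
    (fun n => by rw [h0.2]; exact one_ne_zero)
  rw [h0.1, h0.2] at ev2
  have hpoly : ∀ x z : Fin (g + 1) → ℂ, ∃ p : ℕ → ℂ, ∀ lam, classicalTrace N c x z lam =
      ∑ k ∈ Finset.range (g + 2), lam ^ k * p k := by
    intro x z
    obtain ⟨p, hp⟩ := exists_coeff_prod_ofFn
      (fun n => !![1, c.u n ^ N * x n * (1 + c.κ n ^ N * (c.v n ^ N * z n)); 0, c.v n ^ N * z n])
      (fun n => !![c.u n ^ N * c.ut n ^ N * c.κ n ^ N * (c.v n ^ N * z n), 0;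
        c.ut n ^ N * (x n)⁻¹ * (c.κt n ^ N + c.v n ^ N * z n), c.u n ^ N * c.ut n ^ N * c.κt n ^ N])
    refine ⟨fun k => (p k).trace, fun lam => ?_⟩
    simp only [classicalTrace, classicalLax_eq_add, hp, Matrix.trace_sum, Matrix.trace_smul, smul_eq_mul]
  obtain ⟨p, hp⟩ := hpoly (centreX Y Z P f) (centreZ Y Z P f)
  obtain ⟨p', hp'⟩ := hpoly (fun _ => 1) (fun _ => 1)
  have hd := hYZ.Z_distinct
  simp only [List.nodup_cons, List.mem_cons, List.not_mem_nil, or_false, not_or] at hd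
  obtain ⟨⟨d1, d2, d3⟩, ⟨d4, d5⟩, d6, -⟩ := hd
  set r : ℂ → ℂ := fun t => (ratioAt (Z 0) t * ratioAt (Z 1) t)⁻¹ with hr
  have hinf : {μ : ℂ | classicalTrace N c (centreX Y Z P f) (centreZ Y Z P f) μ =
      classicalTrace N c (fun _ => 1) (fun _ => 1) μ}.Infinite := by
    intro hfin
    set S := {μ : ℂ | classicalTrace N c (centreX Y Z P f) (centreZ Y Z P f) μ =
      classicalTrace N c (fun _ => 1) (fun _ => 1) μ} with hS
    have hcont : Tendsto r (𝓝 (Z 0).2) (𝓝 0) := by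
      have hcont : ContinuousAt (fun t => ((t - (Z 0).2) * (t - (Z 1).2)) /
          ((t - (Z 0).1) * (t - (Z 1).1))) (Z 0).2 := by
        refine ContinuousAt.div (by fun_prop) (by fun_prop) ?_
        exact mul_ne_zero (sub_ne_zero.2 (Ne.symm d1)) (sub_ne_zero.2 d4)
      have h := hcont.tendsto
      simp only [sub_self, zero_mul, zero_div] at h
      refine h.congr fun t => ?_
      simp only [hr, ratioAt]
      rw [div_mul_div_comm, inv_div]
    have hnh : (S \ {0})ᶜ ∈ 𝓝 (0 : ℂ) :=
      (hfin.subset Set.sdiff_subset).isClosed.isOpen_compl.mem_nhds (by simp)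
    have ev3 : ∀ᶠ t in 𝓝[≠] (Z 0).2, r t ∈ (S \ {0})ᶜ :=
      nhdsWithin_le_nhds (hcont.eventually hnh)
    have ev4 : ∀ᶠ t in 𝓝 (Z 0).2, t ≠ (Z 0).1 ∧ t ≠ (Z 1).1 ∧ t ≠ (Z 1).2 := by
      have hq : ∀ b, b ≠ (Z 0).2 → ∀ᶠ t in 𝓝 (Z 0).2, t ≠ b := fun b hb =>
        (continuousAt_id (x := (Z 0).2)).eventually_ne hb.symm
      filter_upwards [hq _ d1, hq _ (Ne.symm d4), hq _ (Ne.symm d5)] with t h1 h2 h3 using ⟨h1, h2, h3⟩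
    obtain ⟨t, ht1, ht2, ht3, ht4, ht5⟩ :=
      (ev1.and (ev2.and (ev3.and ((ev4.filter_mono nhdsWithin_le_nhds).and eventually_mem_nhdsWithin)))).exists
    have ht5 : t ≠ (Z 0).2 := ht5
    refine ht3 ⟨?_, ?_⟩
    · change classicalTrace N c _ _ _ = classicalTrace N c _ _ _
      rw [ht1, ht2]
    · simp only [hr, Set.mem_singleton_iff, inv_eq_zero, mul_eq_zero, not_or, ratioAt, div_eq_zero_iff,
        sub_eq_zero]
      exact ⟨⟨ht4.1, ht5⟩, ht4.2.1, ht4.2.2⟩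
  have := eq_zero_of_infinite_zeros (I := Unit) (J := Unit) (m := g + 2)
    (fun k => Matrix.of fun _ _ => p k - p' k) hinf (fun μ hμ => by
      ext i j
      simp only [Matrix.sum_apply, Matrix.smul_apply, Matrix.of_apply, smul_eq_mul, mul_sub,
        Finset.sum_sub_distrib, ← hp, ← hp', Matrix.zero_apply]
      exact sub_eq_zero.2 hμ) lam
  have h2 := congrFun (congrFun this ()) ()
  simp only [Matrix.sum_apply, Matrix.smul_apply, Matrix.of_apply, smul_eq_mul, mul_sub,
    Finset.sum_sub_distrib, ← hp, ← hp', Matrix.zero_apply] at h2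
  exact sub_eq_zero.1 h2

end ClassicalTrace

end

end BS

namespace BS

noncomputable section

open Filter Topology

section Liouville

/-- A bounded holomorphic function on the complement of a finite set is constant. -/
theorem apply_eq_apply_of_bounded_of_finite {S : Set ℂ} (hS : S.Finite) :
    ∀ {φ : ℂ → ℂ} {B : ℝ}, DifferentiableOn ℂ φ Sᶜ → (∀ s ∈ Sᶜ, ‖φ s‖ ≤ B) →
      ∀ {s t : ℂ}, s ∈ Sᶜ → t ∈ Sᶜ → φ s = φ t := by
  induction S, hS using Set.Finite.induction_on with
  | empty =>
    intro φ B hd hB s t _ _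
    rw [Set.compl_empty, differentiableOn_univ] at hd
    refine hd.apply_eq_apply_of_bounded ?_ s t
    refine (isBounded_iff_forall_norm_le.2 ⟨B, ?_⟩)
    rintro _ ⟨x, rfl⟩
    exact hB x (by simp)
  | insert ha hS ih =>
    rename_i a S
    intro φ B hd hB s t hs ht
    have hset : Sᶜ \ {a} = (insert a S)ᶜ := by
      ext x; simp [not_or, and_comm]
    set ψ := Function.update φ a (limUnder (𝓝[≠] a) φ) with hψ
    have hψd : DifferentiableOn ℂ ψ Sᶜ := by
      refine Complex.differentiableOn_update_limUnder_of_bddAbove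
        (hS.isClosed.isOpen_compl.mem_nhds ha) (hset ▸ hd) ?_
      refine ⟨B, ?_⟩
      rintro _ ⟨x, hx, rfl⟩
      exact hB x (hset ▸ hx)
    have hψb : ∀ x ∈ Sᶜ, ‖ψ x‖ ≤ max B ‖ψ a‖ := by
      intro x hx
      by_cases hxa : x = a
      · rw [hxa]; exact le_max_right _ _
      · rw [hψ, Function.update_of_ne hxa]
        exact (hB x (hset ▸ ⟨hx, hxa⟩)).trans (le_max_left _ _)
    rw [← hset] at hs ht
    have := ih hψd hψb hs.1 ht.1
    rwa [hψ, Function.update_of_ne hs.2, Function.update_of_ne ht.2] at this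

theorem exists_eigenvector_of_mem_roots {ι : Type*} [Fintype ι] [DecidableEq ι] {M : Matrix ι ι ℂ}
    {t : ℂ} (ht : t ∈ M.charpoly.roots) : ∃ v, v ≠ 0 ∧ M.mulVec v = t • v := by
  have h := (Polynomial.mem_roots'.1 ht).2
  rw [Polynomial.IsRoot, Matrix.eval_charpoly] at h
  obtain ⟨v, hv, hv'⟩ := Matrix.exists_mulVec_eq_zero_iff.2 h
  refine ⟨v, hv, ?_⟩
  rw [Matrix.sub_mulVec, sub_eq_zero] at hv'
  rw [← hv']
  simp

theorem norm_eval_charpoly_le {ι : Type*} [Fintype ι] [DecidableEq ι] {M : Matrix ι ι ℂ} {b : ℝ}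
    (hM : ∀ t : ℂ, (∃ v, v ≠ 0 ∧ M.mulVec v = t • v) → ‖t‖ ≤ b) (z : ℂ) :
    ‖M.charpoly.eval z‖ ≤ (‖z‖ + b) ^ Fintype.card ι := by
  have hs := IsAlgClosed.splits M.charpoly
  have hcard : M.charpoly.roots.card = Fintype.card ι := by
    rw [← hs.natDegree_eq_card_roots, Matrix.charpoly_natDegree_eq_dim]
  rw [hs.eval_eq_prod_roots_of_monic M.charpoly_monic, ← hcard]
  have : ∀ R : Multiset ℂ, (∀ t ∈ R, ‖t‖ ≤ b) → ‖(R.map fun t => z - t).prod‖ ≤ (‖z‖ + b) ^ R.card := by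
    intro R
    induction R using Multiset.induction_on with
    | empty => simp
    | cons a R ih =>
      intro h
      rw [Multiset.map_cons, Multiset.prod_cons, norm_mul, Multiset.card_cons, pow_succ']
      have hb := h a (Multiset.mem_cons_self a R)
      refine mul_le_mul ((norm_sub_le _ _).trans (by gcongr))
        (ih fun t ht => h t (Multiset.mem_cons_of_mem ht)) (norm_nonneg _) ?_
      exact add_nonneg (norm_nonneg z) ((norm_nonneg a).trans hb)
  exact this _ fun t ht => hM t (exists_eigenvector_of_mem_roots ht)

end Liouville

section Differentiability

variable {N : ℕ} [NeZero N] {g : ℕ}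

theorem differentiableAt_det {ι : Type*} [Fintype ι] [DecidableEq ι] {M : ℂ → Matrix ι ι ℂ} {s : ℂ}
    (h : ∀ i j, DifferentiableAt ℂ (fun s => M s i j) s) : DifferentiableAt ℂ (fun s => (M s).det) s := by
  simp only [Matrix.det_apply]
  refine DifferentiableAt.fun_sum fun σ _ => ?_
  refine DifferentiableAt.const_smul ?_ _
  exact DifferentiableAt.fun_finsetProd fun i _ => h _ _

theorem differentiableAt_prod_ofFn {I J : Type*} [Fintype I] [DecidableEq I] [Fintype J] [DecidableEq J]
    {m : ℕ} {L : ℂ → Fin m → Matrix I I (Matrix J J ℂ)} {s : ℂ}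
    (h : ∀ n i j a b, DifferentiableAt ℂ (fun s => L s n i j a b) s) (i j : I) (a b : J) :
    DifferentiableAt ℂ (fun s => (List.ofFn (L s)).prod i j a b) s := by
  induction m generalizing i a with
  | zero => simp
  | succ m ih =>
    simp only [List.ofFn_succ, List.prod_cons, Matrix.mul_apply, Matrix.sum_apply]
    refine DifferentiableAt.fun_sum fun k _ => DifferentiableAt.fun_sum fun d _ => ?_
    exact (h _ _ _ _ _).mul (ih (fun n => h n.succ) _ _)

theorem differentiableAt_transfer (c : LaxScalars g) {α β : Fin (g + 1) → ℂ → ℂ} {s : ℂ}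
    (hα : ∀ n, DifferentiableAt ℂ (α n) s) (hβ : ∀ n, DifferentiableAt ℂ (β n) s)
    (hα0 : ∀ n, α n s ≠ 0) (ξ : ℂ) (a b : Fin (g + 1) → ZMod N) :
    DifferentiableAt ℂ (fun s => transfer c (fun n => α n s • clock N) (fun n => β n s • shift N) ξ a b)
      s := by
  simp only [transfer, Matrix.trace, Matrix.diag_apply, Matrix.sum_apply, monodromy]
  refine DifferentiableAt.fun_sum fun i _ => differentiableAt_prod_ofFn (fun n i j a b => ?_) _ _ _ _
  simp only [Matrix.map_apply, siteOp_apply]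
  split_ifs
  · have hinv : ∀ s, (α n s • clock N)⁻¹ = (α n s)⁻¹ • (clock N)⁻¹ := by
      intro s
      by_cases h0 : α n s = 0
      · simp [h0]
      · have := Matrix.inv_smul' (Units.mk0 _ h0) (A := clock N)
          ((Matrix.isUnit_iff_isUnit_det _).1 isUnit_clock)
        simpa [Units.smul_def] using this
    have hα1 := hα n
    have hβ1 := hβ n
    have hα2 := hα1.inv (hα0 n)
    have hα3 : DifferentiableAt ℂ (fun s => (α n s)⁻¹) s := hα2
    fin_cases i <;> fin_cases j
    · simp [lax]
      fun_prop
    · simp [lax, Matrix.mul_apply]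
      fun_prop
    · simp [lax, hinv, Matrix.mul_apply]
      fun_prop
    · simp [lax]
      fun_prop
  · exact differentiableAt_const _

end Differentiability

end

end BS

namespace BS

noncomputable section

open Filter Topology

section Isospectral

variable {N : ℕ} [NeZero N] {g : ℕ}

theorem clock_pow : clock N ^ N = 1 := by
  rw [clock_eq, Matrix.diagonal_pow, ← Matrix.diagonal_one]
  congr 1
  ext a
  exact chi_pow (omega_pow N) a

theorem shift_pow_apply (k : ℕ) (a b : ZMod N) : (shift N ^ k) a b = if a = b + k then 1 else 0 := by
  induction k generalizing b with
  | zero => simp [Matrix.one_apply]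
  | succ k ih =>
    rw [pow_succ, Matrix.mul_apply]
    rw [Finset.sum_eq_single (b + 1)]
    · rw [ih]
      simp only [shift, Matrix.of_apply, if_true, Nat.cast_add, Nat.cast_one, mul_one]
      rw [show b + 1 + (k : ZMod N) = b + (k + 1) by ring]
    · intro x _ hx; simp [shift, hx]
    · simp

theorem shift_pow : shift N ^ N = 1 := by
  ext a b
  rw [shift_pow_apply]
  simp [Matrix.one_apply]

theorem clock_mul_shift : clock N * shift N = omega N • (shift N * clock N) := by
  ext a b
  rw [Matrix.smul_apply, clock_eq, Matrix.diagonal_mul, Matrix.mul_diagonal, shift, Matrix.of_apply]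
  split_ifs with h
  · rw [h, chi_add (omega_pow N), chi_one (omega_pow N)]; simp [mul_comm]
  · simp

theorem isWeylChain_clock_shift {α β : Fin (g + 1) → ℂ} (hα : ∀ n, α n ≠ 0) :
    IsWeylChain (fun n => α n • clock N) (fun n => β n • shift N) (fun n => α n ^ N)
      (fun n => β n ^ N) where
  weyl n := by
    rw [smul_mul_smul_comm, smul_mul_smul_comm, clock_mul_shift, smul_comm, mul_comm (α n)]
  X_pow n := by rw [smul_pow, clock_pow]
  Z_pow n := by rw [smul_pow, shift_pow]
  X_ne n := pow_ne_zero N (hα n)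

theorem exists_root {N : ℕ} [NeZero N] (x : ℂ) : ∃ y : ℂ, y ^ N = x :=
  IsAlgClosed.exists_pow_nat_eq x (NeZero.pos N)

/-- A local holomorphic branch of an `N`-th root. -/
theorem exists_local_root {φ : ℂ → ℂ} {s : ℂ} (hφ : ∀ᶠ t in 𝓝 s, DifferentiableAt ℂ φ t)
    (h0 : φ s ≠ 0) : ∃ ρ : ℂ → ℂ, DifferentiableAt ℂ ρ s ∧ ∀ᶠ t in 𝓝 s, ρ t ^ N = φ t := by
  obtain ⟨r, hr⟩ := exists_root (N := N) (φ s)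
  refine ⟨fun t => r * Complex.exp (Complex.log (φ t / φ s) / N), ?_, ?_⟩
  · have h1 : DifferentiableAt ℂ (fun t => φ t / φ s) s := hφ.self_of_nhds.div_const _
    have h2 : (fun t => φ t / φ s) s ∈ Complex.slitPlane := by
      simp [div_self h0]
    exact ((h1.clog h2).div_const _).cexp.const_mul _
  · filter_upwards [hφ.self_of_nhds.continuousAt.eventually_ne h0] with t ht
    rw [mul_pow, hr, ← Complex.exp_nat_mul, mul_div_cancel₀ _ (Nat.cast_ne_zero.2 (NeZero.ne N)),
      Complex.exp_log (div_ne_zero ht h0), mul_div_cancel₀ _ h0]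

variable {P : Fin g → ℂ × ℂ} {Y : Fin (g + 1) → ℂ × ℂ} {Z : Fin 2 → ℂ × ℂ}

theorem differentiable_H_smul (P : Fin g → ℂ × ℂ) (F : Fin g → ℂ) :
    Differentiable ℂ fun s : ℂ => H P (s • F) := by
  intro s
  unfold H
  refine DifferentiableAt.div_const (differentiableAt_det fun i j => ?_) _
  simp only [Matrix.of_apply, Pi.smul_apply, smul_eq_mul]
  fun_prop

theorem finite_zeros_H_smul (hP : Function.Injective fun j => (P j).2) (F : Fin g → ℂ) :
    {s : ℂ | H P (s • F) = 0}.Finite := by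
  set p : Polynomial ℂ := (Matrix.of fun i j : Fin g => Polynomial.C ((P j).2 ^ (i : ℕ)) -
    Polynomial.X * Polynomial.C (F j * (P j).1 ^ (i : ℕ))).det with hp
  have he : ∀ s, p.eval s =
      (Matrix.of fun i j : Fin g => (P j).2 ^ (i : ℕ) - (s • F) j * (P j).1 ^ (i : ℕ)).det := by
    intro s
    rw [hp, ← Polynomial.coe_evalRingHom, RingHom.map_det]
    congr 1
    ext i j
    simp [mul_assoc]
  have hH : ∀ s, H P (s • F) =
      p.eval s / ∏ i : Fin g, ∏ j ∈ Finset.Ioi i, ((P j).2 - (P i).2) := fun s => by rw [he]; rfl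
  have h0 := hH 0
  rw [zero_smul, H_zero hP] at h0
  have hp0 : p ≠ 0 := by
    intro h; rw [h] at h0; simp at h0
  have hV : ∏ i : Fin g, ∏ j ∈ Finset.Ioi i, ((P j).2 - (P i).2) ≠ 0 := by
    intro h; rw [h] at h0; simp at h0
  refine (Polynomial.finite_setOfPred_isRoot hp0).subset fun s hs => ?_
  have : H P (s • F) = 0 := hs
  rw [hH, div_eq_zero_iff] at this
  exact this.resolve_right hV

/-- The characteristic polynomial of the transfer matrix is constant on the isospectral family. -/
theorem charpoly_transfer_eq (hYZ : AdmissiblePoints Y Z) (hP : IsSolutionSystem Y Z P)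
    {c : LaxScalars g} (hc : c.IsCrossRatioParam N Y Z) {f : Fin g → ℂ}
    {Xop Zop : Fin (g + 1) → Matrix (ZMod N) (ZMod N) ℂ} (hW : IsWeylFamily Y Z P f Xop Zop) (ξ : ℂ) :
    (transfer c Xop Zop ξ).charpoly =
      (transfer c (fun _ => clock N) (fun _ => shift N) ξ).charpoly := by
  have hinj := hP.injective hYZ
  choose ρ hρ using exists_root (N := N)
  set cx : Fin (g + 1) → ℂ → ℂ := fun n s => centreX Y Z P (s • f) n with hcx
  set cz : Fin (g + 1) → ℂ → ℂ := fun n s => centreZ Y Z P (s • f) n with hcz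
  set S : Set ℂ := {s | ∃ n, cx n s = 0} ∪ {s | ∃ n, cz n s = 0} with hS
  have hSfin : S.Finite := by
    have hz := finite_zeros_H_smul (P := P) hinj
    refine Set.Finite.union ?_ ?_
    · rw [Set.ofPred_exists]
      refine Set.finite_iUnion fun n => ?_
      refine ((hz (f * shiftI Y P (n + 1) * mob P (Y n).2)).union
        (hz (f * shiftI Y P (n + 1) * mob P (Y n).2 * sigma P (Z 0)))).subset ?_
      intro s hs
      have hs : centreX Y Z P (s • f) n = 0 := hs
      rw [centreX_eq, div_eq_zero_iff] at hs
      simp only [smul_mul_assoc] at hs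
      exact hs
    · rw [Set.ofPred_exists]
      refine Set.finite_iUnion fun n => ?_
      refine (((hz (f * shiftI Y P (n + 1) * mob P (Z 0).2)).union
        (hz (f * shiftI Y P (n + 1) * mob P (Z 1).1))).union
        ((hz (f * shiftI Y P n * mob P (Z 1).1)).union
          (hz (f * shiftI Y P n * mob P (Z 0).2)))).subset ?_
      intro s hs
      have hs : centreZ Y Z P (s • f) n = 0 := hs
      rw [centreZ_eq hP, mul_eq_zero, div_eq_zero_iff, div_eq_zero_iff] at hs
      simp only [smul_mul_assoc] at hs
      exact hs
  have hgood : ∀ s ∈ Sᶜ, (∀ n, cx n s ≠ 0) ∧ ∀ n, cz n s ≠ 0 := by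
    intro s hs
    simp only [hS, Set.mem_compl_iff, Set.mem_union, Set.mem_ofPred_eq, not_or, not_exists] at hs
    exact hs
  have h0 : (0 : ℂ) ∈ Sᶜ := by
    simp only [hS, hcx, hcz, Set.mem_compl_iff, Set.mem_union, Set.mem_ofPred_eq, not_or, not_exists,
      zero_smul]
    exact ⟨fun n => by rw [(centre_zero hYZ hP n).1]; exact one_ne_zero,
      fun n => by rw [(centre_zero hYZ hP n).2]; exact one_ne_zero⟩
  have h1 : (1 : ℂ) ∈ Sᶜ := by
    simp only [hS, hcx, hcz, Set.mem_compl_iff, Set.mem_union, Set.mem_ofPred_eq, not_or, not_exists,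
      one_smul]
    exact ⟨hW.X_ne, hW.Z_ne⟩
  -- the family, with arbitrary roots
  set T : ℂ → Matrix (Fin (g + 1) → ZMod N) (Fin (g + 1) → ZMod N) ℂ := fun s =>
    transfer c (fun n => ρ (cx n s) • clock N) (fun n => ρ (cz n s) • shift N) ξ with hT
  have hρ0 : ∀ x, x ≠ 0 → ρ x ≠ 0 := fun x hx h => hx (by
    rw [← hρ x, h, zero_pow (NeZero.ne N)])
  have hchain : ∀ s ∈ Sᶜ, IsWeylChain (fun n => ρ (cx n s) • clock N) (fun n => ρ (cz n s) • shift N)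
      (centreX Y Z P (s • f)) (centreZ Y Z P (s • f)) := by
    intro s hs
    have := isWeylChain_clock_shift (N := N) (α := fun n => ρ (cx n s)) (β := fun n => ρ (cz n s))
      fun n => hρ0 _ ((hgood s hs).1 n)
    simpa only [hρ] using this
  obtain ⟨b, hb0, hb⟩ := exists_bound_eigenvalue (N := N) c
    (classicalTrace N c (fun _ => 1) (fun _ => 1)) ξ
  have hbound : ∀ z, ∀ s ∈ Sᶜ, ‖(T s).charpoly.eval z‖ ≤
      (‖z‖ + b) ^ Fintype.card (Fin (g + 1) → ZMod N) := by
    intro z s hs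
    obtain ⟨hX, hZ⟩ := hgood s hs
    refine norm_eval_charpoly_le (fun t ht => ?_) z
    exact hb _ _ _ _ (hchain s hs) (prod_centreZ hP hX hZ)
      (fun lam => classicalTrace_eq hYZ hP hc hX hZ lam) t ht
  have hdx : ∀ s ∈ Sᶜ, ∀ n, DifferentiableAt ℂ (cx n) s ∧ DifferentiableAt ℂ (cz n) s := by
    intro s hs n
    obtain ⟨hX, hZ⟩ := hgood s hs
    obtain ⟨k1, k2⟩ := centre_ne hP hX hZ
    have hdH := differentiable_H_smul P
    constructor
    · simp only [hcx, centreX_eq, smul_mul_assoc]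
      have := (k1 n).2
      simp only [smul_mul_assoc] at this
      exact (hdH _ s).div (hdH _ s) this
    · simp only [hcz, centreZ_eq hP, smul_mul_assoc]
      have n1 := (k2 (n + 1) (by omega)).2
      have n2 := (k2 n (by omega)).1
      simp only [smul_mul_assoc] at n1 n2
      exact ((hdH _ s).div (hdH _ s) n1).mul ((hdH _ s).div (hdH _ s) n2)
  have hopen : IsOpen Sᶜ := hSfin.isClosed.isOpen_compl
  have hdiff : ∀ z, DifferentiableOn ℂ (fun s => (T s).charpoly.eval z) Sᶜ := by
    intro z s hs
    refine DifferentiableAt.differentiableWithinAt ?_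
    have hev : ∀ᶠ t in 𝓝 s, t ∈ Sᶜ := hopen.mem_nhds hs
    choose α hα hα' using fun n => exists_local_root (N := N) (φ := cx n) (s := s)
      (hev.mono fun t ht => (hdx t ht n).1) ((hgood s hs).1 n)
    choose β hβ hβ' using fun n => exists_local_root (N := N) (φ := cz n) (s := s)
      (hev.mono fun t ht => (hdx t ht n).2) ((hgood s hs).2 n)
    have hα0 : ∀ n, α n s ≠ 0 := fun n h => (hgood s hs).1 n (by
      rw [← (hα' n).self_of_nhds, h, zero_pow (NeZero.ne N)])
    have heq : (fun s => (T s).charpoly.eval z) =ᶠ[𝓝 s] fun t => (Matrix.scalar _ z -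
        transfer c (fun n => α n t • clock N) (fun n => β n t • shift N) ξ).det := by
      filter_upwards [hev, eventually_all.2 hα', eventually_all.2 hβ'] with t ht h1 h2
      rw [(hchain t ht).charpoly_transfer (hgood t ht).2 c h1 h2 ξ, Matrix.eval_charpoly]
    refine DifferentiableAt.congr_of_eventuallyEq ?_ heq
    refine differentiableAt_det fun i j => ?_
    simp only [Matrix.sub_apply]
    exact (differentiableAt_const _).sub (differentiableAt_transfer c hα hβ hα0 ξ i j)
  have hconst : (T 1).charpoly = (T 0).charpoly := by
    refine Polynomial.funext fun z => ?_
    exact apply_eq_apply_of_bounded_of_finite hSfin (hdiff z) (hbound z) h1 h0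
  have hWc : IsWeylChain Xop Zop (centreX Y Z P f) (centreZ Y Z P f) :=
    ⟨hW.weyl, hW.X_pow, hW.Z_pow, hW.X_ne⟩
  have e1 : (transfer c Xop Zop ξ).charpoly = (T 1).charpoly := by
    refine hWc.charpoly_transfer hW.Z_ne c (fun n => ?_) (fun n => ?_) ξ
    · rw [hρ]; simp only [hcx, one_smul]
    · rw [hρ]; simp only [hcz, one_smul]
  have e0 : (transfer c (fun _ => clock N) (fun _ => shift N) ξ).charpoly = (T 0).charpoly := by
    have hw : IsWeylChain (fun _ : Fin (g + 1) => clock N) (fun _ => shift N) (fun _ => (1 : ℂ))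
        (fun _ => (1 : ℂ)) := by
      have := isWeylChain_clock_shift (N := N) (g := g) (α := fun _ => 1) (β := fun _ => 1)
        fun _ => one_ne_zero
      simpa using this
    refine hw.charpoly_transfer (fun _ => one_ne_zero) c (fun n => ?_) (fun n => ?_) ξ
    · rw [hρ]; simp only [hcx, zero_smul, (centre_zero hYZ hP n).1]
    · rw [hρ]; simp only [hcz, zero_smul, (centre_zero hYZ hP n).2]
  rw [e1, hconst, e0]

end Isospectral

end

end BS

namespace BS

noncomputable section

open Filter Polynomial

section Generic

/-- The coordinates of a point of the space of parameters. -/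
def coords {ι κ : Type} (x : (ι → ℂ × ℂ) × (κ → ℂ)) : (ι × Bool) ⊕ κ → ℂ :=
  Sum.elim (fun i : ι × Bool => if i.2 then (x.1 i.1).1 else (x.1 i.1).2) x.2

/-- An ultrafilter of parameters that lies outside of all the hypersurfaces. -/
def IsGenericUltrafilter {ι κ : Type} (U : Ultrafilter ((ι → ℂ × ℂ) × (κ → ℂ))) : Prop :=
  ∀ D : MvPolynomial ((ι × Bool) ⊕ κ) ℂ, D ≠ 0 → ∀ᶠ x in (U : Filter ((ι → ℂ × ℂ) × (κ → ℂ))), D.eval (coords x) ≠ 0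

/-- A property is generic if it holds along all generic ultrafilters. -/
theorem generically_of_ultrafilter {ι κ : Type} {p : (ι → ℂ × ℂ) → (κ → ℂ) → Prop}
    (h : ∀ U : Ultrafilter ((ι → ℂ × ℂ) × (κ → ℂ)), IsGenericUltrafilter U →
      ∀ᶠ x in (U : Filter ((ι → ℂ × ℂ) × (κ → ℂ))), p x.1 x.2) : Generically ι κ p := by
  by_contra hp
  simp only [Generically, not_exists, not_and, not_forall] at hp
  set S : {D : MvPolynomial ((ι × Bool) ⊕ κ) ℂ // D ≠ 0} → Set ((ι → ℂ × ℂ) × (κ → ℂ)) :=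
    fun D => {x | D.1.eval (coords x) ≠ 0 ∧ ¬ p x.1 x.2} with hS
  have hne : (⨅ D, 𝓟 (S D)).NeBot := by
    have : Nonempty {D : MvPolynomial ((ι × Bool) ⊕ κ) ℂ // D ≠ 0} := ⟨⟨1, one_ne_zero⟩⟩
    refine iInf_neBot_of_directed' ?_ fun D => ?_
    · intro D E
      refine ⟨⟨D.1 * E.1, mul_ne_zero D.2 E.2⟩, ?_, ?_⟩
      · refine principal_mono.2 fun x hx => ⟨fun h0 => hx.1 ?_, hx.2⟩
        simp [h0]
      · refine principal_mono.2 fun x hx => ⟨fun h0 => hx.1 ?_, hx.2⟩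
        simp [h0]
    · obtain ⟨A, f, h1, h2⟩ := hp D.1 D.2
      exact principal_neBot_iff.2 ⟨(A, f), h1, h2⟩
  obtain ⟨U, hU⟩ := Ultrafilter.exists_le (⨅ D, 𝓟 (S D))
  have hmem : ∀ D, ∀ᶠ x in (U : Filter ((ι → ℂ × ℂ) × (κ → ℂ))), x ∈ S D := fun D =>
    (hU.trans (iInf_le _ D)) (mem_principal_self _)
  have h1 := h U fun D hD => (hmem ⟨D, hD⟩).mono fun x hx => hx.1
  obtain ⟨x, hx1, hx2⟩ := (h1.and (hmem ⟨1, one_ne_zero⟩)).exists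
  exact hx2.2 hx1

end Generic

section SystemPolynomial

variable {R : Type*} [CommRing R] {m : ℕ}

/-- The coefficients of the Möbius involution `a x y + b (x + y) + c = 0` that permutes
`A, C` and `B, D`. -/
def invA (A B C D : R) : R := A + C - (B + D)

/-- See `invA`. -/
def invB (A B C D : R) : R := B * D - A * C

/-- See `invA`. -/
def invC (A B C D : R) : R := (B + D) * (A * C) - (A + C) * (B * D)

/-- The denominator of the involution. -/
def invDen (A B C D : R) : R[X] :=
  Polynomial.C (invA A B C D) * X + Polynomial.C (invB A B C D)

/-- The numerator of the involution. -/
def invNum (A B C D : R) : R[X] :=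
  -(Polynomial.C (invB A B C D) * X + Polynomial.C (invC A B C D))

/-- The polynomial whose roots are the solutions of the system and the fixed points of the
involution. -/
def systemPoly (Y' Y : Fin m → R) (A B C D : R) : R[X] :=
  ∏ n, (invNum A B C D - Polynomial.C (Y' n) * invDen A B C D) * (X - Polynomial.C (Y n)) -
    ∏ n, (invNum A B C D - Polynomial.C (Y n) * invDen A B C D) * (X - Polynomial.C (Y' n))

/-- The difference of the products of the pairs at the preimage of infinity. -/
def systemLead (Y' Y : Fin m → R) (A B C D : R) : R :=
  ∏ n, (invB A B C D + Y' n * invA A B C D) - ∏ n, (invB A B C D + Y n * invA A B C D)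

theorem systemPoly_map {S : Type*} [CommRing S] (φ : R →+* S) (Y' Y : Fin m → R) (A B C D : R) :
    (systemPoly Y' Y A B C D).map φ =
      systemPoly (fun n => φ (Y' n)) (fun n => φ (Y n)) (φ A) (φ B) (φ C) (φ D) := by
  simp [systemPoly, invNum, invDen, invA, invB, invC, Polynomial.map_prod]

theorem systemLead_map {S : Type*} [CommRing S] (φ : R →+* S) (Y' Y : Fin m → R) (A B C D : R) :
    φ (systemLead Y' Y A B C D) =
      systemLead (fun n => φ (Y' n)) (fun n => φ (Y n)) (φ A) (φ B) (φ C) (φ D) := by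
  simp [systemLead, invA, invB]

theorem natDegree_systemPoly_le (Y' Y : Fin m → R) (A B C D : R) :
    (systemPoly Y' Y A B C D).natDegree ≤ 2 * m := by
  have h : ∀ y y' : R, ((invNum A B C D - Polynomial.C y * invDen A B C D) *
      (X - Polynomial.C y')).natDegree ≤ 2 := by
    intro y y'
    have e1 : (invNum A B C D - Polynomial.C y * invDen A B C D) =
        Polynomial.C (-(invB A B C D + y * invA A B C D)) * X +
          Polynomial.C (-(invC A B C D + y * invB A B C D)) := by
      simp only [invNum, invDen, map_neg, map_add, map_mul]; ring
    rw [e1]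
    refine (natDegree_mul_le).trans (add_le_add (natDegree_linear_le) (?_ : _ ≤ 1))
    exact (natDegree_sub_le _ _).trans (max_le natDegree_X_le (by simp))
  have hp : ∀ F : Fin m → R[X], (∀ n, (F n).natDegree ≤ 2) → (∏ n, F n).natDegree ≤ 2 * m := by
    intro F hF
    refine (natDegree_prod_le _ _).trans ((Finset.sum_le_sum fun n _ => hF n).trans ?_)
    simp [mul_comm]
  exact (natDegree_sub_le _ _).trans (max_le (hp _ fun n => h _ _) (hp _ fun n => h _ _))

theorem eval_systemPoly (Y' Y : Fin m → R) (A B C D t : R) :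
    (systemPoly Y' Y A B C D).eval t =
      ∏ n, (-(invB A B C D * t + invC A B C D) - Y' n * (invA A B C D * t + invB A B C D)) * (t - Y n) -
      ∏ n, (-(invB A B C D * t + invC A B C D) - Y n * (invA A B C D * t + invB A B C D)) *
        (t - Y' n) := by
  simp [systemPoly, invNum, invDen, eval_prod]

end SystemPolynomial

end

end BS

namespace BS

noncomputable section

open Filter Polynomial

section Regular

variable {g : ℕ}

/-- The polynomial of the system for the pairs `(P', P)`. -/
def pairPoly (Y : Fin (g + 1) → ℂ × ℂ) (Z : Fin 2 → ℂ × ℂ) : ℂ[X] :=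
  systemPoly (fun n => (Y n).1) (fun n => (Y n).2) (Z 0).1 (Z 0).2 (Z 1).1 (Z 1).2

/-- The conditions that guarantee the maximal number of solutions. -/
structure IsRegular (Y : Fin (g + 1) → ℂ × ℂ) (Z : Fin 2 → ℂ × ℂ) : Prop where
  lead : systemLead (fun n => (Y n).1) (fun n => (Y n).2) (Z 0).1 (Z 0).2 (Z 1).1 (Z 1).2 ≠ 0
  disc : invB (Z 0).1 (Z 0).2 (Z 1).1 (Z 1).2 ^ 2 -
    invA (Z 0).1 (Z 0).2 (Z 1).1 (Z 1).2 * invC (Z 0).1 (Z 0).2 (Z 1).1 (Z 1).2 ≠ 0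
  deg : (pairPoly Y Z).coeff (2 * (g + 1)) ≠ 0
  sep : resultant (pairPoly Y Z) (derivative (pairPoly Y Z)) (2 * (g + 1)) (2 * (g + 1) - 1) ≠ 0
  Y₁ : ∀ n, (pairPoly Y Z).eval (Y n).1 ≠ 0
  Y₂ : ∀ n, (pairPoly Y Z).eval (Y n).2 ≠ 0
  Z₁ : ∀ i, (pairPoly Y Z).eval (Z i).1 ≠ 0
  Z₂ : ∀ i, (pairPoly Y Z).eval (Z i).2 ≠ 0

variable {Y : Fin (g + 1) → ℂ × ℂ} {Z : Fin 2 → ℂ × ℂ}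

theorem PSystem.swap {p : ℂ × ℂ} (h : PSystem Y Z p) : PSystem Y Z p.swap := by
  have e : ∀ A B C D : ℂ, crossRatio B A C D = (crossRatio A B C D)⁻¹ := by
    intro A B C D
    rw [crossRatio, crossRatio, inv_div, mul_comm (B - C), mul_comm (B - D)]
  refine ⟨?_, ?_⟩
  · simp only [Prod.fst_swap, Prod.snd_swap, e p.1 p.2, Finset.prod_inv_distrib, h.1, inv_one]
  · simp only [Prod.fst_swap, Prod.snd_swap, e p.1 p.2, Finset.prod_inv_distrib, h.2, inv_one]

theorem PSystem.ne {p : ℂ × ℂ} (h : PSystem Y Z p) :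
    (∀ n, crossRatio p.1 p.2 (Y n).1 (Y n).2 ≠ 0) ∧ ∀ i, crossRatio p.1 p.2 (Z i).1 (Z i).2 ≠ 0 :=
  ⟨fun n => Finset.prod_ne_zero_iff.1 (h.1 ▸ one_ne_zero) n (Finset.mem_univ n),
    fun i => Finset.prod_ne_zero_iff.1 (h.2 ▸ one_ne_zero) i (Finset.mem_univ i)⟩

theorem involution_factor (A B C D x t : ℂ) :
    (x - A) * (t - B) * ((x - C) * (t - D)) - (x - B) * (t - A) * ((x - D) * (t - C)) =
      (x - t) * (x * (invA A B C D * t + invB A B C D) + (invB A B C D * t + invC A B C D)) := by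
  simp only [invA, invB, invC]; ring

theorem PSystem.involution {p : ℂ × ℂ} (h : PSystem Y Z p) (hp : p.1 ≠ p.2) :
    p.1 * (invA (Z 0).1 (Z 0).2 (Z 1).1 (Z 1).2 * p.2 + invB (Z 0).1 (Z 0).2 (Z 1).1 (Z 1).2) =
      -(invB (Z 0).1 (Z 0).2 (Z 1).1 (Z 1).2 * p.2 + invC (Z 0).1 (Z 0).2 (Z 1).1 (Z 1).2) := by
  have h2 := h.2
  rw [Fin.prod_univ_two] at h2
  have h0 := crossRatio_ne (h.ne.2 0)
  have h1 := crossRatio_ne (h.ne.2 1)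
  simp only [crossRatio] at h2
  have := sub_ne_zero.2 h0.2.2.1
  have := sub_ne_zero.2 h0.2.2.2
  have := sub_ne_zero.2 h1.2.2.1
  have := sub_ne_zero.2 h1.2.2.2
  rw [div_mul_div_comm, div_eq_one_iff_eq (by positivity)] at h2
  have hf := involution_factor (Z 0).1 (Z 0).2 (Z 1).1 (Z 1).2 p.1 p.2
  rw [sub_eq_zero.2 h2] at hf
  have := (mul_eq_zero.1 hf.symm).resolve_left (sub_ne_zero.2 hp)
  linear_combination this

theorem eval_pairPoly_of_involution {x t : ℂ}
    (h : x * (invA (Z 0).1 (Z 0).2 (Z 1).1 (Z 1).2 * t + invB (Z 0).1 (Z 0).2 (Z 1).1 (Z 1).2) =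
      -(invB (Z 0).1 (Z 0).2 (Z 1).1 (Z 1).2 * t + invC (Z 0).1 (Z 0).2 (Z 1).1 (Z 1).2)) :
    (pairPoly Y Z).eval t =
      (invA (Z 0).1 (Z 0).2 (Z 1).1 (Z 1).2 * t + invB (Z 0).1 (Z 0).2 (Z 1).1 (Z 1).2) ^ (g + 1) *
      (∏ n, (x - (Y n).1) * (t - (Y n).2) - ∏ n, (x - (Y n).2) * (t - (Y n).1)) := by
  rw [pairPoly, eval_systemPoly, ← h]
  set d := invA (Z 0).1 (Z 0).2 (Z 1).1 (Z 1).2 * t + invB (Z 0).1 (Z 0).2 (Z 1).1 (Z 1).2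
  have e : ∀ a b : Fin (g + 1) → ℂ, ∏ n, (x * d - a n * d) * (t - b n) =
      d ^ (g + 1) * ∏ n, (x - a n) * (t - b n) := by
    intro a b
    rw [← Fin.prod_const, ← Finset.prod_mul_distrib]
    exact Finset.prod_congr rfl fun n _ => by ring
  rw [e, e, mul_sub]

theorem PSystem.eval_pairPoly {p : ℂ × ℂ} (h : PSystem Y Z p) (hp : p.1 ≠ p.2) :
    (pairPoly Y Z).eval p.2 = 0 := by
  rw [eval_pairPoly_of_involution (h.involution hp)]
  have h1 := h.1
  simp only [crossRatio, Finset.prod_div_distrib] at h1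
  rw [div_eq_one_iff_eq] at h1
  · rw [h1, sub_self, mul_zero]
  · refine Finset.prod_ne_zero_iff.2 fun n _ => ?_
    have := crossRatio_ne (h.ne.1 n)
    exact mul_ne_zero (sub_ne_zero.2 this.2.2.1) (sub_ne_zero.2 this.2.2.2)

theorem prod_pair_ne {x t : ℂ} {U V : Fin (g + 1) → ℂ} (ht : ∀ n, t ≠ V n)
    (hUV : ∀ n k, U n ≠ V k) (ht' : ∀ n, t ≠ U n)
    (h : ∏ n, (x - U n) * (t - V n) = ∏ n, (x - V n) * (t - U n)) (n : Fin (g + 1)) :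
    x ≠ U n ∧ x ≠ V n := by
  refine ⟨fun hx => ?_, fun hx => ?_⟩
  · have h0 : ∏ n, (x - U n) * (t - V n) = 0 :=
      Finset.prod_eq_zero (Finset.mem_univ n) (by rw [hx, sub_self, zero_mul])
    obtain ⟨k, -, hk⟩ := Finset.prod_eq_zero_iff.1 (h.symm.trans h0)
    rcases mul_eq_zero.1 hk with hk | hk
    · exact hUV n k (hx.symm.trans (sub_eq_zero.1 hk))
    · exact ht' k (sub_eq_zero.1 hk)
  · have h0 : ∏ n, (x - V n) * (t - U n) = 0 :=
      Finset.prod_eq_zero (Finset.mem_univ n) (by rw [hx, sub_self, zero_mul])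
    obtain ⟨k, -, hk⟩ := Finset.prod_eq_zero_iff.1 (h.trans h0)
    rcases mul_eq_zero.1 hk with hk | hk
    · exact hUV k n ((sub_eq_zero.1 hk).symm.trans hx)
    · exact ht k (sub_eq_zero.1 hk)

namespace IsRegular

theorem den_ne (h : IsRegular Y Z) {t : ℂ} (ht : (pairPoly Y Z).eval t = 0) :
    invA (Z 0).1 (Z 0).2 (Z 1).1 (Z 1).2 * t + invB (Z 0).1 (Z 0).2 (Z 1).1 (Z 1).2 ≠ 0 := by
  intro hd
  have hl := h.lead
  have hdisc := h.disc
  rw [pairPoly, eval_systemPoly, hd] at ht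
  rw [systemLead] at hl
  set a := invA (Z 0).1 (Z 0).2 (Z 1).1 (Z 1).2
  set b := invB (Z 0).1 (Z 0).2 (Z 1).1 (Z 1).2
  set c := invC (Z 0).1 (Z 0).2 (Z 1).1 (Z 1).2
  have hm : b * t + c ≠ 0 := by
    intro h0
    apply hdisc
    linear_combination b * hd - a * h0
  have hb : b = -(a * t) := by linear_combination hd
  simp only [mul_zero, sub_zero, Finset.prod_mul_distrib, Finset.prod_const] at ht
  rw [← mul_sub] at ht
  have h2 := (mul_eq_zero.1 ht).resolve_left (pow_ne_zero _ (neg_ne_zero.2 hm))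
  apply hl
  have e : ∀ y : Fin (g + 1) → ℂ, ∏ n, (b + y n * a) = (-a) ^ (g + 1) * ∏ n, (t - y n) := by
    intro y
    rw [← Fin.prod_const, ← Finset.prod_mul_distrib]
    exact Finset.prod_congr rfl fun n _ => by rw [hb]; ring
  rw [e, e, ← mul_sub, ← neg_sub, h2, neg_zero, mul_zero]

theorem invA_ne (h : IsRegular Y Z) : invA (Z 0).1 (Z 0).2 (Z 1).1 (Z 1).2 ≠ 0 := by
  intro h0
  apply h.lead
  simp [systemLead, h0]

theorem Y_ne (h : IsRegular Y Z) (n k : Fin (g + 1)) : (Y n).1 ≠ (Y k).2 := by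
  intro h0
  apply h.Y₂ k
  rw [pairPoly, eval_systemPoly, Finset.prod_eq_zero (Finset.mem_univ k) (by simp),
    Finset.prod_eq_zero (Finset.mem_univ n) (by simp [h0]), sub_zero]

/-- The roots other than the fixed points of the involution solve the system. -/
theorem psystem (h : IsRegular Y Z) {x t : ℂ} (ht : (pairPoly Y Z).eval t = 0) (hxt : x ≠ t)
    (hx : x * (invA (Z 0).1 (Z 0).2 (Z 1).1 (Z 1).2 * t + invB (Z 0).1 (Z 0).2 (Z 1).1 (Z 1).2) =
      -(invB (Z 0).1 (Z 0).2 (Z 1).1 (Z 1).2 * t + invC (Z 0).1 (Z 0).2 (Z 1).1 (Z 1).2)) :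
    PSystem Y Z (x, t) := by
  have hd := h.den_ne ht
  have hG := eval_pairPoly_of_involution (Y := Y) hx
  rw [ht] at hG
  have hE := sub_eq_zero.1 ((mul_eq_zero.1 hG.symm).resolve_left (pow_ne_zero _ hd))
  have n1 : ∀ n, t ≠ (Y n).1 := fun n h0 => h.Y₁ n (h0 ▸ ht)
  have n2 : ∀ n, t ≠ (Y n).2 := fun n h0 => h.Y₂ n (h0 ▸ ht)
  have n3 := prod_pair_ne n2 h.Y_ne n1 hE
  have hfac := involution_factor (Z 0).1 (Z 0).2 (Z 1).1 (Z 1).2 x t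
  rw [hx, neg_add_cancel, mul_zero] at hfac
  have hZE := sub_eq_zero.1 hfac
  have m1 : ∀ i, t ≠ (Z i).1 := fun i h0 => h.Z₁ i (h0 ▸ ht)
  have m2 : ∀ i, t ≠ (Z i).2 := fun i h0 => h.Z₂ i (h0 ▸ ht)
  -- the involution permutes the points `Z`
  have i1 : x ≠ (Z 0).1 := by
    rintro rfl
    have : ((Z 0).1 - (Z 0).2) * ((Z 0).1 - (Z 1).2) = 0 := by
      simp only [sub_self, zero_mul] at hZE
      have := mul_ne_zero (sub_ne_zero.2 (m1 0)) (sub_ne_zero.2 (m1 1))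
      refine (mul_eq_zero.1 ?_).resolve_right this
      linear_combination -hZE
    apply h.disc
    have hd' : invB (Z 0).1 (Z 0).2 (Z 1).1 (Z 1).2 ^ 2 -
        invA (Z 0).1 (Z 0).2 (Z 1).1 (Z 1).2 * invC (Z 0).1 (Z 0).2 (Z 1).1 (Z 1).2 =
        (((Z 0).1 - (Z 0).2) * ((Z 0).1 - (Z 1).2)) *
          (((Z 1).1 - (Z 0).2) * ((Z 1).1 - (Z 1).2)) := by
      simp only [invA, invB, invC]; ring
    rw [hd', this, zero_mul]
  have i2 : x ≠ (Z 1).1 := by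
    rintro rfl
    have : ((Z 1).1 - (Z 0).2) * ((Z 1).1 - (Z 1).2) = 0 := by
      simp only [sub_self, zero_mul, mul_zero] at hZE
      have := mul_ne_zero (sub_ne_zero.2 (m1 0)) (sub_ne_zero.2 (m1 1))
      refine (mul_eq_zero.1 ?_).resolve_right this
      linear_combination -hZE
    apply h.disc
    have hd' : invB (Z 0).1 (Z 0).2 (Z 1).1 (Z 1).2 ^ 2 -
        invA (Z 0).1 (Z 0).2 (Z 1).1 (Z 1).2 * invC (Z 0).1 (Z 0).2 (Z 1).1 (Z 1).2 =
        (((Z 0).1 - (Z 0).2) * ((Z 0).1 - (Z 1).2)) *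
          (((Z 1).1 - (Z 0).2) * ((Z 1).1 - (Z 1).2)) := by
      simp only [invA, invB, invC]; ring
    rw [hd', this, mul_zero]
  have hprod : (x - (Z 0).2) * (x - (Z 1).2) ≠ 0 := by
    intro h0
    have : (x - (Z 0).1) * (x - (Z 1).1) * ((t - (Z 0).2) * (t - (Z 1).2)) = 0 := by
      linear_combination hZE + (t - (Z 0).1) * (t - (Z 1).1) * h0
    exact mul_ne_zero (mul_ne_zero (sub_ne_zero.2 i1) (sub_ne_zero.2 i2))
      (mul_ne_zero (sub_ne_zero.2 (m2 0)) (sub_ne_zero.2 (m2 1))) this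
  refine ⟨?_, ?_⟩
  · simp only [crossRatio, Finset.prod_div_distrib]
    rw [div_eq_one_iff_eq]
    · exact hE
    · exact Finset.prod_ne_zero_iff.2 fun n _ =>
        mul_ne_zero (sub_ne_zero.2 (n3 n).2) (sub_ne_zero.2 (n1 n))
  · rw [Fin.prod_univ_two, crossRatio, crossRatio, div_mul_div_comm, div_eq_one_iff_eq]
    · exact hZE
    · exact mul_ne_zero (mul_ne_zero (left_ne_zero_of_mul hprod) (sub_ne_zero.2 (m1 0)))
        (mul_ne_zero (right_ne_zero_of_mul hprod) (sub_ne_zero.2 (m1 1)))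

theorem natDegree (h : IsRegular Y Z) : (pairPoly Y Z).natDegree = 2 * (g + 1) :=
  natDegree_eq_of_le_of_coeff_ne_zero (natDegree_systemPoly_le _ _ _ _ _ _) h.deg

theorem separable (h : IsRegular Y Z) : (pairPoly Y Z).Separable := by
  have hs := h.sep
  have hdd : (derivative (pairPoly Y Z)).natDegree = 2 * (g + 1) - 1 := by
    rw [Polynomial.natDegree_derivative, h.natDegree]
  by_contra hns
  apply hs
  have h0 : pairPoly Y Z ≠ 0 := fun h0 => h.deg (by rw [h0, coeff_zero])
  have h2 : resultant (pairPoly Y Z) (derivative (pairPoly Y Z)) = 0 :=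
    resultant_eq_zero_iff.2 ⟨Or.inl h0, hns⟩
  rwa [h.natDegree, hdd] at h2

theorem card_roots (h : IsRegular Y Z) : (pairPoly Y Z).roots.toFinset.card = 2 * (g + 1) := by
  rw [Multiset.toFinset_card_of_nodup (nodup_roots h.separable),
    ← (IsAlgClosed.splits (pairPoly Y Z)).natDegree_eq_card_roots, h.natDegree]

/-- A regular system has exactly `g` inequivalent solutions. -/
theorem encard_solutionClasses (h : IsRegular Y Z) : (solutionClasses Y Z).encard = (g : ℕ∞) := by
  classical
  have hdisc := h.disc
  have ha := h.invA_ne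
  have hpsys := @IsRegular.psystem g Y Z h
  have hinv := @PSystem.involution g Y Z
  set a := invA (Z 0).1 (Z 0).2 (Z 1).1 (Z 1).2
  set b := invB (Z 0).1 (Z 0).2 (Z 1).1 (Z 1).2
  set c := invC (Z 0).1 (Z 0).2 (Z 1).1 (Z 1).2
  have h0 : pairPoly Y Z ≠ 0 := fun h0 => h.deg (by rw [h0, coeff_zero])
  have hmem : ∀ t, t ∈ (pairPoly Y Z).roots.toFinset ↔ (pairPoly Y Z).eval t = 0 := fun t => by
    rw [Multiset.mem_toFinset, mem_roots h0, IsRoot.def]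
  set R := (pairPoly Y Z).roots.toFinset
  -- the fixed points of the involution
  obtain ⟨δ, hδ⟩ := IsAlgClosed.exists_pow_nat_eq (b ^ 2 - a * c) two_pos
  have hδ0 : δ ≠ 0 := by
    rintro rfl
    exact hdisc (by rw [← hδ]; simp)
  set Φ : Finset ℂ := {(-b + δ) / a, (-b - δ) / a} with hΦ
  have hΦmem : ∀ t, t ∈ Φ ↔ t * (a * t + b) = -(b * t + c) := by
    intro t
    rw [hΦ, Finset.mem_insert, Finset.mem_singleton, eq_div_iff ha, eq_div_iff ha]
    have : t * (a * t + b) = -(b * t + c) ↔ (t * a - (-b + δ)) * (t * a - (-b - δ)) = 0 := by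
      constructor
      · intro h; linear_combination a * h - hδ
      · intro h
        refine mul_left_cancel₀ ha ?_
        linear_combination h + hδ
    rw [this, mul_eq_zero, sub_eq_zero, sub_eq_zero]
  have hΦcard : Φ.card = 2 := by
    rw [hΦ, Finset.card_pair]
    intro he
    rw [div_left_inj' ha] at he
    exact hδ0 (by linear_combination he / 2)
  have hΦR : Φ ⊆ R := by
    intro t ht
    rw [hmem, eval_pairPoly_of_involution ((hΦmem t).1 ht)]
    rw [sub_eq_zero.2, mul_zero]
    exact Finset.prod_congr rfl fun n _ => mul_comm _ _
  set S := R \ Φ with hS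
  have hScard : S.card = 2 * g := by
    rw [hS, Finset.card_sdiff_of_subset hΦR, h.card_roots, hΦcard]; omega
  set inv : ℂ → ℂ := fun t => -(b * t + c) / (a * t + b) with hinvdef
  have hS1 : ∀ t ∈ S, inv t ≠ t ∧ PSystem Y Z (inv t, t) := by
    intro t ht
    rw [hS, Finset.mem_sdiff, hmem] at ht
    have hd := h.den_ne ht.1
    have hx : inv t * (a * t + b) = -(b * t + c) := div_mul_cancel₀ _ hd
    have hne : inv t ≠ t := by
      intro he
      rw [he] at hx
      exact ht.2 ((hΦmem t).2 hx)
    exact ⟨hne, hpsys ht.1 hne hx⟩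
  have hS2 : ∀ p : ℂ × ℂ, p.1 ≠ p.2 → PSystem Y Z p → p.2 ∈ S ∧ p.1 = inv p.2 := by
    intro p hp hs
    have hroot := hs.eval_pairPoly hp
    have hd := h.den_ne hroot
    have hx := hinv hs hp
    have he : p.1 = inv p.2 := (eq_div_iff hd).2 hx
    refine ⟨?_, he⟩
    rw [hS, Finset.mem_sdiff, hmem, hΦmem]
    refine ⟨hroot, fun h2 => hp ?_⟩
    rw [← hx] at h2
    exact (mul_right_cancel₀ hd h2).symm
  have hS3 : ∀ t ∈ S, inv t ∈ S ∧ inv (inv t) = t := by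
    intro t ht
    obtain ⟨h1, h2⟩ := hS1 t ht
    have h3 := hS2 (t, inv t) h1.symm h2.swap
    exact ⟨h3.1, h3.2.symm⟩
  set φ : ℂ → Sym2 ℂ := fun t => s(inv t, t) with hφ
  have himg : solutionClasses Y Z = (S.image φ : Finset (Sym2 ℂ)) := by
    ext s
    simp only [solutionClasses, Finset.coe_image, Set.mem_image, Finset.mem_coe]
    constructor
    · rintro ⟨p, hp, hs, rfl⟩
      obtain ⟨h1, h2⟩ := hS2 p hp hs
      exact ⟨p.2, h1, by rw [hφ, h2]⟩
    · rintro ⟨t, ht, rfl⟩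
      obtain ⟨h1, h2⟩ := hS1 t ht
      exact ⟨(inv t, t), h1, h2, rfl⟩
  have hfib : ∀ s ∈ S.image φ, (S.filter fun t => φ t = s).card = 2 := by
    intro s hs
    obtain ⟨t, ht, rfl⟩ := Finset.mem_image.1 hs
    have : (S.filter fun r => φ r = φ t) = {inv t, t} := by
      ext r
      simp only [Finset.mem_filter, Finset.mem_insert, Finset.mem_singleton, hφ, Sym2.eq_iff]
      constructor
      · rintro ⟨-, h1 | h1⟩
        · exact Or.inr h1.2
        · exact Or.inl h1.2
      · rintro (rfl | rfl)
        · exact ⟨(hS3 t ht).1, Or.inr ⟨(hS3 t ht).2, rfl⟩⟩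
        · exact ⟨ht, Or.inl ⟨rfl, rfl⟩⟩
    rw [this, Finset.card_pair (hS1 t ht).1]
  have hcount := Finset.card_eq_sum_card_image φ S
  rw [Finset.sum_congr rfl hfib, Finset.sum_const, hScard, smul_eq_mul] at hcount
  rw [himg, Set.encard_coe_eq_coe_finsetCard]
  congr 1
  omega

end IsRegular

end Regular

end

end BS

namespace BS

noncomputable section

open Filter Polynomial

section SpecialPoint

variable {g : ℕ}

/-- Pairs `(2 z^n, -1 / (2 z^n))` with `z^2` a primitive root of unity. -/
def specialY (g : ℕ) (n : Fin (g + 1)) : ℂ × ℂ :=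
  (2 * omegaHalf (g + 1) ^ (n : ℕ), -(2 * omegaHalf (g + 1) ^ (n : ℕ))⁻¹)

/-- Pairs for which the involution is `t ↦ 1 / t`. -/
def specialZ : Fin 2 → ℂ × ℂ := ![(3, 2), (1 / 3, 1 / 2)]

theorem special_inv : invA (specialZ 0).1 (specialZ 0).2 (specialZ 1).1 (specialZ 1).2 = 5 / 6 ∧
    invB (specialZ 0).1 (specialZ 0).2 (specialZ 1).1 (specialZ 1).2 = 0 ∧
    invC (specialZ 0).1 (specialZ 0).2 (specialZ 1).1 (specialZ 1).2 = -(5 / 6) := by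
  simp only [specialZ, invA, invB, invC, Matrix.cons_val_zero, Matrix.cons_val_one,
    Matrix.cons_val_fin_one]
  norm_num

theorem exists_pairPoly_special :
    ∃ K : ℂ, K ≠ 0 ∧ pairPoly (specialY g) specialZ = C K * (X ^ (2 * (g + 1)) - C 1) := by
  set z := omegaHalf (g + 1) with hz
  have hz0 : z ≠ 0 := omegaHalf_ne_zero _
  have hprim : IsPrimitiveRoot (z ^ 2) (g + 1) := by
    rw [hz, omegaHalf_sq]; exact omega_primitive (g + 1)
  set w : ℂ := ∏ n : Fin (g + 1), (5 / 6) * (2 * z ^ (n : ℕ))⁻¹ with hw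
  have hw0 : w ≠ 0 := Finset.prod_ne_zero_iff.2 fun n _ =>
    mul_ne_zero (by norm_num) (inv_ne_zero (mul_ne_zero two_ne_zero (pow_ne_zero _ hz0)))
  have h4 : (1 + 4 ^ (g + 1) : ℂ) ≠ 0 := by
    exact_mod_cast (by positivity : (1 + 4 ^ (g + 1) : ℕ) ≠ 0)
  refine ⟨-(w * (1 + 4 ^ (g + 1))), neg_ne_zero.2 (mul_ne_zero hw0 h4), ?_⟩
  refine Polynomial.funext fun t => ?_
  obtain ⟨ha, hb, hc⟩ := special_inv
  rw [pairPoly, eval_systemPoly, ha, hb, hc]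
  have e1 : ∏ n : Fin (g + 1), (-(0 * t + -(5 / 6)) - (specialY g n).1 * (5 / 6 * t + 0)) *
      (t - (specialY g n).2) = w * (1 - 4 ^ (g + 1) * t ^ (2 * (g + 1))) := by
    have := prod_range_sub_pow_mul hprim 1 (4 * t ^ 2)
    rw [mul_pow, one_pow, ← pow_mul] at this
    rw [← this, ← Fin.prod_univ_eq_prod_range (fun k => 1 - (z ^ 2) ^ k * (4 * t ^ 2)) (g + 1), hw,
      ← Finset.prod_mul_distrib]
    refine Finset.prod_congr rfl fun n _ => ?_
    have hzn : z ^ (n : ℕ) ≠ 0 := pow_ne_zero _ hz0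
    simp only [specialY, ← hz]
    rw [← pow_mul, mul_comm 2 (n : ℕ), pow_mul]
    field_simp
    ring
  have e2 : ∏ n : Fin (g + 1), (-(0 * t + -(5 / 6)) - (specialY g n).2 * (5 / 6 * t + 0)) *
      (t - (specialY g n).1) = w * (t ^ (2 * (g + 1)) - 4 ^ (g + 1)) := by
    have := prod_range_sub_pow_mul hprim (t ^ 2) 4
    rw [← pow_mul] at this
    rw [← this, ← Fin.prod_univ_eq_prod_range (fun k => t ^ 2 - (z ^ 2) ^ k * 4) (g + 1), hw,
      ← Finset.prod_mul_distrib]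
    refine Finset.prod_congr rfl fun n _ => ?_
    have hzn : z ^ (n : ℕ) ≠ 0 := pow_ne_zero _ hz0
    simp only [specialY, ← hz]
    rw [← pow_mul, mul_comm 2 (n : ℕ), pow_mul]
    field_simp
    ring
  rw [e1, e2]
  simp only [eval_mul, eval_C, eval_sub, eval_pow, eval_X]
  ring

theorem norm_omegaHalf (N : ℕ) : ‖omegaHalf N‖ = 1 := by
  rw [omegaHalf, show (Real.pi : ℂ) * Complex.I / N = ((Real.pi / N : ℝ) : ℂ) * Complex.I by
    push_cast; ring]
  exact Complex.norm_exp_ofReal_mul_I _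

theorem eval_special_ne {t : ℂ} (ht : ‖t‖ ≠ 1) : (pairPoly (specialY g) specialZ).eval t ≠ 0 := by
  obtain ⟨K, hK, hp⟩ := exists_pairPoly_special (g := g)
  rw [hp]
  simp only [eval_mul, eval_C, eval_sub, eval_pow, eval_X]
  refine mul_ne_zero hK fun h0 => ht ?_
  have h1 : t ^ (2 * (g + 1)) = 1 := sub_eq_zero.1 h0
  have h2 := congrArg norm h1
  rw [norm_pow, norm_one] at h2
  exact (pow_eq_one_iff_of_nonneg (norm_nonneg t) (by omega)).1 h2

theorem isRegular_special : IsRegular (specialY g) specialZ := by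
  obtain ⟨K, hK, hp⟩ := exists_pairPoly_special (g := g)
  obtain ⟨ha, hb, hc⟩ := special_inv
  have hz := norm_omegaHalf (g + 1)
  have hdeg : (pairPoly (specialY g) specialZ).natDegree = 2 * (g + 1) := by
    rw [hp, natDegree_C_mul hK, natDegree_X_pow_sub_C]
  have hY1 : ∀ n, ‖(specialY g n).1‖ = 2 := fun n => by simp [specialY, hz]
  have hY2 : ∀ n, ‖(specialY g n).2‖ = 1 / 2 := fun n => by simp [specialY, hz]
  refine ⟨?_, ?_, ?_, ?_, fun n => eval_special_ne ?_, fun n => eval_special_ne ?_,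
    fun i => eval_special_ne ?_, fun i => eval_special_ne ?_⟩
  · rw [systemLead, ha, hb]
    intro h0
    have h1 := congrArg norm (sub_eq_zero.1 h0)
    simp only [zero_add, norm_prod, norm_mul, hY1, hY2, Finset.prod_const, Finset.card_univ,
      Fintype.card_fin] at h1
    have h2 := (pow_left_inj₀ (by positivity) (by positivity) (Nat.succ_ne_zero g)).1 h1
    norm_num at h2
  · rw [ha, hb, hc]; norm_num
  · rw [← hdeg, coeff_natDegree, leadingCoeff_ne_zero]
    intro h0; rw [h0] at hdeg; simp at hdeg
  · have hsep : (pairPoly (specialY g) specialZ).Separable := by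
      rw [hp]
      exact (separable_X_pow_sub_C (1 : ℂ) (Nat.cast_ne_zero.2 (by omega)) one_ne_zero).unit_mul
        (isUnit_C.2 (isUnit_iff_ne_zero.2 hK))
    have hdd : (derivative (pairPoly (specialY g) specialZ)).natDegree = 2 * (g + 1) - 1 := by
      rw [natDegree_derivative, hdeg]
    have := resultant_ne_zero _ _ hsep
    rwa [hdeg, hdd] at this
  · rw [hY1]; norm_num
  · rw [hY2]; norm_num
  · fin_cases i <;> simp [specialZ]
  · fin_cases i <;> simp [specialZ]

end SpecialPoint

section EventuallyRegular

variable {g : ℕ} {ι κ : Type} {U : Ultrafilter ((ι → ℂ × ℂ) × (κ → ℂ))}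

theorem IsGenericUltrafilter.eventually_ne (hU : IsGenericUltrafilter U)
    {D : MvPolynomial ((ι × Bool) ⊕ κ) ℂ} {x₀ : (ι → ℂ × ℂ) × (κ → ℂ)} (h : D.eval (coords x₀) ≠ 0) :
    ∀ᶠ x in (U : Filter ((ι → ℂ × ℂ) × (κ → ℂ))), D.eval (coords x) ≠ 0 :=
  hU D fun h0 => h (by rw [h0, map_zero])

/-- The coordinate functions of a pair. -/
def varPair (ι κ : Type) (i : ι) :
    MvPolynomial ((ι × Bool) ⊕ κ) ℂ × MvPolynomial ((ι × Bool) ⊕ κ) ℂ :=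
  (MvPolynomial.X (Sum.inl (i, true)), MvPolynomial.X (Sum.inl (i, false)))

theorem eval_varPair (x : (ι → ℂ × ℂ) × (κ → ℂ)) (i : ι) :
    (varPair ι κ i).1.eval (coords x) = (x.1 i).1 ∧ (varPair ι κ i).2.eval (coords x) = (x.1 i).2 := by
  simp [varPair, coords]

/-- The polynomial of the system with indeterminate points. -/
def univPoly (ι κ : Type) (eY : Fin (g + 1) → ι) (eZ : Fin 2 → ι) :
    (MvPolynomial ((ι × Bool) ⊕ κ) ℂ)[X] :=
  systemPoly (fun n => (varPair ι κ (eY n)).1) (fun n => (varPair ι κ (eY n)).2)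
    (varPair ι κ (eZ 0)).1 (varPair ι κ (eZ 0)).2 (varPair ι κ (eZ 1)).1 (varPair ι κ (eZ 1)).2

theorem univPoly_map (eY : Fin (g + 1) → ι) (eZ : Fin 2 → ι) (x : (ι → ℂ × ℂ) × (κ → ℂ)) :
    (univPoly ι κ eY eZ).map (MvPolynomial.eval (coords x)) =
      pairPoly (fun n => x.1 (eY n)) (fun i => x.1 (eZ i)) := by
  simp only [univPoly, systemPoly_map, eval_varPair, pairPoly]

/-- Regularity is an open condition. -/
theorem IsGenericUltrafilter.eventually_isRegular (hU : IsGenericUltrafilter U)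
    (eY : Fin (g + 1) → ι) (eZ : Fin 2 → ι) {x₀ : (ι → ℂ × ℂ) × (κ → ℂ)}
    (h : IsRegular (fun n => x₀.1 (eY n)) (fun i => x₀.1 (eZ i))) :
    ∀ᶠ x in (U : Filter ((ι → ℂ × ℂ) × (κ → ℂ))),
      IsRegular (fun n => x.1 (eY n)) (fun i => x.1 (eZ i)) := by
  have transfer : ∀ (φ : ((ι → ℂ × ℂ) × (κ → ℂ)) → ℂ), (∃ D : MvPolynomial ((ι × Bool) ⊕ κ) ℂ,
      ∀ x, D.eval (coords x) = φ x) → φ x₀ ≠ 0 →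
      ∀ᶠ x in (U : Filter ((ι → ℂ × ℂ) × (κ → ℂ))), φ x ≠ 0 := by
    rintro φ ⟨D, hD⟩ h0
    have := hU.eventually_ne (D := D) (x₀ := x₀) (by rwa [hD])
    simpa only [hD] using this
  have hev : ∀ p : MvPolynomial ((ι × Bool) ⊕ κ) ℂ, ∃ D : MvPolynomial ((ι × Bool) ⊕ κ) ℂ,
      ∀ x, D.eval (coords x) =
        (pairPoly (fun n => x.1 (eY n)) (fun i => x.1 (eZ i))).eval (p.eval (coords x)) := by
    intro p
    refine ⟨(univPoly ι κ eY eZ).eval p, fun x => ?_⟩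
    rw [← univPoly_map, eval_map, eval₂_at_apply]
  have t1 := transfer (fun x => systemLead (fun n => (x.1 (eY n)).1) (fun n => (x.1 (eY n)).2)
    (x.1 (eZ 0)).1 (x.1 (eZ 0)).2 (x.1 (eZ 1)).1 (x.1 (eZ 1)).2)
    ⟨systemLead (fun n => (varPair ι κ (eY n)).1) (fun n => (varPair ι κ (eY n)).2)
    (varPair ι κ (eZ 0)).1 (varPair ι κ (eZ 0)).2 (varPair ι κ (eZ 1)).1 (varPair ι κ (eZ 1)).2,
      fun x => by rw [systemLead_map]; simp only [eval_varPair]⟩ h.lead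
  have t2 := transfer (fun x => invB (x.1 (eZ 0)).1 (x.1 (eZ 0)).2 (x.1 (eZ 1)).1 (x.1 (eZ 1)).2 ^ 2 -
    invA (x.1 (eZ 0)).1 (x.1 (eZ 0)).2 (x.1 (eZ 1)).1 (x.1 (eZ 1)).2 *
    invC (x.1 (eZ 0)).1 (x.1 (eZ 0)).2 (x.1 (eZ 1)).1 (x.1 (eZ 1)).2)
    ⟨invB (varPair ι κ (eZ 0)).1 (varPair ι κ (eZ 0)).2 (varPair ι κ (eZ 1)).1 (varPair ι κ (eZ 1)).2 ^ 2 -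
      invA (varPair ι κ (eZ 0)).1 (varPair ι κ (eZ 0)).2 (varPair ι κ (eZ 1)).1 (varPair ι κ (eZ 1)).2 *
      invC (varPair ι κ (eZ 0)).1 (varPair ι κ (eZ 0)).2 (varPair ι κ (eZ 1)).1 (varPair ι κ (eZ 1)).2,
      fun x => by simp only [invA, invB, invC, map_sub, map_mul, map_add, map_pow, eval_varPair]⟩ h.disc
  have t3 := transfer (fun x => (pairPoly (fun n => x.1 (eY n)) (fun i => x.1 (eZ i))).coeff (2 * (g + 1)))
    ⟨(univPoly ι κ eY eZ).coeff (2 * (g + 1)), fun x => by rw [← univPoly_map, coeff_map]⟩ h.deg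
  have t4 := transfer (fun x => resultant (pairPoly (fun n => x.1 (eY n)) (fun i => x.1 (eZ i)))
    (derivative (pairPoly (fun n => x.1 (eY n)) (fun i => x.1 (eZ i)))) (2 * (g + 1)) (2 * (g + 1) - 1))
    ⟨resultant (univPoly ι κ eY eZ) (derivative (univPoly ι κ eY eZ)) (2 * (g + 1)) (2 * (g + 1) - 1),
      fun x => by rw [← univPoly_map, derivative_map, resultant_map_map]⟩ h.sep
  have tv : ∀ p : MvPolynomial ((ι × Bool) ⊕ κ) ℂ,
      (pairPoly (fun n => x₀.1 (eY n)) (fun i => x₀.1 (eZ i))).eval (p.eval (coords x₀)) ≠ 0 →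
      ∀ᶠ x in (U : Filter ((ι → ℂ × ℂ) × (κ → ℂ))),
        (pairPoly (fun n => x.1 (eY n)) (fun i => x.1 (eZ i))).eval (p.eval (coords x)) ≠ 0 :=
    fun p hp => transfer _ (hev p) hp
  have t5 := eventually_all.2 fun n => tv (varPair ι κ (eY n)).1 (by rw [(eval_varPair x₀ _).1]; exact h.Y₁ n)
  have t6 := eventually_all.2 fun n => tv (varPair ι κ (eY n)).2 (by rw [(eval_varPair x₀ _).2]; exact h.Y₂ n)
  have t7 := eventually_all.2 fun i => tv (varPair ι κ (eZ i)).1 (by rw [(eval_varPair x₀ _).1]; exact h.Z₁ i)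
  have t8 := eventually_all.2 fun i => tv (varPair ι κ (eZ i)).2 (by rw [(eval_varPair x₀ _).2]; exact h.Z₂ i)
  simp only [eval_varPair] at t5 t6 t7 t8
  filter_upwards [t1, t2, t3, t4, t5, t6, t7, t8] with x h1 h2 h3 h4 h5 h6 h7 h8
  exact ⟨h1, h2, h3, h4, h5, h6, h7, h8⟩

/-- The generic number of solutions. -/
theorem generically_encard_solutionClasses (g : ℕ) :
    Generically (Fin (g + 1) ⊕ Fin 2) Empty
      (fun A _ => (solutionClasses (fun n => A (Sum.inl n)) (fun i => A (Sum.inr i))).encard = (g : ℕ∞)) := by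
  refine generically_of_ultrafilter fun U hU => ?_
  have := hU.eventually_isRegular (g := g) Sum.inl Sum.inr
    (x₀ := (Sum.elim (specialY g) specialZ, Empty.elim)) isRegular_special
  exact this.mono fun x hx => hx.encard_solutionClasses

end EventuallyRegular

end

end BS

namespace BS

noncomputable section

section StandardVertex

variable {N : ℕ} [NeZero N] {g : ℕ} {P : Fin g → ℂ × ℂ}

/-- A chosen `N`-th root. -/
def nthRoot (N : ℕ) [NeZero N] (z : ℂ) : ℂ := Classical.choose (exists_root (N := N) z)

theorem nthRoot_pow (z : ℂ) : nthRoot N z ^ N = z := Classical.choose_spec (exists_root (N := N) z)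

theorem nthRoot_ne {z : ℂ} (hz : z ≠ 0) : nthRoot N z ≠ 0 := fun h => hz (by
  rw [← nthRoot_pow (N := N) z, h, zero_pow (NeZero.ne N)])

/-- The root of `Ufun` made of the roots of its factors. -/
def rootU (N : ℕ) [NeZero N] (P : Fin g → ℂ × ℂ) (f : Fin g → ℂ) (A B : ℂ × ℂ) : ℂ :=
  nthRoot N (-(-1) ^ N * ((A.2 - B.1) / (A.2 - B.2))) *
    (nthRoot N (H P (f * mob P A.2)) / nthRoot N (H P (f * mob P A.2 * sigma P B)))

/-- The root of `Wfun` made of the roots of its factors. -/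
def rootW (N : ℕ) [NeZero N] (P : Fin g → ℂ × ℂ) (f : Fin g → ℂ) (A B : ℂ × ℂ) : ℂ :=
  nthRoot N ((-1) ^ N * ((B.2 - A.1) / (B.2 - A.2))) *
    (nthRoot N (H P (f * mob P B.2)) / nthRoot N (H P (f * mob P B.2 * sigma P A)))

theorem rootU_pow (f : Fin g → ℂ) (A B : ℂ × ℂ) : rootU N P f A B ^ N = Ufun N P f A B := by
  rw [rootU, mul_pow, div_pow, nthRoot_pow, nthRoot_pow, nthRoot_pow, Ufun, evalAt_eq]

theorem rootW_pow (f : Fin g → ℂ) (A B : ℂ × ℂ) : rootW N P f A B ^ N = Wfun N P f A B := by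
  rw [rootW, mul_pow, div_pow, nthRoot_pow, nthRoot_pow, nthRoot_pow, Wfun, Ufun, evalAt_eq]
  ring

/-- The vertex with the roots `rootU` and `rootW`. -/
def stdVertex (N : ℕ) [NeZero N] (P : Fin g → ℂ × ℂ) (F : Fin g → ℂ) (X Y Z : ℂ × ℂ) : Vertex where
  u₁ := rootU N P F Y Z
  w₁ := rootW N P F Y Z
  κ₁ := nthRoot N (-crossRatio Y.1 Y.2 Z.1 Z.2)
  u₂ := rootU N P (F * sigma P Y) X Z
  w₂ := rootW N P (F * sigma P Y) X Z
  κ₂ := nthRoot N (-crossRatio X.1 X.2 Z.1 Z.2)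
  u₃ := rootU N P F X Y
  w₃ := rootW N P F X Y
  κ₃ := nthRoot N (-crossRatio X.1 X.2 Y.1 Y.2)
  u₁' := rootU N P (F * sigma P X) Y Z
  w₁' := rootW N P (F * sigma P X) Y Z
  u₂' := rootU N P F X Z
  w₂' := rootW N P F X Z
  u₃' := rootU N P (F * sigma P Z) X Y
  w₃' := rootW N P (F * sigma P Z) X Y

/-- The arguments of the theta functions of a vertex. -/
def vertexArgs (P : Fin g → ℂ × ℂ) (F : Fin g → ℂ) (X Y Z : ℂ × ℂ) : List (Fin g → ℂ) :=
  [F * mob P Y.2, F * mob P Y.2 * sigma P Z, F * mob P Z.2, F * mob P Z.2 * sigma P Y,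
    F * sigma P Y * mob P X.2, F * sigma P Y * mob P X.2 * sigma P Z,
    F * sigma P Y * mob P Z.2, F * sigma P Y * mob P Z.2 * sigma P X,
    F * mob P X.2, F * mob P X.2 * sigma P Y, F * mob P Y.2 * sigma P X,
    F * sigma P X * mob P Y.2, F * sigma P X * mob P Y.2 * sigma P Z,
    F * sigma P X * mob P Z.2, F * sigma P X * mob P Z.2 * sigma P Y,
    F * mob P X.2 * sigma P Z, F * mob P Z.2 * sigma P X,
    F * sigma P Z * mob P X.2, F * sigma P Z * mob P X.2 * sigma P Y,
    F * sigma P Z * mob P Y.2, F * sigma P Z * mob P Y.2 * sigma P X,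
    F * mob P X.2 * mob P Y.2 / mob P Z.1]

/-- Two pairs have no common point. -/
def Apart (A B : ℂ × ℂ) : Prop := A.1 ≠ B.1 ∧ A.1 ≠ B.2 ∧ A.2 ≠ B.1 ∧ A.2 ≠ B.2

theorem Apart.symm {A B : ℂ × ℂ} (h : Apart A B) : Apart B A :=
  ⟨h.1.symm, h.2.2.1.symm, h.2.1.symm, h.2.2.2.symm⟩

/-- The nonvanishing conditions for a vertex. -/
structure VertexRegular (P : Fin g → ℂ × ℂ) (F : Fin g → ℂ) (X Y Z : ℂ × ℂ) : Prop where
  XY : Apart X Y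
  XZ : Apart X Z
  YZ : Apart Y Z
  ZZ : Z.1 ≠ Z.2
  avX : Avoids P X.1 ∧ Avoids P X.2
  avY : Avoids P Y.1 ∧ Avoids P Y.2
  avZ : Avoids P Z.1 ∧ Avoids P Z.2
  H_ne : ∀ v ∈ vertexArgs P F X Y Z, H P v ≠ 0

theorem rootU_ne {f : Fin g → ℂ} {A B : ℂ × ℂ} (h : Apart A B) (h1 : H P (f * mob P A.2) ≠ 0)
    (h2 : H P (f * mob P A.2 * sigma P B) ≠ 0) : rootU N P f A B ≠ 0 := by
  refine mul_ne_zero (nthRoot_ne (mul_ne_zero ?_ ?_)) (div_ne_zero (nthRoot_ne h1) (nthRoot_ne h2))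
  · exact neg_ne_zero.2 (pow_ne_zero _ (neg_ne_zero.2 one_ne_zero))
  · exact div_ne_zero (sub_ne_zero.2 h.2.2.1) (sub_ne_zero.2 h.2.2.2)

theorem rootW_ne {f : Fin g → ℂ} {A B : ℂ × ℂ} (h : Apart A B) (h1 : H P (f * mob P B.2) ≠ 0)
    (h2 : H P (f * mob P B.2 * sigma P A) ≠ 0) : rootW N P f A B ≠ 0 := by
  refine mul_ne_zero (nthRoot_ne (mul_ne_zero ?_ ?_)) (div_ne_zero (nthRoot_ne h1) (nthRoot_ne h2))
  · exact pow_ne_zero _ (neg_ne_zero.2 one_ne_zero)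
  · exact div_ne_zero (sub_ne_zero.2 h.2.1.symm) (sub_ne_zero.2 h.2.2.2.symm)

theorem crossRatio_ne_zero {A B : ℂ × ℂ} (h : Apart A B) : crossRatio A.1 A.2 B.1 B.2 ≠ 0 :=
  div_ne_zero (mul_ne_zero (sub_ne_zero.2 h.1) (sub_ne_zero.2 h.2.2.2))
    (mul_ne_zero (sub_ne_zero.2 h.2.1) (sub_ne_zero.2 h.2.2.1))

theorem crossRatio_eq_div {A B : ℂ × ℂ} :
    crossRatio A.1 A.2 B.1 B.2 = ratioAt B A.1 / ratioAt B A.2 := by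
  rw [crossRatio, ratioAt, ratioAt, div_div_div_eq]

variable {F : Fin g → ℂ} {X Y Z : ℂ × ℂ}

theorem stdVertex_isFunctional (h : VertexRegular P F X Y Z) :
    (stdVertex N P F X Y Z).IsFunctional N P F X Y Z := by
  have hH := h.H_ne
  simp only [vertexArgs, List.forall_mem_cons, List.not_mem_nil, false_imp_iff, implies_true,
    and_true] at hH
  obtain ⟨h1, h2, h3, h4, h5, h6, h7, h8, h9, h10, h11, h12, h13, h14, h15, h16, h17, h18, h19, h20,
    h21, h22⟩ := hH
  have c1 : ∀ v a b : Fin g → ℂ, v * a * b = v * b * a := fun v a b => mul_right_comm v a b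
  refine ⟨rootU_pow _ _ _, rootW_pow _ _ _, rootU_pow _ _ _, rootW_pow _ _ _, rootU_pow _ _ _,
    rootW_pow _ _ _, rootU_pow _ _ _, rootW_pow _ _ _, rootU_pow _ _ _, rootW_pow _ _ _,
    rootU_pow _ _ _, rootW_pow _ _ _, nthRoot_pow _, nthRoot_pow _, nthRoot_pow _, ?_, ?_, ?_, ?_⟩
  · simp only [stdVertex, List.forall_mem_cons, List.not_mem_nil, false_imp_iff, implies_true, and_true]
    exact ⟨rootU_ne h.YZ h1 h2, rootW_ne h.YZ h3 h4, nthRoot_ne (neg_ne_zero.2 (crossRatio_ne_zero h.YZ)),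
      rootU_ne h.XZ h5 h6, rootW_ne h.XZ h7 h8, nthRoot_ne (neg_ne_zero.2 (crossRatio_ne_zero h.XZ)),
      rootU_ne h.XY h9 h10, rootW_ne h.XY h1 h11, nthRoot_ne (neg_ne_zero.2 (crossRatio_ne_zero h.XY)),
      rootU_ne h.YZ h12 h13, rootW_ne h.YZ h14 h15, rootU_ne h.XZ h9 h16, rootW_ne h.XZ h3 h17,
      rootU_ne h.XY h18 h19, rootW_ne h.XY h20 h21⟩
  · simp only [stdVertex, rootW]
    rw [c1 F (mob P Z.2) (sigma P Y), c1 (F * sigma P Y) (mob P Z.2) (sigma P X),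
      c1 (F * sigma P X) (mob P Z.2) (sigma P Y), c1 F (mob P Z.2) (sigma P X),
      c1 F (sigma P X) (sigma P Y)]
    have e1 := nthRoot_ne (N := N) h7
    have e2 := nthRoot_ne (N := N) h14
    field_simp
  · simp only [stdVertex, rootU]
    rw [c1 (F * sigma P Y) (mob P X.2) (sigma P Z), c1 F (mob P X.2) (sigma P Y),
      c1 F (mob P X.2) (sigma P Z), c1 (F * sigma P Z) (mob P X.2) (sigma P Y),
      c1 F (sigma P Z) (sigma P Y)]
    have e1 := nthRoot_ne (N := N) h5
    have e2 := nthRoot_ne (N := N) h18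
    field_simp
  · simp only [stdVertex, rootU, rootW]
    rw [c1 F (mob P Y.2) (sigma P Z), c1 F (mob P Y.2) (sigma P X),
      c1 (F * sigma P X) (mob P Y.2) (sigma P Z), c1 (F * sigma P Z) (mob P Y.2) (sigma P X),
      c1 F (sigma P X) (sigma P Z)]
    have e1 := nthRoot_ne (N := N) h1
    have e2 := nthRoot_ne (N := N) h12
    have e3 := nthRoot_ne (N := N) h20
    rw [c1 (F * sigma P Z) (mob P Y.2) (sigma P X)] at h21
    have e4 := nthRoot_ne (N := N) h21
    field_simp

theorem neg_one_pow_ne (N : ℕ) : ((-1 : ℂ) ^ N) ≠ 0 := pow_ne_zero _ (neg_ne_zero.2 one_ne_zero)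

theorem ratioAt_ne {A : ℂ × ℂ} {t : ℂ} (h1 : t ≠ A.1) (h2 : t ≠ A.2) : ratioAt A t ≠ 0 :=
  div_ne_zero (sub_ne_zero.2 h1) (sub_ne_zero.2 h2)

/-- The `N`-th powers of the coordinates of the Fermat points. -/
theorem stdVertex_x_pow (h : VertexRegular P F X Y Z) :
    (stdVertex N P F X Y Z).x N 0 ^ N = ratioAt Z X.2 / ratioAt Z Y.1 *
      (H P (F * sigma P Y * mob P X.2) / H P (F * sigma P Y * mob P X.2 * sigma P Z) *
        (H P (F * mob P Y.2 * sigma P Z) / H P (F * mob P Y.2))) ∧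
    (stdVertex N P F X Y Z).x N 1 ^ N = ratioAt Z X.1 / ratioAt Z Y.2 *
      (H P (F * mob P X.2) / H P (F * mob P X.2 * sigma P Z) *
        (H P (F * sigma P X * mob P Y.2 * sigma P Z) / H P (F * sigma P X * mob P Y.2))) ∧
    (stdVertex N P F X Y Z).x N 2 ^ N = ratioAt Z X.2 / ratioAt Z Y.2 *
      (H P (F * mob P X.2) / H P (F * mob P X.2 * sigma P Z) *
        (H P (F * mob P Y.2 * sigma P Z) / H P (F * mob P Y.2))) ∧
    (stdVertex N P F X Y Z).x N 3 ^ N = ratioAt Z X.1 / ratioAt Z Y.1 *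
      (H P (F * sigma P Y * mob P X.2) / H P (F * sigma P Y * mob P X.2 * sigma P Z) *
        (H P (F * sigma P X * mob P Y.2 * sigma P Z) / H P (F * sigma P X * mob P Y.2))) := by
  have hε := neg_one_pow_ne N
  have hX := ratioAt_ne h.XZ.2.2.1 h.XZ.2.2.2
  have hX' := ratioAt_ne h.XZ.1 h.XZ.2.1
  have hY := ratioAt_ne h.YZ.2.2.1 h.YZ.2.2.2
  have hY' := ratioAt_ne h.YZ.1 h.YZ.2.1
  have hU : ∀ f A, Ufun N P f A Z = -(-1) ^ N * ratioAt Z A.2 *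
      (H P (f * mob P A.2) / H P (f * mob P A.2 * sigma P Z)) := fun f A => by
    rw [Ufun, evalAt_eq]; rfl
  have hq : (omega N)⁻¹ ^ N = 1 := by rw [inv_pow, omega_pow, inv_one]
  have hh : (omegaHalf N)⁻¹ ^ N = -1 := by rw [inv_pow, omegaHalf_pow]; norm_num
  refine ⟨?_, ?_, ?_, ?_⟩
  · simp only [Vertex.x, stdVertex, Matrix.cons_val_zero, Matrix.cons_val_one, mul_pow, div_pow, hh,
      rootU_pow, nthRoot_pow, hU, crossRatio_eq_div]
    field_simp
  · simp only [Vertex.x, stdVertex, Matrix.cons_val_zero, Matrix.cons_val_one, mul_pow, div_pow, hh,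
      rootU_pow, nthRoot_pow, hU, crossRatio_eq_div]
    field_simp
  · simp only [Vertex.x, stdVertex, Matrix.cons_val, mul_pow, div_pow, hq,
      rootU_pow, nthRoot_pow, hU, crossRatio_eq_div]
    field_simp
  · simp only [Vertex.x, stdVertex, Matrix.cons_val, mul_pow, div_pow, hq,
      rootU_pow, nthRoot_pow, hU, crossRatio_eq_div]
    field_simp

end StandardVertex

end

end BS

namespace BS

noncomputable section

section FermatPoints

variable {N : ℕ} [NeZero N] {g : ℕ} {P : Fin g → ℂ × ℂ} {F : Fin g → ℂ} {X Y Z : ℂ × ℂ}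

theorem one_sub_ratio {A : ℂ × ℂ} {s t : ℂ} (hs : s ≠ A.2) (ht : t ≠ A.2) (ht' : t ≠ A.1) :
    1 - ratioAt A s / ratioAt A t = (A.1 - A.2) * (t - s) / ((t - A.1) * (s - A.2)) := by
  have h1 := sub_ne_zero.2 hs
  have h2 := sub_ne_zero.2 ht
  have h3 := sub_ne_zero.2 ht'
  rw [ratioAt, ratioAt]
  field_simp
  ring

theorem one_sub_of_fay {φ ψ a b c d G : ℂ} (hψ : ψ ≠ 0) (hb : b ≠ 0) (hd : d ≠ 0)
    (h : ψ * (b * d) - φ * (a * c) = (ψ - φ) * G) :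
    1 - φ / ψ * (a / b * (c / d)) = (1 - φ / ψ) * (G / (b * d)) := by
  field_simp
  linear_combination h

theorem stdVertex_one_sub_x_pow (h : VertexRegular P F X Y Z) :
    1 - (stdVertex N P F X Y Z).x N 0 ^ N = (1 - ratioAt Z X.2 / ratioAt Z Y.1) *
      (H P (F * mob P X.2 * mob P Y.2 / mob P Z.1) * H P (F * sigma P Y * mob P Z.2) /
        (H P (F * sigma P Y * mob P X.2 * sigma P Z) * H P (F * mob P Y.2))) ∧
    1 - (stdVertex N P F X Y Z).x N 1 ^ N = (1 - ratioAt Z X.1 / ratioAt Z Y.2) *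
      (H P (F * mob P X.2 * mob P Y.2 / mob P Z.1) * H P (F * sigma P X * mob P Z.2) /
        (H P (F * mob P X.2 * sigma P Z) * H P (F * sigma P X * mob P Y.2))) ∧
    1 - (stdVertex N P F X Y Z).x N 2 ^ N = (1 - ratioAt Z X.2 / ratioAt Z Y.2) *
      (H P (F * mob P X.2 * mob P Y.2 / mob P Z.1) * H P (F * mob P Z.2) /
        (H P (F * mob P X.2 * sigma P Z) * H P (F * mob P Y.2))) ∧
    1 - (stdVertex N P F X Y Z).x N 3 ^ N = (1 - ratioAt Z X.1 / ratioAt Z Y.1) *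
      (H P (F * mob P X.2 * mob P Y.2 / mob P Z.1) * H P (F * sigma P X * sigma P Y * mob P Z.2) /
        (H P (F * sigma P Y * mob P X.2 * sigma P Z) * H P (F * sigma P X * mob P Y.2))) := by
  obtain ⟨e0, e1, e2, e3⟩ := stdVertex_x_pow (N := N) h
  have hH := h.H_ne
  simp only [vertexArgs, List.forall_mem_cons, List.not_mem_nil, false_imp_iff, implies_true,
    and_true] at hH
  obtain ⟨h1, h2, h3, h4, h5, h6, h7, h8, h9, h10, h11, h12, h13, h14, h15, h16, h17, h18, h19, h20,
    h21, h22⟩ := hH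
  have hX := h.avX.2.mob_ne
  have hX' := h.avX.1.mob_ne
  have hY := h.avY.2.mob_ne
  have hY' := h.avY.1.mob_ne
  have hZ := h.avZ.2.mob_ne
  have hZ' := h.avZ.1.mob_ne
  have hφY := ratioAt_ne h.YZ.2.2.1 h.YZ.2.2.2
  have hφY' := ratioAt_ne h.YZ.1 h.YZ.2.1
  have sX := sigma_eq (P := P) X
  have sY := sigma_eq (P := P) Y
  have sZ := sigma_eq (P := P) Z
  have a1 : F * sigma P Y * mob P Y.1 = F * mob P Y.2 := by
    ext j; have := hY' j; simp only [sY, Pi.mul_apply, Pi.div_apply]; field_simp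
  have a2 : F * sigma P Y * mob P X.2 * mob P Y.1 / mob P Z.1 =
      F * mob P X.2 * mob P Y.2 / mob P Z.1 := by
    ext j; have := hY' j; simp only [sY, Pi.mul_apply, Pi.div_apply]; field_simp
  have a3 : F * sigma P X * mob P X.1 = F * mob P X.2 := by
    ext j; have := hX' j; simp only [sX, Pi.mul_apply, Pi.div_apply]; field_simp
  have a4 : F * mob P X.2 * mob P Y.2 / mob P Z.1 = F * sigma P X * mob P X.1 * mob P Y.2 / mob P Z.1 := by
    rw [a3]
  have a5 : F * sigma P X * sigma P Y * mob P X.1 = F * sigma P Y * mob P X.2 := by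
    ext j; have := hX' j; simp only [sX, Pi.mul_apply, Pi.div_apply]; field_simp
  have a6 : F * sigma P X * sigma P Y * mob P Y.1 = F * sigma P X * mob P Y.2 := by
    ext j; have := hY' j; simp only [sY, Pi.mul_apply, Pi.div_apply]; field_simp
  have a7 : F * sigma P Y * mob P X.2 * mob P Y.1 / mob P Z.1 = F * mob P X.2 * mob P Y.2 / mob P Z.1 := by
    ext j; have := hY' j; simp only [sY, Pi.mul_apply, Pi.div_apply]; field_simp
  refine ⟨?_, ?_, ?_, ?_⟩
  · have q := fay_ratio (F * sigma P Y) h.avX.2 h.avY.1 h.avZ.2 h.avZ.1 h.XZ.2.2.2 h.YZ.2.1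
    rw [← sZ, a1, a2] at q
    rw [e0]
    exact one_sub_of_fay hφY' h6 h1 q
  · have q := fay_ratio (F * sigma P X) h.avX.1 h.avY.2 h.avZ.2 h.avZ.1 h.XZ.2.1 h.YZ.2.2.2
    rw [← sZ, a3] at q
    rw [e1]
    exact one_sub_of_fay hφY h16 h12 q
  · have q := fay_ratio F h.avX.2 h.avY.2 h.avZ.2 h.avZ.1 h.XZ.2.2.2 h.YZ.2.2.2
    rw [← sZ] at q
    rw [e2]
    exact one_sub_of_fay hφY h16 h1 q
  · have q := fay_ratio (F * sigma P X * sigma P Y) h.avX.1 h.avY.1 h.avZ.2 h.avZ.1 h.XZ.2.1 h.YZ.2.1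
    rw [← sZ, a5, a6, a7] at q
    rw [e3]
    exact one_sub_of_fay hφY' h6 h12 q

/-- The `y`-coordinates of the Fermat points of the standard vertex. -/
def stdY (N : ℕ) [NeZero N] (V : Vertex) : Fin 4 → ℂ :=
  let y := nthRoot N (1 - V.x N 0 ^ N)
  let z := y * (V.κ₁ * V.w₁ / V.u₃')
  ![y, z * (V.w₃ / V.w₂'), z, y * ((omegaHalf N)⁻¹ * (V.κ₃ * V.w₃ / V.w₂))]

theorem stdVertex_isFermat (h : VertexRegular P F X Y Z) :
    (stdVertex N P F X Y Z).IsFermat N (stdY N (stdVertex N P F X Y Z)) := by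
  obtain ⟨e0, e1, e2, e3⟩ := stdVertex_one_sub_x_pow (N := N) h
  have hV := stdVertex_isFunctional (N := N) h
  have hne := hV.ne_zero
  simp only [List.forall_mem_cons, List.not_mem_nil, false_imp_iff, implies_true,
    and_true] at hne
  obtain ⟨n1, n2, n3, n4, n5, n6, n7, n8, n9, n10, n11, n12, n13, n14, n15⟩ := hne
  have hH := h.H_ne
  simp only [vertexArgs, List.forall_mem_cons, List.not_mem_nil, false_imp_iff, implies_true,
    and_true] at hH
  obtain ⟨h1, h2, h3, h4, h5, h6, h7, h8, h9, h10, h11, h12, h13, h14, h15, h16, h17, h18, h19, h20,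
    h21, h22⟩ := hH
  have c1 : ∀ v a b : Fin g → ℂ, v * a * b = v * b * a := fun v a b => mul_right_comm v a b
  have hYX := h.XY.symm
  have hε := neg_one_pow_ne N
  have d1 := sub_ne_zero.2 h.XY.1
  have d2 := sub_ne_zero.2 h.XY.2.1
  have d3 := sub_ne_zero.2 h.XY.2.2.1
  have d4 := sub_ne_zero.2 h.XY.2.2.2
  have d5 := sub_ne_zero.2 h.YZ.1
  have d6 := sub_ne_zero.2 h.YZ.2.1
  have d7 := sub_ne_zero.2 h.YZ.2.2.1
  have d8 := sub_ne_zero.2 h.YZ.2.2.2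
  have d9 := sub_ne_zero.2 h.XZ.1
  have d10 := sub_ne_zero.2 h.XZ.2.1
  have d11 := sub_ne_zero.2 h.XZ.2.2.1
  have d12 := sub_ne_zero.2 h.XZ.2.2.2
  have g1 := sub_ne_zero.2 h.XY.1.symm
  have g2 := sub_ne_zero.2 h.XY.2.1.symm
  have g3 := sub_ne_zero.2 h.XY.2.2.1.symm
  have g4 := sub_ne_zero.2 h.XY.2.2.2.symm
  have g6 := sub_ne_zero.2 h.YZ.2.1.symm
  have g8 := sub_ne_zero.2 h.YZ.2.2.2.symm
  have g10 := sub_ne_zero.2 h.XZ.2.1.symm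
  have g12 := sub_ne_zero.2 h.XZ.2.2.2.symm
  have dz := sub_ne_zero.2 h.ZZ
  rw [one_sub_ratio h.XZ.2.2.2 h.YZ.2.1 h.YZ.1] at e0
  rw [one_sub_ratio h.XZ.2.1 h.YZ.2.2.2 h.YZ.2.2.1] at e1
  rw [one_sub_ratio h.XZ.2.2.2 h.YZ.2.2.2 h.YZ.2.2.1] at e2
  rw [one_sub_ratio h.XZ.2.1 h.YZ.2.1 h.YZ.1] at e3
  have hh : (omegaHalf N)⁻¹ ^ N = -1 := by rw [inv_pow, omegaHalf_pow]; norm_num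
  have hU : ∀ f A B, Ufun N P f A B = -(-1) ^ N * ((A.2 - B.1) / (A.2 - B.2)) *
      (H P (f * mob P A.2) / H P (f * sigma P B * mob P A.2)) := fun f A B => by
    rw [Ufun, evalAt_eq, c1]
  have hW : ∀ f A B, Wfun N P f A B = (-1) ^ N * ((B.2 - A.1) / (B.2 - A.2)) *
      (H P (f * mob P B.2) / H P (f * sigma P A * mob P B.2)) := fun f A B => by
    rw [Wfun, hU]; ring
  rw [c1 (F * sigma P Y) (mob P X.2) (sigma P Z), c1 F (sigma P Y) (sigma P Z)] at h6 e0 e3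
  rw [c1 F (mob P X.2) (sigma P Z)] at h16 e1 e2
  have hy0 : (stdY N (stdVertex N P F X Y Z)) 0 ^ N = 1 - (stdVertex N P F X Y Z).x N 0 ^ N :=
    nthRoot_pow _
  have hy0ne : (stdY N (stdVertex N P F X Y Z)) 0 ≠ 0 := by
    refine nthRoot_ne ?_
    rw [e0]
    exact mul_ne_zero (div_ne_zero (mul_ne_zero dz g3) (mul_ne_zero d5 d12))
      (div_ne_zero (mul_ne_zero h22 h7) (mul_ne_zero h6 h1))
  have r2 : (stdY N (stdVertex N P F X Y Z)) 2 = (stdY N (stdVertex N P F X Y Z)) 0 *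
    ((stdVertex N P F X Y Z).κ₁ * (stdVertex N P F X Y Z).w₁ / (stdVertex N P F X Y Z).u₃') := rfl
  have r3 : (stdY N (stdVertex N P F X Y Z)) 3 = (stdY N (stdVertex N P F X Y Z)) 0 *
    ((omegaHalf N)⁻¹ * ((stdVertex N P F X Y Z).κ₃ * (stdVertex N P F X Y Z).w₃ /
      (stdVertex N P F X Y Z).w₂)) := rfl
  have r1 : (stdY N (stdVertex N P F X Y Z)) 1 = (stdY N (stdVertex N P F X Y Z)) 2 *
    ((stdVertex N P F X Y Z).w₃ / (stdVertex N P F X Y Z).w₂') := rfl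
  have hy2 : (stdY N (stdVertex N P F X Y Z)) 2 ^ N = 1 - (stdVertex N P F X Y Z).x N 2 ^ N := by
    rw [r2, mul_pow, div_pow, mul_pow, hy0, e0, e2, hV.κ₁_pow, hV.w₁_pow, hV.u₃'_pow, hW, hU, crossRatio]
    field_simp
    ring
  have hoh := omegaHalf_ne_zero N
  have ne2 : (stdY N (stdVertex N P F X Y Z)) 2 ≠ 0 := by
    rw [r2]; exact mul_ne_zero hy0ne (div_ne_zero (mul_ne_zero n3 n2) n14)
  have ne1 : (stdY N (stdVertex N P F X Y Z)) 1 ≠ 0 := by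
    rw [r1]; exact mul_ne_zero ne2 (div_ne_zero n8 n13)
  refine ⟨?_, ?_, ?_, ?_, ?_⟩
  · intro i
    rw [add_comm, ← eq_sub_iff_add_eq]
    fin_cases i
    · exact hy0
    · change (stdY N (stdVertex N P F X Y Z)) 1 ^ N = 1 - (stdVertex N P F X Y Z).x N 1 ^ N
      rw [r1, mul_pow, div_pow, hy2, e2, e1, hV.w₂'_pow, hV.w₃_pow, hW, hW]
      field_simp
      ring
    · exact hy2
    · change (stdY N (stdVertex N P F X Y Z)) 3 ^ N = 1 - (stdVertex N P F X Y Z).x N 3 ^ N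
      rw [r3, mul_pow, mul_pow, div_pow, mul_pow, hy0, e0, e3, hh, hV.κ₃_pow, hV.w₃_pow, hV.w₂_pow,
        hW, hW, crossRatio, c1 F (sigma P X) (sigma P Y)]
      field_simp
      ring
  · intro i
    fin_cases i
    · exact hy0ne
    · exact ne1
    · exact ne2
    · change (stdY N (stdVertex N P F X Y Z)) 3 ≠ 0
      rw [r3]
      exact mul_ne_zero hy0ne (mul_ne_zero (inv_ne_zero hoh) (div_ne_zero (mul_ne_zero n9 n8) n5))
  · rw [r2, mul_div_cancel_left₀ _ hy0ne]
  · rw [r3, mul_div_cancel_left₀ _ hy0ne]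
  · rw [r1]
    field_simp

end FermatPoints

end

end BS

namespace BS

noncomputable section

section StandardChain

variable {N : ℕ} [NeZero N] {g : ℕ} {Y : Fin (g + 1) → ℂ × ℂ} {Z : Fin 2 → ℂ × ℂ}
  {P : Fin g → ℂ × ℂ} {f : Fin g → ℂ} {X : ℂ × ℂ}

/-- The chosen roots of the scalars of the Lax operators. -/
def stdScalars (N : ℕ) [NeZero N] (Y : Fin (g + 1) → ℂ × ℂ) (Z : Fin 2 → ℂ × ℂ) : LaxScalars g where
  u n := nthRoot N (-(-1) ^ N * (((Y n).2 - (Z 0).1) / ((Y n).2 - (Z 0).2)))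
  ut n := nthRoot N (-(-1) ^ N * (((Y n).2 - (Z 1).1) / ((Y n).2 - (Z 1).2)))
  v n := nthRoot N ((-1) ^ N * (((Z 0).2 - (Y n).1) / ((Z 0).2 - (Y n).2))) /
    nthRoot N ((-1) ^ N * (((Z 1).2 - (Y n).1) / ((Z 1).2 - (Y n).2)))
  κ n := nthRoot N (-crossRatio (Y n).1 (Y n).2 (Z 0).1 (Z 0).2)
  κt n := nthRoot N (-crossRatio (Y n).1 (Y n).2 (Z 1).1 (Z 1).2)

theorem stdScalars_isCrossRatioParam (hYZ : AdmissiblePoints Y Z) :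
    (stdScalars N Y Z).IsCrossRatioParam N Y Z := by
  refine ⟨fun n => nthRoot_pow _, fun n => nthRoot_pow _, fun n => ?_, fun n => nthRoot_pow _,
    fun n => nthRoot_pow _⟩
  have hε := neg_one_pow_ne N
  have h0 := hYZ.Y_ne_Z n 0
  have h1 := hYZ.Y_ne_Z n 1
  have a1 := sub_ne_zero.2 h0.2.1
  have a2 := sub_ne_zero.2 h0.2.2.2
  have a3 := sub_ne_zero.2 h1.2.1
  have a4 := sub_ne_zero.2 h1.2.2.2
  have b1 := sub_ne_zero.2 h0.2.1.symm
  have b2 := sub_ne_zero.2 h0.2.2.2.symm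
  have b3 := sub_ne_zero.2 h1.2.1.symm
  have b4 := sub_ne_zero.2 h1.2.2.2.symm
  simp only [stdScalars, div_pow, nthRoot_pow, crossRatio]
  field_simp
  ring

/-- The root of the centre `X_n^N`. -/
def rootX (N : ℕ) [NeZero N] (P : Fin g → ℂ × ℂ) (F : Fin g → ℂ) (Y Z : ℂ × ℂ) : ℂ :=
  nthRoot N (H P (F * mob P Y.2)) / nthRoot N (H P (F * mob P Y.2 * sigma P Z))

/-- The root of the centre `Z_n^N`. -/
def rootZ (N : ℕ) [NeZero N] (P : Fin g → ℂ × ℂ) (F : Fin g → ℂ) (Y : ℂ × ℂ)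
    (Z : Fin 2 → ℂ × ℂ) : ℂ :=
  nthRoot N (H P (F * mob P (Z 0).2)) / nthRoot N (H P (F * mob P (Z 0).2 * sigma P Y)) /
    (nthRoot N (H P (F * sigma P (Z 0) * mob P (Z 1).2)) /
      nthRoot N (H P (F * sigma P (Z 0) * mob P (Z 1).2 * sigma P Y)))

/-- The consistent choice of roots made of chosen roots of the theta functions. -/
def stdRoots (N : ℕ) [NeZero N] (Y : Fin (g + 1) → ℂ × ℂ) (Z : Fin 2 → ℂ × ℂ)
    (P : Fin g → ℂ × ℂ) (f : Fin g → ℂ) (X : ℂ × ℂ) : ChainRoots g where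
  α n := rootX N P (f * shiftI Y P ((n : ℕ) + 1)) (Y n) (Z 0)
  β n := rootZ N P (f * shiftI Y P ((n : ℕ) + 1)) (Y n) Z
  α' n := rootX N P (f * shiftI Y P ((n : ℕ) + 1) * sigma P X) (Y n) (Z 0)
  β' n := rootZ N P (f * shiftI Y P ((n : ℕ) + 1) * sigma P X) (Y n) Z
  V n := stdVertex N P (f * shiftI Y P ((n : ℕ) + 1)) X (Y n) (Z 0)
  Vt n := stdVertex N P (f * shiftI Y P ((n : ℕ) + 1) * sigma P (Z 0)) X (Y n) (Z 1)
  y n := stdY N (stdVertex N P (f * shiftI Y P ((n : ℕ) + 1)) X (Y n) (Z 0))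
  yt n := stdY N (stdVertex N P (f * shiftI Y P ((n : ℕ) + 1) * sigma P (Z 0)) X (Y n) (Z 1))

theorem rootX_pow (f : Fin g → ℂ) (n : Fin (g + 1)) :
    rootX N P (f * shiftI Y P ((n : ℕ) + 1)) (Y n) (Z 0) ^ N = centreX Y Z P f n := by
  rw [rootX, div_pow, nthRoot_pow, nthRoot_pow, centreX, evalAt_eq, mul_right_comm f]

theorem rootZ_pow (hP : IsSolutionSystem Y Z P) (f : Fin g → ℂ) (n : Fin (g + 1)) :
    rootZ N P (f * shiftI Y P ((n : ℕ) + 1)) (Y n) Z ^ N = centreZ Y Z P f n := by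
  have e1 : f * shiftI Y P ((n : ℕ) + 1) * mob P (Z 0).2 =
      f * mob P (Z 0).2 * shiftI Y P ((n : ℕ) + 1) := mul_right_comm _ _ _
  have e2 : f * shiftI Y P ((n : ℕ) + 1) * sigma P (Z 0) * mob P (Z 1).2 =
      f * mob P (Z 1).2 * sigma P (Z 0) * shiftI Y P ((n : ℕ) + 1) := by ring
  rw [rootZ, div_pow, div_pow, div_pow, nthRoot_pow, nthRoot_pow, nthRoot_pow, nthRoot_pow, centreZ,
    evalAt_eq, evalAt_eq, hP.shiftI_eq n, e1, e2, mul_assoc _ _ (sigma P (Y n)),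
    mul_assoc _ _ (sigma P (Y n)), div_div_eq_mul_div, div_mul_div_comm, div_mul_eq_mul_div, div_div]
  congr 1
  ring

theorem shiftI_succ (hP : IsSolutionSystem Y Z P) (n : Fin (g + 1)) :
    f * shiftI Y P (((n + 1 : Fin (g + 1)) : ℕ) + 1) * sigma P (Y (n + 1)) =
      f * shiftI Y P ((n : ℕ) + 1) := by
  rw [mul_assoc, ← hP.shiftI_eq (n + 1)]
  congr 1
  rcases eq_or_ne n (Fin.last g) with rfl | hn
  · rw [Fin.last_add_one, Fin.val_zero, IsSolutionSystem.shiftI_zero, Fin.val_last, hP.shiftI_last]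
  · rw [Fin.val_add_one_of_lt (Fin.lt_last_iff_ne_last.2 hn)]

/-- The nonvanishing conditions for a chain. -/
structure ChainRegular (Y : Fin (g + 1) → ℂ × ℂ) (Z : Fin 2 → ℂ × ℂ)
    (P : Fin g → ℂ × ℂ) (f : Fin g → ℂ) (X : ℂ × ℂ) : Prop where
  points : AdmissiblePoints Y Z
  solution : IsSolutionSystem Y Z P
  vertex : ∀ n : Fin (g + 1), VertexRegular P (f * shiftI Y P ((n : ℕ) + 1)) X (Y n) (Z 0)
  vertex_t : ∀ n : Fin (g + 1),
    VertexRegular P (f * shiftI Y P ((n : ℕ) + 1) * sigma P (Z 0)) X (Y n) (Z 1)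

theorem stdRoots_isConsistent (h : ChainRegular Y Z P f X) :
    (stdRoots N Y Z P f X).IsConsistent N Y Z P (stdScalars N Y Z) f X := by
  have hP := h.solution
  have s01 : ∀ F : Fin g → ℂ, F * sigma P (Z 0) * sigma P (Z 1) = F := fun F => by
    rw [mul_assoc, hP.sigma_Z_mul, mul_one]
  have e1 : ∀ F a : Fin g → ℂ, F * sigma P (Z 0) * a * sigma P (Z 1) = F * a := fun F a => by
    rw [mul_right_comm, s01]
  have e2 : ∀ F : Fin g → ℂ, F * sigma P (Z 0) * sigma P X = F * sigma P X * sigma P (Z 0) :=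
    fun F => mul_right_comm _ _ _
  have e3 : ∀ F a : Fin g → ℂ, F * sigma P (Z 0) * a = F * a * sigma P (Z 0) :=
    fun F a => mul_right_comm _ _ _
  refine ⟨fun j => ?_, fun n => rootX_pow f n, fun n => rootZ_pow hP f n, fun n => ?_, fun n => ?_,
    fun n => stdVertex_isFunctional (h.vertex n), fun n => stdVertex_isFunctional (h.vertex_t n),
    fun n => stdVertex_isFermat (h.vertex n), fun n => stdVertex_isFermat (h.vertex_t n),
    fun n => ⟨rfl, ?_, ?_, rfl, rfl⟩, fun n => ⟨rfl, ?_, ?_⟩, fun n => ?_, fun n => ?_,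
    fun n => ⟨rfl, rfl, rfl⟩, fun n => ?_⟩
  · rw [sigma_eq]
    exact div_ne_zero ((h.vertex 0).avX.2.mob_ne j) ((h.vertex 0).avX.1.mob_ne j)
  · rw [← rootX_pow (N := N), mul_right_comm f]; rfl
  · rw [← rootZ_pow (N := N) hP, mul_right_comm f]; rfl
  · simp only [stdRoots, stdVertex, rootU, rootX, stdScalars, e1, inv_div]
    simp only [e3]
  · simp only [stdRoots, stdVertex, rootW, rootZ, stdScalars]
    rw [div_mul_div_comm]
  · simp only [stdRoots, stdVertex, rootU, rootX, stdScalars, e2, e1, inv_div]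
    simp only [e3]
  · simp only [stdRoots, stdVertex, rootW, rootZ, stdScalars]
    rw [div_mul_div_comm]
    simp only [e2]
  · simp only [stdRoots, stdVertex, shiftI_succ hP, and_self]
  · simp only [stdRoots, stdVertex]
    rw [mul_right_comm _ (sigma P (Z 0)), shiftI_succ hP]
    simp
  · simp only [stdRoots, stdVertex, s01, and_self]

end StandardChain

end

end BS

namespace BS

noncomputable section

section TraceExpansion

theorem prod_ofFn_apply {J R : Type*} [Fintype J] [DecidableEq J] [CommSemiring R] {m : ℕ}
    (M : Fin (m + 1) → Matrix J J R) (i j : J) :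
    (List.ofFn M).prod i j = ∑ s : Fin m → J, ∏ n, M n (Fin.cons (α := fun _ => J) i s n)
      (Fin.snoc (α := fun _ => J) s j n) := by
  induction m generalizing i with
  | zero =>
    simp [Fin.snoc]
  | succ m ih =>
    rw [List.ofFn_succ, List.prod_cons, Matrix.mul_apply,
      ← (Fin.consEquiv fun _ : Fin (m + 1) => J).sum_comp, Fintype.sum_prod_type]
    refine Finset.sum_congr rfl fun k _ => ?_
    rw [ih, Finset.mul_sum]
    refine Finset.sum_congr rfl fun s _ => ?_
    have e : (Fin.consEquiv fun _ : Fin (m + 1) => J) (k, s) = Fin.cons (α := fun _ => J) k s := rfl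
    conv_rhs => rw [Fin.prod_univ_succ]
    rw [e, ← Fin.cons_snoc_eq_snoc_cons]
    rfl

/-- The trace of a product of matrices as a sum over closed paths. -/
theorem trace_prod_ofFn {J R : Type*} [Fintype J] [DecidableEq J] [CommSemiring R] {m : ℕ}
    (M : Fin (m + 1) → Matrix J J R) :
    (List.ofFn M).prod.trace = ∑ s : Fin (m + 1) → J, ∏ n, M n (s n) (s (n + 1)) := by
  rw [← (Fin.consEquiv fun _ : Fin (m + 1) => J).sum_comp, Fintype.sum_prod_type]
  refine Finset.sum_congr rfl fun k _ => ?_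
  rw [Matrix.diag_apply, prod_ofFn_apply]
  refine Finset.sum_congr rfl fun s _ => Finset.prod_congr rfl fun n _ => ?_
  congr 1
  induction n using Fin.lastCases with
  | last => simp [Fin.consEquiv_apply]
  | cast n => simp [Fin.consEquiv_apply, Fin.coeSucc_eq_succ]

variable {N : ℕ} [NeZero N] {g : ℕ}

theorem prod_siteAuxOp_apply (S : Fin (g + 1) → Matrix (ZMod N × ZMod N) (ZMod N × ZMod N) ℂ)
    (l : List (Fin (g + 1))) (hl : l.Nodup) (a b : Fin (g + 1) → ZMod N) (s t : ZMod N) :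
    (l.map fun n => siteAuxOp n (S n)).prod (a, s) (b, t) =
      if ∀ m, m ∉ l → a m = b m then
        (l.map fun n => (Matrix.of fun i j => S n (a n, i) (b n, j))).prod s t else 0 := by
  induction l generalizing a s with
  | nil =>
    by_cases h : a = b <;> by_cases h' : s = t <;>
      simp [Matrix.one_apply, h, h', ← funext_iff]
  | cons n l ih =>
    obtain ⟨hn, hl⟩ := List.nodup_cons.1 hl
    rw [List.map_cons, List.prod_cons, Matrix.mul_apply, Fintype.sum_prod_type,
      Finset.sum_eq_single (Function.update a n (b n))]
    · have e1 : ∀ r, siteAuxOp n (S n) (a, s) (Function.update a n (b n), r) =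
          S n (a n, s) (b n, r) := by
        intro r
        rw [siteAuxOp, Matrix.of_apply, if_pos]
        · simp
        · intro m hm; simp [hm]
      have e2 : (∀ m, m ∉ l → Function.update a n (b n) m = b m) ↔ ∀ m, m ∉ n :: l → a m = b m := by
        constructor
        · intro h m hm
          rw [List.mem_cons, not_or] at hm
          have := h m hm.2
          rwa [Function.update_of_ne hm.1] at this
        · intro h m hm
          rcases eq_or_ne m n with rfl | hmn
          · simp
          · rw [Function.update_of_ne hmn]
            exact h m (by simp [hmn, hm])
      have e3 : (l.map fun k => (Matrix.of fun i j => S k (Function.update a n (b n) k, i) (b k, j))) =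
          l.map fun k => (Matrix.of fun i j => S k (a k, i) (b k, j)) :=
        List.map_congr_left fun k hk => by
          rw [Function.update_of_ne (ne_of_mem_of_not_mem hk hn)]
      simp only [e1, ih hl, e2, e3]
      split_ifs with h
      · rw [List.map_cons, List.prod_cons, Matrix.mul_apply]
        rfl
      · simp
    · intro c _ hc
      refine Finset.sum_eq_zero fun r _ => ?_
      rw [ih hl, siteAuxOp, Matrix.of_apply]
      split_ifs with h1 h2
      · refine absurd ?_ hc
        ext m
        rcases eq_or_ne m n with rfl | hmn
        · rw [Function.update_self, h2 m hn]
        · rw [Function.update_of_ne hmn]; exact (h1 m hmn).symm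
      · rw [mul_zero]
      · rw [zero_mul]
      · rw [zero_mul]
    · simp

/-- The operator `𝐊` as a sum over the states of the auxiliary line. -/
theorem bigK_apply (r : ChainRoots g) (a b : Fin (g + 1) → ZMod N) :
    r.bigK N a b = ∑ s : Fin (g + 1) → ZMod N, ∏ n,
      intertwiner N (r.V n) (r.Vt n) (r.y n) (r.yt n) (a n, s n) (b n, s (n + 1)) := by
  have h := fun s t => prod_siteAuxOp_apply
    (fun n => intertwiner N (r.V n) (r.Vt n) (r.y n) (r.yt n)) (List.finRange (g + 1))
    (List.nodup_finRange _) a b s t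
  simp only [List.mem_finRange, not_true, false_imp_iff, implies_true, if_true,
    ← List.ofFn_eq_map] at h
  rw [ChainRoots.bigK, Matrix.of_apply]
  simp only [ChainRoots.bigQ, h]
  exact trace_prod_ofFn _

/-- The left factor of `𝐊`. -/
def leftFactor (w : Fin (g + 1) → Fin 4 → ZMod N → ℂ) :
    Matrix (Fin (g + 1) → ZMod N) (Fin (g + 1) → ZMod N) ℂ :=
  Matrix.of fun a s => ∏ n, w n 0 (s n - a n) / w n 2 (s (n + 1) - a n) *
    chi (omega N) (-(a n * (s n - s (n + 1))))

/-- The right factor of `𝐊`. -/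
def rightFactor (w : Fin (g + 1) → Fin 4 → ZMod N → ℂ) :
    Matrix (Fin (g + 1) → ZMod N) (Fin (g + 1) → ZMod N) ℂ :=
  Matrix.of fun s b => ∏ n, w n 1 (s (n + 1) - b n) / w n 3 (s n - b n) *
    chi (omega N) (b n * (s n - s (n + 1)))

theorem bigK_eq_mul (r : ChainRoots g) :
    r.bigK N = (N : ℂ) ^ (g + 1) • (leftFactor (fun n => pairW N (r.V n) (r.Vt n) (r.y n) (r.yt n)) *
      rightFactor fun n => pairW N (r.V n) (r.Vt n) (r.y n) (r.yt n)) := by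
  ext a b
  rw [bigK_apply, Matrix.smul_apply, Matrix.mul_apply, smul_eq_mul, Finset.mul_sum]
  refine Finset.sum_congr rfl fun s _ => ?_
  rw [leftFactor, rightFactor, Matrix.of_apply, Matrix.of_apply, ← Finset.prod_mul_distrib,
    ← Fin.prod_const, ← Finset.prod_mul_distrib]
  refine Finset.prod_congr rfl fun n _ => ?_
  have e : (b n - a n) * (s n - s (n + 1)) = -(a n * (s n - s (n + 1))) + b n * (s n - s (n + 1)) := by
    ring
  rw [intertwiner_apply, e, chi_add (omega_pow N)]
  ring

end TraceExpansion

end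

end BS

namespace BS

noncomputable section

section ExistsPlace

open MvPolynomial

variable {L : Type*} [Field L] [Algebra ℂ L] {σ κ : Type*}

theorem exists_valuationSubring_of_hom {T k : Type*} [CommRing T] [Field k] (φ : T →+* L)
    (hφ : Function.Injective φ) (ψ : T →+* k) :
    ∃ B : ValuationSubring L, (∀ t, φ t ∈ B) ∧ ∀ t, ψ t = 0 → φ t ∈ B.nonunits := by
  have hsurj : Function.Surjective φ.rangeRestrict := φ.rangeRestrict_surjective
  have hItop : (RingHom.ker ψ).map φ.rangeRestrict ≠ ⊤ := by
    intro htop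
    have h1 : (1 : φ.range) ∈ (RingHom.ker ψ).map φ.rangeRestrict := htop ▸ Submodule.mem_top
    obtain ⟨t, ht, ht1⟩ := (Ideal.mem_map_iff_of_surjective _ hsurj).1 h1
    have : t = 1 := hφ (by rw [map_one]; exact congrArg Subtype.val ht1)
    rw [this, RingHom.mem_ker, map_one] at ht
    exact one_ne_zero ht
  obtain ⟨B, hB1, hB2⟩ := Ideal.image_subset_nonunits_valuationSubring _ hItop
  exact ⟨B, fun t => hB1 ⟨t, rfl⟩, fun t ht =>
    hB2 ⟨φ.rangeRestrict t, Ideal.mem_map_of_mem _ ht, rfl⟩⟩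

/-- A place of a field that specializes algebraically independent elements `a i` to prescribed
numbers, and further independent elements to zero, faster than all the functions of the `a i`. -/
theorem exists_place (a : σ → L) (f : κ → L) (h : AlgebraicIndependent ℂ (Sum.elim f a))
    (s : σ → ℂ) : ∃ B : ValuationSubring L, (∀ c : ℂ, algebraMap ℂ L c ∈ B) ∧
      (∀ i, a i - algebraMap ℂ L (s i) ∈ B.nonunits) ∧
      ∀ j c, IsAlgebraic (Algebra.adjoin ℂ (Set.range a)) c → f j * c ∈ B.nonunits := by
  classical
  obtain ⟨ha, hf⟩ := AlgebraicIndependent.sumElim_iff.1 h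
  set R := Algebra.adjoin ℂ (Set.range a) with hR
  have hf' := hf.subalgebraAlgebraicClosure
  set L₀ := Subalgebra.algebraicClosure R L with hL₀
  have hinj : Function.Injective (algebraMap L₀ L) := Subtype.val_injective
  let T : Subring (MvPolynomial κ L₀ × MvPolynomial σ ℂ) :=
    RingHom.eqLocus ((algebraMap L₀ L).comp (constantCoeff.comp (RingHom.fst _ _)))
      ((aeval a : MvPolynomial σ ℂ →ₐ[ℂ] L).toRingHom.comp (RingHom.snd _ _))
  have hT : ∀ t, t ∈ T ↔ algebraMap L₀ L (constantCoeff t.1) = aeval a t.2 := fun t => Iff.rfl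
  let φ : T →+* L := ((aeval f : MvPolynomial κ L₀ →ₐ[L₀] L).toRingHom.comp (RingHom.fst _ _)).comp T.subtype
  let ψ : T →+* ℂ := ((aeval s : MvPolynomial σ ℂ →ₐ[ℂ] ℂ).toRingHom.comp (RingHom.snd _ _)).comp T.subtype
  have hφ : ∀ t : T, φ t = aeval f t.1.1 := fun t => rfl
  have hψ : ∀ t : T, ψ t = aeval s t.1.2 := fun t => rfl
  have φinj : Function.Injective φ := by
    intro t t' ht
    have h1 : t.1.1 = t'.1.1 := hf' ht
    have h2 : t.1.2 = t'.1.2 := by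
      apply ha
      rw [← (hT _).1 t.2, ← (hT _).1 t'.2, h1]
    exact Subtype.ext (Prod.ext h1 h2)
  obtain ⟨B, hmem, hnon⟩ := exists_valuationSubring_of_hom φ φinj ψ
  have halg : ∀ r : R, IsAlgebraic R (r : L) := fun r => isAlgebraic_algebraMap r
  refine ⟨B, fun c => ?_, fun i => ?_, fun j c hc => ?_⟩
  · have hm : ((algebraMap ℂ (MvPolynomial κ L₀) c, MvPolynomial.C c) :
        MvPolynomial κ L₀ × MvPolynomial σ ℂ) ∈ T := by
      rw [hT, MvPolynomial.algebraMap_apply]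
      simp
    have := hmem ⟨_, hm⟩
    rw [hφ] at this
    simpa using this
  · have hai : a i ∈ R := Algebra.subset_adjoin ⟨i, rfl⟩
    let a' : L₀ := ⟨a i, halg ⟨a i, hai⟩⟩
    have hm : ((MvPolynomial.C a' - algebraMap ℂ (MvPolynomial κ L₀) (s i), MvPolynomial.X i - MvPolynomial.C (s i)) :
        MvPolynomial κ L₀ × MvPolynomial σ ℂ) ∈ T := by
      rw [hT, MvPolynomial.algebraMap_apply]
      simp
      rfl
    have h1 := hnon ⟨_, hm⟩ (by rw [hψ]; simp)
    rw [hφ] at h1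
    simp only [map_sub, aeval_C, AlgHom.map_algebraMap] at h1
    convert! h1 using 1
  · let c' : L₀ := ⟨c, hc⟩
    have hm : ((MvPolynomial.X j * MvPolynomial.C c', 0) :
        MvPolynomial κ L₀ × MvPolynomial σ ℂ) ∈ T := by
      rw [hT]
      simp
    have h1 := hnon ⟨_, hm⟩ (by rw [hψ]; simp)
    rw [hφ] at h1
    simp only [map_mul, aeval_C, aeval_X] at h1
    exact h1

end ExistsPlace

end

end BS

namespace BS

noncomputable section

open Filter

section Places

variable {Ω : Type} {U : Ultrafilter Ω}

/-- A field of germs of functions. -/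
theorem exists_germField (U : Ultrafilter Ω) : ∃ (L : Type) (_ : Field L) (π : (Ω → ℂ) →+* L),
    ∀ h, π h = 0 ↔ ∀ᶠ x in (U : Filter Ω), h x = 0 :=
  ⟨Germ (U : Filter Ω) ℂ, inferInstance, Germ.coeRingHom _, fun _ => Germ.coe_eq⟩

/-- A place of the field of germs of functions, given by the relation between the finite germs
and their values in the residue field. -/
structure IsPlace (U : Ultrafilter Ω) {k : Type} [Field k] (e : ℂ →+* k)
    (Red : (Ω → ℂ) → k → Prop) : Prop where
  congr : ∀ {h h' : Ω → ℂ} {r : k}, (∀ᶠ x in (U : Filter Ω), h x = h' x) → Red h r → Red h' r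
  add : ∀ {h h' : Ω → ℂ} {r r' : k}, Red h r → Red h' r' → Red (fun x => h x + h' x) (r + r')
  mul : ∀ {h h' : Ω → ℂ} {r r' : k}, Red h r → Red h' r' → Red (fun x => h x * h' x) (r * r')
  const : ∀ c : ℂ, Red (fun _ => c) (e c)
  unique : ∀ {h : Ω → ℂ} {r r' : k}, Red h r → Red h r' → r = r'
  total : ∀ h : Ω → ℂ, (∃ r, Red h r) ∨ Red (fun x => (h x)⁻¹) 0

theorem germ_inv {L : Type} [Field L] {π : (Ω → ℂ) →+* L}
    (hπ : ∀ h, π h = 0 ↔ ∀ᶠ x in (U : Filter Ω), h x = 0) (h : Ω → ℂ) :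
    π (fun x => (h x)⁻¹) = (π h)⁻¹ := by
  by_cases h0 : π h = 0
  · rw [h0, inv_zero, hπ]
    exact ((hπ h).1 h0).mono fun x hx => by rw [hx, inv_zero]
  · refine eq_inv_of_mul_eq_one_left ?_
    rw [← map_mul, ← map_one π, ← sub_eq_zero, ← map_sub, hπ]
    have : ∀ᶠ x in (U : Filter Ω), h x ≠ 0 := Ultrafilter.eventually_not.2 fun h1 => h0 ((hπ h).2 h1)
    exact this.mono fun x hx => by simp [hx]

theorem isPlace_of_valuationSubring {L : Type} [Field L] {π : (Ω → ℂ) →+* L}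
    (hπ : ∀ h, π h = 0 ↔ ∀ᶠ x in (U : Filter Ω), h x = 0) (B : ValuationSubring L)
    (hB : ∀ c : ℂ, π (fun _ => c) ∈ B) :
    IsPlace U ((IsLocalRing.residue B).comp
      (RingHom.codRestrict (π.comp (Pi.constRingHom Ω ℂ)) B.toSubring hB))
      (fun h r => ∃ b : B, (b : L) = π h ∧ IsLocalRing.residue B b = r) where
  congr := by
    rintro h h' r hh ⟨b, hb, hr⟩
    refine ⟨b, hb.trans ?_, hr⟩
    rw [← sub_eq_zero, ← map_sub, hπ]
    exact hh.mono fun x hx => by simp [hx]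
  add := by
    rintro h h' r r' ⟨b, hb, hr⟩ ⟨b', hb', hr'⟩
    refine ⟨b + b', ?_, by rw [map_add, hr, hr']⟩
    rw [show (fun x => h x + h' x) = h + h' from rfl, map_add, ← hb, ← hb']
    rfl
  mul := by
    rintro h h' r r' ⟨b, hb, hr⟩ ⟨b', hb', hr'⟩
    refine ⟨b * b', ?_, by rw [map_mul, hr, hr']⟩
    rw [show (fun x => h x * h' x) = h * h' from rfl, map_mul, ← hb, ← hb']
    rfl
  const c := ⟨⟨π (fun _ => c), hB c⟩, rfl, rfl⟩
  unique := by
    rintro h r r' ⟨b, hb, hr⟩ ⟨b', hb', hr'⟩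
    rw [← hr, ← hr', Subtype.ext (hb.trans hb'.symm)]
  total h := by
    rw [germ_inv hπ]
    by_cases hm : π h ∈ B
    · exact Or.inl ⟨_, ⟨π h, hm⟩, rfl, rfl⟩
    · have h1 : (π h)⁻¹ ∈ B.nonunits := (B.inv_mem_nonunits_iff).2 (Or.inr hm)
      obtain ⟨ha, h2⟩ := (B.mem_nonunits_iff_exists_mem_maximalIdeal).1 h1
      exact Or.inr ⟨⟨_, ha⟩, rfl, (IsLocalRing.residue_eq_zero_iff _).2 h2⟩

namespace IsPlace

variable {k : Type} [Field k] {e : ℂ →+* k} {Red : (Ω → ℂ) → k → Prop}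
  {h h' : Ω → ℂ} {r r' : k}

theorem zero (hR : IsPlace U e Red) : Red (fun _ => 0) 0 := by simpa using hR.const 0

theorem one (hR : IsPlace U e Red) : Red (fun _ => 1) 1 := by simpa using hR.const 1

theorem neg (hR : IsPlace U e Red) (h1 : Red h r) : Red (fun x => -h x) (-r) := by
  simpa using hR.mul (hR.const (-1)) h1

theorem sub (hR : IsPlace U e Red) (h1 : Red h r) (h2 : Red h' r') : Red (fun x => h x - h' x) (r - r') := by
  simpa [sub_eq_add_neg] using hR.add h1 (hR.neg h2)

theorem eventually_ne (hR : IsPlace U e Red) (h1 : Red h r) (hr : r ≠ 0) : ∀ᶠ x in (U : Filter Ω), h x ≠ 0 :=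
  Ultrafilter.eventually_not.2 fun h0 => hr (hR.unique (hR.congr h0 h1) hR.zero)

theorem inv (hR : IsPlace U e Red) (h1 : Red h r) (hr : r ≠ 0) : Red (fun x => (h x)⁻¹) r⁻¹ := by
  have hne := hR.eventually_ne h1 hr
  rcases hR.total fun x => (h x)⁻¹ with ⟨s, hs⟩ | h0
  · have h2 := hR.congr (h' := fun _ => 1) (hne.mono fun x hx => mul_inv_cancel₀ hx) (hR.mul h1 hs)
    have := hR.unique h2 hR.one
    rwa [inv_eq_of_mul_eq_one_right this]
  · simp only [inv_inv] at h0
    exact absurd (hR.unique h1 h0) hr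

theorem div (hR : IsPlace U e Red) (h1 : Red h r) (h2 : Red h' r') (hr : r' ≠ 0) : Red (fun x => h x / h' x) (r / r') := by
  simpa only [div_eq_mul_inv] using hR.mul h1 (hR.inv h2 hr)

theorem sum (hR : IsPlace U e Red) {ι : Type} (s : Finset ι) {H : ι → Ω → ℂ} {ρ : ι → k} (h1 : ∀ i ∈ s, Red (H i) (ρ i)) :
    Red (fun x => ∑ i ∈ s, H i x) (∑ i ∈ s, ρ i) := by
  classical
  induction s using Finset.induction_on with
  | empty => simpa using hR.zero
  | insert i s hi ih =>
    simp only [Finset.sum_insert hi]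
    exact hR.add (h1 i (Finset.mem_insert_self i s)) (ih fun j hj => h1 j (Finset.mem_insert_of_mem hj))

theorem prod (hR : IsPlace U e Red) {ι : Type} (s : Finset ι) {H : ι → Ω → ℂ} {ρ : ι → k} (h1 : ∀ i ∈ s, Red (H i) (ρ i)) :
    Red (fun x => ∏ i ∈ s, H i x) (∏ i ∈ s, ρ i) := by
  classical
  induction s using Finset.induction_on with
  | empty => simpa using hR.one
  | insert i s hi ih =>
    simp only [Finset.prod_insert hi]
    exact hR.mul (h1 i (Finset.mem_insert_self i s)) (ih fun j hj => h1 j (Finset.mem_insert_of_mem hj))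

theorem pow (hR : IsPlace U e Red) (h1 : Red h r) (n : ℕ) : Red (fun x => h x ^ n) (r ^ n) := by
  simpa using hR.prod (Finset.range n) (H := fun _ => h) (ρ := fun _ => r) fun _ _ => h1

theorem det (hR : IsPlace U e Red) {I : Type} [Fintype I] [DecidableEq I] {M : Ω → Matrix I I ℂ} {ρ : Matrix I I k}
    (h1 : ∀ i j, Red (fun x => M x i j) (ρ i j)) : Red (fun x => (M x).det) ρ.det := by
  simp only [Matrix.det_apply']
  refine hR.sum _ fun s _ => hR.mul ?_ (hR.prod _ fun i _ => h1 _ _)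
  simpa using hR.const ((Equiv.Perm.sign s : ℤ) : ℂ)

theorem root (hR : IsPlace U e Red) {N : ℕ} (hN : N ≠ 0) (h1 : Red (fun x => h x ^ N) r) : ∃ s, Red h s ∧ s ^ N = r := by
  rcases hR.total h with ⟨s, hs⟩ | h0
  · exact ⟨s, hs, hR.unique (hR.pow hs N) h1⟩
  · by_cases hz : ∀ᶠ x in (U : Filter Ω), h x = 0
    · have hs := hR.congr (hz.mono fun x hx => hx.symm) hR.zero
      exact ⟨0, hs, hR.unique (hR.pow hs N) h1⟩
    · have h2 := hR.congr (h' := fun _ => 1)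
        ((Ultrafilter.eventually_not.2 hz).mono fun x hx => by
          rw [inv_pow, mul_inv_cancel₀ (pow_ne_zero _ hx)]) (hR.mul h1 (hR.pow h0 N))
      have := hR.unique h2 hR.one
      rw [zero_pow hN, mul_zero] at this
      exact absurd this zero_ne_one

end IsPlace

end Places

end

end BS

namespace BS

noncomputable section

open Filter

section Specialization

variable {ι κ : Type} {U : Ultrafilter ((ι → ℂ × ℂ) × (κ → ℂ))}

/-- A family of functions of the points that is closed under the field operations and under
taking roots of polynomials in the coordinates of the points. -/
structure IsAlgFamily (U : Ultrafilter ((ι → ℂ × ℂ) × (κ → ℂ)))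
    (Alg : (((ι → ℂ × ℂ) × (κ → ℂ)) → ℂ) → Prop) : Prop where
  fst : ∀ i, Alg fun x => (x.1 i).1
  snd : ∀ i, Alg fun x => (x.1 i).2
  const : ∀ c : ℂ, Alg fun _ => c
  add : ∀ {h h'}, Alg h → Alg h' → Alg fun x => h x + h' x
  mul : ∀ {h h'}, Alg h → Alg h' → Alg fun x => h x * h' x
  inv : ∀ {h}, Alg h → Alg fun x => (h x)⁻¹
  root : ∀ {h} (q : Polynomial (MvPolynomial (ι × Bool) ℂ)),
    (∀ᶠ x in (U : Filter ((ι → ℂ × ℂ) × (κ → ℂ))),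
      q.map (MvPolynomial.eval fun i => coords x (Sum.inl i)) ≠ 0 ∧
      (q.map (MvPolynomial.eval fun i => coords x (Sum.inl i))).eval (h x) = 0) → Alg h

namespace IsAlgFamily

variable {Alg : (((ι → ℂ × ℂ) × (κ → ℂ)) → ℂ) → Prop}
  {h h' : ((ι → ℂ × ℂ) × (κ → ℂ)) → ℂ}

theorem sub (hA : IsAlgFamily U Alg) (h1 : Alg h) (h2 : Alg h') : Alg fun x => h x - h' x := by
  simpa [sub_eq_add_neg] using hA.add h1 (hA.mul (hA.const (-1)) h2)

theorem div (hA : IsAlgFamily U Alg) (h1 : Alg h) (h2 : Alg h') : Alg fun x => h x / h' x := by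
  simpa only [div_eq_mul_inv] using hA.mul h1 (hA.inv h2)

theorem sum (hA : IsAlgFamily U Alg) {I : Type} (s : Finset I) {H : I → ((ι → ℂ × ℂ) × (κ → ℂ)) → ℂ}
    (h1 : ∀ i ∈ s, Alg (H i)) : Alg fun x => ∑ i ∈ s, H i x := by
  classical
  induction s using Finset.induction_on with
  | empty => simpa using hA.const 0
  | insert i s hi ih =>
    simp only [Finset.sum_insert hi]
    exact hA.add (h1 i (Finset.mem_insert_self i s)) (ih fun j hj => h1 j (Finset.mem_insert_of_mem hj))

theorem prod (hA : IsAlgFamily U Alg) {I : Type} (s : Finset I) {H : I → ((ι → ℂ × ℂ) × (κ → ℂ)) → ℂ}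
    (h1 : ∀ i ∈ s, Alg (H i)) : Alg fun x => ∏ i ∈ s, H i x := by
  classical
  induction s using Finset.induction_on with
  | empty => simpa using hA.const 1
  | insert i s hi ih =>
    simp only [Finset.prod_insert hi]
    exact hA.mul (h1 i (Finset.mem_insert_self i s)) (ih fun j hj => h1 j (Finset.mem_insert_of_mem hj))

theorem pow (hA : IsAlgFamily U Alg) (h1 : Alg h) (n : ℕ) : Alg fun x => h x ^ n := by
  simpa using hA.prod (Finset.range n) (H := fun _ => h) fun _ _ => h1

theorem det (hA : IsAlgFamily U Alg) {I : Type} [Fintype I] [DecidableEq I] {M : ((ι → ℂ × ℂ) × (κ → ℂ)) → Matrix I I ℂ}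
    (h1 : ∀ i j, Alg fun x => M x i j) : Alg fun x => (M x).det := by
  simp only [Matrix.det_apply']
  exact hA.sum _ fun s _ => hA.mul (hA.const _) (hA.prod _ fun i _ => h1 _ _)

end IsAlgFamily

/-- A place that specializes the points to given ones, and the further parameters to zero. -/
theorem IsGenericUltrafilter.exists_specialization (hU : IsGenericUltrafilter U) (s : ι → ℂ × ℂ) :
    ∃ (k : Type) (_ : Field k) (e : ℂ →+* k)
      (Red : (((ι → ℂ × ℂ) × (κ → ℂ)) → ℂ) → k → Prop)
      (Alg : (((ι → ℂ × ℂ) × (κ → ℂ)) → ℂ) → Prop), IsPlace U e Red ∧ IsAlgFamily U Alg ∧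
      (∀ i, Red (fun x => (x.1 i).1) (e (s i).1) ∧ Red (fun x => (x.1 i).2) (e (s i).2)) ∧
      ∀ j c, Alg c → Red (fun x => x.2 j * c x) 0 := by
  obtain ⟨L, _, π, hπ⟩ := exists_germField U
  let _ : Algebra ℂ L := (π.comp (Pi.constRingHom _ ℂ)).toAlgebra
  have halg : ∀ c : ℂ, algebraMap ℂ L c = π fun _ => c := fun c => rfl
  let v : (ι × Bool) ⊕ κ → L := fun i => π fun x => coords x i
  have hv : ∀ D : MvPolynomial ((ι × Bool) ⊕ κ) ℂ,
      MvPolynomial.aeval v D = π fun x => D.eval (coords x) := by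
    intro D
    have : (MvPolynomial.aeval v : MvPolynomial ((ι × Bool) ⊕ κ) ℂ →ₐ[ℂ] L).toRingHom =
        π.comp (RingHom.pi fun x => MvPolynomial.eval (coords x)) := by
      refine MvPolynomial.ringHom_ext (fun c => ?_) fun i => ?_
      · change MvPolynomial.aeval v (MvPolynomial.C c) = π fun x => MvPolynomial.eval (coords x) (MvPolynomial.C c)
        simp [halg]
      · change MvPolynomial.aeval v (MvPolynomial.X i) = π fun x => MvPolynomial.eval (coords x) (MvPolynomial.X i)
        simp [v]
    exact congrArg (fun φ => φ D) this
  have hind : AlgebraicIndependent ℂ v := by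
    rw [algebraicIndependent_iff]
    intro D hD
    by_contra h0
    rw [hv, hπ] at hD
    obtain ⟨x, hx1, hx2⟩ := ((hU D h0).and hD).exists
    exact hx1 hx2
  have hind' : AlgebraicIndependent ℂ (Sum.elim (fun j => v (Sum.inr j)) fun i => v (Sum.inl i)) :=
    (algebraicIndependent_equiv' (Equiv.sumComm κ (ι × Bool)) (by
      ext i; rcases i with i | i <;> rfl)).2 hind
  obtain ⟨B, hB1, hB2, hB3⟩ := exists_place _ _ hind' fun i => if i.2 then (s i.1).1 else (s i.1).2
  set a : ι × Bool → L := fun i => v (Sum.inl i) with ha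
  have hP := isPlace_of_valuationSubring hπ B hB1
  have hnon : ∀ h : ((ι → ℂ × ℂ) × (κ → ℂ)) → ℂ, π h ∈ B.nonunits →
      ∃ b : B, (b : L) = π h ∧ IsLocalRing.residue B b = 0 := fun h hh => by
    obtain ⟨ha, h2⟩ := (B.mem_nonunits_iff_exists_mem_maximalIdeal).1 hh
    exact ⟨⟨_, ha⟩, rfl, (IsLocalRing.residue_eq_zero_iff _).2 h2⟩
  have hcoe : ∀ r : Algebra.adjoin ℂ (Set.range a),
      IsAlgebraic (Algebra.adjoin ℂ (Set.range a)) (r : L) := fun r => isAlgebraic_algebraMap r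
  have hcoord : ∀ i, IsAlgebraic (Algebra.adjoin ℂ (Set.range a)) (a i) := fun i =>
    hcoe ⟨a i, Algebra.subset_adjoin ⟨i, rfl⟩⟩
  refine ⟨IsLocalRing.ResidueField B, inferInstance, _, _,
    fun h => IsAlgebraic (Algebra.adjoin ℂ (Set.range a)) (π h), hP, ?_, fun i => ⟨?_, ?_⟩,
    fun j c hc => hnon _ (by
      have := hB3 j _ hc
      rwa [← map_mul] at this)⟩
  · refine ⟨fun i => hcoord (i, true), fun i => hcoord (i, false), fun c => ?_, ?_, ?_, ?_, ?_⟩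
    · rw [← halg]
      exact hcoe ⟨_, Subalgebra.algebraMap_mem _ c⟩
    · intro h h' h1 h2
      rw [show (fun x => h x + h' x) = h + h' from rfl, map_add]
      exact h1.add h2
    · intro h h' h1 h2
      rw [show (fun x => h x * h' x) = h * h' from rfl, map_mul]
      exact h1.mul h2
    · intro h h1
      rw [germ_inv hπ]
      exact h1.inv
    · intro h q hq
      let Φ : MvPolynomial (ι × Bool) ℂ →+* (((ι → ℂ × ℂ) × (κ → ℂ)) → ℂ) :=
        RingHom.pi fun x => MvPolynomial.eval fun i => coords x (Sum.inl i)
      have e1 : (fun x => (q.map (MvPolynomial.eval fun i => coords x (Sum.inl i))).eval (h x)) =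
          q.eval₂ Φ h := by
        funext x
        have := Polynomial.hom_eval₂ q Φ (Pi.evalRingHom (fun _ => ℂ) x) h
        rw [Polynomial.eval_map]
        exact this.symm
      have e2 : (q.eval₂ Φ h) =ᶠ[(U : Filter ((ι → ℂ × ℂ) × (κ → ℂ)))] 0 := by
        rw [← e1]
        exact hq.mono fun x hx => hx.2
      have e3 : π (q.eval₂ Φ h) = 0 := (hπ _).2 e2
      rw [Polynomial.hom_eval₂] at e3
      have hmem : ∀ p : MvPolynomial (ι × Bool) ℂ, MvPolynomial.aeval a p ∈ Algebra.adjoin ℂ (Set.range a) := by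
        intro p
        rw [Algebra.adjoin_range_eq_range_aeval]
        exact ⟨p, rfl⟩
      let Ψ : MvPolynomial (ι × Bool) ℂ →+* Algebra.adjoin ℂ (Set.range a) :=
        RingHom.codRestrict (MvPolynomial.aeval a : MvPolynomial (ι × Bool) ℂ →ₐ[ℂ] L).toRingHom
          (Algebra.adjoin ℂ (Set.range a)) hmem
      have hΨ : Function.Injective Ψ := by
        intro p p' hp
        exact (hind'.comp _ Sum.inr_injective) (congrArg Subtype.val hp)
      have e4 : π.comp Φ = (algebraMap (Algebra.adjoin ℂ (Set.range a)) L).comp Ψ := by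
        refine MvPolynomial.ringHom_ext (fun c => ?_) fun i => ?_
        · change (π fun x => MvPolynomial.eval _ (MvPolynomial.C c)) = MvPolynomial.aeval a (MvPolynomial.C c)
          simp [halg]
        · change (π fun x => MvPolynomial.eval _ (MvPolynomial.X i)) = MvPolynomial.aeval a (MvPolynomial.X i)
          simp [v, a]
      have hq0 : q ≠ 0 := by
        obtain ⟨x, hx, -⟩ := hq.exists
        rintro rfl
        simp at hx
      refine ⟨q.map Ψ, (Polynomial.map_ne_zero_iff hΨ).2 hq0, ?_⟩
      rw [Polynomial.aeval_def, Polynomial.eval₂_map, ← e4, e3]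
  · have h1 := hP.add (hnon (fun x => (x.1 i).1 - (s i).1) (by
      have := hB2 (i, true)
      rwa [halg, ← map_sub] at this)) (hP.const (s i).1)
    simpa using h1
  · have h1 := hP.add (hnon (fun x => (x.1 i).2 - (s i).2) (by
      have := hB2 (i, false)
      rwa [halg, ← map_sub] at this)) (hP.const (s i).2)
    simpa using h1

end Specialization

end

end BS

namespace BS

noncomputable section

open Filter

section Fourier

variable {N : ℕ} [NeZero N] {k : Type} [Field k] {ζ : k}

theorem chi_ne_one (h : IsPrimitiveRoot ζ N) {c : ZMod N} (hc : c ≠ 0) : chi ζ c ≠ 1 := by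
  intro h1
  have h2 := (h.pow_eq_one_iff_dvd _).1 h1
  exact hc ((ZMod.val_eq_zero c).1 (Nat.eq_zero_of_dvd_of_lt h2 (ZMod.val_lt c)))

theorem sum_chi_mul (h : IsPrimitiveRoot ζ N) (c : ZMod N) :
    ∑ t, chi ζ (c * t) = if c = 0 then (N : k) else 0 := by
  split_ifs with hc
  · simp [hc, chi_zero, ZMod.card]
  · have h1 : chi ζ c * ∑ t, chi ζ (c * t) = ∑ t, chi ζ (c * t) := by
      have e := Equiv.sum_comp (Equiv.addRight (1 : ZMod N)) fun t => chi ζ (c * t)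
      rw [Finset.mul_sum]
      refine Eq.trans (Finset.sum_congr rfl fun t _ => ?_) e
      rw [Equiv.coe_addRight, mul_add, mul_one, chi_add h.pow_eq_one, mul_comm]
    have h2 : (chi ζ c - 1) * ∑ t, chi ζ (c * t) = 0 := by rw [sub_mul, h1, one_mul, sub_self]
    exact (mul_eq_zero.1 h2).resolve_left (sub_ne_zero.2 (chi_ne_one h hc))

variable {g : ℕ}

/-- The matrix of the Fourier transform combined with a cyclic shift. -/
def fourier (g : ℕ) (ζ : k) : Matrix (Fin (g + 1) → ZMod N) (Fin (g + 1) → ZMod N) k :=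
  Matrix.of fun a s => ∏ n, chi ζ (a n * s (n + 1))

/-- The matrix of the inverse Fourier transform, not normalized. -/
def fourierInv (g : ℕ) (ζ : k) : Matrix (Fin (g + 1) → ZMod N) (Fin (g + 1) → ZMod N) k :=
  Matrix.of fun s b => ∏ n, chi ζ (-(b n * s (n + 1)))

theorem fourier_mul_fourierInv (h : IsPrimitiveRoot ζ N) :
    fourier g ζ * fourierInv g ζ =
      (N : k) ^ (g + 1) • (1 : Matrix (Fin (g + 1) → ZMod N) (Fin (g + 1) → ZMod N) k) := by
  ext a b
  rw [Matrix.mul_apply, ← ((Equiv.addRight (1 : Fin (g + 1))).arrowCongr (Equiv.refl (ZMod N))).sum_comp]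
  have e : ∀ s : Fin (g + 1) → ZMod N, fourier g ζ a
      (((Equiv.addRight (1 : Fin (g + 1))).arrowCongr (Equiv.refl (ZMod N))) s) * fourierInv g ζ
      (((Equiv.addRight (1 : Fin (g + 1))).arrowCongr (Equiv.refl (ZMod N))) s) b =
      ∏ n, chi ζ ((a n - b n) * s n) := by
    intro s
    rw [fourier, fourierInv, Matrix.of_apply, Matrix.of_apply, ← Finset.prod_mul_distrib]
    refine Finset.prod_congr rfl fun n _ => ?_
    rw [← chi_add h.pow_eq_one]
    congr 1
    simp [Equiv.arrowCongr]
    ring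
  simp only [e]
  have e2 := Finset.prod_univ_sum (fun _ : Fin (g + 1) => (Finset.univ : Finset (ZMod N)))
    fun n t => chi ζ ((a n - b n) * t)
  rw [Fintype.piFinset_univ] at e2
  rw [← e2]
  simp only [sum_chi_mul h, sub_eq_zero]
  rw [Matrix.smul_apply, Matrix.one_apply]
  by_cases hab : a = b
  · simp [hab]
  · obtain ⟨n, hn⟩ := Function.ne_iff.1 hab
    rw [Finset.prod_eq_zero (Finset.mem_univ n) (if_neg hn), if_neg hab, smul_zero]

theorem det_fourier_ne (h : IsPrimitiveRoot ζ N) (hN : (N : k) ≠ 0) :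
    (fourier g ζ : Matrix (Fin (g + 1) → ZMod N) _ k).det ≠ 0 ∧
      (fourierInv g ζ : Matrix (Fin (g + 1) → ZMod N) _ k).det ≠ 0 := by
  have h1 := congrArg Matrix.det (fourier_mul_fourierInv (g := g) h)
  rw [Matrix.det_mul, Matrix.det_smul, Matrix.det_one, mul_one] at h1
  exact mul_ne_zero_iff.1 (h1 ▸ pow_ne_zero _ (pow_ne_zero _ hN))

theorem det_scaled_ne {I : Type} [Fintype I] [DecidableEq I] {M : Matrix I I k} (hM : M.det ≠ 0)
    {p q : I → k} (hp : ∀ i, p i ≠ 0) (hq : ∀ i, q i ≠ 0) :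
    (Matrix.of fun i j => p i * q j * M i j).det ≠ 0 := by
  have e : (Matrix.of fun i j => p i * q j * M i j) = Matrix.diagonal p * M * Matrix.diagonal q := by
    ext i j
    rw [Matrix.mul_diagonal, Matrix.diagonal_mul, Matrix.of_apply]
    ring
  rw [e, Matrix.det_mul, Matrix.det_mul, Matrix.det_diagonal, Matrix.det_diagonal]
  exact mul_ne_zero (mul_ne_zero (Finset.prod_ne_zero_iff.2 fun i _ => hp i) hM)
    (Finset.prod_ne_zero_iff.2 fun i _ => hq i)

/-- A character. -/
def IsLinearChar (γ : ZMod N → k) : Prop :=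
  (∀ a, γ a ≠ 0) ∧ ∀ a b, γ (a + b) = γ a * γ b

/-- A quadratic character, with the bilinear form given by the inverse of `χ`. -/
def IsQuadraticChar (ζ : k) (γ : ZMod N → k) : Prop :=
  (∀ a, γ a ≠ 0) ∧ ∀ a b, γ (a + b) = γ a * γ b * (chi ζ (a * b))⁻¹

theorem det_left_ne (h : IsPrimitiveRoot ζ N) (hN : (N : k) ≠ 0)
    {γ : Fin (g + 1) → Fin 4 → ZMod N → k} (h0 : ∀ n, IsQuadraticChar ζ (γ n 0))
    (h2 : ∀ n, IsLinearChar (γ n 2)) :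
    (Matrix.of fun a s : Fin (g + 1) → ZMod N => ∏ n, γ n 0 (s n - a n) / γ n 2 (s (n + 1) - a n) *
      chi ζ (-(a n * (s n - s (n + 1))))).det ≠ 0 := by
  have hz := h.pow_eq_one
  convert det_scaled_ne (det_fourier_ne (g := g) h hN).1
    (p := fun a => ∏ n, (γ n 0 (-a n) / γ n 2 (-a n)))
    (q := fun s => ∏ n, (γ n 0 (s n) / γ n 2 (s (n + 1))))
    (fun a => Finset.prod_ne_zero_iff.2 fun n _ => div_ne_zero ((h0 n).1 _) ((h2 n).1 _))
    (fun s => Finset.prod_ne_zero_iff.2 fun n _ => div_ne_zero ((h0 n).1 _) ((h2 n).1 _)) using 2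
  ext a s
  rw [Matrix.of_apply, Matrix.of_apply, fourier, Matrix.of_apply, ← Finset.prod_mul_distrib,
    ← Finset.prod_mul_distrib]
  refine Finset.prod_congr rfl fun n _ => ?_
  have e1 : -(a n * (s n - s (n + 1))) = s n * -a n + a n * s (n + 1) := by ring
  rw [e1, sub_eq_add_neg, (h0 n).2, sub_eq_add_neg, (h2 n).2, chi_add hz]
  have := chi_ne_zero hz (s n * -a n)
  field_simp

theorem det_right_ne (h : IsPrimitiveRoot ζ N) (hN : (N : k) ≠ 0)
    {γ : Fin (g + 1) → Fin 4 → ZMod N → k} (h3 : ∀ n, IsQuadraticChar ζ (γ n 3))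
    (h1 : ∀ n, IsLinearChar (γ n 1)) :
    (Matrix.of fun s b : Fin (g + 1) → ZMod N => ∏ n, γ n 1 (s (n + 1) - b n) / γ n 3 (s n - b n) *
      chi ζ (b n * (s n - s (n + 1)))).det ≠ 0 := by
  have hz := h.pow_eq_one
  convert det_scaled_ne (det_fourier_ne (g := g) h hN).2
    (p := fun s => ∏ n, (γ n 1 (s (n + 1)) / γ n 3 (s n)))
    (q := fun b => ∏ n, (γ n 1 (-b n) / γ n 3 (-b n)))
    (fun a => Finset.prod_ne_zero_iff.2 fun n _ => div_ne_zero ((h1 n).1 _) ((h3 n).1 _))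
    (fun s => Finset.prod_ne_zero_iff.2 fun n _ => div_ne_zero ((h1 n).1 _) ((h3 n).1 _)) using 2
  ext s b
  rw [Matrix.of_apply, Matrix.of_apply, fourierInv, Matrix.of_apply, ← Finset.prod_mul_distrib,
    ← Finset.prod_mul_distrib]
  refine Finset.prod_congr rfl fun n _ => ?_
  have e1 : b n * (s n - s (n + 1)) = -(s n * -b n) + -(b n * s (n + 1)) := by ring
  have e2 : s n - b n = s n + -b n := sub_eq_add_neg _ _
  rw [e1, chi_add hz, chi_neg hz (s n * -b n), e2, (h3 n).2, sub_eq_add_neg, (h1 n).2]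
  have := chi_ne_zero hz (s n * -b n)
  field_simp

theorem isLinearChar_chi {t : k} (ht : t ^ N = 1) : IsLinearChar (chi t : ZMod N → k) :=
  ⟨chi_ne_zero ht, chi_add ht⟩

theorem isQuadraticChar_of_rec (hz : ζ ^ N = 1) {c : k} (hc : c ≠ 0) {γ : ZMod N → k}
    (h0 : γ 0 = 1) (hγ : ∀ n, γ n * chi ζ n = c * γ (n - 1)) : IsQuadraticChar ζ γ := by
  have hs : ∀ n, γ (n + 1) = c * (chi ζ (n + 1))⁻¹ * γ n := fun n => by
    have := hγ (n + 1)
    rw [add_sub_cancel_right] at this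
    have h1 := chi_ne_zero hz (n + 1)
    field_simp
    exact this
  refine ⟨fun a => ?_, fun a b => ?_⟩
  · obtain ⟨m, rfl⟩ := ZMod.natCast_zmod_surjective a
    induction m with
    | zero => rw [Nat.cast_zero, h0]; exact one_ne_zero
    | succ m ih =>
      rw [Nat.cast_succ, hs]
      exact mul_ne_zero (mul_ne_zero hc (inv_ne_zero (chi_ne_zero hz _))) ih
  · obtain ⟨m, rfl⟩ := ZMod.natCast_zmod_surjective b
    induction m with
    | zero => simp [h0, chi_zero]
    | succ m ih =>
      rw [Nat.cast_succ, ← add_assoc, hs, ih, hs, add_assoc a, chi_add hz a, mul_add, mul_one,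
        chi_add hz _ a, mul_inv, mul_inv]
      ring

theorem IsLinearChar.comp_neg {γ : ZMod N → k} (h : IsLinearChar γ) : IsLinearChar fun n => γ (-n) :=
  ⟨fun a => h.1 _, fun a b => by simp only [neg_add, h.2]⟩

theorem IsLinearChar.mul {γ γ' : ZMod N → k} (h : IsLinearChar γ) (h' : IsLinearChar γ') :
    IsLinearChar fun n => γ n * γ' n :=
  ⟨fun a => mul_ne_zero (h.1 _) (h'.1 _), fun a b => by simp only [h.2, h'.2]; ring⟩

theorem IsQuadraticChar.mul {γ γ' : ZMod N → k} (h : IsQuadraticChar ζ γ) (h' : IsLinearChar γ') :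
    IsQuadraticChar ζ fun n => γ n * γ' n :=
  ⟨fun a => mul_ne_zero (h.1 _) (h'.1 _), fun a b => by simp only [h.2, h'.2]; ring⟩

end Fourier

section WeightLimits

variable {Ω : Type} {U : Ultrafilter Ω} {k : Type} [Field k] {e : ℂ →+* k}
  {Red : (Ω → ℂ) → k → Prop} {N : ℕ} [NeZero N] {x y : Ω → ℂ}

theorem IsPlace.chi (hR : IsPlace U e Red) (n : ZMod N) :
    Red (fun _ => BS.chi (omega N) n) (BS.chi (e (omega N)) n) := by
  have := hR.const (BS.chi (omega N) n)
  rwa [BS.chi, map_pow] at this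

theorem IsPlace.cycW_small (hR : IsPlace U e Red)
    (hc : ∀ᶠ z in (U : Filter Ω), x z ^ N + y z ^ N = 1) (hx : Red (fun z => x z ^ N) 0) :
    ∃ γ : ZMod N → k, IsLinearChar γ ∧ ∀ n, Red (fun z => cycW (omega N) (x z) (y z) n) (γ n) := by
  obtain ⟨s, hs, hs0⟩ := hR.root (NeZero.ne N) hx
  rw [pow_eq_zero_iff (NeZero.ne N)] at hs0
  subst hs0
  have hy : Red (fun z => y z ^ N) 1 := by
    have := hR.sub hR.one hx
    rw [sub_zero] at this
    exact hR.congr (hc.mono fun z hz => by rw [← hz]; ring) this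
  obtain ⟨t, ht, ht1⟩ := hR.root (NeZero.ne N) hy
  refine ⟨BS.chi t, isLinearChar_chi ht1, fun n => ?_⟩
  have : BS.chi t n = ∏ i ∈ Finset.range n.val, t / (1 - e (omega N) ^ (i + 1) * 0) := by
    simp [BS.chi]
  rw [this]
  refine hR.prod _ fun i _ => hR.div ht (hR.sub hR.one (hR.mul ?_ hs)) (by simp)
  simpa using hR.const (omega N ^ (i + 1))

theorem IsPlace.cycW_large (hR : IsPlace U e Red)
    (hc : ∀ᶠ z in (U : Filter Ω), x z ^ N + y z ^ N = 1) (hy : ∀ᶠ z in (U : Filter Ω), y z ≠ 0)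
    (hx0 : ∀ᶠ z in (U : Filter Ω), x z ≠ 0) (hx : Red (fun z => (x z ^ N)⁻¹) 0) :
    ∃ γ : ZMod N → k, IsQuadraticChar (e (omega N)) γ ∧
      ∀ n, Red (fun z => cycW (omega N) (x z) (y z) n) (γ n) := by
  have hζ : e (omega N) ^ N = 1 := by rw [← map_pow, omega_pow, map_one]
  simp only [← inv_pow] at hx
  obtain ⟨s, hs, hs0⟩ := hR.root (NeZero.ne N) hx
  rw [pow_eq_zero_iff (NeZero.ne N)] at hs0
  subst hs0
  have hq : Red (fun z => (y z / x z) ^ N) (-1) := by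
    have := hR.sub hx hR.one
    rw [zero_sub] at this
    refine hR.congr ((hc.and hx0).mono fun z hz => ?_) this
    have h1 : y z ^ N = 1 - x z ^ N := by rw [← hz.1]; ring
    have h2 := pow_ne_zero N hz.2
    rw [div_pow, h1, sub_div, div_self h2, inv_pow, one_div]
  obtain ⟨c, hc', hcN⟩ := hR.root (NeZero.ne N) hq
  have hc0 : c ≠ 0 := by
    rintro rfl
    rw [zero_pow (NeZero.ne N)] at hcN
    exact one_ne_zero (neg_eq_zero.1 hcN.symm)
  have hex : ∀ n : ZMod N, ∃ r, Red (fun z => cycW (omega N) (x z) (y z) n) r := by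
    intro n
    refine ⟨∏ i ∈ Finset.range n.val, c / (0 - e (omega N) ^ (i + 1)), ?_⟩
    have hne : ∀ i : ℕ, (0 - e (omega N) ^ (i + 1)) ≠ 0 := fun i => by
      rw [zero_sub, neg_ne_zero]
      refine pow_ne_zero _ fun h0 => ?_
      rw [h0, zero_pow (NeZero.ne N)] at hζ
      exact zero_ne_one hζ
    have h1 : Red (fun z => ∏ i ∈ Finset.range n.val, (y z / x z) / ((x z)⁻¹ - omega N ^ (i + 1)))
        (∏ i ∈ Finset.range n.val, c / (0 - e (omega N) ^ (i + 1))) := by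
      refine hR.prod _ fun i _ => hR.div hc' (hR.sub hs ?_) (hne i)
      simpa using hR.const (omega N ^ (i + 1))
    refine hR.congr (hx0.mono fun z hz => ?_) h1
    rw [cycW]
    refine Finset.prod_congr rfl fun i _ => ?_
    rw [div_div, mul_sub, mul_inv_cancel₀ hz, mul_comm (x z)]
  choose γ hγ using hex
  refine ⟨γ, isQuadraticChar_of_rec hζ (neg_ne_zero.2 hc0) ?_ fun n => ?_, hγ⟩
  · refine hR.unique (hγ 0) ?_
    simpa [cycW] using hR.one
  · have h1 := hR.mul (hγ n) (hR.sub hs (hR.chi n))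
    have h2 := hR.mul hc' (hγ (n - 1))
    have h3 := hR.congr (h' := fun z => y z / x z * cycW (omega N) (x z) (y z) (n - 1)) ((hc.and (hy.and hx0)).mono fun z hz => ?_) h1
    · have := hR.unique h3 h2
      linear_combination -this
    · have := cycW_mul (omega_primitive N) hz.1 hz.2.1 n
      have hxz := hz.2.2
      field_simp
      linear_combination this

end WeightLimits

end

end BS

namespace BS

noncomputable section

open Filter

section ThetaLimit

variable {ι : Type} {g : ℕ} {U : Ultrafilter ((ι → ℂ × ℂ) × (Fin g → ℂ))} {k : Type} [Field k]
  {e : ℂ →+* k} {Red : (((ι → ℂ × ℂ) × (Fin g → ℂ)) → ℂ) → k → Prop}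
  {Alg : (((ι → ℂ × ℂ) × (Fin g → ℂ)) → ℂ) → Prop}
  {P : ((ι → ℂ × ℂ) × (Fin g → ℂ)) → Fin g → ℂ × ℂ}

/-- Both points of a pair belong to the family. -/
def AlgPair (Alg : (((ι → ℂ × ℂ) × (Fin g → ℂ)) → ℂ) → Prop)
    (A : ((ι → ℂ × ℂ) × (Fin g → ℂ)) → ℂ × ℂ) : Prop :=
  (Alg fun x => (A x).1) ∧ Alg fun x => (A x).2

/-- All the components of a vector belong to the family. -/
def AlgVec (Alg : (((ι → ℂ × ℂ) × (Fin g → ℂ)) → ℂ) → Prop)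
    (v : ((ι → ℂ × ℂ) × (Fin g → ℂ)) → Fin g → ℂ) : Prop := ∀ j, Alg fun x => v x j

/-- The parameters, multiplied by functions of the family. -/
def IsSmall (Alg : (((ι → ℂ × ℂ) × (Fin g → ℂ)) → ℂ) → Prop)
    (w : ((ι → ℂ × ℂ) × (Fin g → ℂ)) → Fin g → ℂ) : Prop :=
  ∃ v, AlgVec Alg v ∧ ∀ x, w x = x.2 * v x

theorem IsSmall.mul (hA : IsAlgFamily U Alg) {w v : ((ι → ℂ × ℂ) × (Fin g → ℂ)) → Fin g → ℂ}
    (hw : IsSmall Alg w) (hv : AlgVec Alg v) : IsSmall Alg fun x => w x * v x := by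
  obtain ⟨u, hu, hwu⟩ := hw
  exact ⟨fun x => u x * v x, fun j => hA.mul (hu j) (hv j), fun x => by simp only [hwu, mul_assoc]⟩

theorem IsSmall.div (hA : IsAlgFamily U Alg) {w v : ((ι → ℂ × ℂ) × (Fin g → ℂ)) → Fin g → ℂ}
    (hw : IsSmall Alg w) (hv : AlgVec Alg v) : IsSmall Alg fun x => w x / v x := by
  obtain ⟨u, hu, hwu⟩ := hw
  exact ⟨fun x => u x / v x, fun j => hA.div (hu j) (hv j), fun x => by simp only [hwu, mul_div_assoc]⟩

theorem isSmall_snd (hA : IsAlgFamily U Alg) :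
    IsSmall Alg fun x : (ι → ℂ × ℂ) × (Fin g → ℂ) => x.2 :=
  ⟨fun _ => 1, fun _ => hA.const 1, fun x => by rw [mul_one]⟩

theorem algVec_mob (hA : IsAlgFamily U Alg) (hP : ∀ j, AlgPair Alg fun x => P x j)
    {a : ((ι → ℂ × ℂ) × (Fin g → ℂ)) → ℂ} (ha : Alg a) : AlgVec Alg fun x => mob (P x) (a x) :=
  fun j => hA.div (hA.sub (hP j).2 ha) (hA.sub (hP j).1 ha)

theorem algVec_sigma (hA : IsAlgFamily U Alg) (hP : ∀ j, AlgPair Alg fun x => P x j)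
    {A : ((ι → ℂ × ℂ) × (Fin g → ℂ)) → ℂ × ℂ} (ha : AlgPair Alg A) :
    AlgVec Alg fun x => sigma (P x) (A x) :=
  fun j => hA.div (hA.mul (hA.sub (hP j).1 ha.1) (hA.sub (hP j).2 ha.2))
    (hA.mul (hA.sub (hP j).1 ha.2) (hA.sub (hP j).2 ha.1))

theorem algVec_shiftI (hA : IsAlgFamily U Alg) (hP : ∀ j, AlgPair Alg fun x => P x j)
    {Y : ((ι → ℂ × ℂ) × (Fin g → ℂ)) → Fin (g + 1) → ℂ × ℂ}
    (hY : ∀ n, AlgPair Alg fun x => Y x n) (m : ℕ) : AlgVec Alg fun x => shiftI (Y x) (P x) m := by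
  intro j
  refine hA.prod _ fun i _ => ?_
  split_ifs
  · exact hA.inv (algVec_sigma hA hP (hY i) j)
  · exact hA.const 1

/-- The theta function is close to `1` for small parameters. -/
theorem IsPlace.theta (hR : IsPlace U e Red) (hA : IsAlgFamily U Alg)
    (hf : ∀ j c, Alg c → Red (fun x => x.2 j * c x) 0) (hP : ∀ j, AlgPair Alg fun x => P x j)
    (hinj : ∀ᶠ x in (U : Filter ((ι → ℂ × ℂ) × (Fin g → ℂ))), Function.Injective fun j => (P x j).2)
    {w : ((ι → ℂ × ℂ) × (Fin g → ℂ)) → Fin g → ℂ} (hw : IsSmall Alg w) :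
    Red (fun x => H (P x) (w x)) 1 := by
  obtain ⟨v, hv, hwv⟩ := hw
  set V : ((ι → ℂ × ℂ) × (Fin g → ℂ)) → Matrix (Fin g) (Fin g) ℂ := fun x =>
    Matrix.of fun i j => (P x j).2 ^ (i : ℕ) with hV
  set E : ((ι → ℂ × ℂ) × (Fin g → ℂ)) → Matrix (Fin g) (Fin g) ℂ := fun x => Matrix.of fun i j =>
    x.2 j * (v x j * ∑ l, ((V x).det⁻¹ * (V x).adjugate i l) * (P x j).1 ^ (l : ℕ)) with hE
  have hVa : ∀ i j, Alg fun x => V x i j := fun i j => hA.pow (hP j).2 _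
  have hEr : ∀ i j, Red (fun x => E x i j) 0 := by
    intro i j
    refine hf j _ (hA.mul (hv j) (hA.sum _ fun l _ => hA.mul (hA.mul (hA.inv (hA.det hVa)) ?_)
      (hA.pow (hP j).1 _)))
    simp only [Matrix.adjugate_apply]
    refine hA.det fun a b => ?_
    by_cases hal : a = l
    · subst hal
      simp only [Matrix.updateRow_self]
      exact hA.const _
    · simp only [Matrix.updateRow_ne hal]
      exact hVa a b
  have h1 : Red (fun x => (1 - E x).det) 1 := by
    have := hR.det (M := fun x => 1 - E x) (ρ := 1) fun i j => by
      have h2 := hR.sub (hR.const ((1 : Matrix (Fin g) (Fin g) ℂ) i j)) (hEr i j)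
      rw [sub_zero, Matrix.one_apply, apply_ite e, map_one, map_zero, ← Matrix.one_apply] at h2
      exact h2
    rwa [Matrix.det_one] at this
  refine hR.congr (hinj.mono fun x hx => ?_) h1
  have hdet : (V x).det = ∏ i : Fin g, ∏ j ∈ Finset.Ioi i, ((P x j).2 - (P x i).2) := by
    rw [← Matrix.det_transpose, ← Matrix.det_vandermonde]
    rfl
  have hne : (V x).det ≠ 0 := by
    rw [hdet, ← Matrix.det_vandermonde]
    exact Matrix.det_vandermonde_ne_zero_iff.2 hx
  rw [H, ← hdet, eq_div_iff hne, mul_comm, ← Matrix.det_mul]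
  congr 1
  rw [Matrix.mul_sub, mul_one]
  have hVE : V x * E x = Matrix.of fun i j : Fin g => w x j * (P x j).1 ^ (i : ℕ) := by
    have e1 : E x = ((V x).det⁻¹ • (V x).adjugate) * Matrix.of fun i j : Fin g => w x j * (P x j).1 ^ (i : ℕ) := by
      ext i j
      simp only [hE, Matrix.of_apply, Matrix.mul_apply, Matrix.smul_apply, smul_eq_mul, hwv,
        Pi.mul_apply, Finset.mul_sum]
      exact Finset.sum_congr rfl fun l _ => by ring
    rw [e1, ← Matrix.mul_assoc, Matrix.mul_smul, Matrix.mul_adjugate, smul_smul, inv_mul_cancel₀ hne,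
      one_smul, Matrix.one_mul]
  rw [hVE]
  rfl

variable {F : ((ι → ℂ × ℂ) × (Fin g → ℂ)) → Fin g → ℂ}
  {X Y Z : ((ι → ℂ × ℂ) × (Fin g → ℂ)) → ℂ × ℂ}

/-- The theta functions of a vertex do not vanish, and are close to `1`. -/
theorem IsPlace.vertexArgs (hR : IsPlace U e Red) (hA : IsAlgFamily U Alg)
    (hf : ∀ j c, Alg c → Red (fun x => x.2 j * c x) 0) (hP : ∀ j, AlgPair Alg fun x => P x j)
    (hinj : ∀ᶠ x in (U : Filter ((ι → ℂ × ℂ) × (Fin g → ℂ))), Function.Injective fun j => (P x j).2)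
    (hF : IsSmall Alg F) (hX : AlgPair Alg X) (hY : AlgPair Alg Y) (hZ : AlgPair Alg Z) :
    ∀ᶠ x in (U : Filter ((ι → ℂ × ℂ) × (Fin g → ℂ))),
      ∀ v ∈ BS.vertexArgs (P x) (F x) (X x) (Y x) (Z x), H (P x) v ≠ 0 := by
  have hne : ∀ {w : ((ι → ℂ × ℂ) × (Fin g → ℂ)) → Fin g → ℂ}, IsSmall Alg w →
      ∀ᶠ x in (U : Filter ((ι → ℂ × ℂ) × (Fin g → ℂ))), H (P x) (w x) ≠ 0 := fun hw =>
    hR.eventually_ne (hR.theta hA hf hP hinj hw) one_ne_zero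
  have mX := algVec_mob hA hP hX.2
  have mY := algVec_mob hA hP hY.2
  have mZ := algVec_mob hA hP hZ.2
  have mZ' := algVec_mob hA hP hZ.1
  have sX := algVec_sigma hA hP hX
  have sY := algVec_sigma hA hP hY
  have sZ := algVec_sigma hA hP hZ
  simp only [BS.vertexArgs, List.forall_mem_cons, List.not_mem_nil, false_imp_iff, implies_true,
    and_true, eventually_and]
  exact ⟨hne (hF.mul hA mY), hne ((hF.mul hA mY).mul hA sZ), hne (hF.mul hA mZ),
    hne ((hF.mul hA mZ).mul hA sY), hne ((hF.mul hA sY).mul hA mX),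
    hne (((hF.mul hA sY).mul hA mX).mul hA sZ), hne ((hF.mul hA sY).mul hA mZ),
    hne (((hF.mul hA sY).mul hA mZ).mul hA sX), hne (hF.mul hA mX), hne ((hF.mul hA mX).mul hA sY),
    hne ((hF.mul hA mY).mul hA sX), hne ((hF.mul hA sX).mul hA mY),
    hne (((hF.mul hA sX).mul hA mY).mul hA sZ), hne ((hF.mul hA sX).mul hA mZ),
    hne (((hF.mul hA sX).mul hA mZ).mul hA sY), hne ((hF.mul hA mX).mul hA sZ),
    hne ((hF.mul hA mZ).mul hA sX), hne ((hF.mul hA sZ).mul hA mX),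
    hne (((hF.mul hA sZ).mul hA mX).mul hA sY), hne ((hF.mul hA sZ).mul hA mY),
    hne (((hF.mul hA sZ).mul hA mY).mul hA sX), hne (((hF.mul hA mX).mul hA mY).div hA mZ')⟩

variable {N : ℕ} [NeZero N]

/-- The ratio of points whose theta function corrections give the `i`-th Fermat point. -/
def fermatRatio (X Y Z : ℂ × ℂ) : Fin 4 → ℂ :=
  ![ratioAt Z X.2 / ratioAt Z Y.1, ratioAt Z X.1 / ratioAt Z Y.2, ratioAt Z X.2 / ratioAt Z Y.2,
    ratioAt Z X.1 / ratioAt Z Y.1]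

/-- The Fermat points of a vertex are approximated by ratios of points. -/
theorem IsPlace.fermat_x (hR : IsPlace U e Red) (hA : IsAlgFamily U Alg)
    (hf : ∀ j c, Alg c → Red (fun x => x.2 j * c x) 0) (hP : ∀ j, AlgPair Alg fun x => P x j)
    (hinj : ∀ᶠ x in (U : Filter ((ι → ℂ × ℂ) × (Fin g → ℂ))), Function.Injective fun j => (P x j).2)
    (hF : IsSmall Alg F) (hX : AlgPair Alg X) (hY : AlgPair Alg Y) (hZ : AlgPair Alg Z)
    (hV : ∀ᶠ x in (U : Filter ((ι → ℂ × ℂ) × (Fin g → ℂ))), VertexRegular (P x) (F x) (X x) (Y x) (Z x))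
    (i : Fin 4) : ∃ h : ((ι → ℂ × ℂ) × (Fin g → ℂ)) → ℂ, Red h 1 ∧
      ∀ᶠ x in (U : Filter ((ι → ℂ × ℂ) × (Fin g → ℂ))),
        (stdVertex N (P x) (F x) (X x) (Y x) (Z x)).x N i ^ N =
          fermatRatio (X x) (Y x) (Z x) i * h x := by
  have hH : ∀ {w : ((ι → ℂ × ℂ) × (Fin g → ℂ)) → Fin g → ℂ}, IsSmall Alg w →
      Red (fun x => H (P x) (w x)) 1 := fun hw => hR.theta hA hf hP hinj hw
  have hq : ∀ {a b c d : ((ι → ℂ × ℂ) × (Fin g → ℂ)) → Fin g → ℂ}, IsSmall Alg a → IsSmall Alg b →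
      IsSmall Alg c → IsSmall Alg d → Red (fun x => H (P x) (a x) / H (P x) (b x) *
        (H (P x) (c x) / H (P x) (d x))) 1 := fun ha hb hc hd => by
    have := hR.mul (hR.div (hH ha) (hH hb) one_ne_zero) (hR.div (hH hc) (hH hd) one_ne_zero)
    rwa [div_one, mul_one] at this
  have mX := algVec_mob hA hP hX.2
  have mY := algVec_mob hA hP hY.2
  have sX := algVec_sigma hA hP hX
  have sY := algVec_sigma hA hP hY
  have sZ := algVec_sigma hA hP hZ
  fin_cases i
  · exact ⟨_, hq ((hF.mul hA sY).mul hA mX) (((hF.mul hA sY).mul hA mX).mul hA sZ)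
      ((hF.mul hA mY).mul hA sZ) (hF.mul hA mY), hV.mono fun x hx => (stdVertex_x_pow (N := N) hx).1⟩
  · exact ⟨_, hq (hF.mul hA mX) ((hF.mul hA mX).mul hA sZ)
      (((hF.mul hA sX).mul hA mY).mul hA sZ) ((hF.mul hA sX).mul hA mY),
      hV.mono fun x hx => (stdVertex_x_pow (N := N) hx).2.1⟩
  · exact ⟨_, hq (hF.mul hA mX) ((hF.mul hA mX).mul hA sZ)
      ((hF.mul hA mY).mul hA sZ) (hF.mul hA mY),
      hV.mono fun x hx => (stdVertex_x_pow (N := N) hx).2.2.1⟩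
  · exact ⟨_, hq ((hF.mul hA sY).mul hA mX) (((hF.mul hA sY).mul hA mX).mul hA sZ)
      (((hF.mul hA sX).mul hA mY).mul hA sZ) ((hF.mul hA sX).mul hA mY),
      hV.mono fun x hx => (stdVertex_x_pow (N := N) hx).2.2.2⟩

end ThetaLimit

end

end BS

namespace BS

noncomputable section

open Filter

section WeightsOfVertices

variable {ι : Type} {g : ℕ} {U : Ultrafilter ((ι → ℂ × ℂ) × (Fin g → ℂ))} {k : Type} [Field k]
  {e : ℂ →+* k} {Red : (((ι → ℂ × ℂ) × (Fin g → ℂ)) → ℂ) → k → Prop}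
  {P : ((ι → ℂ × ℂ) × (Fin g → ℂ)) → Fin g → ℂ × ℂ}
  {F : ((ι → ℂ × ℂ) × (Fin g → ℂ)) → Fin g → ℂ}
  {X Y Z : ((ι → ℂ × ℂ) × (Fin g → ℂ)) → ℂ × ℂ} {N : ℕ} [NeZero N]
  {h : ((ι → ℂ × ℂ) × (Fin g → ℂ)) → ℂ} {i : Fin 4}

theorem fermatRatio_ne {X Y Z : ℂ × ℂ} (hX : Apart X Z) (hY : Apart Y Z) (i : Fin 4) :
    fermatRatio X Y Z i ≠ 0 := by
  have h1 := ratioAt_ne hX.1 hX.2.1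
  have h2 := ratioAt_ne hX.2.2.1 hX.2.2.2
  have h3 := ratioAt_ne hY.1 hY.2.1
  have h4 := ratioAt_ne hY.2.2.1 hY.2.2.2
  fin_cases i
  · exact div_ne_zero h2 h3
  · exact div_ne_zero h1 h4
  · exact div_ne_zero h2 h4
  · exact div_ne_zero h1 h3

theorem IsPlace.weight_small (hR : IsPlace U e Red)
    (hV : ∀ᶠ x in (U : Filter ((ι → ℂ × ℂ) × (Fin g → ℂ))), VertexRegular (P x) (F x) (X x) (Y x) (Z x))
    (h1 : Red h 1)
    (hx : ∀ᶠ x in (U : Filter ((ι → ℂ × ℂ) × (Fin g → ℂ))),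
        (stdVertex N (P x) (F x) (X x) (Y x) (Z x)).x N i ^ N =
          fermatRatio (X x) (Y x) (Z x) i * h x)
    (hr : Red (fun x => fermatRatio (X x) (Y x) (Z x) i) 0) :
    ∃ γ : ZMod N → k, IsLinearChar γ ∧ ∀ n, Red (fun x =>
      cycW (omega N) ((stdVertex N (P x) (F x) (X x) (Y x) (Z x)).x N i)
        (stdY N (stdVertex N (P x) (F x) (X x) (Y x) (Z x)) i) n) (γ n) := by
  refine hR.cycW_small (hV.mono fun x hx => (stdVertex_isFermat hx).curve i) ?_
  have := hR.mul hr h1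
  rw [zero_mul] at this
  exact hR.congr (hx.mono fun x hx => hx.symm) this

theorem IsPlace.weight_large (hR : IsPlace U e Red)
    (hV : ∀ᶠ x in (U : Filter ((ι → ℂ × ℂ) × (Fin g → ℂ))), VertexRegular (P x) (F x) (X x) (Y x) (Z x))
    (h1 : Red h 1)
    (hx : ∀ᶠ x in (U : Filter ((ι → ℂ × ℂ) × (Fin g → ℂ))),
        (stdVertex N (P x) (F x) (X x) (Y x) (Z x)).x N i ^ N =
          fermatRatio (X x) (Y x) (Z x) i * h x)
    (hr : Red (fun x => (fermatRatio (X x) (Y x) (Z x) i)⁻¹) 0) :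
    ∃ γ : ZMod N → k, IsQuadraticChar (e (omega N)) γ ∧ ∀ n, Red (fun x =>
      cycW (omega N) ((stdVertex N (P x) (F x) (X x) (Y x) (Z x)).x N i)
        (stdY N (stdVertex N (P x) (F x) (X x) (Y x) (Z x)) i) n) (γ n) := by
  refine hR.cycW_large (hV.mono fun x hx => (stdVertex_isFermat hx).curve i)
    (hV.mono fun x hx => (stdVertex_isFermat hx).ne_zero i) ?_ ?_
  · filter_upwards [hV, hx, hR.eventually_ne h1 one_ne_zero] with x h2 h3 h4 h0
    rw [h0, zero_pow (NeZero.ne N)] at h3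
    exact mul_ne_zero (fermatRatio_ne h2.XZ h2.YZ i) h4 h3.symm
  · have := hR.mul hr (hR.inv h1 one_ne_zero)
    rw [zero_mul] at this
    exact hR.congr (hx.mono fun x hx => by rw [hx, mul_inv]) this

end WeightsOfVertices

section GenericPoints

variable {ι κ : Type} {U : Ultrafilter ((ι → ℂ × ℂ) × (κ → ℂ))}

theorem IsGenericUltrafilter.eventually_coords_ne (hU : IsGenericUltrafilter U)
    {i j : (ι × Bool) ⊕ κ} (hij : i ≠ j) :
    ∀ᶠ x in (U : Filter ((ι → ℂ × ℂ) × (κ → ℂ))), coords x i ≠ coords x j := by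
  have h0 : (MvPolynomial.X i - MvPolynomial.X j : MvPolynomial ((ι × Bool) ⊕ κ) ℂ) ≠ 0 :=
    sub_ne_zero.2 fun h => hij (MvPolynomial.X_injective h)
  exact (hU _ h0).mono fun x hx h => hx (by simp [h])

theorem IsGenericUltrafilter.eventually_fst_ne_snd (hU : IsGenericUltrafilter U) (i : ι) :
    ∀ᶠ x in (U : Filter ((ι → ℂ × ℂ) × (κ → ℂ))), (x.1 i).1 ≠ (x.1 i).2 :=
  hU.eventually_coords_ne (i := Sum.inl (i, true)) (j := Sum.inl (i, false)) (by simp)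

theorem IsGenericUltrafilter.eventually_apart (hU : IsGenericUltrafilter U) {i j : ι} (hij : i ≠ j) :
    ∀ᶠ x in (U : Filter ((ι → ℂ × ℂ) × (κ → ℂ))), Apart (x.1 i) (x.1 j) := by
  have h := fun b b' : Bool => hU.eventually_coords_ne (i := Sum.inl (i, b)) (j := Sum.inl (j, b'))
    (by simp [hij])
  filter_upwards [h true true, h true false, h false true, h false false] with x h1 h2 h3 h4
  exact ⟨h1, h2, h3, h4⟩

end GenericPoints

section InvertibleK

/-- The space of the parameters of a chain: the pairs `𝒴_n`, `𝒵_0`, `𝒵_1`, `𝒳` and `f`. -/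
abbrev ChainSpace (g : ℕ) : Type := ((Fin (g + 1) ⊕ Fin 2 ⊕ Unit) → ℂ × ℂ) × (Fin g → ℂ)

variable {g : ℕ} {U : Ultrafilter (ChainSpace g)}

/-- The pairs `𝒴_n` of a point of the space of parameters. -/
def pairsY (x : ChainSpace g) : Fin (g + 1) → ℂ × ℂ :=
  fun n => x.1 (Sum.inl n)

/-- The pairs `𝒵_i` of a point of the space of parameters. -/
def pairsZ (x : ChainSpace g) : Fin 2 → ℂ × ℂ :=
  fun i => x.1 (Sum.inr (Sum.inl i))

/-- The pair `𝒳` of a point of the space of parameters. -/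
def pairX (x : ChainSpace g) : ℂ × ℂ :=
  x.1 (Sum.inr (Sum.inr ()))

theorem IsGenericUltrafilter.eventually_admissible (hU : IsGenericUltrafilter U) :
    ∀ᶠ x in (U : Filter (ChainSpace g)), AdmissiblePoints (pairsY x) (pairsZ x) := by
  have h1 := hU.eventually_apart (i := Sum.inr (Sum.inl 0)) (j := Sum.inr (Sum.inl 1)) (by simp)
  have h2 := eventually_all.2 fun n : Fin (g + 1) => eventually_all.2 fun i : Fin 2 =>
    hU.eventually_apart (i := Sum.inl n) (j := Sum.inr (Sum.inl i)) (by simp)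
  filter_upwards [h1, h2, hU.eventually_fst_ne_snd (Sum.inr (Sum.inl 0)),
    hU.eventually_fst_ne_snd (Sum.inr (Sum.inl 1))] with x h1 h2 h3 h4
  refine ⟨?_, fun n i => h2 n i⟩
  obtain ⟨a, b, c, d⟩ := h1
  simp [pairsZ, h3, h4, a, b, c, d]

theorem IsGenericUltrafilter.eventually_regular (hU : IsGenericUltrafilter U) :
    ∀ᶠ x in (U : Filter (ChainSpace g)), IsRegular (pairsY x) (pairsZ x) :=
  hU.eventually_isRegular (fun n => Sum.inl n) (fun i => Sum.inr (Sum.inl i))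
    (x₀ := (Sum.elim (specialY g) (Sum.elim specialZ fun _ => 0), 0)) isRegular_special

theorem IsGenericUltrafilter.eventually_eval_pairX (hU : IsGenericUltrafilter U) :
    ∀ᶠ x in (U : Filter (ChainSpace g)), (pairPoly (pairsY x) (pairsZ x)).eval (pairX x).1 ≠ 0 ∧
      (pairPoly (pairsY x) (pairsZ x)).eval (pairX x).2 ≠ 0 := by
  set x₀ : ChainSpace g :=
    (Sum.elim (specialY g) (Sum.elim specialZ fun _ => 0), 0) with hx₀
  have key : ∀ p : MvPolynomial (((Fin (g + 1) ⊕ Fin 2 ⊕ Unit) × Bool) ⊕ Fin g) ℂ,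
      p.eval (coords x₀) = 0 → ∀ᶠ x in (U : Filter (ChainSpace g)),
        (pairPoly (pairsY x) (pairsZ x)).eval (p.eval (coords x)) ≠ 0 := by
    intro p hp
    have hev : ∀ x, ((univPoly _ (Fin g) (fun n : Fin (g + 1) => Sum.inl n)
        (fun i => Sum.inr (Sum.inl i))).eval p).eval (coords x) =
        (pairPoly (pairsY x) (pairsZ x)).eval (p.eval (coords x)) := fun x => by
      rw [← Polynomial.eval₂_at_apply, ← Polynomial.eval_map, univPoly_map]
      rfl
    have := hU.eventually_ne (x₀ := x₀) (D := (univPoly _ (Fin g) (fun n : Fin (g + 1) => Sum.inl n)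
        (fun i => Sum.inr (Sum.inl i))).eval p) (by
      rw [hev, hp]
      exact eval_special_ne (by simp))
    simpa only [hev] using this
  have h1 := key (varPair _ _ (Sum.inr (Sum.inr ()))).1 (by rw [(eval_varPair x₀ _).1]; rfl)
  have h2 := key (varPair _ _ (Sum.inr (Sum.inr ()))).2 (by rw [(eval_varPair x₀ _).2]; rfl)
  simp only [eval_varPair] at h1 h2
  exact h1.and h2

variable {P : ChainSpace g → Fin g → ℂ × ℂ}
  {Alg : (ChainSpace g → ℂ) → Prop}

/-- The solutions of the system are algebraic functions of the points. -/
theorem IsAlgFamily.solution (hA : IsAlgFamily U Alg) (hU : IsGenericUltrafilter U)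
    (hP : ∀ᶠ x in (U : Filter (ChainSpace g)), IsSolutionSystem (pairsY x) (pairsZ x) (P x)) (j : Fin g) :
    AlgPair Alg fun x => P x j := by
  set q : Polynomial (MvPolynomial ((Fin (g + 1) ⊕ Fin 2 ⊕ Unit) × Bool) ℂ) :=
    systemPoly (fun n : Fin (g + 1) => MvPolynomial.X (Sum.inl n, true))
      (fun n => MvPolynomial.X (Sum.inl n, false))
      (MvPolynomial.X (Sum.inr (Sum.inl 0), true)) (MvPolynomial.X (Sum.inr (Sum.inl 0), false))
      (MvPolynomial.X (Sum.inr (Sum.inl 1), true)) (MvPolynomial.X (Sum.inr (Sum.inl 1), false)) with hq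
  have hmap : ∀ x : ChainSpace g,
      q.map (MvPolynomial.eval fun i => coords x (Sum.inl i)) = pairPoly (pairsY x) (pairsZ x) :=
    fun x => by
      rw [hq, systemPoly_map]
      simp [coords, pairPoly, pairsY, pairsZ]
  have hne : ∀ x : ChainSpace g,
      IsRegular (pairsY x) (pairsZ x) → pairPoly (pairsY x) (pairsZ x) ≠ 0 := fun x hx h0 =>
    hx.deg (by rw [h0, Polynomial.coeff_zero])
  refine ⟨hA.root q ?_, hA.root q ?_⟩
  · filter_upwards [hP, hU.eventually_regular] with x h1 h2
    rw [hmap]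
    exact ⟨hne x h2, (h1.solves j).swap.eval_pairPoly (h1.nontrivial j).symm⟩
  · filter_upwards [hP, hU.eventually_regular] with x h1 h2
    rw [hmap]
    exact ⟨hne x h2, (h1.solves j).eval_pairPoly (h1.nontrivial j)⟩

/-- The points to which the parameters are specialized. -/
def limitPoint (g : ℕ) : (Fin (g + 1) ⊕ Fin 2 ⊕ Unit) → ℂ × ℂ :=
  Sum.elim (fun _ => (0, 1)) (Sum.elim ![(0, 1), (2, 3)] fun _ => (2, 2))

/-- The consistent choice of roots at a point of the space of parameters. -/
def rootsAt (N : ℕ) [NeZero N] (P : ChainSpace g → Fin g → ℂ × ℂ) (x : ChainSpace g) : ChainRoots g :=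
  stdRoots N (pairsY x) (pairsZ x) (P x) x.2 (pairX x)

/-- The weights of the site `n` of the chain. -/
def chainW {N : ℕ} (r : ChainRoots g) (n : Fin (g + 1)) : Fin 4 → ZMod N → ℂ :=
  pairW N (r.V n) (r.Vt n) (r.y n) (r.yt n)

/-- The operator `𝐊` is invertible along a generic ultrafilter. -/
theorem eventually_isUnit_bigK (N : ℕ) [NeZero N] (hU : IsGenericUltrafilter U)
    (hP : ∀ᶠ x in (U : Filter (ChainSpace g)), IsSolutionSystem (pairsY x) (pairsZ x) (P x)) :
    ∀ᶠ x in (U : Filter (ChainSpace g)), ChainRegular (pairsY x) (pairsZ x) (P x) x.2 (pairX x) ∧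
      IsUnit ((rootsAt N P x).bigK N) := by
  obtain ⟨k, _, e, Red, Alg, hR, hA, hs, hf⟩ := hU.exists_specialization (limitPoint g)
  have hPa := hA.solution hU hP
  have hinj : ∀ᶠ x in (U : Filter (ChainSpace g)), Function.Injective fun j => (P x j).2 := by
    filter_upwards [hP, hU.eventually_admissible] with x h1 h2 using h1.injective h2
  have aY : ∀ n, AlgPair Alg fun x => pairsY x n := fun n => ⟨hA.fst _, hA.snd _⟩
  have aZ : ∀ i, AlgPair Alg fun x => pairsZ x i := fun i => ⟨hA.fst _, hA.snd _⟩
  have aX : AlgPair Alg fun x => pairX x := ⟨hA.fst _, hA.snd _⟩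
  have sF : ∀ n : Fin (g + 1), IsSmall Alg fun x => x.2 * shiftI (pairsY x) (P x) ((n : ℕ) + 1) :=
    fun n => (isSmall_snd hA).mul hA (algVec_shiftI hA hPa aY _)
  have sFt : ∀ n : Fin (g + 1), IsSmall Alg fun x => x.2 * shiftI (pairsY x) (P x) ((n : ℕ) + 1) *
      sigma (P x) (pairsZ x 0) := fun n => (sF n).mul hA (algVec_sigma hA hPa (aZ 0))
  have hXav : ∀ᶠ x in (U : Filter (ChainSpace g)), Avoids (P x) (pairX x).1 ∧ Avoids (P x) (pairX x).2 := by
    filter_upwards [hP, hU.eventually_eval_pairX] with x h1 h2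
    refine ⟨fun j => ⟨fun h0 => h2.1 ?_, fun h0 => h2.1 ?_⟩, fun j => ⟨fun h0 => h2.2 ?_, fun h0 => h2.2 ?_⟩⟩
    · rw [← h0]; exact (h1.solves j).swap.eval_pairPoly (h1.nontrivial j).symm
    · rw [← h0]; exact (h1.solves j).eval_pairPoly (h1.nontrivial j)
    · rw [← h0]; exact (h1.solves j).swap.eval_pairPoly (h1.nontrivial j).symm
    · rw [← h0]; exact (h1.solves j).eval_pairPoly (h1.nontrivial j)
  have hXZ := eventually_all.2 fun i : Fin 2 => hU.eventually_apart (i := Sum.inr (Sum.inr ()))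
    (j := Sum.inr (Sum.inl i)) (by simp)
  have hreg : ∀ {F : ChainSpace g → Fin g → ℂ},
      IsSmall Alg F → ∀ (n : Fin (g + 1)) (i : Fin 2), ∀ᶠ x in (U : Filter (ChainSpace g)),
        VertexRegular (P x) (F x) (pairX x) (pairsY x n) (pairsZ x i) := by
    intro F hF n i
    filter_upwards [hP, hU.eventually_admissible, hXav, hXZ,
      hU.eventually_apart (i := Sum.inr (Sum.inr ())) (j := Sum.inl n) (by simp),
      hU.eventually_apart (i := Sum.inl n) (j := Sum.inr (Sum.inl i)) (by simp),
      hU.eventually_fst_ne_snd (Sum.inr (Sum.inl i)),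
      hR.vertexArgs hA hf hPa hinj hF aX (aY n) (aZ i)] with x h1 h2 h3 h4 h5 h6 h7 h8
    exact ⟨h5, h4 i, h6, h7, h3, h1.avoids_Y n, h1.avoids_Z i, h8⟩
  have hV := fun n => hreg (sF n) n 0
  have hVt := fun n => hreg (sFt n) n 1
  have hchain : ∀ᶠ x in (U : Filter (ChainSpace g)), ChainRegular (pairsY x) (pairsZ x) (P x) x.2 (pairX x) := by
    filter_upwards [hP, hU.eventually_admissible, eventually_all.2 hV, eventually_all.2 hVt] with
      x h1 h2 h3 h4
    exact ⟨h2, h1, h3, h4⟩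
  refine hchain.and ?_
  have einj : Function.Injective e := e.injective
  have ene : ∀ {a b : ℂ}, a ≠ b → e a - e b ≠ 0 := fun hab => sub_ne_zero.2 fun h => hab (einj h)
  -- the limits of the ratios of points
  have rat : ∀ {A : ChainSpace g → ℂ × ℂ}
      {t : ChainSpace g → ℂ} {a b c : ℂ},
      Red (fun x => (A x).1) (e a) → Red (fun x => (A x).2) (e b) → Red t (e c) → c ≠ b →
      Red (fun x => ratioAt (A x) (t x)) ((e c - e a) / (e c - e b)) := fun h1 h2 h3 hcb =>
    hR.div (hR.sub h3 h1) (hR.sub h3 h2) (ene hcb)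
  have ratInv : ∀ {A : ChainSpace g → ℂ × ℂ}
      {t : ChainSpace g → ℂ} {a b c : ℂ},
      Red (fun x => (A x).1) (e a) → Red (fun x => (A x).2) (e b) → Red t (e c) → c ≠ a →
      Red (fun x => (ratioAt (A x) (t x))⁻¹) ((e c - e b) / (e c - e a)) := fun h1 h2 h3 hca => by
    simp only [ratioAt, inv_div]
    exact hR.div (hR.sub h3 h2) (hR.sub h3 h1) (ene hca)
  have lY : ∀ n, Red (fun x => (pairsY x n).1) (e 0) ∧ Red (fun x => (pairsY x n).2) (e 1) :=
    fun n => hs (Sum.inl n)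
  have lZ0 : Red (fun x => (pairsZ x 0).1) (e 0) ∧ Red (fun x => (pairsZ x 0).2) (e 1) :=
    hs (Sum.inr (Sum.inl 0))
  have lZ1 : Red (fun x => (pairsZ x 1).1) (e 2) ∧ Red (fun x => (pairsZ x 1).2) (e 3) :=
    hs (Sum.inr (Sum.inl 1))
  have lX : Red (fun x => (pairX x).1) (e 2) ∧ Red (fun x => (pairX x).2) (e 2) :=
    hs (Sum.inr (Sum.inr ()))
  have q1 : ∀ n, Red (fun x => fermatRatio (pairX x) (pairsY x n) (pairsZ x 0) 1) 0 := fun n => by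
    have := hR.mul (rat lZ0.1 lZ0.2 lX.1 (by norm_num)) (ratInv lZ0.1 lZ0.2 (lY n).2 (by norm_num))
    simpa [div_eq_mul_inv, fermatRatio] using this
  have q2 : ∀ n, Red (fun x => fermatRatio (pairX x) (pairsY x n) (pairsZ x 0) 2) 0 := fun n => by
    have := hR.mul (rat lZ0.1 lZ0.2 lX.2 (by norm_num)) (ratInv lZ0.1 lZ0.2 (lY n).2 (by norm_num))
    simpa [div_eq_mul_inv, fermatRatio] using this
  have q0 : ∀ n, Red (fun x => (fermatRatio (pairX x) (pairsY x n) (pairsZ x 0) 0)⁻¹) 0 := fun n => by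
    have := hR.mul (rat lZ0.1 lZ0.2 (lY n).1 (by norm_num)) (ratInv lZ0.1 lZ0.2 lX.2 (by norm_num))
    simpa [div_eq_mul_inv, fermatRatio, mul_comm] using this
  have q3 : ∀ n, Red (fun x => (fermatRatio (pairX x) (pairsY x n) (pairsZ x 0) 3)⁻¹) 0 := fun n => by
    have := hR.mul (rat lZ0.1 lZ0.2 (lY n).1 (by norm_num)) (ratInv lZ0.1 lZ0.2 lX.1 (by norm_num))
    simpa [div_eq_mul_inv, fermatRatio, mul_comm] using this
  have qt : ∀ n i, Red (fun x => fermatRatio (pairX x) (pairsY x n) (pairsZ x 1) i) 0 := by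
    intro n i
    have a1 := rat lZ1.1 lZ1.2 lX.1 (by norm_num)
    have a2 := rat lZ1.1 lZ1.2 lX.2 (by norm_num)
    have b1 := ratInv lZ1.1 lZ1.2 (lY n).1 (by norm_num)
    have b2 := ratInv lZ1.1 lZ1.2 (lY n).2 (by norm_num)
    rw [sub_self, zero_div] at a1 a2
    fin_cases i
    · simpa [div_eq_mul_inv, fermatRatio] using hR.mul a2 b1
    · simpa [div_eq_mul_inv, fermatRatio] using hR.mul a1 b2
    · simpa [div_eq_mul_inv, fermatRatio] using hR.mul a2 b2
    · simpa [div_eq_mul_inv, fermatRatio] using hR.mul a1 b1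
  -- the limits of the weights
  have ex := fun n i => hR.fermat_x (N := N) hA hf hPa hinj (sF n) aX (aY n) (aZ 0) (hV n) i
  have ext := fun n i => hR.fermat_x (N := N) hA hf hPa hinj (sFt n) aX (aY n) (aZ 1) (hVt n) i
  have wt : ∀ n i, ∃ γ : ZMod N → k, IsLinearChar γ ∧ ∀ m, Red (fun x =>
      cycW (omega N) (((rootsAt N P x).Vt n).x N i)
        ((rootsAt N P x).yt n i) m) (γ m) := fun n i => by
    obtain ⟨h, h1, h2⟩ := ext n i
    exact hR.weight_small (hVt n) h1 h2 (qt n i)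
  have pair : ∀ (n : Fin (g + 1)) (i : Fin 4) {γ : ZMod N → k} (_ : ∀ m, Red (fun x =>
      cycW (omega N) (((rootsAt N P x).V n).x N i)
        ((rootsAt N P x).y n i) m) (γ m)),
      ∃ γt : ZMod N → k, IsLinearChar γt ∧ ∀ m, Red (fun x =>
        chainW (rootsAt N P x) n i m) (γ m * γt m) := by
    intro n i γ hγ
    obtain ⟨γt, h1, h2⟩ := wt n i
    exact ⟨fun m => γt (-m), h1.comp_neg, fun m => hR.mul (hγ m) (h2 (-m))⟩
  have wlin : ∀ (n : Fin (g + 1)) (i : Fin 4),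
      Red (fun x => fermatRatio (pairX x) (pairsY x n) (pairsZ x 0) i) 0 →
      ∃ γ : ZMod N → k, IsLinearChar γ ∧ ∀ m, Red (fun x =>
        chainW (rootsAt N P x) n i m) (γ m) := by
    intro n i hq
    obtain ⟨h, h1, h2⟩ := ex n i
    obtain ⟨γ, h3, h4⟩ := hR.weight_small (hV n) h1 h2 hq
    obtain ⟨γt, h5, h6⟩ := pair n i h4
    exact ⟨_, h3.mul h5, h6⟩
  have wquad : ∀ (n : Fin (g + 1)) (i : Fin 4),
      Red (fun x => (fermatRatio (pairX x) (pairsY x n) (pairsZ x 0) i)⁻¹) 0 →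
      ∃ γ : ZMod N → k, IsQuadraticChar (e (omega N)) γ ∧ ∀ m, Red (fun x =>
        chainW (rootsAt N P x) n i m) (γ m) := by
    intro n i hq
    obtain ⟨h, h1, h2⟩ := ex n i
    obtain ⟨γ, h3, h4⟩ := hR.weight_large (hV n) h1 h2 hq
    obtain ⟨γt, h5, h6⟩ := pair n i h4
    exact ⟨_, h3.mul h5, h6⟩
  choose γ0 g0 r0 using fun n => wquad n 0 (q0 n)
  choose γ1 g1 r1 using fun n => wlin n 1 (q1 n)
  choose γ2 g2 r2 using fun n => wlin n 2 (q2 n)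
  choose γ3 g3 r3 using fun n => wquad n 3 (q3 n)
  have hprim : IsPrimitiveRoot (e (omega N)) N := (omega_primitive N).map_of_injective einj
  have hN : (N : k) ≠ 0 := by
    rw [← map_natCast e]
    exact fun h => NeZero.ne N (Nat.cast_injective (R := ℂ) (einj (by simpa using h)))
  set γ : Fin (g + 1) → Fin 4 → ZMod N → k := fun n => ![γ0 n, γ1 n, γ2 n, γ3 n] with hγ
  have dl := hR.eventually_ne (hR.det (M := fun x => leftFactor (N := N) (chainW (rootsAt N P x)))
      (ρ := Matrix.of fun a s => ∏ n, γ n 0 (s n - a n) / γ n 2 (s (n + 1) - a n) *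
        chi (e (omega N)) (-(a n * (s n - s (n + 1)))))
      fun a s => hR.prod Finset.univ fun n _ => hR.mul
        (hR.div (r0 n (s n - a n)) (r2 n (s (n + 1) - a n)) ((g2 n).1 _))
        (hR.chi (-(a n * (s n - s (n + 1))))))
    (det_left_ne hprim hN (γ := γ) g0 g2)
  have dr := hR.eventually_ne (hR.det (M := fun x => rightFactor (N := N) (chainW (rootsAt N P x)))
      (ρ := Matrix.of fun s b => ∏ n, γ n 1 (s (n + 1) - b n) / γ n 3 (s n - b n) *
        chi (e (omega N)) (b n * (s n - s (n + 1))))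
      fun s b => hR.prod Finset.univ fun n _ => hR.mul
        (hR.div (r1 n (s (n + 1) - b n)) (r3 n (s n - b n)) ((g3 n).1 _))
        (hR.chi (b n * (s n - s (n + 1)))))
    (det_right_ne hprim hN (γ := γ) g3 g1)
  filter_upwards [dl, dr] with x hl hr
  rw [bigK_eq_mul, Matrix.isUnit_iff_isUnit_det, isUnit_iff_ne_zero, Matrix.det_smul, Matrix.det_mul]
  exact mul_ne_zero (pow_ne_zero _ (pow_ne_zero _ (Nat.cast_ne_zero.2 (NeZero.ne N)))) (mul_ne_zero hl hr)

/-- For generic data there are consistent roots for which `𝐊` is invertible. -/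
theorem generically_exists_isUnit_bigK (N : ℕ) [NeZero N] (g : ℕ) :
    Generically (Fin (g + 1) ⊕ Fin 2 ⊕ Unit) (Fin g)
      (fun A f => ∀ P : Fin g → ℂ × ℂ,
        IsSolutionSystem (fun n => A (Sum.inl n)) (fun i => A (Sum.inr (Sum.inl i))) P →
        ∃ (c : LaxScalars g) (r : ChainRoots g),
          c.IsCrossRatioParam N (fun n => A (Sum.inl n)) (fun i => A (Sum.inr (Sum.inl i))) ∧
          r.IsConsistent N (fun n => A (Sum.inl n)) (fun i => A (Sum.inr (Sum.inl i))) P c f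
            (A (Sum.inr (Sum.inr ()))) ∧
          IsUnit (r.bigK N)) := by
  refine generically_of_ultrafilter fun U hU => ?_
  by_contra hcon
  have hbad := Ultrafilter.eventually_not.2 hcon
  simp only [not_forall] at hbad
  have hex : ∀ x : ChainSpace g, ∃ P : Fin g → ℂ × ℂ,
      (∃ (P : Fin g → ℂ × ℂ) (_ : IsSolutionSystem (pairsY x) (pairsZ x) P),
        ¬ ∃ (c : LaxScalars g) (r : ChainRoots g), c.IsCrossRatioParam N (pairsY x) (pairsZ x) ∧
          r.IsConsistent N (pairsY x) (pairsZ x) P c x.2 (pairX x) ∧ IsUnit (r.bigK N)) →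
      IsSolutionSystem (pairsY x) (pairsZ x) P ∧
        ¬ ∃ (c : LaxScalars g) (r : ChainRoots g), c.IsCrossRatioParam N (pairsY x) (pairsZ x) ∧
          r.IsConsistent N (pairsY x) (pairsZ x) P c x.2 (pairX x) ∧ IsUnit (r.bigK N) := by
    intro x
    by_cases h : ∃ (P : Fin g → ℂ × ℂ) (_ : IsSolutionSystem (pairsY x) (pairsZ x) P),
        ¬ ∃ (c : LaxScalars g) (r : ChainRoots g), c.IsCrossRatioParam N (pairsY x) (pairsZ x) ∧
          r.IsConsistent N (pairsY x) (pairsZ x) P c x.2 (pairX x) ∧ IsUnit (r.bigK N)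
    · obtain ⟨P, h1, h2⟩ := h
      exact ⟨P, fun _ => ⟨h1, h2⟩⟩
    · exact ⟨0, fun h' => absurd h' h⟩
  choose P hPx using hex
  have hP := hbad.mono fun x hx => hPx x hx
  obtain ⟨x, h1, h2⟩ := (hP.and (eventually_isUnit_bigK N hU (hP.mono fun x hx => hx.1))).exists
  exact h1.2 ⟨_, _, stdScalars_isCrossRatioParam h2.1.points, stdRoots_isConsistent h2.1, h2.2⟩

end InvertibleK

end

end BS

theorem proposition2 (N : ℕ) [NeZero N] (hN : 2 ≤ N) (g : ℕ) :
    -- for generic points the system for `(P', P)` has exactly `Q - 1 = g` inequivalent solutions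
    BS.Generically (Fin (g + 1) ⊕ Fin 2) Empty
      (fun A _ => (BS.solutionClasses (fun n => A (Sum.inl n)) (fun i => A (Sum.inr i))).encard
        = (g : ℕ∞)) ∧
    (∀ (Y : Fin (g + 1) → ℂ × ℂ) (Z : Fin 2 → ℂ × ℂ), BS.AdmissiblePoints Y Z →
      ∀ P : Fin g → ℂ × ℂ, BS.IsSolutionSystem Y Z P →
        -- for `{f_j} = {0}` all the centres are `1`
        (∀ n, BS.centreX Y Z P 0 n = 1 ∧ BS.centreZ Y Z P 0 n = 1) ∧
      ∀ c : BS.LaxScalars g, c.IsCrossRatioParam N Y Z →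
        -- the spectrum does not depend on `{f_j}` and is that of the initial transfer matrix
        (∀ (f : Fin g → ℂ) (Xop Zop : Fin (g + 1) → Matrix (ZMod N) (ZMod N) ℂ),
          BS.IsWeylFamily Y Z P f Xop Zop →
          ∀ ξ : ℂ, (BS.transfer c Xop Zop ξ).charpoly =
            (BS.transfer c (fun _ => BS.clock N) (fun _ => BS.shift N) ξ).charpoly) ∧
        -- the operator `𝐊` intertwines `T(ξ; {f_j})` and `T(ξ; {f_j σ_j(𝒳)})`
        (∀ (f : Fin g → ℂ) (X : ℂ × ℂ) (r : BS.ChainRoots g), r.IsConsistent N Y Z P c f X →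
          ∀ ξ : ℂ, r.transferBefore N c ξ * r.bigK N = r.bigK N * r.transferAfter N c ξ)) ∧
    -- for generic data there are consistent roots for which `𝐊` is invertible
    BS.Generically (Fin (g + 1) ⊕ Fin 2 ⊕ Unit) (Fin g)
      (fun A f => ∀ P : Fin g → ℂ × ℂ,
        BS.IsSolutionSystem (fun n => A (Sum.inl n)) (fun i => A (Sum.inr (Sum.inl i))) P →
        ∃ (c : BS.LaxScalars g) (r : BS.ChainRoots g),
          c.IsCrossRatioParam N (fun n => A (Sum.inl n)) (fun i => A (Sum.inr (Sum.inl i))) ∧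
          r.IsConsistent N (fun n => A (Sum.inl n)) (fun i => A (Sum.inr (Sum.inl i))) P c f
            (A (Sum.inr (Sum.inr ()))) ∧
          IsUnit (r.bigK N)) := by
  exact ⟨BS.generically_encard_solutionClasses g, fun Y Z hYZ P hP =>
    ⟨BS.centre_zero hYZ hP, fun c hc => ⟨fun f Xop Zop hW ξ => BS.charpoly_transfer_eq hYZ hP hc hW ξ,
      fun f X r hr ξ => BS.transfer_mul_bigK hr ξ⟩⟩, BS.generically_exists_isUnit_bigK N g⟩
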